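/- Let $P$ be a closed oriented polyhedral surface all of whose faces are regular $n$-gons, $n\in\{3,4,6\}$. Its translation cover $X$ is the smallest cover, branched at most over the vertices, on which the flat metric has trivial holonomy; it is glued from copies of the faces, laid out in the plane, by translations. After a linear change of coordinates the faces are lattice polygons, $X$ is square-tiled, and there is a branched covering $p\colon X\to\mathbb{R}^2/\mathbb{Z}^2$ with $\omega=p^*(dz)$. Let $\mathrm{Aff}(X)$ be the group of orientation-preserving affine homeomorphisms of $(X,\omega)$, let $\mathrm{Aut}(X)\subset\mathrm{Aff}(X)$ be the finite group of homeomorphisms $f$ with $p\circ f=p$, and let $\mathrm{Aff}_*(X)$ be the subgroup of the elements of $\mathrm{Aff}(X)$ that commute with all elements of $\mathrm{Aut}(X)$. Let $\alpha$ be the action of $\mathrm{Aff}(X)$ on the zero-holonomy subspace $H_1^{(0)}(X)=\{\gamma\in H_1(X;\mathbb{R}):\int_\gamma\omega=0\}$. The group $\alpha(\mathrm{Aff}(X))$ is the Kontsevich--Zorich monodromy group; let $G\subset \mathrm{GL}(H_1^{(0)}(X))$ be its Zariski closure and $G^\circ$ the identity component of $G$, that is, the smallest Zariski closed subgroup of finite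 index. Theorem. Up to finite index, $G$ is a power of $\mathrm{SL}(2,\mathbb{R})$ for the following translation covers. More precisely, $G^\circ$ has finite index in $G$, $\mathrm{Aff}_*(X)$ has finite index in $\mathrm{Aff}(X)$, $G^\circ$ is the Zariski closure of $\alpha(\mathrm{Aff}_*(X))$, and, as a linear algebraic group, $G^\circ$ is isomorphic to 1. $\mathrm{SL}(2,\mathbb{R})$ if $X$ is the translation cover (a 3-cover) of the octahedron, or the translation cover of the compact quotient, by its lattice of translations, of the triply periodic polyhedron Octa-8 $\{3,12\}$; 2. $\mathrm{SL}(2,\mathbb{R})^3$ if $X$ is the translation cover (a 4-cover) of the cube, or the translation cover of the compact quotient, by the lattice of its orientation-preserving translations, of the triply periodic polyhedron Mucube $\{4,6\}$; 3. $\mathrm{SL}(2,\mathbb{R})^4$ if $X$ is the translation cover (a 2-cover) of the compact genus-three quotient of the triply periodic polyhedron Mutetrahedron $\{6,6\}$. -/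

import Mathlib

open scoped Topology

/-! ### First singular homology with real coefficients -/

/-- `H₁(X; ℝ)`: the first singular homology of `X` with real coefficients. -/
noncomputable abbrev H₁ (X : Type) [TopologicalSpace X] : ModuleCat.{0} ℝ :=
  ((AlgebraicTopology.singularHomologyFunctor (ModuleCat.{0} ℝ) 1).obj (ModuleCat.of ℝ ℝ)).obj
    (TopCat.of X)

/-- The linear map `H₁(X; ℝ) → H₁(Y; ℝ)` induced by a continuous map. -/
noncomputable def H₁map {X Y : Type} [TopologicalSpace X] [TopologicalSpace Y] (f : C(X, Y)) :
    H₁ X →ₗ[ℝ] H₁ Y :=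
  (((AlgebraicTopology.singularHomologyFunctor (ModuleCat.{0} ℝ) 1).obj
    (ModuleCat.of ℝ ℝ)).map (TopCat.ofHom f)).hom

theorem H₁map_id {X : Type} [TopologicalSpace X] (w : H₁ X) :
    H₁map (ContinuousMap.id X) w = w := by
  have h : TopCat.ofHom (ContinuousMap.id X) = CategoryTheory.CategoryStruct.id (TopCat.of X) := rfl
  rw [H₁map, h, CategoryTheory.Functor.map_id]
  rfl

theorem H₁map_comp {X Y Z : Type} [TopologicalSpace X] [TopologicalSpace Y] [TopologicalSpace Z]
    (g : C(Y, Z)) (f : C(X, Y)) (w : H₁ X) : H₁map (g.comp f) w = H₁map g (H₁map f w) := by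
  have h : TopCat.ofHom (g.comp f) =
    CategoryTheory.CategoryStruct.comp (TopCat.ofHom f) (TopCat.ofHom g) := rfl
  rw [H₁map, h, CategoryTheory.Functor.map_comp]
  rfl

/-! ### Translation surfaces made of lattice polygons -/

/-- Gluing data for a translation surface: a family of convex polygons in the plane whose corners
(listed counterclockwise) are integer points, and a relation saying that side `j` of the polygon
`c` (the one from corner `j` to corner `j + 1`) is glued by a translation to side `j'` of `c'`,
with the directions of the two sides reversed. -/
structure LatticePolygons (n : ℕ) where
  Cell : Type
  corner : Cell → Fin n → Fin 2 → ℤ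
  Glued : Cell → Fin n → Cell → Fin n → Prop

namespace LatticePolygons

variable {n : ℕ} [NeZero n] (X : LatticePolygons n)

/-- The corner `j` of the polygon `c` as a point of the real plane. -/
def realCorner (c : X.Cell) (j : Fin n) : Fin 2 → ℝ := fun i => (X.corner c j i : ℝ)

/-- The closed polygon `c`. -/
def polygon (c : X.Cell) : Set (Fin 2 → ℝ) := convexHull ℝ (Set.range (X.realCorner c))

/-- If side `j` of `c` is glued to side `j'` of `c'`, then a point `x` of the former is identified
with its image `y` under the translation taking corner `j` of `c` to corner `j' + 1` of `c'`. -/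
inductive Ident : (Σ c : X.Cell, X.polygon c) → (Σ c : X.Cell, X.polygon c) → Prop
  | glue (c c' : X.Cell) (j j' : Fin n) (hg : X.Glued c j c' j')
      (x : X.polygon c) (y : X.polygon c')
      (hx : (x : Fin 2 → ℝ) ∈ segment ℝ (X.realCorner c j) (X.realCorner c (j + 1)))
      (hy : (y : Fin 2 → ℝ) = x + (X.realCorner c' (j' + 1) - X.realCorner c j)) :
      Ident ⟨c, x⟩ ⟨c', y⟩

/-- The surface: the quotient of the disjoint union of the polygons by the equivalence relation
generated by the side identifications, with the quotient topology. -/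
def Surface : Type := Quot X.Ident

instance : TopologicalSpace X.Surface := inferInstanceAs (TopologicalSpace (Quot X.Ident))

/-- The point of the surface given by a point of the polygon `c`. -/
def pt (c : X.Cell) (x : X.polygon c) : X.Surface := Quot.mk X.Ident ⟨c, x⟩

/-- The projection `p` of the surface to the square torus `ℝ² / ℤ²`; the one-form of the surface is
`ω = p^*(dz)`. -/
def toTorus : C(X.Surface, UnitAddTorus (Fin 2)) where
  toFun := Quot.lift
    (fun q i => (((q.2 : Fin 2 → ℝ) i : ℝ) : UnitAddCircle)) (by
      rintro _ _ ⟨c, c', j, j', -, x, y, -, hy⟩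
      funext i
      have h : (y : Fin 2 → ℝ) i =
          (x : Fin 2 → ℝ) i + ((X.corner c' (j' + 1) i - X.corner c j i : ℤ) : ℝ) := by
        rw [hy]; simp [realCorner]
      have hz : (((X.corner c' (j' + 1) i - X.corner c j i : ℤ) : ℝ) : UnitAddCircle) = 0 :=
        (AddCircle.coe_eq_zero_iff 1).2 ⟨X.corner c' (j' + 1) i - X.corner c j i, by simp⟩
      change (((x : Fin 2 → ℝ) i : ℝ) : UnitAddCircle) = (((y : Fin 2 → ℝ) i : ℝ) : UnitAddCircle)
      rw [h, AddCircle.coe_add, hz, add_zero])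
  continuous_toFun := by
    refine continuous_quot_lift _ ?_
    refine continuous_sigma fun c => continuous_pi fun i => ?_
    exact (AddCircle.continuous_mk' 1).comp ((continuous_apply i).comp continuous_subtype_val)

/-- The zero-holonomy subspace `H₁⁽⁰⁾ = {γ : ∫_γ ω = 0}`. As `∫_γ p^*(dz) = ∫_{p_* γ} dz` and
integration of `dz` is an isomorphism from `H₁` of the torus to the plane, it is the kernel of the
map induced by `p`. -/
noncomputable def zeroHolonomy : Submodule ℝ (H₁ X.Surface) := LinearMap.ker (H₁map X.toTorus)

/-- `φ` restricted to the open set `U` is a local primitive of `ω`: in the plane coordinate `z` of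
each polygon it is, locally, `z` plus a constant. -/
def IsLocalPrimitive (U : Set X.Surface) (φ : X.Surface → Fin 2 → ℝ) : Prop :=
  IsOpen U ∧ ∀ (c : X.Cell) (x : X.polygon c), X.pt c x ∈ U →
    ∀ᶠ z : X.polygon c in 𝓝 x, φ (X.pt c z) = φ (X.pt c x) + ((z : Fin 2 → ℝ) - x)

/-- The homeomorphism `f` is affine with derivative `A`, that is, `f^* ω = A ω`: the local
primitives `φ` of `ω` are those functions for which `A⁻¹ (φ ∘ f)` is a local primitive of `ω`. -/
def IsAffine (A : Matrix.SpecialLinearGroup (Fin 2) ℝ) (f : X.Surface ≃ₜ X.Surface) : Prop :=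
  ∀ (U : Set X.Surface) (φ : X.Surface → Fin 2 → ℝ), X.IsLocalPrimitive U φ ↔
    X.IsLocalPrimitive (f ⁻¹' U) (fun x => (A⁻¹).1.mulVec (φ (f x)))

theorem isAffine_one : X.IsAffine 1 1 := by
  intro U φ
  have h : (fun x => ((1 : Matrix.SpecialLinearGroup (Fin 2) ℝ)⁻¹).1.mulVec
      (φ ((1 : X.Surface ≃ₜ X.Surface) x))) = φ := by
    funext x; simp
  rw [h]
  rfl

variable {X} in
theorem IsAffine.mul {A B : Matrix.SpecialLinearGroup (Fin 2) ℝ} {f g : X.Surface ≃ₜ X.Surface}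
    (hf : X.IsAffine A f) (hg : X.IsAffine B g) : X.IsAffine (A * B) (f * g) := by
  intro U φ
  rw [hf U φ, hg]
  simp only [mul_inv_rev, Matrix.SpecialLinearGroup.coe_mul, Matrix.mulVec_mulVec]
  rfl

variable {X} in
theorem IsAffine.inv {A : Matrix.SpecialLinearGroup (Fin 2) ℝ} {f : X.Surface ≃ₜ X.Surface}
    (hf : X.IsAffine A f) : X.IsAffine A⁻¹ f⁻¹ := by
  intro U φ
  rw [hf ((f⁻¹ : X.Surface ≃ₜ X.Surface) ⁻¹' U)]
  have h1 : f ⁻¹' ((f⁻¹ : X.Surface ≃ₜ X.Surface) ⁻¹' U) = U := by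
    ext x; simp
  have h2 : (fun x => (A⁻¹).1.mulVec (((A⁻¹)⁻¹).1.mulVec (φ (f⁻¹ (f x))))) = φ := by
    funext x
    rw [Matrix.mulVec_mulVec, ← Matrix.SpecialLinearGroup.coe_mul]
    simp
  rw [h1, h2]

/-- `Aff(X)`: the group of orientation-preserving affine homeomorphisms. -/
def Aff : Subgroup (X.Surface ≃ₜ X.Surface) where
  carrier := {f | ∃ A, X.IsAffine A f}
  mul_mem' := fun ⟨A, hA⟩ ⟨B, hB⟩ => ⟨A * B, hA.mul hB⟩
  one_mem' := ⟨1, X.isAffine_one⟩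
  inv_mem' := fun ⟨A, hA⟩ => ⟨A⁻¹, hA.inv⟩

/-- `Aut(X)`: the group of the homeomorphisms `f` with `p ∘ f = p`. -/
def Aut : Subgroup (X.Surface ≃ₜ X.Surface) where
  carrier := {f | ∀ x, X.toTorus (f x) = X.toTorus x}
  mul_mem' := fun hf hg x => (hf _).trans (hg x)
  one_mem' := fun _ => rfl
  inv_mem' := fun {f} hf x => by simpa using (hf (f⁻¹ x)).symm

/-- The subgroup of `Aff(X)` of the elements that commute with all elements of `Aut(X)`. -/
def AffCentral : Subgroup (X.Surface ≃ₜ X.Surface) :=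
  X.Aff ⊓ Subgroup.centralizer (X.Aut : Set (X.Surface ≃ₜ X.Surface))

/-- The group of linear automorphisms of the zero-holonomy subspace that are induced by the
elements of a group `Γ` of homeomorphisms. -/
noncomputable def homologyAction (Γ : Subgroup (X.Surface ≃ₜ X.Surface)) :
    Subgroup (X.zeroHolonomy ≃ₗ[ℝ] X.zeroHolonomy) where
  carrier := {g | ∃ f ∈ Γ, ∀ w : X.zeroHolonomy,
    ((g w : X.zeroHolonomy) : H₁ X.Surface) = H₁map (f : C(X.Surface, X.Surface)) w}
  mul_mem' := by
    rintro g₁ g₂ ⟨f₁, h₁, e₁⟩ ⟨f₂, h₂, e₂⟩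
    refine ⟨f₁ * f₂, Γ.mul_mem h₁ h₂, fun w => ?_⟩
    have h := H₁map_comp (f₁ : C(X.Surface, X.Surface)) (f₂ : C(X.Surface, X.Surface)) w
    rw [LinearEquiv.mul_apply, e₁, e₂, ← h]
    rfl
  one_mem' := ⟨1, Γ.one_mem, fun w => (H₁map_id (w : H₁ X.Surface)).symm⟩
  inv_mem' := by
    rintro g ⟨f, h, e⟩
    refine ⟨f⁻¹, Γ.inv_mem h, fun w => ?_⟩
    have h1 : (w : H₁ X.Surface) = H₁map (f : C(X.Surface, X.Surface)) (g⁻¹ w : X.zeroHolonomy) := by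
      rw [← e, ← LinearEquiv.mul_apply, mul_inv_cancel]; rfl
    rw [h1, ← H₁map_comp]
    have h2 : ((f⁻¹ : X.Surface ≃ₜ X.Surface) : C(X.Surface, X.Surface)).comp
        (f : C(X.Surface, X.Surface)) = ContinuousMap.id X.Surface := by
      ext x; simp
    rw [h2, H₁map_id]

/-- The Kontsevich–Zorich monodromy group: the action of `Aff(X)` on the zero-holonomy subspace. -/
noncomputable def monodromyGroup : Subgroup (X.zeroHolonomy ≃ₗ[ℝ] X.zeroHolonomy) :=
  X.homologyAction X.Aff

end LatticePolygons

/-! ### Unfolding of polyhedral surfaces -/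

/-- A regular `n`-gon with unit sides in the plane, in coordinates with respect to a basis of a
lattice that contains its corners and is invariant under the rotation `rot`, of order `m`, such
that the powers of `rot` are the rotational parts of all isometries between glued copies of it. -/
structure Tile (n m : ℕ) where
  corner : Fin n → Fin 2 → ℤ
  rot : Matrix (Fin 2) (Fin 2) ℤ

/-- The equilateral triangle, in the basis `1, exp(iπ/3)` of the plane; `rot` is the rotation by
`π/3`. -/
def triangleTile : Tile 3 6 where
  corner := ![![0, 0], ![1, 0], ![0, 1]]
  rot := !![0, -1; 1, 1]

/-- The square, in the basis `1, i` of the plane; `rot` is the rotation by `π/2`. -/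
def squareTile : Tile 4 4 where
  corner := ![![0, 0], ![1, 0], ![1, 1], ![0, 1]]
  rot := !![0, -1; 1, 0]

/-- The regular hexagon, in the basis `1, exp(iπ/3)` of the plane; `rot` is the rotation by
`π/3`. -/
def hexagonTile : Tile 6 6 where
  corner := ![![0, 0], ![1, 0], ![1, 1], ![0, 2], ![-1, 2], ![-1, 1]]
  rot := !![0, -1; 1, 1]

/-- An oriented polyhedral surface in `ℝ³` with regular `n`-gons as faces, or the quotient of a
periodic one by a lattice `period` of translations. `Face` indexes the faces (up to translations by
`period`), and the vertices of each face are listed counterclockwise with respect to the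
orientation of the surface. -/
structure PolyhedralSurface (n m : ℕ) where
  tile : Tile n m
  Face : Type
  base : Face
  vertex : Face → Fin n → Fin 3 → ℤ
  period : AddSubgroup (Fin 3 → ℤ)

namespace PolyhedralSurface

variable {n m : ℕ} [NeZero n] [NeZero m] (P : PolyhedralSurface n m)

/-- Side `j` of the face `f` and side `j'` of the face `f'` are the same edge of the surface. -/
def SameEdge (f : P.Face) (j : Fin n) (f' : P.Face) (j' : Fin n) : Prop :=
  ∃ t ∈ P.period, P.vertex f' j' = P.vertex f (j + 1) + t ∧ P.vertex f' (j' + 1) = P.vertex f j + t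

/-- The corner `j` of the tile rotated by the `k`-th power of `rot`. -/
def rotatedCorner (k : Fin m) (j : Fin n) : Fin 2 → ℤ :=
  (P.tile.rot ^ (k : ℕ)).mulVec (P.tile.corner j)

/-- The face `f` laid out in the plane with rotation `k` and the face `f'` laid out with rotation
`k'` fit together along their sides `j` and `j'` up to a translation. -/
def Fits (q : P.Face × Fin m) (j : Fin n) (q' : P.Face × Fin m) (j' : Fin n) : Prop :=
  P.SameEdge q.1 j q'.1 j' ∧
    P.rotatedCorner q'.2 (j' + 1) - P.rotatedCorner q'.2 j' =
      -(P.rotatedCorner q.2 (j + 1) - P.rotatedCorner q.2 j)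

/-- The translation cover (unfolding) of the polyhedral surface: its polygons are the faces laid out
in the plane in all the positions, up to translation, that are reached from one position of one face
by developing the surface along sequences of adjacent faces; polygons are glued along a side when
the faces share that edge and fit together by a translation. -/
def translationCover : LatticePolygons n where
  Cell := {q : P.Face × Fin m //
    Relation.ReflTransGen (fun a b => ∃ j j', P.Fits a j b j') (P.base, 0) q}
  corner q j := P.rotatedCorner q.1.2 j
  Glued q j q' j' := P.Fits q.1 j q'.1 j'

end PolyhedralSurface

/-- The octahedron with vertices `±e₁, ±e₂, ±e₃`. -/
def octahedron : PolyhedralSurface 3 6 where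
  tile := triangleTile
  Face := Fin 8
  base := 0
  vertex :=
    ![![![1, 0, 0], ![0, 1, 0], ![0, 0, 1]],
      ![![1, 0, 0], ![0, 0, -1], ![0, 1, 0]],
      ![![1, 0, 0], ![0, 0, 1], ![0, -1, 0]],
      ![![1, 0, 0], ![0, -1, 0], ![0, 0, -1]],
      ![![-1, 0, 0], ![0, 0, 1], ![0, 1, 0]],
      ![![-1, 0, 0], ![0, 1, 0], ![0, 0, -1]],
      ![![-1, 0, 0], ![0, -1, 0], ![0, 0, 1]],
      ![![-1, 0, 0], ![0, 0, -1], ![0, -1, 0]]]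
  period := ⊥

/-- The cube `[0, 1]³`. -/
def cube : PolyhedralSurface 4 4 where
  tile := squareTile
  Face := Fin 6
  base := 0
  vertex :=
    ![![![1, 0, 0], ![1, 1, 0], ![1, 1, 1], ![1, 0, 1]],
      ![![0, 0, 0], ![0, 0, 1], ![0, 1, 1], ![0, 1, 0]],
      ![![0, 1, 0], ![0, 1, 1], ![1, 1, 1], ![1, 1, 0]],
      ![![0, 0, 0], ![1, 0, 0], ![1, 0, 1], ![0, 0, 1]],
      ![![0, 0, 1], ![1, 0, 1], ![1, 1, 1], ![0, 1, 1]],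
      ![![0, 0, 0], ![0, 1, 0], ![1, 1, 0], ![1, 0, 0]]]
  period := ⊥

/-- The triples of signs with product `1`. -/
def evenSigns : Fin 4 → Fin 3 → ℤ := ![![1, 1, 1], ![1, -1, -1], ![-1, 1, -1], ![-1, -1, 1]]

/-- The compact quotient of the mutetrahedron `{6,6}`. Up to translations the faces are the four
hexagons of the truncated tetrahedron whose vertices are the permutations of `(±1, ±1, ±3)` with an
even number of minus signs. -/
def mutetrahedron : PolyhedralSurface 6 6 where
  tile := hexagonTile
  Face := Fin 4
  base := 0
  vertex q j i := evenSigns q i *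
    (![![-3, 1, -1], ![-1, 1, -3], ![1, -1, -3], ![1, -3, -1], ![-1, -3, 1], ![-3, -1, 1]] :
      Fin 6 → Fin 3 → ℤ) j i
  period := AddSubgroup.closure {![4, 4, 0], ![4, 0, 4], ![0, 4, 4]}

/-- The compact quotient of Octa-8 `{3,12}`. On each pair of opposite faces of the octahedron with
vertices `±3e₁, ±3e₂, ±3e₃` and its translates by `period`, tunnels are attached: the tunnel number
`q` is the octahedron with the vertices `a i` and `t i`, where the face `a 0, a 1, a 2` is shared
with the first octahedron and the face `t 0, t 1, t 2` with a translate of it. The surface consists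
of the six other faces of each of the four tunnels. -/
def octa8 : PolyhedralSurface 3 6 where
  tile := triangleTile
  Face := Fin 4 × Bool × Fin 3
  base := (0, false, 0)
  vertex := fun ⟨q, b, i⟩ =>
    let a : Fin 3 → Fin 3 → ℤ := fun l => Pi.single l (3 * evenSigns q l)
    let t : Fin 3 → Fin 3 → ℤ := fun l => 4 • evenSigns q - a l
    if b then ![t (i + 1), t i, a (i + 2)] else ![a i, a (i + 1), t (i + 2)]
  period := AddSubgroup.closure {![4, 4, 4], ![4, -4, -4], ![-4, 4, -4]}

/-- The compact quotient of the mucube `{4,6}`: the boundary of the union of the unit cubes whose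
lowest corner is an integer point with at most one odd coordinate. -/
def mucube : PolyhedralSurface 4 4 where
  tile := squareTile
  Face := Fin 12
  base := 0
  vertex :=
    ![![![1, 1, 0], ![1, 1, 1], ![2, 1, 1], ![2, 1, 0]],
      ![![1, 0, 0], ![2, 0, 0], ![2, 0, 1], ![1, 0, 1]],
      ![![1, 0, 1], ![2, 0, 1], ![2, 1, 1], ![1, 1, 1]],
      ![![1, 0, 0], ![1, 1, 0], ![2, 1, 0], ![2, 0, 0]],
      ![![0, 1, 1], ![1, 1, 1], ![1, 2, 1], ![0, 2, 1]],
      ![![0, 1, 0], ![0, 2, 0], ![1, 2, 0], ![1, 1, 0]],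
      ![![1, 1, 0], ![1, 2, 0], ![1, 2, 1], ![1, 1, 1]],
      ![![0, 1, 0], ![0, 1, 1], ![0, 2, 1], ![0, 2, 0]],
      ![![1, 0, 1], ![1, 1, 1], ![1, 1, 2], ![1, 0, 2]],
      ![![0, 0, 1], ![0, 0, 2], ![0, 1, 2], ![0, 1, 1]],
      ![![0, 1, 1], ![0, 1, 2], ![1, 1, 2], ![1, 1, 1]],
      ![![0, 0, 1], ![1, 0, 1], ![1, 0, 2], ![0, 0, 2]]]
  period := AddSubgroup.closure {![2, 0, 0], ![0, 2, 0], ![0, 0, 2]}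

/-! ### Zariski closures -/

section Zariski

variable (V : Type) [AddCommGroup V] [Module ℝ V]

/-- The algebra of regular functions on `GL(V)`, generated by the coefficients of `g` and `g⁻¹`. -/
def regularGL : Subalgebra ℝ ((V ≃ₗ[ℝ] V) → ℝ) :=
  Algebra.adjoin ℝ
    ({F | ∃ (l : Module.Dual ℝ V) (v : V), F = fun g => l (g v)} ∪
      {F | ∃ (l : Module.Dual ℝ V) (v : V), F = fun g => l (g⁻¹ v)})

variable {V}

theorem regularGL_comp (u : (V ≃ₗ[ℝ] V) → (V ≃ₗ[ℝ] V))
    (h1 : ∀ (l : Module.Dual ℝ V) (v : V), (fun g => l (u g v)) ∈ regularGL V)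
    (h2 : ∀ (l : Module.Dual ℝ V) (v : V), (fun g => l ((u g)⁻¹ v)) ∈ regularGL V)
    (F : (V ≃ₗ[ℝ] V) → ℝ) (hF : F ∈ regularGL V) : (fun g => F (u g)) ∈ regularGL V := by
  induction hF using Algebra.adjoin_induction with
  | mem F hF =>
    rcases hF with ⟨l, v, rfl⟩ | ⟨l, v, rfl⟩
    · exact h1 l v
    · exact h2 l v
  | algebraMap r => exact (regularGL V).algebraMap_mem r
  | add F G _ _ hF hG => exact (regularGL V).add_mem hF hG
  | mul F G _ _ hF hG => exact (regularGL V).mul_mem hF hG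

theorem regularGL_coeff (l : Module.Dual ℝ V) (v : V) :
    (fun g : V ≃ₗ[ℝ] V => l (g v)) ∈ regularGL V :=
  Algebra.subset_adjoin (Or.inl ⟨l, v, rfl⟩)

theorem regularGL_coeff_inv (l : Module.Dual ℝ V) (v : V) :
    (fun g : V ≃ₗ[ℝ] V => l (g⁻¹ v)) ∈ regularGL V :=
  Algebra.subset_adjoin (Or.inr ⟨l, v, rfl⟩)

theorem regularGL_mul_left (a : V ≃ₗ[ℝ] V) (F : (V ≃ₗ[ℝ] V) → ℝ) (hF : F ∈ regularGL V) :
    (fun g => F (a * g)) ∈ regularGL V :=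
  regularGL_comp (fun g => a * g)
    (fun l v => regularGL_coeff (l ∘ₗ a.toLinearMap) v)
    (fun l v => by
      have := regularGL_coeff_inv l (a⁻¹ v)
      simpa only [mul_inv_rev, LinearEquiv.mul_apply] using this) F hF

theorem regularGL_mul_right (a : V ≃ₗ[ℝ] V) (F : (V ≃ₗ[ℝ] V) → ℝ) (hF : F ∈ regularGL V) :
    (fun g => F (g * a)) ∈ regularGL V :=
  regularGL_comp (fun g => g * a)
    (fun l v => regularGL_coeff l (a v))
    (fun l v => by
      have := regularGL_coeff_inv (l ∘ₗ (a⁻¹ : V ≃ₗ[ℝ] V).toLinearMap) v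
      simpa only [mul_inv_rev, LinearEquiv.mul_apply, LinearMap.comp_apply,
        LinearEquiv.coe_coe] using this) F hF

theorem regularGL_inv (F : (V ≃ₗ[ℝ] V) → ℝ) (hF : F ∈ regularGL V) :
    (fun g => F g⁻¹) ∈ regularGL V :=
  regularGL_comp (fun g => g⁻¹) (fun l v => regularGL_coeff_inv l v)
    (fun l v => by simpa only [inv_inv] using regularGL_coeff l v) F hF

/-- The Zariski closure in `GL(V)` of a subgroup: the set of common zeros of all the regular
functions on `GL(V)` that vanish on the subgroup. -/
def zariskiClosure (Γ : Subgroup (V ≃ₗ[ℝ] V)) : Subgroup (V ≃ₗ[ℝ] V) where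
  carrier := {g | ∀ F ∈ regularGL V, (∀ γ ∈ Γ, F γ = 0) → F g = 0}
  mul_mem' := by
    intro a b ha hb F hF h0
    refine ha _ (regularGL_mul_right b F hF) fun γ hγ => ?_
    exact hb _ (regularGL_mul_left γ F hF) fun δ hδ => h0 _ (Γ.mul_mem hγ hδ)
  one_mem' := fun _ _ h0 => h0 1 Γ.one_mem
  inv_mem' := by
    intro a ha F hF h0
    exact ha _ (regularGL_inv F hF) fun γ hγ => h0 _ (Γ.inv_mem hγ)

/-- The identity component of a Zariski closed subgroup `G` of `GL(V)`: the smallest Zariski closed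
subgroup of finite index in `G`. -/
def identityComponent (G : Subgroup (V ≃ₗ[ℝ] V)) : Subgroup (V ≃ₗ[ℝ] V) :=
  sInf {K | K ≤ G ∧ zariskiClosure K = K ∧ K.IsFiniteRelIndex G}

/-- The algebra of regular functions on `SL(2, ℝ)^k`, generated by the matrix entries. -/
def regularSL2Pow (k : ℕ) : Subalgebra ℝ ((Fin k → Matrix.SpecialLinearGroup (Fin 2) ℝ) → ℝ) :=
  Algebra.adjoin ℝ {F | ∃ (i : Fin k) (a b : Fin 2), F = fun x => (x i).1 a b}

/-- The subgroup `G` of `GL(V)` is isomorphic to `SL(2, ℝ)^k` as a linear algebraic group: there is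
a group isomorphism that is regular in both directions. -/
def IsAlgebraicallySL2Pow (G : Subgroup (V ≃ₗ[ℝ] V)) (k : ℕ) : Prop :=
  ∃ e : (Fin k → Matrix.SpecialLinearGroup (Fin 2) ℝ) ≃* G,
    (∀ F ∈ regularGL V, (fun x => F (e x)) ∈ regularSL2Pow k) ∧
    ∀ F ∈ regularSL2Pow k, ∃ F' ∈ regularGL V, ∀ g : G, F (e.symm g) = F' g

end Zariski

/-- The Zariski closure `G` of the Kontsevich–Zorich monodromy group of `X` is, up to finite index,
`SL(2, ℝ)^k`: its identity component is of finite index in `G`, is isomorphic to `SL(2, ℝ)^k` as an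
algebraic group, and is the Zariski closure of the image of the group of the affine homeomorphisms
that commute with `Aut(X)`, which is of finite index in `Aff(X)`. -/
def HasMonodromySL2Pow {n : ℕ} [NeZero n] (X : LatticePolygons n) (k : ℕ) : Prop :=
  IsAlgebraicallySL2Pow (identityComponent (zariskiClosure X.monodromyGroup)) k ∧
  (identityComponent (zariskiClosure X.monodromyGroup)).IsFiniteRelIndex
    (zariskiClosure X.monodromyGroup) ∧
  X.AffCentral.IsFiniteRelIndex X.Aff ∧
  identityComponent (zariskiClosure X.monodromyGroup) =
    zariskiClosure (X.homologyAction X.AffCentral)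

/-! ### Linear functionals on the first homology as cocycles on paths -/

/-! Each of the five covers is square-tiled. Its faces, in lattice coordinates, are unions of halves
of unit squares, and regrouping the halves into squares gives an origami, that is, two permutations
`right` and `up` of the squares. The octahedron and Octa-8 lead to the same origami, labelled by the
tetrahedral group of order 12; the cube and the mucube lead to one labelled by the symmetric group
of degree four; the mutetrahedron leads to 24 squares on which an elementary abelian group of order
eight acts freely.

Under the symmetries over the torus, the first cohomology is the sum of the holonomy plane and of
summands V_j ⊗ ℝ², one for each of k pairwise different absolutely irreducible V_j: one of dimension
3; three of dimensions 2, 3, 3; four characters. An affine homeomorphism f carries singular points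
to singular points, so its linear part is integral; hence f differs from a product of shears and
quarter turns by an isomorphism over the torus, and it preserves the intersection form. If f also
commutes with Aut(X), it acts on V_j ⊗ ℝ² through the factor ℝ² alone, and the form makes the
determinant equal to one. So the image of Aff_*(X) lies in a copy of SL(2, ℝ)^k, which is cut out by
polynomial equations on the matrix coefficients (`Frame.Symmetries.IsFor.exists_actsBy`,
`mem_range_blockAction_of_mem_zariskiClosure`).

Conversely, in a direction in which all cylinders have widths dividing r, the r-fold shear is an
affine map that commutes with Aut(X) and is unipotent on each factor ℝ² (`exists_twist`,
`Frame.Twist.IsFor.exists_actsBy`). A polynomial that vanishes on the powers of a unipotent element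
vanishes on its one-parameter group, so the Zariski closure contains these groups. Two of them with
different axes produce SL(2, ℝ) at a place, a commutator with an element of smaller support isolates
the place, and the isolated places can be divided out (`SL2.place_inter_eq_top`,
`SL2.place_diff_eq_top`).

Finiteness of the indices holds because Aff(X) normalizes the finite group Aut(X). Since SL(2, ℝ)^k
is generated by divisible unipotent groups, it has no proper subgroup of finite index, and is
therefore the identity component.

The cohomology is made computable as follows. Functionals on singular H₁ are cocycles on paths
modulo variations of functions, and on an origami the class is determined by the values on the sides
of the squares (`pathCocycle.exists_eq_sub_of_sides`). Cutting the surface along a tree and further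
sides bounds the dimension from above (`CutSystem.IsFor.finrank_dual_le`); explicit orthogonal
planes with nonzero intersection form bound it from below (`Frame.linearIndependent`). What remains
are finite tables. -/

section PathCocycles

open CategoryTheory AlgebraicTopology Simplicial unitInterval

variable (X : Type) [TopologicalSpace X]

/-- The singular `1`-simplex with the same points as the path `γ`. -/
noncomputable def pathSimplex {X : Type} [TopologicalSpace X] (γ : C(I, X)) :
    C(stdSimplex ℝ (Fin 2), X) :=
  γ.comp (stdSimplexHomeomorphUnitInterval : C(stdSimplex ℝ (Fin 2), I))

/-- The path with the same points as a singular `1`-simplex. -/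
noncomputable def simplexPath {X : Type} [TopologicalSpace X] (s : C(stdSimplex ℝ (Fin 2), X)) :
    C(I, X) :=
  s.comp (stdSimplexHomeomorphUnitInterval.symm : C(I, stdSimplex ℝ (Fin 2)))

/-- The side of a singular triangle opposite to the vertex `i`, as a path. -/
noncomputable def sidePath {X : Type} [TopologicalSpace X] (τ : C(stdSimplex ℝ (Fin 3), X))
    (i : Fin 3) : C(I, X) :=
  simplexPath (τ.comp ⟨stdSimplex.map (Fin.succAbove i), stdSimplex.continuous_map _⟩)

/-- Real-valued functions on the paths of `X` that are cocycles on every singular triangle. -/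
def pathCocycle : Submodule ℝ (C(I, X) → ℝ) where
  carrier := {κ | ∀ τ : C(stdSimplex ℝ (Fin 3), X),
    κ (sidePath τ 0) - κ (sidePath τ 1) + κ (sidePath τ 2) = 0}
  add_mem' := fun {a b} ha hb τ => by
    have h1 := ha τ
    have h2 := hb τ
    simp only [Pi.add_apply]
    linarith
  zero_mem' := fun τ => by simp
  smul_mem' := fun r a ha τ => by
    have h1 := ha τ
    simp only [Pi.smul_apply, smul_eq_mul]
    linear_combination r * h1

/-! ### Extension of functionals from homology to chains. -/

section Extension

variable (K : ChainComplex (ModuleCat.{0} ℝ) ℕ) {R : ModuleCat.{0} ℝ}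

/-- Homology embeds into chains modulo boundaries, and over a field the embedding has a linear
retraction, with which a functional can be composed. -/
theorem exists_homologyι_comp_eq (L : K.homology 1 ⟶ R) :
    ∃ φ : K.opcycles 1 ⟶ R, K.homologyι 1 ≫ φ = L := by
  have hmono : Function.Injective (K.homologyι 1).hom :=
    (ModuleCat.mono_iff_injective _).1 inferInstance
  obtain ⟨s, hs⟩ := LinearMap.exists_leftInverse_of_injective (K.homologyι 1).hom
    (LinearMap.ker_eq_bot.2 hmono)
  refine ⟨ModuleCat.ofHom (L.hom ∘ₗ s), ModuleCat.hom_ext (LinearMap.ext fun w => ?_)⟩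
  exact congrArg L.hom (LinearMap.congr_fun hs w)

/-- Homology is the kernel of the differential on chains modulo boundaries. A functional that
vanishes there descends to the image of the differential and extends from this subspace to all
`0`-chains. This is what turns vanishing on homology into being a coboundary. -/
theorem exists_fromOpcycles_comp_eq (D : K.opcycles 1 ⟶ R) (h : K.homologyι 1 ≫ D = 0) :
    ∃ g : K.X 0 ⟶ R, K.fromOpcycles 1 0 ≫ g = D := by
  have hker : LinearMap.ker (K.fromOpcycles 1 0).hom ≤ LinearMap.ker D.hom := by
    intro x hx
    -- The element `x` of the kernel is regarded as a morphism from `ℝ`, so that the universal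
    -- property of the kernel applies to it.
    let k : ModuleCat.of ℝ ℝ ⟶ K.opcycles 1 := ModuleCat.ofHom (LinearMap.toSpanSingleton ℝ _ x)
    have hk : k ≫ K.fromOpcycles 1 0 = 0 := by
      refine ModuleCat.hom_ext (LinearMap.ext_ring ?_)
      change (K.fromOpcycles 1 0).hom ((1 : ℝ) • x) = 0
      rw [one_smul]
      exact hx
    let l := Limits.KernelFork.IsLimit.lift' (K.homologyIsKernel 1 0 (by simp)) k hk
    have hl : l.1 ≫ K.homologyι 1 = k := l.2
    have h2 : k ≫ D = 0 := by rw [← hl, Category.assoc, h, Limits.comp_zero]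
    have h3 : D.hom ((1 : ℝ) • x) = 0 := congrArg (fun φ => φ.hom (1 : ℝ)) h2
    rw [one_smul] at h3
    exact h3
  obtain ⟨g, hg⟩ := LinearMap.exists_extend
    (((LinearMap.ker (K.fromOpcycles 1 0).hom).liftQ D.hom hker) ∘ₗ
      (K.fromOpcycles 1 0).hom.quotKerEquivRange.symm.toLinearMap)
  refine ⟨ModuleCat.ofHom g, ModuleCat.hom_ext (LinearMap.ext fun x => ?_)⟩
  have := LinearMap.congr_fun hg ⟨(K.fromOpcycles 1 0).hom x, LinearMap.mem_range_self _ x⟩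
  rw [LinearMap.comp_apply, LinearMap.comp_apply] at this
  erw [LinearMap.quotKerEquivRange_symm_apply_image] at this
  exact this

end Extension

/-! ### Cocycles on paths represent the dual of the first homology. -/

namespace pathCocycle

/-- The real chain complex of the singular simplicial set. -/
noncomputable abbrev chains : ChainComplex (ModuleCat.{0} ℝ) ℕ :=
  (TopCat.toSSet.obj (TopCat.of X)).chainComplex (ModuleCat.of ℝ ℝ)

variable {X}

theorem simplexPath_pathSimplex (γ : C(I, X)) : simplexPath (pathSimplex γ) = γ := by
  ext t; simp [simplexPath, pathSimplex]

theorem pathSimplex_simplexPath (s : C(stdSimplex ℝ (Fin 2), X)) :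
    pathSimplex (simplexPath s) = s := by
  ext t; simp [simplexPath, pathSimplex]

/-- The linear map on singular `n`-chains with prescribed values on simplices. -/
noncomputable def ofSimplices {n : ℕ} (κ : C(stdSimplex ℝ (Fin (n + 1)), X) → ℝ) :
    (chains X).X n ⟶ ModuleCat.of ℝ ℝ :=
  ((TopCat.toSSet.obj (TopCat.of X)).isColimitChainComplexXCofan (ModuleCat.of ℝ ℝ) n).desc
    (Limits.Cofan.mk _ fun x => ModuleCat.ofHom
      (κ (TopCat.toSSetObjEquiv (TopCat.of X) _ x) • LinearMap.id))

theorem ι_ofSimplices {n : ℕ} (κ : C(stdSimplex ℝ (Fin (n + 1)), X) → ℝ)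
    (x : (TopCat.toSSet.obj (TopCat.of X)) _⦋n⦌) :
    (TopCat.toSSet.obj (TopCat.of X)).ιChainComplex x ≫ ofSimplices κ =
      ModuleCat.ofHom (κ (TopCat.toSSetObjEquiv (TopCat.of X) _ x) • LinearMap.id) :=
  ((TopCat.toSSet.obj (TopCat.of X)).isColimitChainComplexXCofan (ModuleCat.of ℝ ℝ) n).fac
    (Limits.Cofan.mk _ fun x => ModuleCat.ofHom
      (κ (TopCat.toSSetObjEquiv (TopCat.of X) _ x) • LinearMap.id)) ⟨x⟩

/-- The linear map on singular `1`-chains defined by a function on paths. -/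
noncomputable def onChains (κ : C(I, X) → ℝ) : (chains X).X 1 ⟶ ModuleCat.of ℝ ℝ :=
  ofSimplices (n := 1) fun s => κ (simplexPath s)

theorem d_onChains (κ : pathCocycle X) : (chains X).d 2 1 ≫ onChains κ.1 = 0 := by
  refine SSet.chainComplex_hom_ext fun x => ?_
  rw [SSet.ιChainComplex_d_assoc, Limits.comp_zero, Preadditive.sum_comp, Fin.sum_univ_three]
  simp only [onChains, ι_ofSimplices, Linear.smul_comp]
  have h := κ.2 (TopCat.toSSetObjEquiv (TopCat.of X) _ x)
  refine ModuleCat.hom_ext (LinearMap.ext fun r => ?_)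
  have h' : (κ.1 (sidePath (TopCat.toSSetObjEquiv (TopCat.of X) _ x) 0) -
    κ.1 (sidePath (TopCat.toSSetObjEquiv (TopCat.of X) _ x) 1) +
    κ.1 (sidePath (TopCat.toSSetObjEquiv (TopCat.of X) _ x) 2)) * r = 0 := by rw [h, zero_mul]
  rw [sub_eq_add_neg, add_mul, add_mul, neg_mul] at h'
  simp [pow_succ]
  exact h'

/-- The linear functional on `H₁` defined by a cocycle on paths. -/
noncomputable def functionalHom (κ : pathCocycle X) :
    (chains X).homology 1 ⟶ ModuleCat.of ℝ ℝ :=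
  (chains X).homologyι 1 ≫ (chains X).descOpcycles (onChains κ.1) 2 (by simp) (d_onChains κ)

theorem hom_ext_opcycles {f g : (chains X).opcycles 1 ⟶ ModuleCat.of ℝ ℝ}
    (h : ∀ x : (TopCat.toSSet.obj (TopCat.of X)) _⦋1⦌,
      (TopCat.toSSet.obj (TopCat.of X)).ιChainComplex x ≫ (chains X).pOpcycles 1 ≫ f =
      (TopCat.toSSet.obj (TopCat.of X)).ιChainComplex x ≫ (chains X).pOpcycles 1 ≫ g) : f = g := by
  rw [← cancel_epi ((chains X).pOpcycles 1)]
  exact SSet.chainComplex_hom_ext h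

theorem functionalHom_add (κ κ' : pathCocycle X) :
    functionalHom (κ + κ') = functionalHom κ + functionalHom κ' := by
  rw [functionalHom, functionalHom, functionalHom, ← Preadditive.comp_add]
  congr 1
  refine hom_ext_opcycles fun x => ?_
  simp only [Preadditive.comp_add, HomologicalComplex.p_descOpcycles, onChains, ι_ofSimplices]
  rw [← ModuleCat.ofHom_add, ← add_smul]

theorem functionalHom_smul (r : ℝ) (κ : pathCocycle X) :
    functionalHom (r • κ) = r • functionalHom κ := by
  rw [functionalHom, functionalHom, ← Linear.comp_smul]
  congr 1
  refine hom_ext_opcycles fun x => ?_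
  simp only [Linear.comp_smul, HomologicalComplex.p_descOpcycles, onChains, ι_ofSimplices]
  refine ModuleCat.hom_ext (LinearMap.ext fun r => ?_)
  simp [mul_assoc]

variable (X) in
/-- The linear functional on `H₁` defined by a cocycle on paths, as a linear map. -/
noncomputable def functional : pathCocycle X →ₗ[ℝ] Module.Dual ℝ (H₁ X) where
  toFun κ := (functionalHom κ).hom
  map_add' κ κ' := congrArg ModuleCat.Hom.hom (functionalHom_add κ κ')
  map_smul' r κ := congrArg ModuleCat.Hom.hom (functionalHom_smul r κ)

/-- The pullback of a cocycle along a continuous map. -/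
def pullback {Y : Type} [TopologicalSpace Y] (f : C(X, Y)) (κ : pathCocycle Y) : pathCocycle X :=
  ⟨fun γ => κ.1 (f.comp γ), fun τ => by exact κ.2 (f.comp τ)⟩

theorem functional_H₁map {Y : Type} [TopologicalSpace Y] (f : C(X, Y)) (κ : pathCocycle Y)
    (w : H₁ X) : functional Y κ (H₁map f w) = functional X (pullback f κ) w := by
  have h : HomologicalComplex.homologyMap (SSet.chainComplexMap
      (TopCat.toSSet.map (TopCat.ofHom f)) (ModuleCat.of ℝ ℝ)) 1 ≫ functionalHom κ =
      functionalHom (pullback f κ) := by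
    rw [functionalHom, functionalHom, HomologicalComplex.homologyι_naturality_assoc]
    congr 1
    refine hom_ext_opcycles fun x => ?_
    rw [HomologicalComplex.p_opcyclesMap_assoc]
    simp only [HomologicalComplex.p_descOpcycles]
    rw [SSet.ι_chainComplexMap_f_assoc]
    simp only [onChains, ι_ofSimplices]
    rfl
  exact congrArg (fun φ => φ.hom w) h

/-- The functional extends to chains modulo boundaries; evaluating the extension on single paths
gives the function, and killing boundaries of singular triangles is the cocycle condition. -/
theorem functional_surjective : Function.Surjective (functional X) := by
  intro L
  obtain ⟨φ, hφ⟩ := exists_homologyι_comp_eq (chains X) (R := ModuleCat.of ℝ ℝ) (ModuleCat.ofHom L)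
  let κ₀ : C(I, X) → ℝ := fun γ => (((TopCat.toSSet.obj (TopCat.of X)).ιChainComplex
    ((TopCat.toSSetObjEquiv (TopCat.of X) (Opposite.op ⦋1⦌)).symm (pathSimplex γ)) ≫
      (chains X).pOpcycles 1 ≫ φ).hom (1 : ℝ) : ℝ)
  have hκ : onChains κ₀ = (chains X).pOpcycles 1 ≫ φ := by
    refine SSet.chainComplex_hom_ext fun x => ?_
    rw [onChains, ι_ofSimplices]
    refine ModuleCat.hom_ext (LinearMap.ext_ring ?_)
    simp only [κ₀, pathSimplex_simplexPath, ModuleCat.hom_ofHom, LinearMap.smul_apply,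
      LinearMap.id_apply, smul_eq_mul, mul_one]
    erw [Equiv.symm_apply_apply]
  have hc : κ₀ ∈ pathCocycle X := by
    intro τ
    have h0 : (TopCat.toSSet.obj (TopCat.of X)).ιChainComplex
        ((TopCat.toSSetObjEquiv (TopCat.of X) (Opposite.op ⦋2⦌)).symm τ) ≫
        (chains X).d 2 1 ≫ onChains κ₀ = 0 := by
      rw [hκ, HomologicalComplex.d_pOpcycles_assoc, Limits.zero_comp, Limits.comp_zero]
    rw [SSet.ιChainComplex_d_assoc, Preadditive.sum_comp, Fin.sum_univ_three] at h0
    simp only [Preadditive.zsmul_comp, onChains, ι_ofSimplices] at h0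
    have h1 := congrArg (fun φ => (φ.hom (1 : ℝ) : ℝ)) h0
    simp [pow_succ] at h1
    rw [sub_eq_add_neg]
    exact h1
  refine ⟨⟨κ₀, hc⟩, ?_⟩
  have h2 : (chains X).descOpcycles (onChains κ₀) 2 (by simp) (d_onChains ⟨κ₀, hc⟩) = φ := by
    rw [← cancel_epi ((chains X).pOpcycles 1), HomologicalComplex.p_descOpcycles, hκ]
  have h3 : functionalHom ⟨κ₀, hc⟩ = ModuleCat.ofHom L := by rw [functionalHom, h2, hφ]; rfl
  exact congrArg ModuleCat.Hom.hom h3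

/-- The point of the standard `0`-simplex. -/
noncomputable def pointValue (u : X → ℝ) (s : C(stdSimplex ℝ (Fin 1), X)) : ℝ :=
  u (s (stdSimplex.vertex 0))

/-- The face with number `i` omits the vertex `i`, so the face `0` is the end point and the face `1`
the starting point. -/
theorem face_vertex (s : C(stdSimplex ℝ (Fin 2), X)) (i : Fin 2) :
    (s.comp ⟨stdSimplex.map (S := ℝ) (Fin.succAbove i : Fin 1 → Fin 2),
      stdSimplex.continuous_map _⟩) (stdSimplex.vertex 0) = simplexPath s (if i = 0 then 1 else 0) := by
  simp only [simplexPath, ContinuousMap.comp_apply]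
  congr 1
  refine (stdSimplexHomeomorphUnitInterval.symm_apply_eq.2 ?_).symm
  fin_cases i <;> simp [stdSimplexHomeomorphUnitInterval] <;> rfl

theorem d_ofSimplices_pointValue (u : X → ℝ) :
    (chains X).d 1 0 ≫ ofSimplices (n := 0) (pointValue u) =
      onChains fun γ => u (γ 1) - u (γ 0) := by
  refine SSet.chainComplex_hom_ext fun x => ?_
  rw [SSet.ιChainComplex_d_assoc, Preadditive.sum_comp, Fin.sum_univ_two]
  simp only [Preadditive.zsmul_comp, onChains, ι_ofSimplices]
  have h0 : pointValue u (TopCat.toSSetObjEquiv (TopCat.of X) _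
      ((TopCat.toSSet.obj (TopCat.of X)).δ 0 x)) =
      u (simplexPath (TopCat.toSSetObjEquiv (TopCat.of X) _ x) 1) :=
    congrArg u (face_vertex (X := X) (TopCat.toSSetObjEquiv (TopCat.of X) _ x) 0)
  have h1 : pointValue u (TopCat.toSSetObjEquiv (TopCat.of X) _
      ((TopCat.toSSet.obj (TopCat.of X)).δ 1 x)) =
      u (simplexPath (TopCat.toSSetObjEquiv (TopCat.of X) _ x) 0) :=
    congrArg u (face_vertex (X := X) (TopCat.toSSetObjEquiv (TopCat.of X) _ x) 1)
  refine ModuleCat.hom_ext (LinearMap.ext_ring ?_)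
  simp only [ModuleCat.hom_add, ModuleCat.hom_neg, ModuleCat.hom_ofHom, LinearMap.add_apply,
    LinearMap.smul_apply, LinearMap.id_apply, smul_eq_mul, mul_one, Fin.val_zero, pow_zero,
    one_smul, Fin.val_one, pow_one, neg_smul, LinearMap.neg_apply]
  erw [h0, h1]
  exact (sub_eq_add_neg (u _) (u _)).symm

/-- A functional vanishing on homology factors through the boundary map to `0`-chains, and the
values of the second factor on points form the potential `u`. Conversely cycles have zero boundary.
No continuity of `u` is involved. -/
theorem functional_eq_zero_iff (κ : pathCocycle X) :
    functional X κ = 0 ↔ ∃ u : X → ℝ, ∀ γ, κ.1 γ = u (γ 1) - u (γ 0) := by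
  constructor
  · intro h
    set D := (chains X).descOpcycles (onChains κ.1) 2 (by simp) (d_onChains κ) with hD
    have h1 : (chains X).homologyι 1 ≫ D = 0 := ModuleCat.hom_ext h
    obtain ⟨g, hfac⟩ := exists_fromOpcycles_comp_eq (chains X) D h1
    have hon : onChains κ.1 = (chains X).d 1 0 ≫ g := by
      rw [← (chains X).p_fromOpcycles 1 0, Category.assoc, hfac, hD,
        HomologicalComplex.p_descOpcycles]
    let u : X → ℝ := fun x => g.hom (((TopCat.toSSet.obj (TopCat.of X)).ιChainComplex
      (R := ModuleCat.of ℝ ℝ)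
      ((TopCat.toSSetObjEquiv (TopCat.of X) (Opposite.op ⦋0⦌)).symm (ContinuousMap.const _ x))).hom
        (1 : ℝ))
    have hgu : g = ofSimplices (n := 0) (pointValue u) := by
      refine SSet.chainComplex_hom_ext fun x => ?_
      rw [ι_ofSimplices]
      refine ModuleCat.hom_ext (LinearMap.ext_ring ?_)
      -- The standard `0`-simplex is a single point, so every singular `0`-simplex is constant.
      have hx : x = (TopCat.toSSetObjEquiv (TopCat.of X) (Opposite.op ⦋0⦌)).symm
          (ContinuousMap.const _ ((TopCat.toSSetObjEquiv (TopCat.of X) (Opposite.op ⦋0⦌) x)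
            (stdSimplex.vertex 0))) := by
        rw [Equiv.eq_symm_apply]
        refine ContinuousMap.ext fun y => ?_
        have : Subsingleton (stdSimplex ℝ (Fin 1)) := inferInstance
        exact congrArg _ (this.elim _ _)
      conv_lhs => rw [hx]
      simp only [ModuleCat.hom_ofHom, LinearMap.smul_apply, LinearMap.id_apply, smul_eq_mul, mul_one]
      rfl
    refine ⟨u, fun γ => ?_⟩
    rw [hgu, d_ofSimplices_pointValue] at hon
    have h5 := congrArg (fun φ => ((TopCat.toSSet.obj (TopCat.of X)).ιChainComplex
      (R := ModuleCat.of ℝ ℝ) ((TopCat.toSSetObjEquiv (TopCat.of X) (Opposite.op ⦋1⦌)).symm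
        (pathSimplex γ)) ≫ φ).hom (1 : ℝ)) hon
    simp only [onChains, ι_ofSimplices] at h5
    erw [Equiv.apply_symm_apply] at h5
    simpa [simplexPath_pathSimplex] using h5
  · rintro ⟨u, hu⟩
    have h : functionalHom κ = 0 := by
      have h1 : (chains X).descOpcycles (onChains κ.1) 2 (by simp) (d_onChains κ) =
          (chains X).fromOpcycles 1 0 ≫ ofSimplices (n := 0) (pointValue u) := by
        rw [← cancel_epi ((chains X).pOpcycles 1), HomologicalComplex.p_descOpcycles,
          HomologicalComplex.p_fromOpcycles_assoc, d_ofSimplices_pointValue]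
        congr 1
        exact funext hu
      rw [functionalHom, h1, HomologicalComplex.homologyι_comp_fromOpcycles_assoc, Limits.zero_comp]
    exact congrArg ModuleCat.Hom.hom h

end pathCocycle

end PathCocycles

/-! ### Subdivision, homotopy and lifting for cocycles on paths. -/

section PathCalculus

open unitInterval

/-- Linear interpolation in the unit interval. -/
noncomputable def lerp (a b t : I) : I :=
  ⟨(1 - (t : ℝ)) * a + t * b, by
    constructor
    · have := t.2.2; have := a.2.1; have := b.2.1; have := t.2.1
      nlinarith [mul_nonneg (sub_nonneg.2 t.2.2) a.2.1, mul_nonneg t.2.1 b.2.1]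
    · nlinarith [mul_le_mul_of_nonneg_left a.2.2 (sub_nonneg.2 t.2.2),
        mul_le_mul_of_nonneg_left b.2.2 t.2.1]⟩

theorem coe_lerp (a b t : I) : (lerp a b t : ℝ) = (1 - (t : ℝ)) * a + t * b := rfl

@[simp] theorem lerp_zero (a b : I) : lerp a b 0 = a := Subtype.ext (by simp [coe_lerp])
@[simp] theorem lerp_one (a b : I) : lerp a b 1 = b := Subtype.ext (by simp [coe_lerp])
@[simp] theorem lerp_self (a t : I) : lerp a a t = a := Subtype.ext (by simp [coe_lerp]; ring)
@[simp] theorem lerp_zero_one (t : I) : lerp 0 1 t = t := Subtype.ext (by simp [coe_lerp])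

theorem continuous_lerp : Continuous fun q : I × I × I => lerp q.1 q.2.1 q.2.2 :=
  Continuous.subtype_mk (by fun_prop) _

variable {X : Type} [TopologicalSpace X]

/-- The image of the straight segment from `A` to `B` in the unit square. -/
noncomputable def segPath (g : C(I × I, X)) (A B : I × I) : C(I, X) :=
  g.comp ⟨fun t => (lerp A.1 B.1 t, lerp A.2 B.2 t),
    (continuous_lerp.comp (by fun_prop : Continuous fun t : I => (A.1, B.1, t))).prodMk
      (continuous_lerp.comp (by fun_prop : Continuous fun t : I => (A.2, B.2, t)))⟩

theorem segPath_apply (g : C(I × I, X)) (A B : I × I) (t : I) :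
    segPath g A B t = g (lerp A.1 B.1 t, lerp A.2 B.2 t) := rfl

/-- The image of the path `γ` restricted to `[a, b]`. -/
noncomputable def subPath (γ : C(I, X)) (a b : I) : C(I, X) :=
  segPath (γ.comp ⟨Prod.fst, continuous_fst⟩) (a, 0) (b, 0)

theorem subPath_apply (γ : C(I, X)) (a b t : I) : subPath γ a b t = γ (lerp a b t) := rfl

theorem subPath_zero_one (γ : C(I, X)) : subPath γ 0 1 = γ := by
  ext t; simp [subPath_apply]

/-- The barycentric combination of three points of the unit interval. -/
noncomputable def baryComb (a : Fin 3 → I) (x : stdSimplex ℝ (Fin 3)) : I :=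
  ⟨∑ i, x.1 i * a i, by
    have h0 := x.2.1
    have h1 := x.2.2
    constructor
    · exact Finset.sum_nonneg fun i _ => mul_nonneg (h0 i) (a i).2.1
    · rw [← h1]
      exact Finset.sum_le_sum fun i _ => mul_le_of_le_one_right (h0 i) (a i).2.2⟩

theorem continuous_baryComb (a : Fin 3 → I) : Continuous (baryComb a) := by
  refine Continuous.subtype_mk ?_ _
  refine continuous_finsetSum _ fun i _ => ?_
  exact ((continuous_apply i).comp continuous_subtype_val).mul continuous_const

theorem baryComb_map (a : Fin 3 → I) (i : Fin 3) (t : I) :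
    baryComb a (stdSimplex.map (Fin.succAbove i) (stdSimplexHomeomorphUnitInterval.symm t)) =
      lerp (a (i.succAbove 0)) (a (i.succAbove 1)) t := by
  refine Subtype.ext ?_
  have hs : (stdSimplexHomeomorphUnitInterval.symm t).1 = ![1 - (t : ℝ), t] := by
    obtain ⟨x, rfl⟩ := stdSimplexHomeomorphUnitInterval.surjective t
    rw [Homeomorph.symm_apply_apply]
    have h1 := x.2.2
    rw [Fin.sum_univ_two] at h1
    funext j
    fin_cases j
    · change x.1 0 = 1 - x.1 1
      linarith
    · rfl
  simp only [baryComb, coe_lerp]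
  change ∑ j, FunOnFinite.map (Fin.succAbove i) (stdSimplexHomeomorphUnitInterval.symm t).1 j * _ = _
  rw [hs]
  simp only [FunOnFinite.map_apply_apply, Finset.sum_filter, Fin.sum_univ_two]
  fin_cases i <;> simp [Fin.succAbove, Fin.lt_def] <;> rw [Fin.sum_univ_three] <;> simp

namespace pathCocycle

/-- The affine triangle with the corners `A`, `B`, `C` lies in the unit square, and its image under
`g` is a singular triangle whose sides are the three segments. All homotopy invariance used below
comes from this. -/
theorem segPath_add (κ : pathCocycle X) (g : C(I × I, X)) (A B C : I × I) :
    κ.1 (segPath g A B) + κ.1 (segPath g B C) = κ.1 (segPath g A C) := by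
  have h := κ.2 (g.comp ⟨fun x => (baryComb ![A.1, B.1, C.1] x, baryComb ![A.2, B.2, C.2] x),
    (continuous_baryComb _).prodMk (continuous_baryComb _)⟩)
  have h0 : sidePath (g.comp ⟨fun x => (baryComb ![A.1, B.1, C.1] x, baryComb ![A.2, B.2, C.2] x),
    (continuous_baryComb _).prodMk (continuous_baryComb _)⟩) 0 = segPath g B C := by
    ext t
    simp only [sidePath, simplexPath, ContinuousMap.comp_apply, ContinuousMap.coe_mk,
      baryComb_map, segPath_apply]
    rfl
  have h1 : sidePath (g.comp ⟨fun x => (baryComb ![A.1, B.1, C.1] x, baryComb ![A.2, B.2, C.2] x),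
    (continuous_baryComb _).prodMk (continuous_baryComb _)⟩) 1 = segPath g A C := by
    ext t
    simp only [sidePath, simplexPath, ContinuousMap.comp_apply, ContinuousMap.coe_mk,
      baryComb_map, segPath_apply]
    rfl
  have h2 : sidePath (g.comp ⟨fun x => (baryComb ![A.1, B.1, C.1] x, baryComb ![A.2, B.2, C.2] x),
    (continuous_baryComb _).prodMk (continuous_baryComb _)⟩) 2 = segPath g A B := by
    ext t
    simp only [sidePath, simplexPath, ContinuousMap.comp_apply, ContinuousMap.coe_mk,
      baryComb_map, segPath_apply]
    rfl
  rw [h0, h1, h2] at h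
  linarith

theorem subPath_add (κ : pathCocycle X) (γ : C(I, X)) (a b c : I) :
    κ.1 (subPath γ a b) + κ.1 (subPath γ b c) = κ.1 (subPath γ a c) :=
  segPath_add κ _ _ _ _

/-- A constant path is the concatenation of two copies of itself. -/
theorem const_eq_zero (κ : pathCocycle X) (x : X) : κ.1 (ContinuousMap.const I x) = 0 := by
  have h := subPath_add κ (ContinuousMap.const I x) 0 1 1
  have h0 : ∀ a b, subPath (ContinuousMap.const I x) a b = ContinuousMap.const I x := by
    intro a b; ext t; simp [subPath_apply]
  rw [h0, h0] at h
  linarith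

/-- Going around a square. -/
theorem square (κ : pathCocycle X) (g : C(I × I, X)) :
    κ.1 (segPath g (0, 0) (1, 0)) + κ.1 (segPath g (1, 0) (1, 1)) =
      κ.1 (segPath g (0, 0) (0, 1)) + κ.1 (segPath g (0, 1) (1, 1)) := by
  rw [segPath_add, segPath_add]

/-- A cocycle that is the variation of a function on the paths in the members of an open cover is
so on all paths. -/
theorem eq_sub_of_openCover (κ : pathCocycle X) (u : X → ℝ) {ι : Type*} (U : ι → Set X)
    (hU : ∀ i, IsOpen (U i)) (hcov : ∀ x, ∃ i, x ∈ U i)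
    (h : ∀ i (γ : C(I, X)), (∀ t, γ t ∈ U i) → κ.1 γ = u (γ 1) - u (γ 0)) (γ : C(I, X)) :
    κ.1 γ = u (γ 1) - u (γ 0) := by
  -- By compactness the unit interval has a subdivision each of whose pieces is mapped into one
  -- member of the cover; the variations along the pieces then telescope.
  obtain ⟨t, ht0, hmono, ⟨n, hn⟩, ht⟩ := exists_monotone_Icc_subset_open_cover_unitInterval
    (c := fun i => γ ⁻¹' U i) (fun i => (hU i).preimage γ.continuous)
    (fun s _ => Set.mem_iUnion.2 (hcov (γ s)))
  have key : ∀ m, κ.1 (subPath γ (t 0) (t m)) = u (γ (t m)) - u (γ (t 0)) := by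
    intro m
    induction m with
    | zero =>
      have := subPath_add κ γ (t 0) (t 0) (t 0)
      linarith
    | succ m ih =>
      rw [← subPath_add κ γ (t 0) (t m), ih]
      obtain ⟨i, hi⟩ := ht m
      have := h i (subPath γ (t m) (t (m + 1))) (fun s => hi (by
        have hm : (t m : ℝ) ≤ t (m + 1) := hmono (Nat.le_succ m)
        constructor
        · change (t m : ℝ) ≤ lerp (t m) (t (m + 1)) s
          rw [coe_lerp]; nlinarith [s.2.1]
        · change (lerp (t m) (t (m + 1)) s : ℝ) ≤ t (m + 1)
          rw [coe_lerp]; nlinarith [s.2.2]))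
      rw [this]
      simp [subPath_apply]
  have := key n
  rwa [ht0, hn n le_rfl, subPath_zero_one] at this

theorem exists_lift_circle (θ : C(I, UnitAddCircle)) :
    ∃ Γ : C(I, ℝ), ∀ t, ((Γ t : ℝ) : UnitAddCircle) = θ t := by
  obtain ⟨e, he⟩ := QuotientAddGroup.mk_surjective (θ 0)
  obtain ⟨Γ, h1, -⟩ := (AddCircle.isCoveringMap_coe (1 : ℝ)).exists_path_lifts θ e he.symm
  exact ⟨Γ, fun t => congrFun h1 t⟩

/-- The triangle is star-shaped with respect to a vertex. The contraction `k` to this vertex is a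
homotopy that starts at a constant map; lifting it from the constant lift and evaluating at time `1`
gives the lift. -/
theorem exists_lift_circle_triangle (θ : C(stdSimplex ℝ (Fin 3), UnitAddCircle)) :
    ∃ Γ : C(stdSimplex ℝ (Fin 3), ℝ), ∀ t, ((Γ t : ℝ) : UnitAddCircle) = θ t := by
  let P := stdSimplex ℝ (Fin 3)
  have hconv : Convex ℝ P := convex_stdSimplex ℝ (Fin 3)
  let v : P := stdSimplex.vertex 0
  let k : C(I × P, P) := ⟨fun q => ⟨(1 - (q.1 : ℝ)) • v.1 + (q.1 : ℝ) • q.2.1,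
    hconv v.2 q.2.2 (sub_nonneg.2 q.1.2.2) q.1.2.1 (by ring)⟩, by
      refine Continuous.subtype_mk ?_ _
      fun_prop⟩
  obtain ⟨e, he⟩ := QuotientAddGroup.mk_surjective (θ v)
  have H0 : ∀ a, (θ.comp k) (0, a) = (((ContinuousMap.const P e) a : ℝ) : UnitAddCircle) := by
    intro a
    have : k (0, a) = v := Subtype.ext (by simp [k])
    rw [ContinuousMap.comp_apply, this, ← he]
    rfl
  let L := (AddCircle.isCoveringMap_coe (1 : ℝ)).liftHomotopy (θ.comp k) (ContinuousMap.const P e) H0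
  refine ⟨L.comp ⟨fun a => (1, a), by fun_prop⟩, fun a => ?_⟩
  have h := congrFun ((AddCircle.isCoveringMap_coe (1 : ℝ)).liftHomotopy_lifts (θ.comp k)
    (ContinuousMap.const P e) H0) (1, a)
  have h1 : k (1, a) = a := Subtype.ext (by simp [k])
  rw [ContinuousMap.comp_apply, h1] at h
  exact h

/-- The difference of two lifts is continuous with integer values, hence constant on the interval.
-/
theorem lift_circle_unique {Γ Γ' : C(I, ℝ)}
    (h : ∀ t, ((Γ t : ℝ) : UnitAddCircle) = ((Γ' t : ℝ) : UnitAddCircle)) :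
    Γ 1 - Γ 0 = Γ' 1 - Γ' 0 := by
  have hz : ∀ t, ∃ n : ℤ, (n : ℝ) = Γ t - Γ' t := by
    intro t
    have h0 : (((Γ t - Γ' t : ℝ)) : UnitAddCircle) = 0 := by
      rw [AddCircle.coe_sub, h t, sub_self]
    obtain ⟨n, hn⟩ := (AddCircle.coe_eq_zero_iff (1 : ℝ)).1 h0
    exact ⟨n, by simpa using hn⟩
  have hc : Continuous fun t => Γ t - Γ' t := by fun_prop
  have : ∀ s t, Γ s - Γ' s = Γ t - Γ' t := by
    have hmem : ∀ t, Γ t - Γ' t ∈ Set.range ((↑) : ℤ → ℝ) := fun t => hz t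
    have hcc : Continuous fun t : I => (⟨Γ t - Γ' t, hmem t⟩ : Set.range ((↑) : ℤ → ℝ)) :=
      Continuous.subtype_mk hc _
    have hd : DiscreteTopology (Set.range ((↑) : ℤ → ℝ)) :=
      (Homeomorph.discreteTopology_iff
        Int.isClosedEmbedding_coe_real.isEmbedding.toHomeomorph).1 inferInstance
    intro s t
    exact congrArg Subtype.val (PreconnectedSpace.constant inferInstance hcc (x := s) (y := t))
  have := this 0 1
  linarith

/-- The six end points of the three sides are the three vertices, each occurring twice with opposite
signs. -/
theorem sidePath_sum {Z : Type} [TopologicalSpace Z] (τ : C(stdSimplex ℝ (Fin 3), Z)) (w : Z → ℝ) :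
    (w (sidePath τ 0 1) - w (sidePath τ 0 0)) - (w (sidePath τ 1 1) - w (sidePath τ 1 0)) +
      (w (sidePath τ 2 1) - w (sidePath τ 2 0)) = 0 := by
  have hv : ∀ i : Fin 3, sidePath τ i 0 = τ (stdSimplex.vertex (i.succAbove 0)) ∧
      sidePath τ i 1 = τ (stdSimplex.vertex (i.succAbove 1)) := by
    intro i
    have e0 : stdSimplexHomeomorphUnitInterval.symm (0 : I) = stdSimplex.vertex 0 := by
      rw [Homeomorph.symm_apply_eq]
      refine Subtype.ext ?_
      change (0 : ℝ) = (Pi.single 0 1 : Fin 2 → ℝ) 1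
      simp
    have e1 : stdSimplexHomeomorphUnitInterval.symm (1 : I) = stdSimplex.vertex 1 := by
      rw [Homeomorph.symm_apply_eq]
      refine Subtype.ext ?_
      change (1 : ℝ) = (Pi.single 1 1 : Fin 2 → ℝ) 1
      simp
    simp [sidePath, simplexPath, e0, e1, stdSimplex.map_vertex]
  rw [(hv 0).1, (hv 0).2, (hv 1).1, (hv 1).2, (hv 2).1, (hv 2).2]
  have k0 : (0 : Fin 3).succAbove 0 = 1 := rfl
  have k1 : (0 : Fin 3).succAbove 1 = 2 := rfl
  have k2 : (1 : Fin 3).succAbove 0 = 0 := rfl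
  have k3 : (1 : Fin 3).succAbove 1 = 2 := rfl
  have k4 : (2 : Fin 3).succAbove 0 = 0 := rfl
  have k5 : (2 : Fin 3).succAbove 1 = 1 := rfl
  rw [k0, k1, k2, k3, k4, k5]
  ring

/-- The variation of a function along paths. -/
def coboundary (w : X → ℝ) : pathCocycle X :=
  ⟨fun γ => w (γ 1) - w (γ 0), fun τ => sidePath_sum τ w⟩

/-- The cocycle of a circle-valued function: its variation along paths. -/
noncomputable def ofCircle (θ : C(X, UnitAddCircle)) : pathCocycle X :=
  ⟨fun γ => (exists_lift_circle (θ.comp γ)).choose 1 - (exists_lift_circle (θ.comp γ)).choose 0, by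
    intro τ
    obtain ⟨Γ, hΓ⟩ := exists_lift_circle_triangle (θ.comp τ)
    -- The variation does not depend on the lift, so on all three sides it may be read off from one
    -- lift over the whole triangle.
    have h : ∀ i, (exists_lift_circle (θ.comp (sidePath τ i))).choose 1 -
        (exists_lift_circle (θ.comp (sidePath τ i))).choose 0 =
        sidePath Γ i 1 - sidePath Γ i 0 := fun i =>
      lift_circle_unique fun t => by
        rw [(exists_lift_circle (θ.comp (sidePath τ i))).choose_spec t]
        exact (hΓ _).symm
    simp only [h]
    exact sidePath_sum Γ fun r => r⟩

theorem ofCircle_eq (θ : C(X, UnitAddCircle)) (γ : C(I, X)) (Γ : C(I, ℝ))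
    (h : ∀ t, ((Γ t : ℝ) : UnitAddCircle) = θ (γ t)) : (ofCircle θ).1 γ = Γ 1 - Γ 0 :=
  lift_circle_unique fun t => by
    rw [(exists_lift_circle (θ.comp γ)).choose_spec t, h t]
    rfl

end pathCocycle

end PathCalculus

/-! ### Square-tiled surfaces -/

/-- A square-tiled surface: `right q` and `up q` are the squares glued to the right and to the
upper side of the square `q`. -/
structure Origami (Q : Type) where
  right : Equiv.Perm Q
  up : Equiv.Perm Q

namespace Origami

open unitInterval

variable {Q : Type} (O : Origami Q)

/-- The side identifications of the unit squares. -/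
inductive Rel : (Σ _ : Q, I × I) → (Σ _ : Q, I × I) → Prop
  | right (q : Q) (y : I) : Rel ⟨q, (1, y)⟩ ⟨O.right q, (0, y)⟩
  | up (q : Q) (x : I) : Rel ⟨q, (x, 1)⟩ ⟨O.up q, (x, 0)⟩

/-- The surface glued from the squares. -/
def Surface : Type := Quot O.Rel

instance : TopologicalSpace O.Surface := inferInstanceAs (TopologicalSpace (Quot O.Rel))

/-- The closed square `q` in the surface. -/
def square (q : Q) : C(I × I, O.Surface) :=
  ⟨fun z => Quot.mk O.Rel ⟨q, z⟩, continuous_quot_mk.comp continuous_sigmaMk⟩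

theorem square_right (q : Q) (y : I) : O.square q (1, y) = O.square (O.right q) (0, y) :=
  Quot.sound (Rel.right q y)

theorem square_up (q : Q) (x : I) : O.square q (x, 1) = O.square (O.up q) (x, 0) :=
  Quot.sound (Rel.up q x)

variable {O} in
theorem exists_square_eq (s : O.Surface) : ∃ q z, O.square q z = s := by
  obtain ⟨⟨q, z⟩, rfl⟩ := Quot.exists_rep s
  exact ⟨q, z, rfl⟩

/-- A function on the surface given by its values on the squares. -/
def descend {Z : Type*} (f : Q → I × I → Z) (hr : ∀ q y, f q (1, y) = f (O.right q) (0, y))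
    (hu : ∀ q x, f q (x, 1) = f (O.up q) (x, 0)) : O.Surface → Z :=
  Quot.lift (fun z => f z.1 z.2) (by
    rintro _ _ (⟨q, y⟩ | ⟨q, x⟩)
    · exact hr q y
    · exact hu q x)

/-- A continuous map on the surface given by continuous maps on the squares. -/
def lift {Z : Type*} [TopologicalSpace Z] (f : Q → C(I × I, Z))
    (hr : ∀ q y, f q (1, y) = f (O.right q) (0, y))
    (hu : ∀ q x, f q (x, 1) = f (O.up q) (x, 0)) : C(O.Surface, Z) :=
  ⟨O.descend (fun q => f q) hr hu,
    continuous_quot_lift _ (continuous_sigma fun q => (f q).continuous)⟩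

@[simp] theorem lift_square {Z : Type*} [TopologicalSpace Z] (f : Q → C(I × I, Z))
    (hr : ∀ q y, f q (1, y) = f (O.right q) (0, y))
    (hu : ∀ q x, f q (x, 1) = f (O.up q) (x, 0)) (q : Q) (z : I × I) :
    O.lift f hr hu (O.square q z) = f q z := rfl

theorem isOpen_iff {U : Set O.Surface} : IsOpen U ↔ ∀ q, IsOpen (O.square q ⁻¹' U) := by
  change IsOpen (Quot.mk O.Rel ⁻¹' U) ↔ _
  rw [isOpen_sigma_iff]
  rfl

/-- The projection to the square torus. -/
def toTorus : C(O.Surface, UnitAddTorus (Fin 2)) :=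
  O.lift (fun _ => ⟨fun z i => (((![(z.1 : ℝ), (z.2 : ℝ)] i : ℝ)) : UnitAddCircle), by
      refine continuous_pi fun i => (AddCircle.continuous_mk' 1).comp ?_
      fin_cases i
      · exact continuous_subtype_val.comp continuous_fst
      · exact continuous_subtype_val.comp continuous_snd⟩)
    (fun q y => by
      funext i
      fin_cases i
      · simp
      · rfl)
    (fun q x => by
      funext i
      fin_cases i
      · rfl
      · simp)

theorem toTorus_square_zero (q : Q) (z : I × I) :
    O.toTorus (O.square q z) 0 = ((z.1 : ℝ) : UnitAddCircle) := rfl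

theorem toTorus_square_one (q : Q) (z : I × I) :
    O.toTorus (O.square q z) 1 = ((z.2 : ℝ) : UnitAddCircle) := rfl

/-! #### Collapsing a neighbourhood of the sides -/

/-- The map of the unit interval that collapses neighbourhoods of the end points. -/
noncomputable def collapseI (x : I) : I := Set.projIcc (0 : ℝ) 1 zero_le_one (2 * x - 1 / 2)

theorem continuous_collapseI : Continuous collapseI :=
  continuous_projIcc.comp (by fun_prop)

theorem collapseI_of_lt {x : I} (h : (x : ℝ) < 1 / 4) : collapseI x = 0 :=
  Set.projIcc_of_le_left _ (by linarith)

theorem collapseI_of_gt {x : I} (h : 3 / 4 < (x : ℝ)) : collapseI x = 1 :=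
  Set.projIcc_of_right_le _ (by linarith)

@[simp] theorem collapseI_zero : collapseI 0 = 0 := collapseI_of_lt (by norm_num)
@[simp] theorem collapseI_one : collapseI 1 = 1 := collapseI_of_gt (by norm_num)

/-- The straight-line homotopy from the identity to the collapsing map. -/
noncomputable def collapseHomotopy : C(O.Surface, C(I, O.Surface)) :=
  O.lift (fun q => ContinuousMap.curry ((O.square q).comp
      ⟨fun a => (lerp a.1.1 (collapseI a.1.1) a.2, lerp a.1.2 (collapseI a.1.2) a.2), by
        have h := continuous_collapseI
        exact (continuous_lerp.comp (by fun_prop : Continuous fun a : (I × I) × I =>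
          (a.1.1, collapseI a.1.1, a.2))).prodMk (continuous_lerp.comp (by fun_prop :
            Continuous fun a : (I × I) × I => (a.1.2, collapseI a.1.2, a.2)))⟩))
    (fun q y => by ext t; simp [square_right])
    (fun q x => by ext t; simp [square_up])

theorem collapseHomotopy_square (q : Q) (z : I × I) (t : I) :
    O.collapseHomotopy (O.square q z) t =
      O.square q (lerp z.1 (collapseI z.1) t, lerp z.2 (collapseI z.2) t) := rfl

/-- The collapsing map. -/
noncomputable def collapse (s : O.Surface) : O.Surface := O.collapseHomotopy s 1

theorem collapse_square (q : Q) (z : I × I) :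
    O.collapse (O.square q z) = O.square q (collapseI z.1, collapseI z.2) := by
  simp [collapse, collapseHomotopy_square]

theorem collapseHomotopy_zero (s : O.Surface) : O.collapseHomotopy s 0 = s := by
  obtain ⟨q, z, rfl⟩ := exists_square_eq s
  simp [collapseHomotopy_square]

/-! #### Open cells and their stars -/

/-- The open square. -/
def face (q : Q) : Set O.Surface :=
  {s | O.descend (fun q' z => q' = q ∧ z.1 ≠ 0 ∧ z.1 ≠ 1 ∧ z.2 ≠ 0 ∧ z.2 ≠ 1)
    (by simp) (by simp) s}

/-- The star of the open lower side of the square `q`. -/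
def horStar (q : Q) : Set O.Surface :=
  {s | O.descend (fun q' z => z.1 ≠ 0 ∧ z.1 ≠ 1 ∧
      ((q' = q ∧ (z.2 : ℝ) < 1 / 4) ∨ (O.up q' = q ∧ 3 / 4 < (z.2 : ℝ))))
    (by simp) (by intro q' x; norm_num) s}

/-- The star of the open left side of the square `q`. -/
def verStar (q : Q) : Set O.Surface :=
  {s | O.descend (fun q' z => z.2 ≠ 0 ∧ z.2 ≠ 1 ∧
      ((q' = q ∧ (z.1 : ℝ) < 1 / 4) ∨ (O.right q' = q ∧ 3 / 4 < (z.1 : ℝ))))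
    (by intro q' x; norm_num) (by simp) s}

/-- The star of the vertex `v`. -/
def vertexStar (v : O.Surface) : Set O.Surface :=
  {s | O.descend (fun q' z => ((z.1 : ℝ) < 1 / 4 ∨ 3 / 4 < (z.1 : ℝ)) ∧
      ((z.2 : ℝ) < 1 / 4 ∨ 3 / 4 < (z.2 : ℝ)) ∧ O.square q' (collapseI z.1, collapseI z.2) = v)
    (by intro q' y; norm_num [square_right]) (by intro q' x; norm_num [square_up]) s}

variable {O}

theorem square_mem_face {q q' : Q} {z : I × I} : O.square q' z ∈ O.face q ↔
    q' = q ∧ z.1 ≠ 0 ∧ z.1 ≠ 1 ∧ z.2 ≠ 0 ∧ z.2 ≠ 1 := Iff.rfl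

theorem square_mem_horStar {q q' : Q} {z : I × I} : O.square q' z ∈ O.horStar q ↔
    z.1 ≠ 0 ∧ z.1 ≠ 1 ∧ ((q' = q ∧ (z.2 : ℝ) < 1 / 4) ∨ (O.up q' = q ∧ 3 / 4 < (z.2 : ℝ))) :=
  Iff.rfl

theorem square_mem_verStar {q q' : Q} {z : I × I} : O.square q' z ∈ O.verStar q ↔
    z.2 ≠ 0 ∧ z.2 ≠ 1 ∧ ((q' = q ∧ (z.1 : ℝ) < 1 / 4) ∨ (O.right q' = q ∧ 3 / 4 < (z.1 : ℝ))) :=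
  Iff.rfl

theorem square_mem_vertexStar {v : O.Surface} {q' : Q} {z : I × I} :
    O.square q' z ∈ O.vertexStar v ↔ ((z.1 : ℝ) < 1 / 4 ∨ 3 / 4 < (z.1 : ℝ)) ∧
      ((z.2 : ℝ) < 1 / 4 ∨ 3 / 4 < (z.2 : ℝ)) ∧
      O.square q' (collapseI z.1, collapseI z.2) = v := Iff.rfl

theorem isOpen_fst_ne (a : I) : IsOpen {z : I × I | z.1 ≠ a} :=
  isOpen_ne_fun continuous_fst continuous_const

theorem isOpen_snd_ne (a : I) : IsOpen {z : I × I | z.2 ≠ a} :=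
  isOpen_ne_fun continuous_snd continuous_const

theorem isOpen_fst_lt : IsOpen {z : I × I | (z.1 : ℝ) < 1 / 4} :=
  isOpen_lt (by fun_prop) continuous_const

theorem isOpen_fst_gt : IsOpen {z : I × I | 3 / 4 < (z.1 : ℝ)} :=
  isOpen_lt continuous_const (by fun_prop)

theorem isOpen_snd_lt : IsOpen {z : I × I | (z.2 : ℝ) < 1 / 4} :=
  isOpen_lt (by fun_prop) continuous_const

theorem isOpen_snd_gt : IsOpen {z : I × I | 3 / 4 < (z.2 : ℝ)} :=
  isOpen_lt continuous_const (by fun_prop)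

theorem isOpen_face (q : Q) : IsOpen (O.face q) := by
  refine O.isOpen_iff.2 fun q' => ?_
  have e : O.square q' ⁻¹' O.face q = {z : I × I | q' = q ∧ z.1 ≠ 0 ∧ z.1 ≠ 1 ∧ z.2 ≠ 0 ∧ z.2 ≠ 1} :=
    Set.ext fun z => Iff.rfl
  rw [e]
  exact isOpen_const.and ((isOpen_fst_ne 0).and ((isOpen_fst_ne 1).and
    ((isOpen_snd_ne 0).and (isOpen_snd_ne 1))))

theorem isOpen_horStar (q : Q) : IsOpen (O.horStar q) := by
  refine O.isOpen_iff.2 fun q' => ?_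
  have e : O.square q' ⁻¹' O.horStar q = {z : I × I | z.1 ≠ 0} ∩ ({z : I × I | z.1 ≠ 1} ∩
      ({z : I × I | q' = q ∧ (z.2 : ℝ) < 1 / 4} ∪ {z : I × I | O.up q' = q ∧ 3 / 4 < (z.2 : ℝ)})) :=
    Set.ext fun z => Iff.rfl
  rw [e]
  exact (isOpen_fst_ne 0).inter ((isOpen_fst_ne 1).inter
    ((isOpen_const.and isOpen_snd_lt).union (isOpen_const.and isOpen_snd_gt)))

theorem isOpen_verStar (q : Q) : IsOpen (O.verStar q) := by
  refine O.isOpen_iff.2 fun q' => ?_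
  have e : O.square q' ⁻¹' O.verStar q = {z : I × I | z.2 ≠ 0} ∩ ({z : I × I | z.2 ≠ 1} ∩
      ({z : I × I | q' = q ∧ (z.1 : ℝ) < 1 / 4} ∪
        {z : I × I | O.right q' = q ∧ 3 / 4 < (z.1 : ℝ)})) :=
    Set.ext fun z => Iff.rfl
  rw [e]
  exact (isOpen_snd_ne 0).inter ((isOpen_snd_ne 1).inter
    ((isOpen_const.and isOpen_fst_lt).union (isOpen_const.and isOpen_fst_gt)))

theorem isOpen_vertexStar (v : O.Surface) : IsOpen (O.vertexStar v) := by
  refine O.isOpen_iff.2 fun q => ?_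
  -- The condition does not involve `z`. The preimage of a vertex star consists of four corner
  -- regions of the square, and on each of them the collapse is constant.
  have h : ∀ a b : I, IsOpen {z : I × I | O.square q (a, b) = v} := fun a b => isOpen_const
  have e : O.square q ⁻¹' O.vertexStar v =
      {z : I × I | (z.1 : ℝ) < 1 / 4 ∧ (z.2 : ℝ) < 1 / 4 ∧ O.square q (0, 0) = v} ∪
      {z : I × I | (z.1 : ℝ) < 1 / 4 ∧ 3 / 4 < (z.2 : ℝ) ∧ O.square q (0, 1) = v} ∪
      ({z : I × I | 3 / 4 < (z.1 : ℝ) ∧ (z.2 : ℝ) < 1 / 4 ∧ O.square q (1, 0) = v} ∪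
      {z : I × I | 3 / 4 < (z.1 : ℝ) ∧ 3 / 4 < (z.2 : ℝ) ∧ O.square q (1, 1) = v}) := by
    ext z
    simp only [Set.mem_preimage, square_mem_vertexStar, Set.mem_union, Set.mem_ofPred_eq]
    constructor
    · rintro ⟨h1 | h1, h2 | h2, h3⟩
      · exact Or.inl (Or.inl ⟨h1, h2, by rwa [collapseI_of_lt h1, collapseI_of_lt h2] at h3⟩)
      · exact Or.inl (Or.inr ⟨h1, h2, by rwa [collapseI_of_lt h1, collapseI_of_gt h2] at h3⟩)
      · exact Or.inr (Or.inl ⟨h1, h2, by rwa [collapseI_of_gt h1, collapseI_of_lt h2] at h3⟩)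
      · exact Or.inr (Or.inr ⟨h1, h2, by rwa [collapseI_of_gt h1, collapseI_of_gt h2] at h3⟩)
    · rintro ((⟨h1, h2, h3⟩ | ⟨h1, h2, h3⟩) | (⟨h1, h2, h3⟩ | ⟨h1, h2, h3⟩))
      · exact ⟨Or.inl h1, Or.inl h2, by rwa [collapseI_of_lt h1, collapseI_of_lt h2]⟩
      · exact ⟨Or.inl h1, Or.inr h2, by rwa [collapseI_of_lt h1, collapseI_of_gt h2]⟩
      · exact ⟨Or.inr h1, Or.inl h2, by rwa [collapseI_of_gt h1, collapseI_of_lt h2]⟩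
      · exact ⟨Or.inr h1, Or.inr h2, by rwa [collapseI_of_gt h1, collapseI_of_gt h2]⟩
  rw [e]
  exact ((isOpen_fst_lt.and (isOpen_snd_lt.and (h 0 0))).union
    (isOpen_fst_lt.and (isOpen_snd_gt.and (h 0 1)))).union
    ((isOpen_fst_gt.and (isOpen_snd_lt.and (h 1 0))).union
    (isOpen_fst_gt.and (isOpen_snd_gt.and (h 1 1))))

/-- Every point lies in one of the squares with coordinates less than `1`. -/
theorem exists_square_eq_lt (s : O.Surface) : ∃ q z, O.square q z = s ∧ z.1 ≠ 1 ∧ z.2 ≠ 1 := by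
  have h0 : ∀ s : O.Surface, ∃ q z, O.square q z = s ∧ z.1 ≠ 1 := by
    intro s
    obtain ⟨q, z, rfl⟩ := exists_square_eq s
    by_cases h : z.1 = 1
    · exact ⟨O.right q, (0, z.2), by rw [← square_right, ← h], by simp⟩
    · exact ⟨q, z, rfl, h⟩
  obtain ⟨q, z, rfl, h⟩ := h0 s
  by_cases h' : z.2 = 1
  · exact ⟨O.up q, (z.1, 0), by rw [← square_up, ← h'], h, by simp⟩
  · exact ⟨q, z, rfl, h, h'⟩

/-- The stars of the cells. -/
def star : (Q ⊕ Q) ⊕ (Q ⊕ O.Surface) → Set O.Surface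
  | Sum.inl (Sum.inl q) => O.face q
  | Sum.inl (Sum.inr q) => O.horStar q
  | Sum.inr (Sum.inl q) => O.verStar q
  | Sum.inr (Sum.inr v) => O.vertexStar v

theorem isOpen_star (i : (Q ⊕ Q) ⊕ (Q ⊕ O.Surface)) : IsOpen (star i) := by
  rcases i with (q | q) | (q | v)
  exacts [isOpen_face q, isOpen_horStar q, isOpen_verStar q, isOpen_vertexStar v]

theorem exists_mem_star (s : O.Surface) : ∃ i, s ∈ star i := by
  obtain ⟨q, z, rfl, h1, h2⟩ := exists_square_eq_lt s
  by_cases h3 : z.1 = 0 <;> by_cases h4 : z.2 = 0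
  · refine ⟨Sum.inr (Sum.inr (O.square q (0, 0))), ?_⟩
    exact square_mem_vertexStar.2 (by rw [h3, h4]; norm_num)
  · exact ⟨Sum.inr (Sum.inl q), square_mem_verStar.2 ⟨h4, h2, Or.inl ⟨rfl, by rw [h3]; norm_num⟩⟩⟩
  · exact ⟨Sum.inl (Sum.inr q), square_mem_horStar.2 ⟨h3, h1, Or.inl ⟨rfl, by rw [h4]; norm_num⟩⟩⟩
  · exact ⟨Sum.inl (Sum.inl q), square_mem_face.2 ⟨rfl, h3, h1, h4, h2⟩⟩

/-- The representative in the unit interval of a point of the circle. -/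
noncomputable def circleCoord (θ : UnitAddCircle) : I :=
  Set.projIcc (0 : ℝ) 1 zero_le_one (AddCircle.equivIco 1 0 θ)

theorem circleCoord_coe {x : I} (h : x ≠ 1) : circleCoord ((x : ℝ) : UnitAddCircle) = x := by
  have hx : (x : ℝ) ∈ Set.Ico (0 : ℝ) (0 + 1) :=
    ⟨x.2.1, by rw [zero_add]; exact lt_of_le_of_ne x.2.2 fun e => h (Subtype.ext e)⟩
  have := AddCircle.equivIco_coe_eq (p := (1 : ℝ)) (a := 0) hx
  rw [circleCoord, this]
  exact Set.projIcc_val _ _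

theorem coe_circle_eq_zero {x : I} (h1 : x ≠ 1) (h : ((x : ℝ) : UnitAddCircle) = 0) : x = 0 := by
  have h2 := circleCoord_coe h1
  have h3 := circleCoord_coe (x := 0) (by simp)
  rw [h] at h2
  rw [← h2, ← h3]
  simp

theorem continuousAt_circleCoord {θ : UnitAddCircle} (h : θ ≠ 0) : ContinuousAt circleCoord θ := by
  have h' : θ ≠ ((0 : ℝ) : UnitAddCircle) := by simpa using h
  have h2 := AddCircle.continuousAt_equivIco 1 0 h'
  exact continuous_projIcc.continuousAt.comp (continuous_subtype_val.continuousAt.comp h2)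

theorem continuous_circleCoord_comp {f : I → UnitAddCircle} (hf : Continuous f)
    (h : ∀ t, f t ≠ 0) : Continuous fun t => circleCoord (f t) :=
  continuous_iff_continuousAt.2 fun t =>
    ContinuousAt.comp (f := f) (continuousAt_circleCoord (h t)) hf.continuousAt

/-- A path in the star of a cell is collapsed into a closed square. -/
theorem exists_collapse_eq (i : (Q ⊕ Q) ⊕ (Q ⊕ O.Surface)) (γ : C(I, O.Surface))
    (h : ∀ t, γ t ∈ star i) :
    ∃ (q : Q) (z : C(I, I × I)), ∀ t, O.collapse (γ t) = O.square q (z t) := by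
  -- `circleCoord` jumps only at `0`, so a coordinate of the path is continuous as long as the path
  -- avoids the sides on which this coordinate is an integer.
  have hx : (∀ t, O.toTorus (γ t) 0 ≠ 0) →
      Continuous fun t => circleCoord (O.toTorus (γ t) 0) := fun hn =>
    continuous_circleCoord_comp ((continuous_apply 0).comp
      (O.toTorus.continuous.comp γ.continuous)) hn
  have hy : (∀ t, O.toTorus (γ t) 1 ≠ 0) →
      Continuous fun t => circleCoord (O.toTorus (γ t) 1) := fun hn =>
    continuous_circleCoord_comp ((continuous_apply 1).comp
      (O.toTorus.continuous.comp γ.continuous)) hn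
  rcases i with (q | q) | (q | v)
  · have hm : ∀ t, γ t ∈ O.face q := h
    have hx' : Continuous fun t => circleCoord (O.toTorus (γ t) 0) := hx fun t e => by
      have := hm t
      obtain ⟨q', z, hz⟩ := exists_square_eq (γ t)
      rw [← hz] at this e
      obtain ⟨-, h1, h2, -⟩ := square_mem_face.1 this
      exact h1 (coe_circle_eq_zero h2 e)
    have hy' : Continuous fun t => circleCoord (O.toTorus (γ t) 1) := hy fun t e => by
      have := hm t
      obtain ⟨q', z, hz⟩ := exists_square_eq (γ t)
      rw [← hz] at this e
      obtain ⟨-, -, -, h1, h2⟩ := square_mem_face.1 this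
      exact h1 (coe_circle_eq_zero h2 e)
    refine ⟨q, ⟨fun t => (collapseI (circleCoord (O.toTorus (γ t) 0)),
      collapseI (circleCoord (O.toTorus (γ t) 1))),
      (continuous_collapseI.comp hx').prodMk (continuous_collapseI.comp hy')⟩, fun t => ?_⟩
    have := hm t
    change O.collapse (γ t) = O.square q (collapseI (circleCoord (O.toTorus (γ t) 0)),
      collapseI (circleCoord (O.toTorus (γ t) 1)))
    obtain ⟨q', z, hz⟩ := exists_square_eq (γ t)
    rw [← hz] at this ⊢
    obtain ⟨rfl, -, h2, -, h4⟩ := square_mem_face.1 this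
    rw [toTorus_square_zero, toTorus_square_one, circleCoord_coe h2, circleCoord_coe h4,
      collapse_square]
  · have hm : ∀ t, γ t ∈ O.horStar q := h
    have hx' : Continuous fun t => circleCoord (O.toTorus (γ t) 0) := hx fun t e => by
      have := hm t
      obtain ⟨q', z, hz⟩ := exists_square_eq (γ t)
      rw [← hz] at this e
      obtain ⟨h1, h2, -⟩ := square_mem_horStar.1 this
      exact h1 (coe_circle_eq_zero h2 e)
    refine ⟨q, ⟨fun t => (collapseI (circleCoord (O.toTorus (γ t) 0)), 0),
      (continuous_collapseI.comp hx').prodMk continuous_const⟩, fun t => ?_⟩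
    have := hm t
    change O.collapse (γ t) = O.square q (collapseI (circleCoord (O.toTorus (γ t) 0)), 0)
    obtain ⟨q', z, hz⟩ := exists_square_eq (γ t)
    rw [← hz] at this ⊢
    obtain ⟨-, h2, h3⟩ := square_mem_horStar.1 this
    rw [toTorus_square_zero, circleCoord_coe h2, collapse_square]
    -- The star of a lower side meets the square above and the square below it; both strips are
    -- collapsed onto the same side.
    rcases h3 with ⟨rfl, h3⟩ | ⟨rfl, h3⟩
    · rw [collapseI_of_lt h3]
    · rw [collapseI_of_gt h3, square_up]
  · have hm : ∀ t, γ t ∈ O.verStar q := h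
    have hy' : Continuous fun t => circleCoord (O.toTorus (γ t) 1) := hy fun t e => by
      have := hm t
      obtain ⟨q', z, hz⟩ := exists_square_eq (γ t)
      rw [← hz] at this e
      obtain ⟨h1, h2, -⟩ := square_mem_verStar.1 this
      exact h1 (coe_circle_eq_zero h2 e)
    refine ⟨q, ⟨fun t => (0, collapseI (circleCoord (O.toTorus (γ t) 1))),
      continuous_const.prodMk (continuous_collapseI.comp hy')⟩, fun t => ?_⟩
    have := hm t
    change O.collapse (γ t) = O.square q (0, collapseI (circleCoord (O.toTorus (γ t) 1)))
    obtain ⟨q', z, hz⟩ := exists_square_eq (γ t)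
    rw [← hz] at this ⊢
    obtain ⟨-, h2, h3⟩ := square_mem_verStar.1 this
    rw [toTorus_square_one, circleCoord_coe h2, collapse_square]
    rcases h3 with ⟨rfl, h3⟩ | ⟨rfl, h3⟩
    · rw [collapseI_of_lt h3]
    · rw [collapseI_of_gt h3, square_right]
  -- The whole star of a vertex is collapsed to the vertex, so a constant path does.
  · obtain ⟨q, z, rfl⟩ := exists_square_eq v
    refine ⟨q, ContinuousMap.const I z, fun t => ?_⟩
    have := h t
    obtain ⟨q', z', hz⟩ := exists_square_eq (γ t)
    rw [← hz] at this ⊢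
    rw [collapse_square]
    exact (square_mem_vertexStar.1 this).2.2

/-! #### Cocycles vanishing on the sides -/

/-- The lower side of the square `q`. -/
noncomputable def bottom (q : Q) : C(I, O.Surface) := segPath (O.square q) (0, 0) (1, 0)

/-- The left side of the square `q`. -/
noncomputable def left (q : Q) : C(I, O.Surface) := segPath (O.square q) (0, 0) (0, 1)

end Origami

namespace pathCocycle

open unitInterval

/-- In a square, the value of a cocycle on a path is the difference of its values on the radial
paths. -/
theorem comp_square {X : Type} [TopologicalSpace X] (κ : pathCocycle X) (g : C(I × I, X))
    (z : C(I, I × I)) :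
    κ.1 (g.comp z) = κ.1 (segPath g (0, 0) (z 1)) - κ.1 (segPath g (0, 0) (z 0)) := by
  -- The cone over the path `z` with apex at the lower left corner is a map of a square one side of
  -- which is constant.
  have h := square κ (g.comp ⟨fun a : I × I => (lerp 0 (z a.1).1 a.2, lerp 0 (z a.1).2 a.2),
    (continuous_lerp.comp (by fun_prop : Continuous fun a : I × I => ((0 : I), (z a.1).1, a.2))).prodMk
      (continuous_lerp.comp (by fun_prop : Continuous fun a : I × I => ((0 : I), (z a.1).2, a.2)))⟩)
  have e1 : ∀ f : C(I × I, X), (∀ t, f (t, 0) = g (0, 0)) →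
      segPath f (0, 0) (1, 0) = ContinuousMap.const I (g (0, 0)) := by
    intro f hf; ext t; simp [segPath_apply, hf]
  rw [e1 _ (by simp), const_eq_zero] at h
  have e2 : ∀ f : C(I × I, X), (∀ t, f (t, 1) = g (z t)) →
      segPath f (0, 1) (1, 1) = g.comp z := by
    intro f hf; ext t; simp [segPath_apply, hf]
  rw [e2 _ (by simp)] at h
  have e3 : ∀ (f : C(I × I, X)) (a : I), (∀ t, f (a, t) = segPath g (0, 0) (z a) t) →
      segPath f (a, 0) (a, 1) = segPath g (0, 0) (z a) := by
    intro f a hf; ext t; rw [segPath_apply, ← hf]; simp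
  rw [e3 _ 1 (by intro t; rfl), e3 _ 0 (by intro t; rfl)] at h
  linarith

variable {Q : Type} {O : Origami Q}

/-- A cocycle that vanishes on the sides of the squares is the variation of a function. -/
theorem exists_eq_sub_of_sides (κ : pathCocycle O.Surface)
    (hb : ∀ q, κ.1 (Origami.bottom (O := O) q) = 0) (hl : ∀ q, κ.1 (Origami.left (O := O) q) = 0) :
    ∃ u : O.Surface → ℝ, ∀ γ, κ.1 γ = u (γ 1) - u (γ 0) := by
  -- The potential at a point of a square is the value on the segment from the lower left corner.
  -- Passing to the neighbouring square changes the origin along a side, where the cocycle vanishes,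
  -- so these functions fit together.
  let w : O.Surface → ℝ := O.descend (fun q z => κ.1 (segPath (O.square q) (0, 0) z))
    (fun q y => by
      rw [← segPath_add κ (O.square q) (0, 0) (1, 0) (1, y)]
      change κ.1 (Origami.bottom q) + _ = _
      rw [hb, zero_add]
      refine congrArg κ.1 (ContinuousMap.ext fun t => ?_)
      simp [segPath_apply, Origami.square_right])
    (fun q x => by
      rw [← segPath_add κ (O.square q) (0, 0) (0, 1) (x, 1)]
      change κ.1 (Origami.left q) + _ = _
      rw [hl, zero_add]
      refine congrArg κ.1 (ContinuousMap.ext fun t => ?_)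
      simp [segPath_apply, Origami.square_up])
  have hw : ∀ q z, w (O.square q z) = κ.1 (segPath (O.square q) (0, 0) z) := fun _ _ => rfl
  -- The function `w` is a potential for paths inside one closed square. A short path is first
  -- pushed into such a square by the collapse, at the cost of the value on the track of the
  -- homotopy.
  let u : O.Surface → ℝ := fun s => w (O.collapse s) - κ.1 (O.collapseHomotopy s)
  refine ⟨u, fun γ => eq_sub_of_openCover κ u Origami.star Origami.isOpen_star
    Origami.exists_mem_star (fun i γ hγ => ?_) γ⟩
  obtain ⟨q, z, hz⟩ := Origami.exists_collapse_eq i γ hγ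
  -- The four sides of this square are the path, the two tracks of its end points, and the collapsed
  -- path.
  have h := square κ (ContinuousMap.uncurry (O.collapseHomotopy.comp γ))
  have e1 : segPath (ContinuousMap.uncurry (O.collapseHomotopy.comp γ)) (0, 0) (1, 0) = γ := by
    ext t; simp [segPath_apply, Origami.collapseHomotopy_zero]
  have e2 : ∀ a, segPath (ContinuousMap.uncurry (O.collapseHomotopy.comp γ)) (a, 0) (a, 1) =
      O.collapseHomotopy (γ a) := by
    intro a; ext t; simp [segPath_apply]
  have e3 : segPath (ContinuousMap.uncurry (O.collapseHomotopy.comp γ)) (0, 1) (1, 1) =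
      (O.square q).comp z := by
    ext t
    rw [ContinuousMap.comp_apply, ← hz]
    simp [segPath_apply, Origami.collapse]
  rw [e1, e2, e2, e3, comp_square, ← hw, ← hw, ← hz, ← hz] at h
  simp only [u]
  linarith

end pathCocycle

namespace Origami

open unitInterval

variable {Q : Type} {O : Origami Q}

/-! #### Separation, compactness, connectedness -/

theorem coe_circle_inj {x y : I} (hx : x ≠ 1) (hy : y ≠ 1)
    (h : ((x : ℝ) : UnitAddCircle) = ((y : ℝ) : UnitAddCircle)) : x = y := by
  rw [← circleCoord_coe hx, ← circleCoord_coe hy, h]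

theorem disjoint_face {q q' : Q} (h : q ≠ q') : Disjoint (O.face q) (O.face q') := by
  rw [Set.disjoint_left]
  intro s h1 h2
  obtain ⟨q₀, z, rfl⟩ := exists_square_eq s
  exact h ((square_mem_face.1 h1).1.symm.trans (square_mem_face.1 h2).1)

theorem disjoint_horStar {q q' : Q} (h : q ≠ q') : Disjoint (O.horStar q) (O.horStar q') := by
  rw [Set.disjoint_left]
  intro s h1 h2
  obtain ⟨q₀, z, rfl⟩ := exists_square_eq s
  obtain ⟨-, -, h1⟩ := square_mem_horStar.1 h1
  obtain ⟨-, -, h2⟩ := square_mem_horStar.1 h2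
  rcases h1 with ⟨e1, k1⟩ | ⟨e1, k1⟩ <;> rcases h2 with ⟨e2, k2⟩ | ⟨e2, k2⟩
  · exact h (e1.symm.trans e2)
  · linarith
  · linarith
  · exact h (e1.symm.trans e2)

theorem disjoint_verStar {q q' : Q} (h : q ≠ q') : Disjoint (O.verStar q) (O.verStar q') := by
  rw [Set.disjoint_left]
  intro s h1 h2
  obtain ⟨q₀, z, rfl⟩ := exists_square_eq s
  obtain ⟨-, -, h1⟩ := square_mem_verStar.1 h1
  obtain ⟨-, -, h2⟩ := square_mem_verStar.1 h2
  rcases h1 with ⟨e1, k1⟩ | ⟨e1, k1⟩ <;> rcases h2 with ⟨e2, k2⟩ | ⟨e2, k2⟩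
  · exact h (e1.symm.trans e2)
  · linarith
  · linarith
  · exact h (e1.symm.trans e2)

theorem disjoint_vertexStar {v w : O.Surface} (h : v ≠ w) :
    Disjoint (O.vertexStar v) (O.vertexStar w) := by
  rw [Set.disjoint_left]
  intro s h1 h2
  obtain ⟨q₀, z, rfl⟩ := exists_square_eq s
  exact h ((square_mem_vertexStar.1 h1).2.2.symm.trans (square_mem_vertexStar.1 h2).2.2)

/-- Points with different images in the torus are separated there. Two points over the same point of
the torus lie in cells of the same kind, and the stars of two different cells of one kind are
disjoint. -/
instance : T2Space O.Surface := by
  refine ⟨fun s s' hne => ?_⟩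
  by_cases hp : O.toTorus s = O.toTorus s'
  · obtain ⟨q, z, rfl, h1, h2⟩ := exists_square_eq_lt s
    obtain ⟨q', z', rfl, h1', h2'⟩ := exists_square_eq_lt s'
    have e1 : z.1 = z'.1 := coe_circle_inj h1 h1' (congrFun hp 0)
    have e2 : z.2 = z'.2 := coe_circle_inj h2 h2' (congrFun hp 1)
    obtain ⟨x, y⟩ := z
    obtain ⟨x', y'⟩ := z'
    dsimp only at e1 e2 h1 h2
    subst e1 e2
    by_cases hx : x = 0 <;> by_cases hy : y = 0
    · subst hx hy
      exact ⟨O.vertexStar (O.square q (0, 0)), O.vertexStar (O.square q' (0, 0)),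
        isOpen_vertexStar _, isOpen_vertexStar _, square_mem_vertexStar.2 (by norm_num),
        square_mem_vertexStar.2 (by norm_num), disjoint_vertexStar hne⟩
    · subst hx
      exact ⟨O.verStar q, O.verStar q', isOpen_verStar _, isOpen_verStar _,
        square_mem_verStar.2 ⟨hy, h2, Or.inl ⟨rfl, by norm_num⟩⟩,
        square_mem_verStar.2 ⟨hy, h2, Or.inl ⟨rfl, by norm_num⟩⟩,
        disjoint_verStar fun e => hne (by rw [e])⟩
    · subst hy
      exact ⟨O.horStar q, O.horStar q', isOpen_horStar _, isOpen_horStar _,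
        square_mem_horStar.2 ⟨hx, h1, Or.inl ⟨rfl, by norm_num⟩⟩,
        square_mem_horStar.2 ⟨hx, h1, Or.inl ⟨rfl, by norm_num⟩⟩,
        disjoint_horStar fun e => hne (by rw [e])⟩
    · exact ⟨O.face q, O.face q', isOpen_face _, isOpen_face _,
        square_mem_face.2 ⟨rfl, hx, h1, hy, h2⟩, square_mem_face.2 ⟨rfl, hx, h1, hy, h2⟩,
        disjoint_face fun e => hne (by rw [e])⟩
  · obtain ⟨U, V, hU, hV, hsU, hsV, hUV⟩ := t2_separation hp
    exact ⟨O.toTorus ⁻¹' U, O.toTorus ⁻¹' V, hU.preimage O.toTorus.continuous,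
      hV.preimage O.toTorus.continuous, hsU, hsV, hUV.preimage _⟩

instance [Finite Q] : CompactSpace O.Surface :=
  inferInstanceAs (CompactSpace (Quot O.Rel))

theorem preconnectedSpace (q₀ : Q)
    (h : ∀ q, Relation.ReflTransGen (fun a b => b = O.right a ∨ b = O.up a) q₀ q) :
    PreconnectedSpace O.Surface := by
  have hcc : ∀ q z z', O.square q z ∈ connectedComponent (O.square q z') := by
    intro q z z'
    have hr : IsPreconnected (Set.range (O.square q)) := isPreconnected_range (O.square q).continuous
    exact hr.subset_connectedComponent ⟨z', rfl⟩ ⟨z, rfl⟩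
  have key : ∀ q, connectedComponent (O.square q (0, 0)) =
      connectedComponent (O.square q₀ (0, 0)) := by
    intro q
    induction h q with
    | refl => rfl
    | @tail b c _ hbc ih =>
      rw [← ih]
      rcases hbc with rfl | rfl
      · rw [← square_right]
        exact (connectedComponent_eq (hcc b _ _)).symm
      · rw [← square_up]
        exact (connectedComponent_eq (hcc b _ _)).symm
  refine (preconnectedSpace_iff_connectedComponent).2 ?_
  intro s
  refine Set.eq_univ_of_forall fun s' => ?_
  obtain ⟨q, z, rfl⟩ := exists_square_eq s
  obtain ⟨q', z', rfl⟩ := exists_square_eq s'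
  rw [connectedComponent_eq (hcc q (0, 0) z), key, ← key q']
  exact hcc _ _ _

/-! #### Sides of the squares and cellular cochains -/

/-- The values of a cocycle on the lower sides. -/
noncomputable def horValue (κ : pathCocycle O.Surface) (q : Q) : ℝ := κ.1 (bottom q)

/-- The values of a cocycle on the left sides. -/
noncomputable def verValue (κ : pathCocycle O.Surface) (q : Q) : ℝ := κ.1 (left q)

variable (O) in
/-- A cellular cochain with values `a` on the lower and `b` on the left sides is closed. -/
def IsClosed {R : Type*} [Add R] (a b : Q → R) : Prop :=
  ∀ q, a q + b (O.right q) = b q + a (O.up q)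

variable (O) in
/-- A function on the squares that is constant around each vertex, when considered as a function of
the lower left corner. -/
def IsVertexFunction {R : Type*} (u : Q → R) : Prop := ∀ q, u (O.up (O.right q)) = u (O.right (O.up q))

theorem segPath_right (q : Q) (y y' : I) :
    segPath (O.square q) (1, y) (1, y') = segPath (O.square (O.right q)) (0, y) (0, y') := by
  ext t; simp [segPath_apply, square_right]

theorem segPath_up (q : Q) (x x' : I) :
    segPath (O.square q) (x, 1) (x', 1) = segPath (O.square (O.up q)) (x, 0) (x', 0) := by
  ext t; simp [segPath_apply, square_up]

theorem isClosed_values (κ : pathCocycle O.Surface) : O.IsClosed (horValue κ) (verValue κ) := by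
  intro q
  have h := pathCocycle.square κ (O.square q)
  rw [segPath_right, segPath_up] at h
  exact h

/-- The difference of the cocycles vanishes on all sides and so is the variation of a function: the
class of a cocycle is determined by its cellular cochain. -/
theorem functional_eq_of_values {κ κ' : pathCocycle O.Surface}
    (hh : ∀ q, horValue κ q = horValue κ' q) (hv : ∀ q, verValue κ q = verValue κ' q) :
    pathCocycle.functional O.Surface κ = pathCocycle.functional O.Surface κ' := by
  rw [← sub_eq_zero, ← map_sub, pathCocycle.functional_eq_zero_iff]
  exact pathCocycle.exists_eq_sub_of_sides (κ - κ') (fun q => sub_eq_zero.2 (hh q))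
    (fun q => sub_eq_zero.2 (hv q))

theorem square_corner_right (q : Q) : O.square q (1, 0) = O.square (O.right q) (0, 0) :=
  square_right _ _ _

theorem square_corner_up (q : Q) : O.square q (0, 1) = O.square (O.up q) (0, 0) :=
  square_up _ _ _

theorem exists_values_eq_of_functional_eq_zero {κ : pathCocycle O.Surface}
    (h : pathCocycle.functional O.Surface κ = 0) :
    ∃ u : Q → ℝ, O.IsVertexFunction u ∧ (∀ q, horValue κ q = u (O.right q) - u q) ∧
      ∀ q, verValue κ q = u (O.up q) - u q := by
  obtain ⟨w, hw⟩ := (pathCocycle.functional_eq_zero_iff κ).1 h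
  refine ⟨fun q => w (O.square q (0, 0)), fun q => ?_, fun q => ?_, fun q => ?_⟩
  · dsimp only
    rw [← square_corner_up, ← square_corner_right, ← square_right, ← square_up]
  · dsimp only
    rw [← square_corner_right]
    simpa [horValue, bottom, segPath_apply] using hw (bottom q)
  · dsimp only
    rw [← square_corner_up]
    simpa [verValue, left, segPath_apply] using hw (left q)

open Classical in
theorem functional_eq_zero_of_values {κ : pathCocycle O.Surface} {u : Q → ℝ}
    (hu : O.IsVertexFunction u) (hh : ∀ q, horValue κ q = u (O.right q) - u q)
    (hv : ∀ q, verValue κ q = u (O.up q) - u q) : pathCocycle.functional O.Surface κ = 0 := by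
  -- Only the values at the vertices matter. The function is zero elsewhere; it is discontinuous,
  -- but its variation along paths is still a cocycle. At the upper right corner compatibility with
  -- the gluing is the condition that `u` is a vertex function.
  let w : O.Surface → ℝ := O.descend
    (fun q z => if z.1 = 0 then (if z.2 = 0 then u q else if z.2 = 1 then u (O.up q) else 0)
      else if z.1 = 1 then (if z.2 = 0 then u (O.right q) else
        if z.2 = 1 then u (O.up (O.right q)) else 0) else 0)
    (fun q y => by simp)
    (fun q x => by simp [hu q])
  let δ : pathCocycle O.Surface := pathCocycle.coboundary w
  have hδ : pathCocycle.functional O.Surface δ = 0 :=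
    (pathCocycle.functional_eq_zero_iff δ).2 ⟨w, fun _ => rfl⟩
  have hw : ∀ q, w (O.square q (0, 0)) = u q := fun q => by
    change (if (0 : I) = 0 then (if (0 : I) = 0 then u q else _) else _) = u q
    simp
  rw [← hδ]
  refine functional_eq_of_values (fun q => ?_) (fun q => ?_)
  · rw [hh, ← hw, ← hw, ← square_corner_right]
    change _ = w (bottom q 1) - w (bottom q 0)
    simp [bottom, segPath_apply]
  · rw [hv, ← hw, ← hw, ← square_corner_up]
    change _ = w (left q 1) - w (left q 0)
    simp [left, segPath_apply]

variable (O) in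
/-- The circle-valued function with prescribed integral variation along the sides. -/
noncomputable def circleMap (a b : Q → ℤ) (h : O.IsClosed a b) : C(O.Surface, UnitAddCircle) :=
  -- Bilinear interpolation: the mixed coefficient is chosen so that the upper side has slope `a
  -- (O.up q)`; the right side then has slope `b (O.right q)` because the cochain is closed. The
  -- remaining constants are integers and disappear in the circle.
  O.lift (fun q => ⟨fun z => (((a q * z.1 + b q * z.2 + (a (O.up q) - a q) * (z.1 * z.2) : ℝ)) :
      UnitAddCircle), (AddCircle.continuous_mk' 1).comp (by fun_prop)⟩)
    (fun q y => by
      have hc : (a q : ℝ) + b (O.right q) = b q + a (O.up q) := by exact_mod_cast h q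
      have e : (a q * ((1 : I) : ℝ) + b q * (y : ℝ) +
          (a (O.up q) - a q) * (((1 : I) : ℝ) * (y : ℝ)) : ℝ) =
          (a (O.right q) * ((0 : I) : ℝ) + b (O.right q) * (y : ℝ) +
          (a (O.up (O.right q)) - a (O.right q)) * (((0 : I) : ℝ) * (y : ℝ)) : ℝ) + (a q : ℤ) := by
        simp only [Set.Icc.coe_one, Set.Icc.coe_zero]
        linear_combination (-(y : ℝ)) * hc
      have hz : (((a q : ℤ) : ℝ) : UnitAddCircle) = 0 :=
        (AddCircle.coe_eq_zero_iff 1).2 ⟨a q, by simp⟩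
      refine (congrArg (fun r : ℝ => (r : UnitAddCircle)) e).trans ?_
      rw [AddCircle.coe_add, hz, add_zero]
      rfl)
    (fun q x => by
      have e : (a q * (x : ℝ) + b q * ((1 : I) : ℝ) +
          (a (O.up q) - a q) * ((x : ℝ) * ((1 : I) : ℝ)) : ℝ) =
          (a (O.up q) * (x : ℝ) + b (O.up q) * ((0 : I) : ℝ) +
          (a (O.up (O.up q)) - a (O.up q)) * ((x : ℝ) * ((0 : I) : ℝ)) : ℝ) + (b q : ℤ) := by
        simp only [Set.Icc.coe_one, Set.Icc.coe_zero]
        ring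
      have hz : (((b q : ℤ) : ℝ) : UnitAddCircle) = 0 :=
        (AddCircle.coe_eq_zero_iff 1).2 ⟨b q, by simp⟩
      refine (congrArg (fun r : ℝ => (r : UnitAddCircle)) e).trans ?_
      rw [AddCircle.coe_add, hz, add_zero]
      rfl)

variable (O) in
/-- The cocycle on paths with prescribed integral values on the sides. -/
noncomputable def cellCocycle (a b : Q → ℤ) (h : O.IsClosed a b) : pathCocycle O.Surface :=
  pathCocycle.ofCircle (O.circleMap a b h)

theorem horValue_cellCocycle (a b : Q → ℤ) (h : O.IsClosed a b) (q : Q) :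
    horValue (O.cellCocycle a b h) q = a q := by
  have := pathCocycle.ofCircle_eq (O.circleMap a b h) (bottom q)
    ⟨fun t => a q * (t : ℝ), by fun_prop⟩ (fun t => by
      rw [bottom, segPath_apply, circleMap, lift_square]
      simp)
  refine this.trans ?_
  simp

theorem verValue_cellCocycle (a b : Q → ℤ) (h : O.IsClosed a b) (q : Q) :
    verValue (O.cellCocycle a b h) q = b q := by
  have := pathCocycle.ofCircle_eq (O.circleMap a b h) (left q)
    ⟨fun t => b q * (t : ℝ), by fun_prop⟩ (fun t => by
      rw [left, segPath_apply, circleMap, lift_square]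
      simp)
  refine this.trans ?_
  simp

/-! #### The homology of the torus and the zero-holonomy subspace -/

/-- The coordinate functions of the torus. -/
def torusCoord (i : Fin 2) : C(UnitAddTorus (Fin 2), UnitAddCircle) := ⟨fun θ => θ i, continuous_apply i⟩

variable (O) in
/-- The real and imaginary part of the holonomy. -/
noncomputable def holonomy (i : Fin 2) : pathCocycle O.Surface :=
  pathCocycle.ofCircle ((torusCoord i).comp O.toTorus)

theorem holonomy_eq_pullback (i : Fin 2) :
    O.holonomy i = pathCocycle.pullback O.toTorus (pathCocycle.ofCircle (torusCoord i)) := rfl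

theorem horValue_holonomy (i : Fin 2) (q : Q) : horValue (O.holonomy i) q = ![1, 0] i := by
  have := pathCocycle.ofCircle_eq ((torusCoord i).comp O.toTorus) (bottom q)
    ⟨fun t => ![(t : ℝ), 0] i, by fin_cases i <;> simp <;> fun_prop⟩ (fun t => by
      rw [bottom, segPath_apply, ContinuousMap.comp_apply]
      fin_cases i
      · exact (congrArg (fun x : I => ((x : ℝ) : UnitAddCircle)) (lerp_zero_one t)).symm
      · exact (congrArg (fun x : I => ((x : ℝ) : UnitAddCircle)) (lerp_self 0 t)).symm)
  refine this.trans ?_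
  fin_cases i <;> simp

theorem verValue_holonomy (i : Fin 2) (q : Q) : verValue (O.holonomy i) q = ![0, 1] i := by
  have := pathCocycle.ofCircle_eq ((torusCoord i).comp O.toTorus) (left q)
    ⟨fun t => ![0, (t : ℝ)] i, by fin_cases i <;> simp <;> fun_prop⟩ (fun t => by
      rw [left, segPath_apply, ContinuousMap.comp_apply]
      fin_cases i
      · exact (congrArg (fun x : I => ((x : ℝ) : UnitAddCircle)) (lerp_self 0 t)).symm
      · exact (congrArg (fun x : I => ((x : ℝ) : UnitAddCircle)) (lerp_zero_one t)).symm)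
  refine this.trans ?_
  fin_cases i <;> simp

/-- The torus as a square-tiled surface. -/
def torus : Origami Unit := ⟨1, 1⟩

theorem bijective_toTorus_torus : Function.Bijective torus.toTorus := by
  constructor
  · intro s s' hp
    obtain ⟨q, z, rfl, h1, h2⟩ := exists_square_eq_lt s
    obtain ⟨q', z', rfl, h1', h2'⟩ := exists_square_eq_lt s'
    have e1 : z.1 = z'.1 := coe_circle_inj h1 h1' (congrFun hp 0)
    have e2 : z.2 = z'.2 := coe_circle_inj h2 h2' (congrFun hp 1)
    rw [show z = z' from Prod.ext e1 e2]
  · intro θ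
    have hs : ∀ θ : UnitAddCircle, ∃ x : I, ((x : ℝ) : UnitAddCircle) = θ := by
      intro θ
      have h := (AddCircle.equivIco (1 : ℝ) 0 θ).2
      refine ⟨⟨AddCircle.equivIco (1 : ℝ) 0 θ, h.1, by have := h.2; linarith⟩, ?_⟩
      exact (AddCircle.equivIco (1 : ℝ) 0).symm_apply_apply θ
    obtain ⟨x, hx⟩ := hs (θ 0)
    obtain ⟨y, hy⟩ := hs (θ 1)
    refine ⟨torus.square () (x, y), ?_⟩
    funext i
    fin_cases i
    · exact hx
    · exact hy

/-- The torus is the origami with one square. A class on it has just two side values, and so it is a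
combination of the two coordinate classes; if both vanish on `w`, all functionals do. -/
theorem H₁_torus_eq_zero (w : H₁ (UnitAddTorus (Fin 2)))
    (h : ∀ i, pathCocycle.functional _ (pathCocycle.ofCircle (torusCoord i)) w = 0) : w = 0 := by
  let e : torus.Surface ≃ₜ UnitAddTorus (Fin 2) :=
    (Equiv.ofBijective _ bijective_toTorus_torus).toHomeomorphOfContinuousClosed
      torus.toTorus.continuous torus.toTorus.continuous.isClosedMap
  have hw : H₁map torus.toTorus (H₁map (e.symm : C(UnitAddTorus (Fin 2), torus.Surface)) w) = w := by
    rw [← H₁map_comp]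
    have : torus.toTorus.comp (e.symm : C(UnitAddTorus (Fin 2), torus.Surface)) =
        ContinuousMap.id _ := by
      ext1 θ
      exact e.apply_symm_apply θ
    rw [this, H₁map_id]
  set w' := H₁map (e.symm : C(UnitAddTorus (Fin 2), torus.Surface)) w with hw'
  have hh : ∀ i, pathCocycle.functional _ (torus.holonomy i) w' = 0 := by
    intro i
    rw [holonomy_eq_pullback, ← pathCocycle.functional_H₁map, hw, h]
  suffices hz : w' = 0 by rw [← hw, hz, map_zero]
  rw [← Module.forall_dual_apply_eq_zero_iff ℝ]
  intro L
  obtain ⟨κ, rfl⟩ := pathCocycle.functional_surjective L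
  have : pathCocycle.functional _ κ = pathCocycle.functional _
      (horValue κ () • torus.holonomy 0 + verValue κ () • torus.holonomy 1) := by
    refine functional_eq_of_values (fun q => ?_) (fun q => ?_)
    · change _ = horValue κ () * horValue (torus.holonomy 0) q +
        verValue κ () * horValue (torus.holonomy 1) q
      rw [horValue_holonomy, horValue_holonomy]
      simp
    · change _ = horValue κ () * verValue (torus.holonomy 0) q +
        verValue κ () * verValue (torus.holonomy 1) q
      rw [verValue_holonomy, verValue_holonomy]
      simp
  rw [this, map_add, map_smul, map_smul]
  simp [hh]

theorem H₁map_toTorus_eq_zero_iff (w : H₁ O.Surface) :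
    H₁map O.toTorus w = 0 ↔ ∀ i, pathCocycle.functional _ (O.holonomy i) w = 0 := by
  constructor
  · intro h i
    rw [holonomy_eq_pullback, ← pathCocycle.functional_H₁map, h, map_zero]
  · intro h
    refine H₁_torus_eq_zero _ fun i => ?_
    rw [pathCocycle.functional_H₁map, ← holonomy_eq_pullback, h]

/-! #### The intersection form -/

section Form

variable [Fintype Q] {R : Type*} [CommRing R]

variable (O) in
/-- The cup product of two cellular cochains. -/
def cup (a b a' b' : Q → R) : R := ∑ q, (a q * b' (O.right q) - b q * a' (O.up q))

variable (O) in
/-- The antisymmetrized cup product of two cellular cochains. -/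
def form (a b a' b' : Q → R) : R := O.cup a b a' b' - O.cup a' b' a b

theorem form_swap (a b a' b' : Q → R) : O.form a' b' a b = -O.form a b a' b' := by
  simp [form]

/-- Summation by parts: reindexing by `right` and `up` moves the differences away from `u`, and
closedness of the other cochain makes the terms cancel. In the second half the two ways from a
square to the diagonal neighbour are identified by the vertex condition. Hence the form depends only
on cohomology classes. -/
theorem form_coboundary {u a b : Q → R} (hu : O.IsVertexFunction u) (h : O.IsClosed a b) :
    O.form (fun q => u (O.right q) - u q) (fun q => u (O.up q) - u q) a b = 0 := by
  have h1 : O.cup (fun q => u (O.right q) - u q) (fun q => u (O.up q) - u q) a b = 0 := by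
    have e1 : ∑ q, u (O.right q) * b (O.right q) = ∑ q, u q * b q :=
      Equiv.sum_comp O.right fun q => u q * b q
    have e2 : ∑ q, u (O.up q) * a (O.up q) = ∑ q, u q * a q :=
      Equiv.sum_comp O.up fun q => u q * a q
    have e3 : ∑ q, u q * (a q + b (O.right q)) = ∑ q, u q * (b q + a (O.up q)) :=
      Finset.sum_congr rfl fun q _ => by rw [h q]
    simp only [cup, sub_mul, Finset.sum_sub_distrib, e1, e2]
    simp only [mul_add, Finset.sum_add_distrib] at e3
    linear_combination -e3
  have h2 : O.cup a b (fun q => u (O.right q) - u q) (fun q => u (O.up q) - u q) = 0 := by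
    have e1 : ∑ q, b (O.right q) * u (O.up (O.right q)) = ∑ q, b q * u (O.up q) :=
      Equiv.sum_comp O.right fun q => b q * u (O.up q)
    have e2 : ∑ q, a (O.up q) * u (O.right (O.up q)) = ∑ q, a q * u (O.right q) :=
      Equiv.sum_comp O.up fun q => a q * u (O.right q)
    have e3 : ∑ q, (a q + b (O.right q)) * u (O.up (O.right q)) =
        ∑ q, (b q + a (O.up q)) * u (O.right (O.up q)) :=
      Finset.sum_congr rfl fun q _ => by rw [h q, hu q]
    have e4 : ∑ q, a q * u (O.up (O.right q)) - ∑ q, b q * u (O.right (O.up q)) =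
        ∑ q, a q * u (O.right q) - ∑ q, b q * u (O.up q) := by
      simp only [add_mul, Finset.sum_add_distrib, e1, e2] at e3
      linear_combination e3
    simp only [cup, mul_sub, Finset.sum_sub_distrib]
    linear_combination e4
  rw [form, h1, h2, sub_zero]

/-- The intersection form on cocycles. -/
noncomputable def pairing (κ κ' : pathCocycle O.Surface) : ℝ :=
  O.form (horValue κ) (verValue κ) (horValue κ') (verValue κ')

theorem pairing_swap (κ κ' : pathCocycle O.Surface) : pairing κ' κ = -pairing κ κ' := form_swap _ _ _ _

theorem pairing_add (κ₁ κ₂ κ' : pathCocycle O.Surface) :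
    pairing (κ₁ + κ₂) κ' = pairing κ₁ κ' + pairing κ₂ κ' := by
  have h1 : horValue (κ₁ + κ₂) = horValue κ₁ + horValue κ₂ := rfl
  have h2 : verValue (κ₁ + κ₂) = verValue κ₁ + verValue κ₂ := rfl
  simp only [pairing, form, cup, h1, h2, Pi.add_apply, ← Finset.sum_sub_distrib,
    ← Finset.sum_add_distrib]
  exact Finset.sum_congr rfl fun q _ => by ring

theorem pairing_smul (r : ℝ) (κ κ' : pathCocycle O.Surface) :
    pairing (r • κ) κ' = r * pairing κ κ' := by
  have h1 : horValue (r • κ) = r • horValue κ := rfl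
  have h2 : verValue (r • κ) = r • verValue κ := rfl
  simp only [pairing, form, cup, h1, h2, Pi.smul_apply, ← Finset.sum_sub_distrib,
    Finset.mul_sum, smul_eq_mul]
  exact Finset.sum_congr rfl fun q _ => by ring

theorem pairing_eq_zero {κ : pathCocycle O.Surface} (h : pathCocycle.functional _ κ = 0)
    (κ' : pathCocycle O.Surface) : pairing κ κ' = 0 := by
  obtain ⟨u, hu, h1, h2⟩ := exists_values_eq_of_functional_eq_zero h
  rw [pairing, funext h1, funext h2]
  exact form_coboundary hu (isClosed_values κ')

end Form

end Origami

/-! ### Maps of square-tiled surfaces with integral linear part. -/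

/-- The action of an integral matrix on the torus. -/
noncomputable def torusLinear (A : Matrix (Fin 2) (Fin 2) ℤ) (θ : UnitAddTorus (Fin 2)) :
    UnitAddTorus (Fin 2) := fun i => ∑ j, A i j • θ j

theorem torusLinear_mul (A B : Matrix (Fin 2) (Fin 2) ℤ) (θ : UnitAddTorus (Fin 2)) :
    torusLinear (A * B) θ = torusLinear A (torusLinear B θ) := by
  funext i
  simp only [torusLinear, Matrix.mul_apply, Fin.sum_univ_two, smul_add, add_smul, mul_smul]
  abel

@[simp] theorem torusLinear_one (θ : UnitAddTorus (Fin 2)) : torusLinear 1 θ = θ := by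
  funext i
  simp [torusLinear, Matrix.one_apply]

namespace Origami

open unitInterval

variable {Q : Type} {O O' O'' : Origami Q}

@[ext] theorem ext_perm {O O' : Origami Q} (h1 : O.right = O'.right) (h2 : O.up = O'.up) : O = O' := by
  cases O; cases O'; subst h1 h2; rfl

/-- The map `f` of square-tiled surfaces has linear part `A`. -/
def HasLinearPart (A : Matrix (Fin 2) (Fin 2) ℤ) (f : O.Surface ≃ₜ O'.Surface) : Prop :=
  ∀ s, O'.toTorus (f s) = torusLinear A (O.toTorus s)

/-- The map `f` preserves the intersection form. -/
def PreservesForm [Fintype Q] (f : O.Surface ≃ₜ O'.Surface) : Prop :=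
  ∀ κ κ', pairing (pathCocycle.pullback (f : C(O.Surface, O'.Surface)) κ)
    (pathCocycle.pullback (f : C(O.Surface, O'.Surface)) κ') = pairing κ κ'

theorem HasLinearPart.trans {A B : Matrix (Fin 2) (Fin 2) ℤ} {f : O.Surface ≃ₜ O'.Surface}
    {g : O'.Surface ≃ₜ O''.Surface} (hf : HasLinearPart A f) (hg : HasLinearPart B g) :
    HasLinearPart (B * A) (f.trans g) := fun s => by
  rw [Homeomorph.trans_apply, hg, hf, torusLinear_mul]

theorem HasLinearPart.symm {A B : Matrix (Fin 2) (Fin 2) ℤ} {f : O.Surface ≃ₜ O'.Surface}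
    (hf : HasLinearPart A f) (h : B * A = 1) : HasLinearPart B f.symm := fun s => by
  obtain ⟨s, rfl⟩ := f.surjective s
  rw [f.symm_apply_apply, hf, ← torusLinear_mul, h, torusLinear_one]

theorem PreservesForm.trans [Fintype Q] {f : O.Surface ≃ₜ O'.Surface} {g : O'.Surface ≃ₜ O''.Surface}
    (hf : PreservesForm f) (hg : PreservesForm g) : PreservesForm (f.trans g) := fun κ κ' =>
  (hf (pathCocycle.pullback (g : C(O'.Surface, O''.Surface)) κ)
    (pathCocycle.pullback (g : C(O'.Surface, O''.Surface)) κ')).trans (hg κ κ')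

theorem PreservesForm.symm [Fintype Q] {f : O.Surface ≃ₜ O'.Surface}
    (hf : PreservesForm f) : PreservesForm f.symm := fun κ κ' => by
  have e : ∀ κ, pathCocycle.pullback (f : C(O.Surface, O'.Surface))
      (pathCocycle.pullback (f.symm : C(O'.Surface, O.Surface)) κ) = κ := by
    intro κ
    refine Subtype.ext (funext fun γ => congrArg κ.1 (ContinuousMap.ext fun t => ?_))
    simp
  rw [← hf, e, e]

/-! #### Shear -/

variable (O) in
/-- The image of a square-tiled surface under the shear `(x, y) ↦ (x + y, y)`. -/
def shear : Origami Q := ⟨O.right, O.up * O.right⁻¹⟩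

/-- The nearest point of the unit interval. -/
noncomputable def clamp (x : ℝ) : I := Set.projIcc 0 1 zero_le_one x

theorem continuous_clamp : Continuous clamp := continuous_projIcc (h := zero_le_one)

@[simp] theorem clamp_coe (x : I) : clamp x = x := Set.projIcc_val _ _

theorem clamp_of_mem {x : ℝ} (h : x ∈ I) : clamp x = ⟨x, h⟩ := Set.projIcc_of_mem _ h

theorem clamp_one : clamp 1 = 1 := clamp_of_mem ⟨zero_le_one, le_rfl⟩

theorem clamp_zero : clamp 0 = 0 := clamp_of_mem ⟨le_rfl, zero_le_one⟩

variable (O) in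
/-- The shear on a square. -/
noncomputable def shearSquare (q : Q) : C(I × I, O.shear.Surface) :=
  ⟨fun z => if (z.1 + z.2 : ℝ) ≤ 1 then O.shear.square q (clamp (z.1 + z.2), z.2)
    else O.shear.square (O.right q) (clamp (z.1 + z.2 - 1), z.2), by
    refine Continuous.if_le ?_ ?_ (by fun_prop) continuous_const ?_
    · exact (O.shear.square q).continuous.comp
        ((continuous_clamp.comp (by fun_prop)).prodMk continuous_snd)
    · exact (O.shear.square (O.right q)).continuous.comp
        ((continuous_clamp.comp (by fun_prop)).prodMk continuous_snd)
    · intro z hz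
      rw [hz, sub_self, clamp_one, clamp_zero]
      exact square_right _ _ _⟩

variable (O) in
/-- The inverse shear on a square. -/
noncomputable def unshearSquare (q : Q) : C(I × I, O.Surface) :=
  ⟨fun z => if (z.2 : ℝ) ≤ z.1 then O.square q (clamp (z.1 - z.2), z.2)
    else O.square (O.right.symm q) (clamp (1 + z.1 - z.2), z.2), by
    refine Continuous.if_le ?_ ?_ (by fun_prop) (by fun_prop) ?_
    · exact (O.square q).continuous.comp
        ((continuous_clamp.comp (by fun_prop)).prodMk continuous_snd)
    · exact (O.square (O.right.symm q)).continuous.comp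
        ((continuous_clamp.comp (by fun_prop)).prodMk continuous_snd)
    · intro z hz
      rw [hz, sub_self, add_sub_cancel_right, clamp_one, clamp_zero, square_right,
        Equiv.apply_symm_apply]⟩

theorem coe_eq_of_one_le {x : I} (h : (1 : ℝ) ≤ x) : x = 1 := Subtype.ext (le_antisymm x.2.2 h)

theorem coe_eq_of_le_zero {x : I} (h : (x : ℝ) ≤ 0) : x = 0 := Subtype.ext (le_antisymm h x.2.1)

variable (O) in
/-- The shear as a map of surfaces. -/
noncomputable def shearMap : C(O.Surface, O.shear.Surface) :=
  O.lift O.shearSquare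
    (fun q y => by
      simp only [shearSquare, ContinuousMap.coe_mk, Set.Icc.coe_one, Set.Icc.coe_zero, zero_add,
        add_sub_cancel_left, clamp_coe, if_pos y.2.2]
      split_ifs with h
      · obtain rfl : y = 0 := coe_eq_of_le_zero (by linarith)
        rw [Set.Icc.coe_zero, add_zero, clamp_one]
        exact square_right _ _ _
      · rfl)
    (fun q x => by
      -- The shear moves the upper side of `q` one unit to the right, over the square `O.right q`.
      have h0 : O.up q = O.shear.up (O.right q) := by simp [shear]
      simp only [shearSquare, ContinuousMap.coe_mk, Set.Icc.coe_one, Set.Icc.coe_zero, add_zero,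
        add_sub_cancel_right, clamp_coe, if_pos x.2.2]
      split_ifs with h
      · obtain rfl : x = 0 := coe_eq_of_le_zero (by linarith)
        rw [Set.Icc.coe_zero, zero_add, clamp_one, h0, ← square_up]
        exact square_right _ _ _
      · rw [h0, ← square_up])

variable (O) in
/-- The inverse shear as a map of surfaces. -/
noncomputable def unshearMap : C(O.shear.Surface, O.Surface) :=
  O.shear.lift O.unshearSquare
    (fun q y => by
      have h0 : O.shear.right = O.right := rfl
      simp only [unshearSquare, ContinuousMap.coe_mk, Set.Icc.coe_one, Set.Icc.coe_zero, add_zero,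
        if_pos y.2.2, h0, Equiv.symm_apply_apply]
      split_ifs with h
      · obtain rfl : y = 0 := coe_eq_of_le_zero (by linarith)
        rw [Set.Icc.coe_zero, sub_zero, sub_zero, clamp_one, clamp_zero, square_right]
      · rfl)
    (fun q x => by
      have h0 : O.shear.up q = O.up (O.right.symm q) := rfl
      simp only [unshearSquare, ContinuousMap.coe_mk, Set.Icc.coe_one, Set.Icc.coe_zero, sub_zero,
        if_pos x.2.1, h0, add_sub_cancel_left, clamp_coe]
      split_ifs with h
      · obtain rfl : x = 1 := coe_eq_of_one_le h
        rw [Set.Icc.coe_one, sub_self, clamp_zero, square_up, ← square_up, ← square_up]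
        rw [square_right, Equiv.apply_symm_apply]
      · rw [square_up])

variable (O) in
/-- The shear as a homeomorphism. -/
noncomputable def shearHomeo : O.Surface ≃ₜ O.shear.Surface where
  toFun := O.shearMap
  invFun := O.unshearMap
  left_inv s := by
    obtain ⟨q, z, rfl⟩ := exists_square_eq s
    rw [shearMap, lift_square]
    simp only [shearSquare, ContinuousMap.coe_mk]
    split_ifs with h
    · rw [unshearMap, lift_square, clamp_of_mem ⟨add_nonneg z.1.2.1 z.2.2.1, h⟩]
      simp only [unshearSquare, ContinuousMap.coe_mk, add_sub_cancel_right, clamp_coe]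
      rw [if_pos (by have := z.1.2.1; linarith)]
    · rw [unshearMap, lift_square, clamp_of_mem ⟨by linarith, by
        have := z.1.2.2; have := z.2.2.2; linarith⟩]
      simp only [unshearSquare, ContinuousMap.coe_mk, Equiv.symm_apply_apply]
      split_ifs with h'
      · obtain ⟨x, y⟩ := z
        obtain rfl : x = 1 := coe_eq_of_one_le (by dsimp at h'; linarith)
        dsimp
        rw [show (1 + (y : ℝ) - 1 - y) = 0 by ring, clamp_zero, square_right]
      · rw [show (1 + ((z.1 : ℝ) + z.2 - 1) - z.2) = z.1 by ring, clamp_coe]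
  right_inv s := by
    obtain ⟨q, z, rfl⟩ := exists_square_eq s
    rw [unshearMap, lift_square]
    simp only [unshearSquare, ContinuousMap.coe_mk]
    split_ifs with h
    · rw [shearMap, lift_square, clamp_of_mem ⟨by linarith, by
        have := z.1.2.2; have := z.2.2.1; linarith⟩]
      simp only [shearSquare, ContinuousMap.coe_mk, sub_add_cancel, clamp_coe]
      rw [if_pos z.1.2.2]
    · rw [shearMap, lift_square, clamp_of_mem ⟨by
        have := z.1.2.1; have := z.2.2.2; linarith, by linarith⟩]
      simp only [shearSquare, ContinuousMap.coe_mk, sub_add_cancel, Equiv.apply_symm_apply,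
        add_sub_cancel_left, clamp_coe]
      split_ifs with h'
      · obtain ⟨x, y⟩ := z
        obtain rfl : x = 0 := coe_eq_of_le_zero (by dsimp at h'; linarith)
        rw [Set.Icc.coe_zero, add_zero, clamp_one, square_right]
        congr 2
        exact O.right.apply_symm_apply q
      · rfl
  continuous_toFun := O.shearMap.continuous
  continuous_invFun := O.unshearMap.continuous

theorem shearHomeo_square_of_le (q : Q) (z : I × I) (h : (z.1 + z.2 : ℝ) ≤ 1) :
    O.shearHomeo (O.square q z) = O.shear.square q (clamp (z.1 + z.2), z.2) := by
  change O.shearSquare q z = _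
  simp only [shearSquare, ContinuousMap.coe_mk, if_pos h]

theorem hasLinearPart_shear : HasLinearPart !![1, 1; 0, 1] O.shearHomeo := by
  intro s
  obtain ⟨q, z, rfl⟩ := exists_square_eq s
  change O.shear.toTorus (O.shearSquare q z) = _
  simp only [shearSquare, ContinuousMap.coe_mk]
  split_ifs with h
  · rw [clamp_of_mem ⟨add_nonneg z.1.2.1 z.2.2.1, h⟩]
    funext i
    fin_cases i
    · change ((z.1 + z.2 : ℝ) : UnitAddCircle) = _
      simp [torusLinear, Fin.sum_univ_two, toTorus_square_zero, toTorus_square_one]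
    · change ((z.2 : ℝ) : UnitAddCircle) = _
      simp [torusLinear, Fin.sum_univ_two, toTorus_square_zero, toTorus_square_one]
  · rw [clamp_of_mem ⟨by linarith, by have := z.1.2.2; have := z.2.2.2; linarith⟩]
    funext i
    fin_cases i
    · change ((z.1 + z.2 - 1 : ℝ) : UnitAddCircle) = _
      simp [torusLinear, Fin.sum_univ_two, toTorus_square_zero, toTorus_square_one]
    · change ((z.2 : ℝ) : UnitAddCircle) = _
      simp [torusLinear, Fin.sum_univ_two, toTorus_square_zero, toTorus_square_one]

theorem horValue_shear (κ : pathCocycle O.shear.Surface) (q : Q) :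
    horValue (pathCocycle.pullback (O.shearHomeo : C(O.Surface, O.shear.Surface)) κ) q =
      horValue κ q := by
  refine congrArg κ.1 (ContinuousMap.ext fun t => ?_)
  change O.shearHomeo (bottom q t) = bottom q t
  rw [bottom, segPath_apply, shearHomeo_square_of_le _ _ (by simpa using t.2.2)]
  simp [bottom, segPath_apply]

/-- The left side is mapped to the diagonal of the square, which a cocycle does not distinguish from
the lower side followed by the right side. -/
theorem verValue_shear (κ : pathCocycle O.shear.Surface) (q : Q) :
    verValue (pathCocycle.pullback (O.shearHomeo : C(O.Surface, O.shear.Surface)) κ) q =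
      horValue κ q + verValue κ (O.right q) := by
  have h1 : verValue (pathCocycle.pullback (O.shearHomeo : C(O.Surface, O.shear.Surface)) κ) q =
      κ.1 (segPath (O.shear.square q) (0, 0) (1, 1)) := by
    refine congrArg κ.1 (ContinuousMap.ext fun t => ?_)
    change O.shearHomeo (left q t) = _
    rw [left, segPath_apply, shearHomeo_square_of_le _ _ (by simpa using t.2.2)]
    simp [segPath_apply]
  rw [h1, ← pathCocycle.segPath_add κ _ (0, 0) (1, 0) (1, 1), segPath_right]
  rfl

/-- After reindexing by `right`, corresponding summands differ by `a q` times the closedness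
relation of the second cochain at the square `O.right q`. -/
theorem cup_shear [Fintype Q] {R : Type*} [CommRing R] {a b a' b' : Q → R}
    (h' : O.shear.IsClosed a' b') :
    O.cup a (fun q => a q + b (O.right q)) a' (fun q => a' q + b' (O.right q)) =
      O.shear.cup a b a' b' := by
  have e1 : ∑ q, b (O.right q) * a' (O.up q) = ∑ q, b q * a' (O.shear.up q) := by
    rw [← Equiv.sum_comp O.right fun q => b q * a' (O.shear.up q)]
    simp [shear]
  have e2 : ∀ q, a' (O.right q) + b' (O.right (O.right q)) - a' (O.up q) = b' (O.right q) := by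
    intro q
    have := h' (O.right q)
    have e : O.shear.up (O.right q) = O.up q := congrArg O.up (O.right.symm_apply_apply q)
    rw [e] at this
    change a' (O.right q) + b' (O.right (O.right q)) = b' (O.right q) + a' (O.up q) at this
    linear_combination this
  have e3 : O.shear.cup a b a' b' = ∑ q, (a q * b' (O.right q) - b (O.right q) * a' (O.up q)) := by
    rw [Finset.sum_sub_distrib, e1, ← Finset.sum_sub_distrib]
    rfl
  rw [e3]
  refine Finset.sum_congr rfl fun q _ => ?_
  linear_combination a q * e2 q

theorem preservesForm_shear [Fintype Q] : PreservesForm O.shearHomeo := by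
  intro κ κ'
  simp only [pairing, funext (horValue_shear _), funext (verValue_shear _), form]
  rw [cup_shear (isClosed_values κ'), cup_shear (isClosed_values κ)]

/-! #### Rotation -/

variable (O) in
/-- The image of a square-tiled surface under the rotation `(x, y) ↦ (-y, x)`. -/
def rotate : Origami Q := ⟨O.up⁻¹, O.right⟩

variable (O) in
/-- The rotation as a map of surfaces. -/
noncomputable def rotateMap : C(O.Surface, O.rotate.Surface) :=
  O.lift (fun q => (O.rotate.square q).comp ⟨fun z => (unitInterval.symm z.2, z.1), by fun_prop⟩)
    (fun q y => O.rotate.square_up q (unitInterval.symm y))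
    (fun q x => by
      have h := O.rotate.square_right (O.up q) x
      rw [show O.rotate.right (O.up q) = q from O.up.symm_apply_apply q] at h
      simpa only [ContinuousMap.comp_apply, ContinuousMap.coe_mk, unitInterval.symm_zero,
        unitInterval.symm_one] using h.symm)

variable (O) in
/-- The inverse rotation as a map of surfaces. -/
noncomputable def unrotateMap : C(O.rotate.Surface, O.Surface) :=
  O.rotate.lift (fun q => (O.square q).comp ⟨fun z => (z.2, unitInterval.symm z.1), by fun_prop⟩)
    (fun q y => by
      have h := (O.square_up (O.up.symm q) y).symm
      rw [Equiv.apply_symm_apply] at h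
      simp only [ContinuousMap.comp_apply, ContinuousMap.coe_mk, unitInterval.symm_zero,
        unitInterval.symm_one]
      exact h)
    (fun q x => O.square_right q (unitInterval.symm x))

variable (O) in
/-- The rotation as a homeomorphism. -/
noncomputable def rotateHomeo : O.Surface ≃ₜ O.rotate.Surface where
  toFun := O.rotateMap
  invFun := O.unrotateMap
  left_inv s := by
    obtain ⟨q, z, rfl⟩ := exists_square_eq s
    change O.square q (z.1, unitInterval.symm (unitInterval.symm z.2)) = O.square q z
    rw [unitInterval.symm_symm]
  right_inv s := by
    obtain ⟨q, z, rfl⟩ := exists_square_eq s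
    change O.rotate.square q (unitInterval.symm (unitInterval.symm z.1), z.2) = O.rotate.square q z
    rw [unitInterval.symm_symm]
  continuous_toFun := O.rotateMap.continuous
  continuous_invFun := O.unrotateMap.continuous

theorem rotateHomeo_square (q : Q) (z : I × I) :
    O.rotateHomeo (O.square q z) = O.rotate.square q (unitInterval.symm z.2, z.1) := rfl

theorem hasLinearPart_rotate : HasLinearPart !![0, -1; 1, 0] O.rotateHomeo := by
  intro s
  obtain ⟨q, z, rfl⟩ := exists_square_eq s
  rw [rotateHomeo_square]
  funext i
  fin_cases i
  · change ((1 - z.2 : ℝ) : UnitAddCircle) = _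
    simp [torusLinear, Fin.sum_univ_two, toTorus_square_zero, toTorus_square_one]
  · change ((z.1 : ℝ) : UnitAddCircle) = _
    simp [torusLinear, Fin.sum_univ_two, toTorus_square_zero, toTorus_square_one]

theorem horValue_rotate (κ : pathCocycle O.rotate.Surface) (q : Q) :
    horValue (pathCocycle.pullback (O.rotateHomeo : C(O.Surface, O.rotate.Surface)) κ) q =
      verValue κ (O.up.symm q) := by
  have h1 : horValue (pathCocycle.pullback (O.rotateHomeo : C(O.Surface, O.rotate.Surface)) κ) q =
      κ.1 (segPath (O.rotate.square q) (1, 0) (1, 1)) := by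
    refine congrArg κ.1 (ContinuousMap.ext fun t => ?_)
    change O.rotateHomeo (bottom q t) = _
    rw [bottom, segPath_apply, rotateHomeo_square]
    simp [segPath_apply]
  rw [h1, segPath_right]
  rfl

theorem verValue_rotate (κ : pathCocycle O.rotate.Surface) (q : Q) :
    verValue (pathCocycle.pullback (O.rotateHomeo : C(O.Surface, O.rotate.Surface)) κ) q =
      -horValue κ q := by
  have h1 : verValue (pathCocycle.pullback (O.rotateHomeo : C(O.Surface, O.rotate.Surface)) κ) q =
      κ.1 (segPath (O.rotate.square q) (1, 0) (0, 0)) := by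
    refine congrArg κ.1 (ContinuousMap.ext fun t => ?_)
    change O.rotateHomeo (left q t) = _
    rw [left, segPath_apply, rotateHomeo_square, segPath_apply]
    congr 2
    · refine Subtype.ext ?_
      simp [coe_lerp]
  -- The lower side followed in both directions has the value of a constant path, and `h3` shows
  -- that this value is zero.
  have h2 := pathCocycle.segPath_add κ (O.rotate.square q) (1, 0) (0, 0) (1, 0)
  have h3 := pathCocycle.segPath_add κ (O.rotate.square q) (1, 0) (1, 0) (1, 0)
  rw [h1]
  change _ = -κ.1 (segPath (O.rotate.square q) (0, 0) (1, 0))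
  linarith

/-- With the closedness relations inserted, the two sums differ by the sum of `a q * a' q` minus its
translate under `right`. -/
theorem cup_rotate [Fintype Q] {R : Type*} [CommRing R] {a b a' b' : Q → R}
    (h : O.rotate.IsClosed a b) (h' : O.rotate.IsClosed a' b') :
    O.cup (fun q => b (O.up.symm q)) (fun q => -a q) (fun q => b' (O.up.symm q)) (fun q => -a' q) =
      O.rotate.cup a b a' b' := by
  have e1 : ∀ q, b (O.up.symm q) = b q + a (O.right q) - a q := fun q => by
    have : a q + b (O.up.symm q) = b q + a (O.right q) := h q
    linear_combination this
  have e2 : ∀ q, b' (O.up.symm q) = b' q + a' (O.right q) - a' q := fun q => by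
    have : a' q + b' (O.up.symm q) = b' q + a' (O.right q) := h' q
    linear_combination this
  have e3 : ∑ q, a (O.right q) * a' (O.right q) = ∑ q, a q * a' q :=
    Equiv.sum_comp O.right fun q => a q * a' q
  have e4 : O.rotate.cup a b a' b' =
      ∑ q, (a q * (b' q + a' (O.right q) - a' q) - b q * a' (O.right q)) := by
    simp only [← e2]
    rfl
  have e5 : O.cup (fun q => b (O.up.symm q)) (fun q => -a q) (fun q => b' (O.up.symm q))
      (fun q => -a' q) = ∑ q, (a q * b' q - (b q + a (O.right q) - a q) * a' (O.right q)) := by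
    simp only [cup, ← e1, Equiv.symm_apply_apply]
    exact Finset.sum_congr rfl fun q _ => by ring
  rw [e4, e5, ← sub_eq_zero, ← Finset.sum_sub_distrib]
  have : ∀ q, (a q * b' q - (b q + a (O.right q) - a q) * a' (O.right q)) -
      (a q * (b' q + a' (O.right q) - a' q) - b q * a' (O.right q)) =
      a q * a' q - a (O.right q) * a' (O.right q) := fun q => by ring
  simp only [this]
  rw [Finset.sum_sub_distrib, e3, sub_self]

theorem preservesForm_rotate [Fintype Q] : PreservesForm O.rotateHomeo := by
  intro κ κ'
  simp only [pairing, funext (horValue_rotate _), funext (verValue_rotate _), form]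
  rw [cup_rotate (isClosed_values κ) (isClosed_values κ'),
    cup_rotate (isClosed_values κ') (isClosed_values κ)]

/-! #### Isomorphisms over the torus -/

theorem eq_of_mem_face {q : Q} {s : O.Surface} {z : I × I} (h : s ∈ O.face q)
    (hp : ∀ i, O.toTorus s i = O.toTorus (O.square q z) i) (h1 : z.1 ≠ 1) (h2 : z.2 ≠ 1) :
    s = O.square q z := by
  obtain ⟨q', z', rfl⟩ := exists_square_eq s
  obtain ⟨rfl, -, h3, -, h4⟩ := square_mem_face.1 h
  have e1 : z'.1 = z.1 := coe_circle_inj h3 h1 (hp 0)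
  have e2 : z'.2 = z.2 := coe_circle_inj h4 h2 (hp 1)
  rw [show z' = z from Prod.ext e1 e2]

theorem mem_face_of_toTorus {s : O.Surface} {x y : I}
    (h0 : O.toTorus s 0 = ((x : ℝ) : UnitAddCircle))
    (h1 : O.toTorus s 1 = ((y : ℝ) : UnitAddCircle)) (hx : x ≠ 0) (hx' : x ≠ 1) (hy : y ≠ 0)
    (hy' : y ≠ 1) : ∃ q, s ∈ O.face q := by
  obtain ⟨q, z, rfl, k1, k2⟩ := exists_square_eq_lt s
  have e1 : z.1 = x := coe_circle_inj k1 hx' h0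
  have e2 : z.2 = y := coe_circle_inj k2 hy' h1
  exact ⟨q, square_mem_face.2 ⟨rfl, by rwa [e1], k1, by rwa [e2], k2⟩⟩

/-- The center of the unit square. -/
noncomputable def center : I := ⟨1 / 2, by norm_num, by norm_num⟩

theorem center_ne_zero : center ≠ 0 := fun h => by
  have := congrArg Subtype.val h; norm_num [center] at this

theorem center_ne_one : center ≠ 1 := fun h => by
  have := congrArg Subtype.val h; norm_num [center] at this

/-- Over the interior of the unit square the target is a disjoint union of open faces, so by
connectedness the interior of `q` goes into a single face, where the coordinates in the torus
determine the image. Density of the interior extends the formula to the closed square. -/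
theorem exists_square_of_toTorus {O O' : Origami Q} (f : C(O.Surface, O'.Surface))
    (hf : ∀ s, O'.toTorus (f s) = O.toTorus s) (q : Q) :
    ∃ q', ∀ z, f (O.square q z) = O'.square q' z := by
  let W : Set (I × I) := Set.Ioo 0 1 ×ˢ Set.Ioo 0 1
  have hWne : ∀ z ∈ W, z.1 ≠ 0 ∧ z.1 ≠ 1 ∧ z.2 ≠ 0 ∧ z.2 ≠ 1 := fun z hz =>
    ⟨hz.1.1.ne', hz.1.2.ne, hz.2.1.ne', hz.2.2.ne⟩
  have hWc : IsPreconnected W := isPreconnected_Ioo.prod isPreconnected_Ioo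
  have hWd : Dense W := by
    have h : closure (Set.Ioo (0 : I) 1) = Set.univ := by
      rw [closure_Ioo zero_ne_one]
      exact Set.eq_univ_of_forall fun x => ⟨x.2.1, x.2.2⟩
    exact (dense_iff_closure_eq.2 h).prod (dense_iff_closure_eq.2 h)
  have hface : ∀ z ∈ W, ∃ q', f (O.square q z) ∈ O'.face q' := fun z hz => by
    obtain ⟨h1, h2, h3, h4⟩ := hWne z hz
    exact mem_face_of_toTorus (x := z.1) (y := z.2) (by rw [hf]; rfl) (by rw [hf]; rfl) h1 h2 h3 h4
  have hcW : (center, center) ∈ W := by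
    refine ⟨⟨?_, ?_⟩, ⟨?_, ?_⟩⟩ <;> simp only [← Subtype.coe_lt_coe] <;> norm_num [center]
  obtain ⟨q', hq'⟩ := hface _ hcW
  refine ⟨q', fun z => ?_⟩
  have hcont : Continuous fun z => f (O.square q z) := by fun_prop
  have hsub : W ⊆ (fun z => f (O.square q z)) ⁻¹' O'.face q' := by
    refine hWc.subset_left_of_subset_union ((isOpen_face q').preimage hcont)
      ((isOpen_iUnion fun q'' : {q'' // q'' ≠ q'} => isOpen_face (O := O') q''.1).preimage hcont)
      ?_ ?_ ⟨_, hcW, hq'⟩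
    · refine Disjoint.preimage _ ?_
      rw [Set.disjoint_iUnion_right]
      exact fun q'' => disjoint_face q''.2.symm
    · intro z hz
      obtain ⟨q'', h⟩ := hface z hz
      by_cases e : q'' = q'
      · exact Or.inl (e ▸ h)
      · exact Or.inr (Set.mem_iUnion.2 ⟨⟨q'', e⟩, h⟩)
  have heq : Set.EqOn (fun z => f (O.square q z)) (O'.square q') W := fun z hz => by
    obtain ⟨h1, h2, h3, h4⟩ := hWne z hz
    exact eq_of_mem_face (hsub hz) (fun i => by rw [hf]; rfl) h2 h4
  exact congrFun (Continuous.ext_on hWd hcont (O'.square q').continuous heq) z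

theorem square_injective (q q' : Q) {z : I × I} (h1 : z.1 ≠ 0) (h2 : z.1 ≠ 1) (h3 : z.2 ≠ 0)
    (h4 : z.2 ≠ 1) (h : O.square q z = O.square q' z) : q = q' := by
  by_contra hne
  exact Set.disjoint_left.1 (disjoint_face (O := O) hne)
    (square_mem_face.2 ⟨rfl, h1, h2, h3, h4⟩) (h ▸ square_mem_face.2 ⟨rfl, h1, h2, h3, h4⟩)

theorem exists_perm_of_toTorus {O O' : Origami Q} (f : O.Surface ≃ₜ O'.Surface)
    (hf : ∀ s, O'.toTorus (f s) = O.toTorus s) :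
    ∃ τ : Equiv.Perm Q, (∀ q z, f (O.square q z) = O'.square (τ q) z) ∧
      (∀ q, τ (O.right q) = O'.right (τ q)) ∧ ∀ q, τ (O.up q) = O'.up (τ q) := by
  choose τ hτ using fun q => exists_square_of_toTorus (f : C(O.Surface, O'.Surface)) hf q
  choose τ' hτ' using fun q => exists_square_of_toTorus (f.symm : C(O'.Surface, O.Surface))
    (fun s => by rw [← hf]; exact congrArg _ (f.apply_symm_apply s)) q
  have hinj : ∀ (O : Origami Q) (q q' : Q), O.square q (center, center) = O.square q' (center, center) →
      q = q' := fun O q q' => square_injective q q' center_ne_zero center_ne_one center_ne_zero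
        center_ne_one
  refine ⟨⟨τ, τ', fun q => ?_, fun q => ?_⟩, hτ, fun q => ?_, fun q => ?_⟩
  · refine hinj O _ _ ?_
    rw [← hτ', ← hτ]
    exact f.symm_apply_apply _
  · refine hinj O' _ _ ?_
    rw [← hτ, ← hτ']
    exact f.apply_symm_apply _
  -- Compatibility with the gluing is tested at the midpoint of a side: the stars of different open
  -- sides are disjoint.
  · by_contra hne
    have h1 : O'.square (τ (O.right q)) (0, center) = O'.square (O'.right (τ q)) (0, center) := by
      rw [← hτ, ← square_right, ← square_right, hτ]
    have hm : ∀ q', O'.square q' (0, center) ∈ O'.verStar q' := fun q' =>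
      square_mem_verStar.2 ⟨center_ne_zero, center_ne_one, Or.inl ⟨rfl, by norm_num⟩⟩
    exact Set.disjoint_left.1 (disjoint_verStar (O := O') hne) (hm _) (h1 ▸ hm _)
  · by_contra hne
    have h1 : O'.square (τ (O.up q)) (center, 0) = O'.square (O'.up (τ q)) (center, 0) := by
      rw [← hτ, ← square_up, ← square_up, hτ]
    have hm : ∀ q', O'.square q' (center, 0) ∈ O'.horStar q' := fun q' =>
      square_mem_horStar.2 ⟨center_ne_zero, center_ne_one, Or.inl ⟨rfl, by norm_num⟩⟩
    exact Set.disjoint_left.1 (disjoint_horStar (O := O') hne) (hm _) (h1 ▸ hm _)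

theorem horValue_pullback_perm {f : C(O.Surface, O'.Surface)} {τ : Q → Q}
    (h : ∀ q z, f (O.square q z) = O'.square (τ q) z) (κ : pathCocycle O'.Surface) (q : Q) :
    horValue (pathCocycle.pullback f κ) q = horValue κ (τ q) :=
  congrArg κ.1 (ContinuousMap.ext fun _ => h q _)

theorem verValue_pullback_perm {f : C(O.Surface, O'.Surface)} {τ : Q → Q}
    (h : ∀ q z, f (O.square q z) = O'.square (τ q) z) (κ : pathCocycle O'.Surface) (q : Q) :
    verValue (pathCocycle.pullback f κ) q = verValue κ (τ q) :=
  congrArg κ.1 (ContinuousMap.ext fun _ => h q _)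

theorem preservesForm_of_toTorus [Fintype Q] {O O' : Origami Q} (f : O.Surface ≃ₜ O'.Surface)
    (hf : ∀ s, O'.toTorus (f s) = O.toTorus s) : PreservesForm f := by
  obtain ⟨τ, h1, h2, h3⟩ := exists_perm_of_toTorus f hf
  have hcup : ∀ a b a' b' : Q → ℝ, O.cup (fun q => a (τ q)) (fun q => b (τ q)) (fun q => a' (τ q))
      (fun q => b' (τ q)) = O'.cup a b a' b' := by
    intro a b a' b'
    simp only [cup, h2, h3]
    exact Equiv.sum_comp τ fun q => a q * b' (O'.right q) - b q * a' (O'.up q)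
  intro κ κ'
  simp only [pairing, form]
  rw [funext (horValue_pullback_perm (f := (f : C(O.Surface, O'.Surface))) h1 κ),
    funext (verValue_pullback_perm (f := (f : C(O.Surface, O'.Surface))) h1 κ),
    funext (horValue_pullback_perm (f := (f : C(O.Surface, O'.Surface))) h1 κ'),
    funext (verValue_pullback_perm (f := (f : C(O.Surface, O'.Surface))) h1 κ'), hcup, hcup]

/-! #### All integral linear parts -/

/-- The group SL(2, ℤ) is generated by the quarter turn and the unit shear, which are realized
geometrically. The assertion is made for every source and for every target, because inverses
exchange the two. -/
theorem exists_linearPart [Fintype Q] (A : Matrix.SpecialLinearGroup (Fin 2) ℤ) :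
    (∀ O : Origami Q, ∃ (O' : Origami Q) (f : O.Surface ≃ₜ O'.Surface),
      HasLinearPart A.1 f ∧ PreservesForm f) ∧
    ∀ O' : Origami Q, ∃ (O : Origami Q) (f : O.Surface ≃ₜ O'.Surface),
      HasLinearPart A.1 f ∧ PreservesForm f := by
  have hA : A ∈ Subgroup.closure {ModularGroup.S, ModularGroup.T} := by
    rw [SpecialLinearGroup.SL2Z_generators]; trivial
  induction hA using Subgroup.closure_induction with
  | mem A hA =>
    rcases hA with rfl | rfl
    · refine ⟨fun O => ⟨O.rotate, O.rotateHomeo, hasLinearPart_rotate, preservesForm_rotate⟩,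
        fun O' => ?_⟩
      -- Rotation is a bijection on the set of origamis with squares `Q`, so every origami is the
      -- target of a rotation; the same holds for the shear.
      obtain ⟨O, rfl⟩ : ∃ O : Origami Q, O' = O.rotate := ⟨⟨O'.up, O'.right⁻¹⟩, by ext1 <;> simp [rotate]⟩
      exact ⟨O, O.rotateHomeo, hasLinearPart_rotate, preservesForm_rotate⟩
    · refine ⟨fun O => ⟨O.shear, O.shearHomeo, hasLinearPart_shear, preservesForm_shear⟩,
        fun O' => ?_⟩
      obtain ⟨O, rfl⟩ : ∃ O : Origami Q, O' = O.shear :=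
        ⟨⟨O'.right, O'.up * O'.right⟩, by ext1 <;> simp [shear]⟩
      exact ⟨O, O.shearHomeo, hasLinearPart_shear, preservesForm_shear⟩
  | one =>
    have h : ∀ O : Origami Q, HasLinearPart (1 : Matrix (Fin 2) (Fin 2) ℤ) (Homeomorph.refl O.Surface) ∧
        PreservesForm (Homeomorph.refl O.Surface) := fun O =>
      ⟨fun s => by simp, fun κ κ' => rfl⟩
    exact ⟨fun O => ⟨O, Homeomorph.refl _, h O⟩, fun O => ⟨O, Homeomorph.refl _, h O⟩⟩
  | mul A B _ _ ihA ihB =>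
    constructor
    · intro O
      obtain ⟨O', f, h1, h2⟩ := ihB.1 O
      obtain ⟨O'', g, h3, h4⟩ := ihA.1 O'
      exact ⟨O'', f.trans g, h1.trans h3, h2.trans h4⟩
    · intro O''
      obtain ⟨O', g, h3, h4⟩ := ihA.2 O''
      obtain ⟨O, f, h1, h2⟩ := ihB.2 O'
      exact ⟨O, f.trans g, h1.trans h3, h2.trans h4⟩
  | inv A _ ih =>
    have hinv : (A⁻¹).1 * A.1 = 1 := by
      rw [← Matrix.SpecialLinearGroup.coe_mul, inv_mul_cancel, Matrix.SpecialLinearGroup.coe_one]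
    constructor
    · intro O
      obtain ⟨O', f, h1, h2⟩ := ih.2 O
      exact ⟨O', f.symm, h1.symm hinv, h2.symm⟩
    · intro O
      obtain ⟨O', f, h1, h2⟩ := ih.1 O
      exact ⟨O', f.symm, h1.symm hinv, h2.symm⟩

/-- Homeomorphisms with integral linear part preserve the intersection form. -/
theorem preservesForm_of_hasLinearPart [Fintype Q] {A : Matrix.SpecialLinearGroup (Fin 2) ℤ}
    {f : O.Surface ≃ₜ O.Surface} (hf : HasLinearPart A.1 f) : PreservesForm f := by
  obtain ⟨O', g, h1, h2⟩ := (exists_linearPart A).1 O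
  have hinv : (A⁻¹).1 * A.1 = 1 := by
    rw [← Matrix.SpecialLinearGroup.coe_mul, inv_mul_cancel, Matrix.SpecialLinearGroup.coe_one]
  -- The standard map `g` has the same linear part as `f`, so the two differ by an isomorphism over
  -- the torus, which merely permutes the squares.
  have h3 : PreservesForm (f.symm.trans g) := preservesForm_of_toTorus _ fun s => by
    have := (hf.symm hinv).trans h1 s
    rw [this, ← Matrix.SpecialLinearGroup.coe_mul, mul_inv_cancel, Matrix.SpecialLinearGroup.coe_one,
      torusLinear_one]
  have h4 : f = g.trans (f.symm.trans g).symm := by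
    ext s; simp
  rw [h4]
  exact h2.trans h3.symm

end Origami

/-! ### Affine homeomorphisms -/

/-- The representative of smallest size of a point of the circle. -/
noncomputable def circleLift (θ : UnitAddCircle) : ℝ := AddCircle.equivIco 1 (-(1 / 2)) θ

/-- The projection of the plane to the torus. -/
def torusCoe (z : Fin 2 → ℝ) : UnitAddTorus (Fin 2) := fun i => ((z i : ℝ) : UnitAddCircle)

/-- The representative of smallest size of a point of the torus. -/
noncomputable def torusLift (θ : UnitAddTorus (Fin 2)) : Fin 2 → ℝ := fun i => circleLift (θ i)

theorem torusCoe_add (z w : Fin 2 → ℝ) : torusCoe (z + w) = torusCoe z + torusCoe w := rfl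

theorem torusCoe_sub (z w : Fin 2 → ℝ) : torusCoe (z - w) = torusCoe z - torusCoe w := rfl

theorem torusCoe_torusLift (θ : UnitAddTorus (Fin 2)) : torusCoe (torusLift θ) = θ :=
  funext fun _ => AddCircle.coe_equivIco

theorem torusLift_injective : Function.Injective torusLift :=
  Function.LeftInverse.injective torusCoe_torusLift

theorem circleLift_coe {x : ℝ} (h : |x| < 1 / 2) : circleLift (x : UnitAddCircle) = x := by
  have hx : x ∈ Set.Ico (-(1 / 2) : ℝ) (-(1 / 2) + 1) :=
    ⟨by linarith [neg_abs_le x], by linarith [le_abs_self x]⟩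
  rw [circleLift, AddCircle.equivIco_coe_eq hx]

theorem torusLift_torusCoe {z : Fin 2 → ℝ} (h : ‖z‖ < 1 / 2) : torusLift (torusCoe z) = z :=
  funext fun i => circleLift_coe ((norm_le_pi_norm z i).trans_lt h)

@[simp] theorem torusLift_zero : torusLift 0 = 0 :=
  torusLift_torusCoe (z := 0) (by norm_num)

theorem continuousAt_torusLift : ContinuousAt torusLift 0 := by
  refine continuousAt_pi.2 fun i => ?_
  have h : ContinuousAt circleLift 0 := by
    refine continuous_subtype_val.continuousAt.comp (AddCircle.continuousAt_equivIco _ _ ?_)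
    intro h
    obtain ⟨n, hn⟩ := (AddCircle.coe_eq_zero_iff (1 : ℝ)).1 h.symm
    have h2 : ((2 * n : ℤ) : ℝ) = ((-1 : ℤ) : ℝ) := by
      push_cast
      rw [zsmul_one] at hn
      linarith
    have := Int.cast_injective h2
    omega
  exact ContinuousAt.comp (g := circleLift) (f := fun θ : UnitAddTorus (Fin 2) => θ i) h
    (continuous_apply i).continuousAt

theorem torusLift_add {θ η : UnitAddTorus (Fin 2)} (h : ‖torusLift θ‖ < 1 / 4)
    (h' : ‖torusLift η‖ < 1 / 4) : torusLift (θ + η) = torusLift θ + torusLift η := by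
  conv_lhs => rw [← torusCoe_torusLift θ, ← torusCoe_torusLift η, ← torusCoe_add]
  exact torusLift_torusCoe ((norm_add_le _ _).trans_lt (by linarith))

theorem torusLinear_torusCoe (B : Matrix (Fin 2) (Fin 2) ℤ) (z : Fin 2 → ℝ) :
    torusLinear B (torusCoe z) = torusCoe ((B.map (Int.cast : ℤ → ℝ)).mulVec z) := by
  funext i
  simp [torusLinear, torusCoe, Matrix.mulVec, dotProduct, Fin.sum_univ_two]

theorem torusLinear_sub (B : Matrix (Fin 2) (Fin 2) ℤ) (θ η : UnitAddTorus (Fin 2)) :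
    torusLinear B (θ - η) = torusLinear B θ - torusLinear B η := by
  funext i
  simp [torusLinear, smul_sub]

section LocallyAffine

variable {S S' : Type} [TopologicalSpace S] [TopologicalSpace S']

theorem eventually_norm_torusLift_lt (p : C(S, UnitAddTorus (Fin 2))) (x : S) {ε : ℝ} (hε : 0 < ε) :
    ∀ᶠ y in 𝓝 x, ‖torusLift (p y - p x)‖ < ε := by
  have h1 : Filter.Tendsto (fun y => p y - p x) (𝓝 x) (𝓝 0) := by
    have : Filter.Tendsto (fun y => p y - p x) (𝓝 x) (𝓝 (p x - p x)) :=
      (p.continuous.sub continuous_const : Continuous fun y => p y - p x).tendsto x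
    rwa [sub_self] at this
  have h2 := (continuousAt_torusLift.tendsto.comp h1).norm
  rw [torusLift_zero, norm_zero] at h2
  exact h2.eventually (gt_mem_nhds hε)

/-- In the local coordinates given by `p`, the map `f` is affine with linear part `A`. -/
def IsLocallyAffine (p : C(S, UnitAddTorus (Fin 2))) (A : Matrix (Fin 2) (Fin 2) ℝ) (f : S → S) :
    Prop :=
  ∀ x, ∀ᶠ y in 𝓝 x, torusLift (p (f y) - p (f x)) = A.mulVec (torusLift (p y - p x))

theorem IsLocallyAffine.conj {p : C(S, UnitAddTorus (Fin 2))} {p' : C(S', UnitAddTorus (Fin 2))}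
    {A : Matrix (Fin 2) (Fin 2) ℝ} {f : S → S} (h : IsLocallyAffine p A f) (Ψ : S ≃ₜ S')
    (hΨ : ∀ s, p' (Ψ s) = p s) : IsLocallyAffine p' A fun s => Ψ (f (Ψ.symm s)) := by
  intro x
  have h1 := Ψ.symm.continuous.continuousAt.eventually (h (Ψ.symm x))
  filter_upwards [h1] with y hy
  have hp : ∀ s, p (Ψ.symm s) = p' s := fun s => by rw [← hΨ, Ψ.apply_symm_apply]
  rwa [hp, hp, ← hΨ, ← hΨ] at hy

theorem isLocallyAffine_of_torusLinear {p : C(S, UnitAddTorus (Fin 2))}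
    {B : Matrix (Fin 2) (Fin 2) ℤ} {f : S → S} (h : ∀ s, p (f s) = torusLinear B (p s)) :
    IsLocallyAffine p (B.map (Int.cast : ℤ → ℝ)) f := by
  intro x
  let L : (Fin 2 → ℝ) →ₗ[ℝ] (Fin 2 → ℝ) := (B.map (Int.cast : ℤ → ℝ)).mulVecLin
  have hL : Continuous L := L.continuous_of_finiteDimensional
  have h0 : ∀ᶠ z in 𝓝 (0 : Fin 2 → ℝ), ‖L z‖ < 1 / 2 := by
    have h1 : Filter.Tendsto (fun z => ‖L z‖) (𝓝 0) (𝓝 0) := by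
      simpa using (hL.norm).tendsto 0
    exact h1.eventually (gt_mem_nhds (by norm_num))
  obtain ⟨ε, hε, hball⟩ := Metric.eventually_nhds_iff.1 h0
  filter_upwards [eventually_norm_torusLift_lt p x hε] with y hy
  rw [h, h, ← torusLinear_sub]
  conv_lhs => rw [← torusCoe_torusLift (p y - p x), torusLinear_torusCoe]
  exact torusLift_torusCoe (hball (by rwa [dist_zero_right]))

/-- Points near which `p` is not injective. -/
def IsSingularPoint (p : C(S, UnitAddTorus (Fin 2))) (x : S) : Prop :=
  ∀ U ∈ 𝓝 x, ¬ Set.InjOn p U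

/-- Near `x` the local formula makes `p (f y)` a function of `p y`, so coincidences of `p`
arbitrarily close to `x` become coincidences arbitrarily close to `f x`. -/
theorem IsLocallyAffine.isSingularPoint {p : C(S, UnitAddTorus (Fin 2))}
    {A : Matrix (Fin 2) (Fin 2) ℝ} {f : S ≃ₜ S} (hf : IsLocallyAffine p A f) {x : S}
    (hx : IsSingularPoint p x) : IsSingularPoint p (f x) := by
  intro U hU hinj
  refine hx _ (Filter.inter_mem (f.continuous.continuousAt hU) (hf x)) fun y hy y' hy' e => ?_
  refine f.injective (hinj hy.1 hy'.1 ?_)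
  have h1 : torusLift (p (f y) - p (f x)) = torusLift (p (f y') - p (f x)) := by
    have h2 := hy.2
    have h3 := hy'.2
    simp only [Set.mem_ofPred_eq] at h2 h3
    rw [h2, h3, e]
  exact sub_left_injective (torusLift_injective h1)

/-- Along a path that is a segment in the local coordinates, a locally affine map acts by its
linear part. -/
theorem IsLocallyAffine.sub_eq {p : C(S, UnitAddTorus (Fin 2))} {A : Matrix (Fin 2) (Fin 2) ℝ}
    {f : S ≃ₜ S} (hf : IsLocallyAffine p A f) (γ : C(unitInterval, S)) (v : Fin 2 → ℝ)
    (hγ : ∀ t, p (γ t) = torusCoe ((t : ℝ) • v)) :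
    p (f (γ 1)) - p (f (γ 0)) = torusCoe (A.mulVec v) := by
  have hsmul : Continuous fun t : unitInterval => (t : ℝ) • v := by fun_prop
  -- The difference between the actual image and the expected straight segment does not change
  -- locally, hence is constant; comparing the two ends gives the displacement.
  have hloc : IsLocallyConstant fun t : unitInterval =>
      p (f (γ t)) - torusCoe ((t : ℝ) • A.mulVec v) := by
    refine (IsLocallyConstant.iff_eventually_eq _).2 fun t₀ => ?_
    have h1 := γ.continuous.continuousAt.eventually (hf (γ t₀))
    have h2 : ∀ᶠ t : unitInterval in 𝓝 t₀, ‖(t : ℝ) • v - (t₀ : ℝ) • v‖ < 1 / 2 := by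
      have : Filter.Tendsto (fun t : unitInterval => ‖(t : ℝ) • v - (t₀ : ℝ) • v‖) (𝓝 t₀) (𝓝 0) := by
        simpa using ((hsmul.sub (continuous_const (y := (t₀ : ℝ) • v))).norm).tendsto t₀
      exact this.eventually (gt_mem_nhds (by norm_num))
    filter_upwards [h1, h2] with t ht ht'
    rw [hγ, hγ, ← torusCoe_sub, torusLift_torusCoe ht'] at ht
    have h3 := congrArg torusCoe ht
    rw [torusCoe_torusLift, Matrix.mulVec_sub, Matrix.mulVec_smul, Matrix.mulVec_smul,
      torusCoe_sub] at h3
    rw [sub_eq_sub_iff_sub_eq_sub, h3]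
  have h := hloc.apply_eq_of_preconnectedSpace 1 0
  simp only [Set.Icc.coe_one, Set.Icc.coe_zero, one_smul, zero_smul] at h
  have h0 : torusCoe 0 = 0 := rfl
  rw [h0, sub_zero] at h
  rw [← h, sub_sub_cancel]

theorem torusCoe_eq_zero {z : Fin 2 → ℝ} (h : torusCoe z = 0) : ∀ i, ∃ n : ℤ, (n : ℝ) = z i := fun i => by
  obtain ⟨n, hn⟩ := (AddCircle.coe_eq_zero_iff (1 : ℝ)).1 (congrFun h i)
  exact ⟨n, by rw [← hn, zsmul_one]⟩

/-- The linear part is integral, so it acts on the torus, and the difference of the two sides is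
locally constant. It vanishes at `x₀` and the surface is connected. -/
theorem IsLocallyAffine.eq_torusLinear [PreconnectedSpace S] {p : C(S, UnitAddTorus (Fin 2))}
    {B : Matrix (Fin 2) (Fin 2) ℤ} {f : S → S}
    (hf : IsLocallyAffine p (B.map (Int.cast : ℤ → ℝ)) f) {x₀ : S} (h0 : p x₀ = 0)
    (h1 : p (f x₀) = 0) (s : S) : p (f s) = torusLinear B (p s) := by
  have hloc : IsLocallyConstant fun s => p (f s) - torusLinear B (p s) := by
    refine (IsLocallyConstant.iff_eventually_eq _).2 fun x => ?_
    filter_upwards [hf x] with y hy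
    have h3 := congrArg torusCoe hy
    rw [torusCoe_torusLift, ← torusLinear_torusCoe, torusCoe_torusLift, torusLinear_sub] at h3
    rw [sub_eq_sub_iff_sub_eq_sub, h3]
  have h := hloc.apply_eq_of_preconnectedSpace s x₀
  simp only [h0, h1] at h
  have h2 : torusLinear B 0 = 0 := by funext i; simp [torusLinear]
  rw [h2, sub_zero] at h
  exact sub_eq_zero.1 h

end LocallyAffine

/-! ### Affine homeomorphisms in terms of the projection to the torus. -/

namespace LatticePolygons

variable {n : ℕ} [NeZero n] (X : LatticePolygons n)

theorem toTorus_pt (c : X.Cell) (x : X.polygon c) : X.toTorus (X.pt c x) = torusCoe x := rfl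

theorem continuous_pt (c : X.Cell) : Continuous (X.pt c) :=
  continuous_quot_mk.comp continuous_sigmaMk

omit [NeZero n] in
theorem isCompact_polygon (c : X.Cell) : IsCompact (X.polygon c) :=
  (Set.finite_range (X.realCorner c)).isCompact_convexHull ℝ

instance (c : X.Cell) : CompactSpace (X.polygon c) :=
  isCompact_iff_compactSpace.1 (X.isCompact_polygon c)

theorem torusLift_sub_pt {c : X.Cell} {x z : X.polygon c} (h : ‖(z : Fin 2 → ℝ) - x‖ < 1 / 2) :
    torusLift (X.toTorus (X.pt c z) - X.toTorus (X.pt c x)) = (z : Fin 2 → ℝ) - x := by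
  rw [toTorus_pt, toTorus_pt, ← torusCoe_sub, torusLift_torusCoe h]

omit [NeZero n] in
theorem eventually_norm_sub_lt {c : X.Cell} (x : X.polygon c) :
    ∀ᶠ z : X.polygon c in 𝓝 x, ‖(z : Fin 2 → ℝ) - x‖ < 1 / 2 := by
  have : Filter.Tendsto (fun z : X.polygon c => ‖(z : Fin 2 → ℝ) - x‖) (𝓝 x) (𝓝 0) := by
    simpa using ((continuous_subtype_val.sub continuous_const).norm :
      Continuous fun z : X.polygon c => ‖(z : Fin 2 → ℝ) - x‖).tendsto x
  exact this.eventually (gt_mem_nhds (by norm_num))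

/-- The definition of a local primitive is tested polygon by polygon. Since the quotient map from a
compact disjoint union to a Hausdorff space is closed, a property that holds near every preimage of
`x` holds near `x`. In the surface the displacement is recovered as the small lift of the difference
in the torus. -/
theorem isLocalPrimitive_iff [Finite X.Cell] [T2Space X.Surface] (U : Set X.Surface)
    (φ : X.Surface → Fin 2 → ℝ) : X.IsLocalPrimitive U φ ↔
    IsOpen U ∧ ∀ x ∈ U, ∀ᶠ y in 𝓝 x, φ y = φ x + torusLift (X.toTorus y - X.toTorus x) := by
  refine and_congr_right fun hU => ⟨fun h x hx => ?_, fun h c x hx => ?_⟩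
  · have hclosed : IsClosedMap (Quot.mk X.Ident : (Σ c, X.polygon c) → X.Surface) :=
      Continuous.isClosedMap (Y := X.Surface) continuous_quot_mk
    have key := hclosed.eventually_nhds_fiber
      (p := fun a : Σ c, X.polygon c => φ (X.pt a.1 a.2) = φ x +
        torusLift (X.toTorus (X.pt a.1 a.2) - X.toTorus x)) x (by
        rintro ⟨c, z₀⟩ rfl
        rw [Sigma.nhds_mk, Filter.eventually_map]
        filter_upwards [h c z₀ hx, X.eventually_norm_sub_lt z₀] with z hz hz'
        change φ (X.pt c z) = φ (X.pt c z₀) +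
          torusLift (X.toTorus (X.pt c z) - X.toTorus (X.pt c z₀))
        rw [hz, X.torusLift_sub_pt hz'])
    filter_upwards [key] with y hy
    obtain ⟨⟨c, z⟩, rfl⟩ := Quot.exists_rep y
    exact hy ⟨c, z⟩ rfl
  · filter_upwards [(X.continuous_pt c).continuousAt.eventually (h _ hx),
      X.eventually_norm_sub_lt x] with z hz hz'
    rw [hz, X.torusLift_sub_pt hz']

variable {X}

theorem isLocalPrimitive_torusLift [Finite X.Cell] [T2Space X.Surface] (x₀ : X.Surface) :
    X.IsLocalPrimitive (interior {y | ‖torusLift (X.toTorus y - X.toTorus x₀)‖ < 1 / 4})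
      fun y => torusLift (X.toTorus y - X.toTorus x₀) := by
  refine (X.isLocalPrimitive_iff _ _).2 ⟨isOpen_interior, fun x hx => ?_⟩
  filter_upwards [eventually_norm_torusLift_lt X.toTorus x (ε := 1 / 4) (by norm_num)] with y hy
  have hx' : ‖torusLift (X.toTorus x - X.toTorus x₀)‖ < 1 / 4 := by
    have := interior_subset hx
    exact this
  rw [← torusLift_add hx' hy]
  congr 1
  abel

/-- The affinity condition is applied to one primitive, the lifted displacement from `f x`, and the
result is read near `x`. -/
theorem IsAffine.isLocallyAffine [Finite X.Cell] [T2Space X.Surface]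
    {A : Matrix.SpecialLinearGroup (Fin 2) ℝ} {f : X.Surface ≃ₜ X.Surface} (hf : X.IsAffine A f) :
    IsLocallyAffine X.toTorus A.1 f := by
  intro x
  have h1 := (hf _ _).1 (isLocalPrimitive_torusLift (f x))
  have h2 := ((X.isLocalPrimitive_iff _ _).1 h1).2 x (by
    rw [Set.mem_preimage, mem_interior_iff_mem_nhds]
    exact eventually_norm_torusLift_lt X.toTorus (f x) (by norm_num))
  filter_upwards [h2] with y hy
  rw [sub_self, torusLift_zero, Matrix.mulVec_zero, zero_add] at hy
  rw [← hy, Matrix.mulVec_mulVec, ← Matrix.SpecialLinearGroup.coe_mul, mul_inv_cancel,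
    Matrix.SpecialLinearGroup.coe_one, Matrix.one_mulVec]

theorem isAffine_of_isLocallyAffine [Finite X.Cell] [T2Space X.Surface]
    {A : Matrix.SpecialLinearGroup (Fin 2) ℝ} {f : X.Surface ≃ₜ X.Surface}
    (hf : IsLocallyAffine X.toTorus A.1 f) : X.IsAffine A f := by
  have hA : ∀ v, (A⁻¹).1.mulVec (A.1.mulVec v) = v := fun v => by
    rw [Matrix.mulVec_mulVec, ← Matrix.SpecialLinearGroup.coe_mul, inv_mul_cancel,
      Matrix.SpecialLinearGroup.coe_one, Matrix.one_mulVec]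
  have hinj : Function.Injective (A⁻¹).1.mulVec := by
    intro v w h
    have := congrArg A.1.mulVec h
    simpa only [Matrix.mulVec_mulVec, ← Matrix.SpecialLinearGroup.coe_mul, mul_inv_cancel,
      Matrix.SpecialLinearGroup.coe_one, Matrix.one_mulVec] using this
  intro U φ
  rw [X.isLocalPrimitive_iff, X.isLocalPrimitive_iff, f.isOpen_preimage]
  refine and_congr_right fun hU => ⟨fun h x hx => ?_, fun h x hx => ?_⟩
  · filter_upwards [f.continuous.continuousAt.eventually (h (f x) hx), hf x] with y hy hy'
    rw [hy, Matrix.mulVec_add, hy', hA]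
  · obtain ⟨x, rfl⟩ := f.surjective x
    have h1 : ∀ᶠ y in 𝓝 x, φ (f y) = φ (f x) + torusLift (X.toTorus (f y) - X.toTorus (f x)) := by
      filter_upwards [h x hx, hf x] with y hy hy'
      refine hinj ?_
      rw [hy, Matrix.mulVec_add, hy', hA]
    have h2 := f.symm.continuous.continuousAt (x := f x)
    rw [ContinuousAt, f.symm_apply_apply] at h2
    filter_upwards [h2.eventually h1] with y hy
    rwa [f.apply_symm_apply] at hy

end LatticePolygons

/-! ### Singular points and integrality of linear parts. -/

namespace Origami

open unitInterval

variable {Q : Type} {O : Origami Q}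

/-- The open faces and the stars of open sides map injectively to the torus, so a singular point is
a vertex, and vertices lie over the origin. -/
theorem toTorus_eq_zero_of_isSingularPoint {s : O.Surface} (hs : IsSingularPoint O.toTorus s) :
    O.toTorus s = 0 := by
  obtain ⟨q, z, rfl, h1, h2⟩ := exists_square_eq_lt s
  have hcoord : ∀ {q q' : Q} {z z' : I × I}, O.toTorus (O.square q z) = O.toTorus (O.square q' z') →
      z.1 ≠ 1 → z'.1 ≠ 1 → z.2 ≠ 1 → z'.2 ≠ 1 → z = z' := fun e k1 k2 k3 k4 =>
    Prod.ext (coe_circle_inj k1 k2 (congrFun e 0)) (coe_circle_inj k3 k4 (congrFun e 1))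
  by_cases h3 : z.1 = 0
  · by_cases h4 : z.2 = 0
    · funext i
      fin_cases i
      · change ((z.1 : ℝ) : UnitAddCircle) = 0
        rw [h3]; rfl
      · change ((z.2 : ℝ) : UnitAddCircle) = 0
        rw [h4]; rfl
    · refine absurd ?_ (hs _ ((isOpen_verStar q).mem_nhds
        (square_mem_verStar.2 ⟨h4, h2, Or.inl ⟨rfl, by rw [h3]; norm_num⟩⟩)))
      intro s hs s' hs' e
      obtain ⟨q₁, z₁, rfl, k1, k2⟩ := exists_square_eq_lt s
      obtain ⟨q₂, z₂, rfl, k3, k4⟩ := exists_square_eq_lt s'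
      obtain rfl := hcoord e k1 k3 k2 k4
      obtain ⟨-, -, ⟨rfl, l1⟩ | ⟨rfl, l1⟩⟩ := square_mem_verStar.1 hs <;>
      obtain ⟨-, -, ⟨l2, l3⟩ | ⟨l2, l3⟩⟩ := square_mem_verStar.1 hs'
      · rw [l2]
      · linarith
      · linarith
      · rw [O.right.injective l2]
  · by_cases h4 : z.2 = 0
    · refine absurd ?_ (hs _ ((isOpen_horStar q).mem_nhds
        (square_mem_horStar.2 ⟨h3, h1, Or.inl ⟨rfl, by rw [h4]; norm_num⟩⟩)))
      intro s hs s' hs' e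
      obtain ⟨q₁, z₁, rfl, k1, k2⟩ := exists_square_eq_lt s
      obtain ⟨q₂, z₂, rfl, k3, k4⟩ := exists_square_eq_lt s'
      obtain rfl := hcoord e k1 k3 k2 k4
      obtain ⟨-, -, ⟨rfl, l1⟩ | ⟨rfl, l1⟩⟩ := square_mem_horStar.1 hs <;>
      obtain ⟨-, -, ⟨l2, l3⟩ | ⟨l2, l3⟩⟩ := square_mem_horStar.1 hs'
      · rw [l2]
      · linarith
      · linarith
      · rw [O.up.injective l2]
    · refine absurd ?_ (hs _ ((isOpen_face q).mem_nhds (square_mem_face.2 ⟨rfl, h3, h1, h4, h2⟩)))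
      intro s hs s' hs' e
      obtain ⟨q₁, z₁, rfl, k1, k2⟩ := exists_square_eq_lt s
      obtain ⟨q₂, z₂, rfl, k3, k4⟩ := exists_square_eq_lt s'
      obtain rfl := hcoord e k1 k3 k2 k4
      rw [(square_mem_face.1 hs).1, (square_mem_face.1 hs').1]

/-- Two different squares have the upper right corner of `q` as their lower left corner. Points with
the same small positive coordinates in these squares are different but have the same image in the
torus. -/
theorem isSingularPoint_square {q : Q} (h : O.up (O.right q) ≠ O.right (O.up q)) :
    IsSingularPoint O.toTorus (O.square q (1, 1)) := by
  intro U hU hinj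
  have key : ∀ j, O.square j (0, 0) = O.square q (1, 1) →
      ∀ᶠ t : I in 𝓝 0, O.square j (t, t) ∈ U := by
    intro j hj
    have hc : Continuous fun t : I => O.square j (t, t) := by fun_prop
    exact hc.continuousAt (hj ▸ hU)
  have e1 : O.square (O.up (O.right q)) (0, 0) = O.square q (1, 1) := by
    rw [← square_up, ← square_right]
  have e2 : O.square (O.right (O.up q)) (0, 0) = O.square q (1, 1) := by
    rw [← square_right, ← square_up]
  have hsmall : ∃ᶠ t : I in 𝓝 0, t ≠ 0 ∧ t ≠ 1 := by
    rw [Filter.frequently_iff]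
    intro V hV
    obtain ⟨ε, hε, hball⟩ := Metric.mem_nhds_iff.1 hV
    have hm1 : 0 < min (ε / 2) (1 / 2) := lt_min (by linarith) (by norm_num)
    have hm2 : min (ε / 2) (1 / 2) ≤ 1 / 2 := min_le_right _ _
    have hm3 : min (ε / 2) (1 / 2) ≤ ε / 2 := min_le_left _ _
    refine ⟨⟨min (ε / 2) (1 / 2), hm1.le, by linarith⟩, hball ?_, ?_, ?_⟩
    · rw [Metric.mem_ball, Subtype.dist_eq, Real.dist_eq]
      simp only [Set.Icc.coe_zero, sub_zero, abs_of_pos hm1]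
      linarith
    · intro e
      have := congrArg Subtype.val e
      simp only [Set.Icc.coe_zero] at this
      linarith
    · intro e
      have := congrArg Subtype.val e
      simp only [Set.Icc.coe_one] at this
      linarith
  obtain ⟨t, ⟨ht0, ht1⟩, h1, h2⟩ := (hsmall.and_eventually ((key _ e1).and (key _ e2))).exists
  exact h (square_injective _ _ ht0 ht1 ht0 ht1 (hinj h1 h2 rfl))

/-- The surface is connected and has a lower and a left side both of whose end points are
singular. -/
structure IsRigid (O : Origami Q) : Prop where
  preconnectedSpace : PreconnectedSpace O.Surface
  horizontal : ∃ q, IsSingularPoint O.toTorus (O.square q (0, 0)) ∧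
    IsSingularPoint O.toTorus (O.square q (1, 0))
  vertical : ∃ q, IsSingularPoint O.toTorus (O.square q (0, 0)) ∧
    IsSingularPoint O.toTorus (O.square q (0, 1))

/-- An affine map takes singular points to singular points, which lie over the origin. A horizontal
and a vertical unit side with singular ends are therefore carried to segments with integral
displacement, and these displacements are the columns of the linear part. -/
theorem IsRigid.exists_hasLinearPart (hO : O.IsRigid) {A : Matrix.SpecialLinearGroup (Fin 2) ℝ}
    {f : O.Surface ≃ₜ O.Surface} (hf : IsLocallyAffine O.toTorus A.1 f) :
    ∃ B : Matrix.SpecialLinearGroup (Fin 2) ℤ, HasLinearPart B.1 f := by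
  obtain ⟨q, h1, h2⟩ := hO.horizontal
  obtain ⟨q', h3, h4⟩ := hO.vertical
  have hz : ∀ {s}, IsSingularPoint O.toTorus s → O.toTorus (f s) = 0 := fun hs =>
    toTorus_eq_zero_of_isSingularPoint (hf.isSingularPoint hs)
  have k1 := hf.sub_eq ⟨fun t => O.square q (t, 0), by fun_prop⟩ ![1, 0] (fun t => by
    funext i
    fin_cases i
    · change ((t : ℝ) : UnitAddCircle) = (((t : ℝ) * 1 : ℝ) : UnitAddCircle)
      rw [mul_one]
    · change ((0 : ℝ) : UnitAddCircle) = (((t : ℝ) * 0 : ℝ) : UnitAddCircle)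
      rw [mul_zero])
  have k2 := hf.sub_eq ⟨fun t => O.square q' (0, t), by fun_prop⟩ ![0, 1] (fun t => by
    funext i
    fin_cases i
    · change ((0 : ℝ) : UnitAddCircle) = (((t : ℝ) * 0 : ℝ) : UnitAddCircle)
      rw [mul_zero]
    · change ((t : ℝ) : UnitAddCircle) = (((t : ℝ) * 1 : ℝ) : UnitAddCircle)
      rw [mul_one])
  simp only [ContinuousMap.coe_mk, hz h1, hz h2, sub_self] at k1
  simp only [ContinuousMap.coe_mk, hz h3, hz h4, sub_self] at k2
  choose b₁ hb₁ using torusCoe_eq_zero k1.symm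
  choose b₂ hb₂ using torusCoe_eq_zero k2.symm
  let B : Matrix (Fin 2) (Fin 2) ℤ := Matrix.of fun i j => ![b₁ i, b₂ i] j
  have hB : B.map (Int.cast : ℤ → ℝ) = A.1 := by
    ext i j
    fin_cases j
    · have := hb₁ i
      simp [Matrix.mulVec, dotProduct, Fin.sum_univ_two] at this
      simpa [B] using this
    · have := hb₂ i
      simp [Matrix.mulVec, dotProduct, Fin.sum_univ_two] at this
      simpa [B] using this
  have hdet : B.det = 1 := by
    have h := A.2
    rw [← hB] at h
    have h5 : ((Int.castRingHom ℝ).mapMatrix B).det = 1 := h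
    rw [← RingHom.map_det] at h5
    simpa using h5
  rw [← hB] at hf
  have := hO.preconnectedSpace
  -- A singular point and its image both lie over the origin, so no translation enters.
  exact ⟨⟨B, hdet⟩, fun s => hf.eq_torusLinear (toTorus_eq_zero_of_isSingularPoint h1) (hz h1) s⟩

end Origami

/-! ### Unipotent elements of `SL(2, ℝ)` -/

namespace SL2

open Matrix

/-- The unipotent element that fixes `(p, q)`. -/
def uni (p q s : ℝ) : SpecialLinearGroup (Fin 2) ℝ :=
  ⟨!![1 - s * p * q, s * p ^ 2; -(s * q ^ 2), 1 + s * p * q], by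
    rw [det_fin_two_of]; ring⟩

theorem uni_coe (p q s : ℝ) : ((uni p q s : SpecialLinearGroup (Fin 2) ℝ) : Matrix (Fin 2) (Fin 2) ℝ) =
    !![1 - s * p * q, s * p ^ 2; -(s * q ^ 2), 1 + s * p * q] := rfl

theorem uni_mul (p q s s' : ℝ) : uni p q s * uni p q s' = uni p q (s + s') := by
  ext i j
  fin_cases i <;> fin_cases j <;> simp [uni_coe, mul_apply, Fin.sum_univ_two] <;> ring

@[simp] theorem uni_zero (p q : ℝ) : uni p q 0 = 1 := by
  ext i j
  fin_cases i <;> fin_cases j <;> simp [uni]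

theorem uni_inv (p q s : ℝ) : (uni p q s)⁻¹ = uni p q (-s) :=
  inv_eq_of_mul_eq_one_right (by rw [uni_mul, add_neg_cancel, uni_zero])

theorem uni_pow (p q s : ℝ) (n : ℕ) : uni p q s ^ n = uni p q (n * s) := by
  induction n with
  | zero => simp
  | succ n ih => rw [pow_succ, ih, uni_mul]; congr 1; push_cast; ring

theorem uni_smul (p q r s : ℝ) : uni (r * p) (r * q) s = uni p q (r ^ 2 * s) := by
  ext i j
  fin_cases i <;> fin_cases j <;> simp [uni] <;> ring

theorem conj_uni (A : SpecialLinearGroup (Fin 2) ℝ) (p q s : ℝ) :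
    A * uni p q s * A⁻¹ = uni (A.1 0 0 * p + A.1 0 1 * q) (A.1 1 0 * p + A.1 1 1 * q) s := by
  have hd := A.2
  rw [det_fin_two] at hd
  rw [mul_inv_eq_iff_eq_mul]
  ext i j
  fin_cases i <;> fin_cases j <;> simp [uni_coe, mul_apply, Fin.sum_univ_two]
  · linear_combination (s * q * (A.1 0 0 * p + A.1 0 1 * q)) * hd
  · linear_combination (-s * p * (A.1 0 0 * p + A.1 0 1 * q)) * hd
  · linear_combination (s * q * (A.1 1 0 * p + A.1 1 1 * q)) * hd
  · linear_combination (-s * p * (A.1 1 0 * p + A.1 1 1 * q)) * hd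

/-- An element with nonzero lower left entry is a product of an upper, a lower and an upper
unipotent matrix. Any other element acquires such an entry when multiplied by a lower unipotent one.
-/
theorem eq_top_of_upper_lower {K : Subgroup (SpecialLinearGroup (Fin 2) ℝ)}
    (h1 : ∀ s, uni 1 0 s ∈ K) (h2 : ∀ s, uni 0 1 s ∈ K) : K = ⊤ := by
  have key : ∀ A : SpecialLinearGroup (Fin 2) ℝ, A.1 1 0 ≠ 0 → A ∈ K := by
    intro A hA
    have hd := A.2
    rw [det_fin_two] at hd
    -- By the sign convention of `uni`, the matrix `uni 0 1 (-c)` has the lower left entry `c`.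
    have e : A = uni 1 0 ((A.1 0 0 - 1) / A.1 1 0) * uni 0 1 (-A.1 1 0) *
        uni 1 0 ((A.1 1 1 - 1) / A.1 1 0) := by
      ext i j
      fin_cases i <;> fin_cases j <;> simp [uni_coe, mul_apply, Fin.sum_univ_two] <;> field_simp
      · ring
      · linear_combination -hd
      · ring
    rw [e]
    exact K.mul_mem (K.mul_mem (h1 _) (h2 _)) (h1 _)
  refine (Subgroup.eq_top_iff' K).2 fun A => ?_
  by_cases hA : A.1 1 0 = 0
  · have hd := A.2
    rw [det_fin_two, hA, mul_zero, sub_zero] at hd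
    have ha : A.1 0 0 ≠ 0 := fun h => by rw [h, zero_mul] at hd; exact zero_ne_one hd
    have h3 : uni 0 1 1 * A ∈ K := key _ (by
      simpa [SpecialLinearGroup.coe_mul, uni_coe, mul_apply, Fin.sum_univ_two, hA] using ha)
    have h4 := K.mul_mem (K.inv_mem (h2 1)) h3
    rwa [inv_mul_cancel_left] at h4
  · exact key A hA

/-- An element that maps the first basis vector to `(p, q)`. -/
noncomputable def column (p q : ℝ) (h : p ^ 2 + q ^ 2 ≠ 0) : SpecialLinearGroup (Fin 2) ℝ :=
  ⟨!![p, -q / (p ^ 2 + q ^ 2); q, p / (p ^ 2 + q ^ 2)], by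
    rw [det_fin_two_of]; field_simp; ring⟩

theorem conj_column (p q s : ℝ) (h : p ^ 2 + q ^ 2 ≠ 0) :
    column p q h * uni 1 0 s * (column p q h)⁻¹ = uni p q s := by
  rw [conj_uni]; simp [column]

/-- The quarter turn. -/
def quarterTurn : SpecialLinearGroup (Fin 2) ℝ := ⟨!![0, -1; 1, 0], by simp [det_fin_two_of]⟩

theorem conj_quarterTurn (s : ℝ) : quarterTurn * uni 1 0 s * quarterTurn⁻¹ = uni 0 1 s := by
  rw [conj_uni]; simp [quarterTurn]

/-- The diagonal matrix with entries `2` and `1 / 2`. -/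
noncomputable def stretch : SpecialLinearGroup (Fin 2) ℝ :=
  ⟨!![2, 0; 0, 1 / 2], by simp [det_fin_two_of]⟩

theorem conj_stretch (s : ℝ) : stretch * uni 1 0 s * stretch⁻¹ = uni 1 0 (4 * s) := by
  rw [conj_uni]
  have := uni_smul 1 0 2 s
  norm_num at this
  simpa [stretch] using this

theorem sq_add_sq_ne_zero {p q p' q' : ℝ} (h : p * q' - q * p' ≠ 0) : p ^ 2 + q ^ 2 ≠ 0 := by
  intro e
  have hp : p = 0 := by nlinarith [sq_nonneg p, sq_nonneg q]
  have hq : q = 0 := by nlinarith [sq_nonneg p, sq_nonneg q]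
  rw [hp, hq] at h
  simp at h

/-- Two independent directions can be moved to the coordinate axes: first the matrix `B` makes the
first direction the first axis, then an upper unipotent matrix, which belongs to the conjugated
group, straightens the second one. -/
theorem eq_top_of_transversal {K : Subgroup (SpecialLinearGroup (Fin 2) ℝ)} {p q p' q' : ℝ}
    (h : p * q' - q * p' ≠ 0) (h1 : ∀ s, uni p q s ∈ K) (h2 : ∀ s, uni p' q' s ∈ K) : K = ⊤ := by
  have hpq := sq_add_sq_ne_zero h
  set B := column p q hpq with hB
  have hconj : ∀ s, uni 1 0 s ∈ K.comap (MulAut.conj B).toMonoidHom := fun s => by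
    have : B * uni 1 0 s * B⁻¹ ∈ K := by rw [conj_column]; exact h1 s
    exact this
  -- The numbers `c` and `d` are the coordinates of `(p', q')` in the basis formed by the columns of
  -- `B`.
  set c := (p * p' + q * q') / (p ^ 2 + q ^ 2) with hc
  set d := p * q' - q * p' with hd
  have hconj' : ∀ s, uni c d s ∈ K.comap (MulAut.conj B).toMonoidHom := fun s => by
    have : B * uni c d s * B⁻¹ ∈ K := by
      rw [conj_uni]
      have e1 : B.1 0 0 * c + B.1 0 1 * d = p' := by
        simp only [hB, column, hc, hd]
        simp
        field_simp
        ring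
      have e2 : B.1 1 0 * c + B.1 1 1 * d = q' := by
        simp only [hB, column, hc, hd]
        simp
        field_simp
        ring
      rw [e1, e2]
      exact h2 s
    exact this
  have hlow : ∀ s, uni 0 1 s ∈ K.comap (MulAut.conj B).toMonoidHom := by
    intro s
    -- The upper unipotent matrix takes `(c, d)` to `(0, d)`; dividing the parameter by `d ^ 2`
    -- compensates for the length of this vector.
    have e : uni 0 1 s = uni 1 0 (-(c / d)) * uni c d (s / d ^ 2) * (uni 1 0 (-(c / d)))⁻¹ := by
      rw [conj_uni]
      have e1 : (uni 1 0 (-(c / d))).1 0 0 * c + (uni 1 0 (-(c / d))).1 0 1 * d = d * 0 := by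
        simp [uni]; field_simp; ring
      have e2 : (uni 1 0 (-(c / d))).1 1 0 * c + (uni 1 0 (-(c / d))).1 1 1 * d = d * 1 := by
        simp [uni]
      rw [e1, e2, uni_smul]
      congr 1
      field_simp
    rw [e]
    exact Subgroup.mul_mem _ (Subgroup.mul_mem _ (hconj _) (hconj' _)) (Subgroup.inv_mem _ (hconj _))
  have htop := eq_top_of_upper_lower hconj hlow
  refine (Subgroup.eq_top_iff' K).2 fun A => ?_
  have : B⁻¹ * A * B ∈ K.comap (MulAut.conj B).toMonoidHom := by rw [htop]; trivial
  have h3 : B * (B⁻¹ * A * B) * B⁻¹ ∈ K := this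
  have e : B * (B⁻¹ * A * B) * B⁻¹ = A := by group
  rwa [e] at h3

/-! ### Subgroups of powers of `SL(2, ℝ)` -/

variable {k : ℕ}

/-- The elements of `SL(2, ℝ)` that occur at the place `i` in the elements of `G` supported in
`S`. -/
def place (G : Subgroup (Fin k → SpecialLinearGroup (Fin 2) ℝ)) (S : Set (Fin k)) (i : Fin k) :
    Subgroup (SpecialLinearGroup (Fin 2) ℝ) where
  carrier := {A | ∃ g ∈ G, (∀ j, j ∉ S → g j = 1) ∧ g i = A}
  one_mem' := ⟨1, G.one_mem, fun _ _ => rfl, rfl⟩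
  mul_mem' := by
    rintro _ _ ⟨g, hg, h1, rfl⟩ ⟨g', hg', h1', rfl⟩
    exact ⟨g * g', G.mul_mem hg hg', fun j hj => by simp [h1 j hj, h1' j hj], rfl⟩
  inv_mem' := by
    rintro _ ⟨g, hg, h1, rfl⟩
    exact ⟨g⁻¹, G.inv_mem hg, fun j hj => by simp [h1 j hj], rfl⟩

variable {G : Subgroup (Fin k → SpecialLinearGroup (Fin 2) ℝ)}

/-- A one-parameter group of unipotent elements, with a direction and a speed at each place. -/
def uniPi (m p q : Fin k → ℝ) (s : ℝ) : Fin k → SpecialLinearGroup (Fin 2) ℝ :=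
  fun i => uni (p i) (q i) (s * m i)

theorem uni_mem_place {m p q : Fin k → ℝ} (hG : ∀ s, uniPi m p q s ∈ G) {S : Set (Fin k)}
    (hS : ∀ j, j ∉ S → m j = 0) {i : Fin k} (hi : m i ≠ 0) (s : ℝ) : uni (p i) (q i) s ∈ place G S i :=
  ⟨uniPi m p q (s / m i), hG _, fun j hj => by simp [uniPi, hS j hj], by
    simp [uniPi, div_mul_cancel₀ _ hi]⟩

theorem place_eq_top {m p q m' p' q' : Fin k → ℝ} (hG : ∀ s, uniPi m p q s ∈ G)
    (hG' : ∀ s, uniPi m' p' q' s ∈ G) {S : Set (Fin k)} (hS : ∀ j, j ∉ S → m j = 0)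
    (hS' : ∀ j, j ∉ S → m' j = 0) {i : Fin k} (hi : m i ≠ 0) (hi' : m' i ≠ 0)
    (h : p i * q' i - q i * p' i ≠ 0) : place G S i = ⊤ :=
  eq_top_of_transversal h (uni_mem_place hG hS hi) (uni_mem_place hG' hS' hi')

/-- A commutator of an element supported in `S` with one supported in `S'` is supported in the
intersection. At the place `i` the elements obtained in this way form a subgroup that is normalized
by all of SL(2, ℝ) and contains a full unipotent group, so it is everything. -/
theorem place_inter_eq_top {m p q : Fin k → ℝ} (hG : ∀ s, uniPi m p q s ∈ G) {S S' : Set (Fin k)}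
    (hS' : ∀ j, j ∉ S' → m j = 0) {i : Fin k} (hi : m i ≠ 0) (hpq : p i ^ 2 + q i ^ 2 ≠ 0)
    (h : place G S i = ⊤) : place G (S ∩ S') i = ⊤ := by
  have hconj : ∀ (A B : SpecialLinearGroup (Fin 2) ℝ), B ∈ place G (S ∩ S') i →
      A * B * A⁻¹ ∈ place G (S ∩ S') i := by
    rintro A _ ⟨g, hg, hg1, rfl⟩
    obtain ⟨a, ha, -, rfl⟩ : A ∈ place G S i := by rw [h]; trivial
    exact ⟨a * g * a⁻¹, G.mul_mem (G.mul_mem ha hg) (G.inv_mem ha),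
      fun j hj => by simp [hg1 j hj], rfl⟩
  have hcomm : ∀ (A : SpecialLinearGroup (Fin 2) ℝ) (s : ℝ),
      A * uni (p i) (q i) s * A⁻¹ * (uni (p i) (q i) s)⁻¹ ∈ place G (S ∩ S') i := by
    intro A s
    obtain ⟨a, ha, ha1, rfl⟩ : A ∈ place G S i := by rw [h]; trivial
    obtain ⟨g, hg, hg1, e⟩ := uni_mem_place hG hS' hi s
    rw [← e]
    refine ⟨a * g * a⁻¹ * g⁻¹, G.mul_mem (G.mul_mem (G.mul_mem ha hg) (G.inv_mem ha))
      (G.inv_mem hg), fun j hj => ?_, rfl⟩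
    by_cases h1 : j ∈ S
    · have h2 : j ∉ S' := fun h2 => hj ⟨h1, h2⟩
      simp [hg1 j h2]
    · simp [ha1 j h1]
  have hup : ∀ s, uni 1 0 s ∈ place G (S ∩ S') i := by
    intro s
    set B := column (p i) (q i) hpq with hB
    -- In adapted coordinates the stretch multiplies the unipotent parameter by `4`; the commutator
    -- keeps `4 - 1 = 3` times the parameter, whence the division by `3`.
    have h1 := hconj B⁻¹ _ (hcomm (B * stretch * B⁻¹) (s / 3))
    have e : B⁻¹ * (B * stretch * B⁻¹ * uni (p i) (q i) (s / 3) * (B * stretch * B⁻¹)⁻¹ *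
        (uni (p i) (q i) (s / 3))⁻¹) * B⁻¹⁻¹ = uni 1 0 s := by
      have h2 : uni (p i) (q i) (s / 3) = B * uni 1 0 (s / 3) * B⁻¹ := (conj_column _ _ _ hpq).symm
      have h3 : uni 1 0 s = stretch * uni 1 0 (s / 3) * stretch⁻¹ * (uni 1 0 (s / 3))⁻¹ := by
        rw [conj_stretch, uni_inv, uni_mul]; congr 1; ring
      rw [h2, h3]
      group
    rwa [e] at h1
  exact eq_top_of_upper_lower hup fun s => by
    rw [← conj_quarterTurn]; exact hconj _ _ (hup s)

/-- The entry at `j` of an element supported in `S` is removed by dividing by an element supported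
at `j` alone, which does not affect the place `i`. -/
theorem place_diff_eq_top {S : Set (Fin k)} {i j : Fin k} (hij : i ≠ j) (h : place G S i = ⊤)
    (hj : place G {j} j = ⊤) : place G (S \ {j}) i = ⊤ := by
  refine (Subgroup.eq_top_iff' _).2 fun A => ?_
  obtain ⟨a, ha, ha1, rfl⟩ : A ∈ place G S i := by rw [h]; trivial
  obtain ⟨b, hb, hb1, e⟩ : a j ∈ place G {j} j := by rw [hj]; trivial
  refine ⟨a * b⁻¹, G.mul_mem ha (G.inv_mem hb), fun l hl => ?_, ?_⟩
  · by_cases hlj : l = j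
    · subst hlj
      simp [e]
    · have : l ∉ S := fun h => hl ⟨h, hlj⟩
      simp [ha1 l this, hb1 l hlj]
  · simp [hb1 i hij]

theorem eq_top_of_place (h : ∀ i, place G {i} i = ⊤) : G = ⊤ := by
  refine (Subgroup.eq_top_iff' _).2 fun g => ?_
  have hs : ∀ i (A : SpecialLinearGroup (Fin 2) ℝ), Pi.mulSingle i A ∈ G := by
    intro i A
    obtain ⟨a, ha, ha1, rfl⟩ : A ∈ place G {i} i := by rw [h]; trivial
    have e : Pi.mulSingle i (a i) = a := by
      funext j
      by_cases hj : j = i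
      · subst hj; simp
      · rw [Pi.mulSingle_eq_of_ne hj, ha1 j hj]
    rwa [e]
  exact Subgroup.pi_mem_of_mulSingle_mem g fun i => hs i (g i)

/-- Unipotent one-parameter groups are divisible, and a fixed power of every element lies in a
subgroup of finite index. Such a subgroup therefore contains all unipotent elements at all places.
-/
theorem eq_top_of_relIndex_ne_zero (h : G.index ≠ 0) : G = ⊤ := by
  have huni : ∀ i (p q s : ℝ), Pi.mulSingle i (uni p q s) ∈ G := by
    intro i p q s
    -- The subgroup need not be normal, so the exponent is the factorial of the index, which is
    -- divisible by the order of every possible orbit of cosets.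
    have h1 := Subgroup.pow_mem_of_index_ne_zero_of_dvd (H := G) h
      (Pi.mulSingle i (uni p q (s / G.index.factorial)) : Fin k → SpecialLinearGroup (Fin 2) ℝ)
      (n := G.index.factorial) (fun m h1 h2 => Nat.dvd_factorial h1 h2)
    have hne : (G.index.factorial : ℝ) ≠ 0 := by exact_mod_cast Nat.factorial_ne_zero _
    rwa [← Pi.mulSingle_pow, uni_pow, mul_div_cancel₀ _ hne] at h1
  refine eq_top_of_place fun i => eq_top_of_upper_lower (fun s => ?_) fun s => ?_
  · exact ⟨_, huni i 1 0 s, fun j hj => Pi.mulSingle_eq_of_ne hj _, by simp⟩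
  · exact ⟨_, huni i 0 1 s, fun j hj => Pi.mulSingle_eq_of_ne hj _, by simp⟩

end SL2

/-! ### Zariski closures in coordinates -/

section Zariski

open Matrix

variable {V : Type} [AddCommGroup V] [Module ℝ V]

theorem le_zariskiClosure (Γ : Subgroup (V ≃ₗ[ℝ] V)) : Γ ≤ zariskiClosure Γ :=
  fun g hg _ _ h => h g hg

theorem zariskiClosure_mono {Γ Δ : Subgroup (V ≃ₗ[ℝ] V)} (h : Γ ≤ Δ) :
    zariskiClosure Γ ≤ zariskiClosure Δ :=
  fun _ hg F hF h0 => hg F hF fun γ hγ => h0 γ (h hγ)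

theorem zariskiClosure_idem (Γ : Subgroup (V ≃ₗ[ℝ] V)) :
    zariskiClosure (zariskiClosure Γ) = zariskiClosure Γ :=
  le_antisymm (fun _ hg F hF h0 => hg F hF fun _ hγ => hγ F hF h0) (le_zariskiClosure _)

/-- The closure of a finite union of cosets is the union of their closures. If `g` avoided the
closures of all cosets of `Δ`, a product of translated functions, one for each coset, would vanish
on `Γ` but not at `g`. -/
theorem isFiniteRelIndex_zariskiClosure {Γ Δ : Subgroup (V ≃ₗ[ℝ] V)} [hfin : Δ.IsFiniteRelIndex Γ] :
    (zariskiClosure Δ).IsFiniteRelIndex (zariskiClosure Γ) := by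
  have : Finite (Γ ⧸ Δ.subgroupOf Γ) := Subgroup.finite_quotient_of_finiteIndex
  have : Fintype (Γ ⧸ Δ.subgroupOf Γ) := Fintype.ofFinite _
  have key : ∀ g ∈ zariskiClosure Γ, ∃ c : Γ ⧸ Δ.subgroupOf Γ,
      ((c.out : Γ) : V ≃ₗ[ℝ] V)⁻¹ * g ∈ zariskiClosure Δ := by
    intro g hg
    by_contra! hcon
    have h1 : ∀ c : Γ ⧸ Δ.subgroupOf Γ, ∃ F ∈ regularGL V, (∀ γ ∈ Δ, F γ = 0) ∧
        F (((c.out : Γ) : V ≃ₗ[ℝ] V)⁻¹ * g) ≠ 0 := by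
      intro c
      have := hcon c
      change ¬ (∀ F ∈ regularGL V, (∀ γ ∈ Δ, F γ = 0) → F _ = 0) at this
      push Not at this
      exact this
    choose F hF hF0 hFg using h1
    -- At an element of `Γ` the factor that belongs to its own coset vanishes.
    have h2 := hg (∏ c, fun x => F c (((c.out : Γ) : V ≃ₗ[ℝ] V)⁻¹ * x))
      (Subalgebra.prod_mem _ fun c _ => regularGL_mul_left _ _ (hF c)) (by
        intro γ hγ
        rw [Finset.prod_apply]
        refine Finset.prod_eq_zero (Finset.mem_univ (QuotientGroup.mk (⟨γ, hγ⟩ : Γ))) (hF0 _ _ ?_)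
        have h3 := QuotientGroup.eq.1 (Quotient.out_eq'
          (QuotientGroup.mk (⟨γ, hγ⟩ : Γ) : Γ ⧸ Δ.subgroupOf Γ))
        exact h3)
    rw [Finset.prod_apply] at h2
    exact Finset.prod_ne_zero_iff.2 (fun c _ => hFg c) h2
  refine ⟨?_⟩
  have hsurj : Function.Surjective (fun c : Γ ⧸ Δ.subgroupOf Γ =>
      (QuotientGroup.mk (⟨(c.out : Γ), le_zariskiClosure Γ (c.out : Γ).2⟩ : zariskiClosure Γ) :
        zariskiClosure Γ ⧸ (zariskiClosure Δ).subgroupOf (zariskiClosure Γ))) := by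
    intro x
    obtain ⟨⟨g, hg⟩, rfl⟩ := QuotientGroup.mk_surjective x
    obtain ⟨c, hc⟩ := key g hg
    exact ⟨c, QuotientGroup.eq.2 hc⟩
  have := Finite.of_surjective _ hsurj
  exact Subgroup.index_ne_zero_of_finite

variable {k : ℕ} {ι : Type}

/-- The action of `SL(2, ℝ)^k` on `ℝ^ι ⊗ ℝ²`, where the place `t a` acts on the summand `a`. -/
def blockEnd (t : ι → Fin k) (g : Fin k → SpecialLinearGroup (Fin 2) ℝ) :
    (ι × Fin 2 → ℝ) →ₗ[ℝ] (ι × Fin 2 → ℝ) where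
  toFun x p := ∑ b, (g (t p.1)).1 p.2 b * x (p.1, b)
  map_add' x y := by funext p; simp [mul_add, Finset.sum_add_distrib]
  map_smul' r x := by funext p; simp; ring

theorem blockEnd_apply (t : ι → Fin k) (g : Fin k → SpecialLinearGroup (Fin 2) ℝ)
    (x : ι × Fin 2 → ℝ) (a : ι) (b : Fin 2) :
    blockEnd t g x (a, b) = ∑ b', (g (t a)).1 b b' * x (a, b') := rfl

theorem blockEnd_mul (t : ι → Fin k) (g g' : Fin k → SpecialLinearGroup (Fin 2) ℝ)
    (x : ι × Fin 2 → ℝ) : blockEnd t (g * g') x = blockEnd t g (blockEnd t g' x) := by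
  funext ⟨a, b⟩
  have e : ∀ b', ((g * g') (t a)).1 b b' =
      (g (t a)).1 b 0 * (g' (t a)).1 0 b' + (g (t a)).1 b 1 * (g' (t a)).1 1 b' := fun b' => by
    change ((g (t a)).1 * (g' (t a)).1) b b' = _
    rw [mul_apply, Fin.sum_univ_two]
  simp only [blockEnd_apply, e, Fin.sum_univ_two]
  ring

theorem blockEnd_one (t : ι → Fin k) (x : ι × Fin 2 → ℝ) : blockEnd t 1 x = x := by
  funext ⟨a, b⟩
  simp [blockEnd_apply, Matrix.one_apply]

/-- The action of `SL(2, ℝ)^k` on `V` given by coordinates on `V`. -/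
def blockAction (t : ι → Fin k) (Φ : V ≃ₗ[ℝ] (ι × Fin 2 → ℝ)) :
    (Fin k → SpecialLinearGroup (Fin 2) ℝ) →* (V ≃ₗ[ℝ] V) where
  toFun g := LinearEquiv.ofLinearMap (Φ.symm.toLinearMap ∘ₗ blockEnd t g ∘ₗ Φ.toLinearMap)
    (Φ.symm.toLinearMap ∘ₗ blockEnd t g⁻¹ ∘ₗ Φ.toLinearMap)
    (by ext x; simp [← blockEnd_mul, blockEnd_one]) (by ext x; simp [← blockEnd_mul, blockEnd_one])
  map_one' := by ext x; simp [blockEnd_one]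
  map_mul' g g' := by ext x; simp [blockEnd_mul]

variable {t : ι → Fin k} {Φ : V ≃ₗ[ℝ] (ι × Fin 2 → ℝ)}

theorem coord_blockAction (g : Fin k → SpecialLinearGroup (Fin 2) ℝ) (v : V) :
    Φ (blockAction t Φ g v) = blockEnd t g (Φ v) := by
  change Φ (Φ.symm _) = _
  rw [Φ.apply_symm_apply]
  rfl

theorem regularSL2Pow_entry (i : Fin k) (a b : Fin 2) :
    (fun x : Fin k → SpecialLinearGroup (Fin 2) ℝ => (x i).1 a b) ∈ regularSL2Pow k :=
  Algebra.subset_adjoin ⟨i, a, b, rfl⟩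

theorem regularSL2Pow_sum {σ : Type} [Fintype σ] {F : σ → (Fin k → SpecialLinearGroup (Fin 2) ℝ) → ℝ}
    (h : ∀ p, F p ∈ regularSL2Pow k) : (fun x => ∑ p, F p x) ∈ regularSL2Pow k := by
  have := Subalgebra.sum_mem (regularSL2Pow k) (t := Finset.univ) fun p _ => h p
  convert! this using 1
  funext x
  simp

theorem regularSL2Pow_const_mul {F : (Fin k → SpecialLinearGroup (Fin 2) ℝ) → ℝ}
    (h : F ∈ regularSL2Pow k) (r : ℝ) : (fun x => r * F x) ∈ regularSL2Pow k :=
  (regularSL2Pow k).smul_mem h r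

/-- In determinant one the inverse is the adjugate, whose entries are again entries up to sign. -/
theorem regularSL2Pow_inv {F : (Fin k → SpecialLinearGroup (Fin 2) ℝ) → ℝ}
    (h : F ∈ regularSL2Pow k) : (fun x => F x⁻¹) ∈ regularSL2Pow k := by
  induction h using Algebra.adjoin_induction with
  | mem F hF =>
    obtain ⟨i, a, b, rfl⟩ := hF
    have e : ∀ x : Fin k → SpecialLinearGroup (Fin 2) ℝ, (x⁻¹ i).1 = (x i).1.adjugate := fun x => rfl
    simp only [e, adjugate_fin_two]
    fin_cases a <;> fin_cases b
    · exact regularSL2Pow_entry i 1 1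
    · exact (regularSL2Pow k).neg_mem (regularSL2Pow_entry i 0 1)
    · exact (regularSL2Pow k).neg_mem (regularSL2Pow_entry i 1 0)
    · exact regularSL2Pow_entry i 0 0
  | algebraMap r => exact (regularSL2Pow k).algebraMap_mem r
  | add F G _ _ hF hG => exact (regularSL2Pow k).add_mem hF hG
  | mul F G _ _ hF hG => exact (regularSL2Pow k).mul_mem hF hG

variable [Fintype ι] [DecidableEq ι]

theorem regular_blockAction {F : (V ≃ₗ[ℝ] V) → ℝ} (hF : F ∈ regularGL V) :
    (fun x => F (blockAction t Φ x)) ∈ regularSL2Pow k := by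
  have hcoeff : ∀ (l : Module.Dual ℝ V) (v : V),
      (fun x => l (blockAction t Φ x v)) ∈ regularSL2Pow k := by
    intro l v
    have e : ∀ x, l (blockAction t Φ x v) =
        ∑ p : ι × Fin 2, l (Φ.symm (Pi.single p 1)) * ∑ b, Φ v (p.1, b) * (x (t p.1)).1 p.2 b := by
      intro x
      have h1 : blockAction t Φ x v = ∑ p : ι × Fin 2, (blockEnd t x (Φ v) p) • Φ.symm (Pi.single p 1) := by
        rw [← Φ.symm_apply_apply (blockAction t Φ x v), coord_blockAction]
        conv_lhs => rw [pi_eq_sum_univ' (blockEnd t x (Φ v))]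
        rw [map_sum]
        refine Finset.sum_congr rfl fun p _ => ?_
        rw [map_smul]
      rw [h1, map_sum]
      refine Finset.sum_congr rfl fun p _ => ?_
      rw [map_smul, smul_eq_mul, mul_comm]
      congr 1
      change ∑ b, (x (t p.1)).1 p.2 b * Φ v (p.1, b) = _
      exact Finset.sum_congr rfl fun b _ => mul_comm _ _
    simp only [e]
    exact regularSL2Pow_sum fun p => regularSL2Pow_const_mul (regularSL2Pow_sum fun b =>
      regularSL2Pow_const_mul (regularSL2Pow_entry _ _ _) _) _
  induction hF using Algebra.adjoin_induction with
  | mem F hF =>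
    rcases hF with ⟨l, v, rfl⟩ | ⟨l, v, rfl⟩
    · exact hcoeff l v
    · have := regularSL2Pow_inv (hcoeff l v)
      simpa only [map_inv] using this
  | algebraMap r => exact (regularSL2Pow k).algebraMap_mem r
  | add F G _ _ hF hG => exact (regularSL2Pow k).add_mem hF hG
  | mul F G _ _ hF hG => exact (regularSL2Pow k).mul_mem hF hG

/-- Each matrix entry is affine in the parameter, because the nilpotent part enters only to first
order. -/
theorem exists_polynomial_uniPi (m p q : Fin k → ℝ) {F : (Fin k → SpecialLinearGroup (Fin 2) ℝ) → ℝ}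
    (hF : F ∈ regularSL2Pow k) : ∃ P : Polynomial ℝ, ∀ s, F (SL2.uniPi m p q s) = P.eval s := by
  induction hF using Algebra.adjoin_induction with
  | mem F hF =>
    obtain ⟨i, a, b, rfl⟩ := hF
    refine ⟨Polynomial.C ((1 : Matrix (Fin 2) (Fin 2) ℝ) a b) +
      Polynomial.C ((!![-(m i * p i * q i), m i * p i ^ 2; -(m i * q i ^ 2), m i * p i * q i] :
        Matrix (Fin 2) (Fin 2) ℝ) a b) * Polynomial.X, fun s => ?_⟩
    fin_cases a <;> fin_cases b <;> simp [SL2.uniPi, SL2.uni_coe] <;> ring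
  | algebraMap r => exact ⟨Polynomial.C r, fun s => by simp⟩
  | add F G _ _ hF hG =>
    obtain ⟨P, hP⟩ := hF
    obtain ⟨R, hR⟩ := hG
    exact ⟨P + R, fun s => by simp [hP, hR]⟩
  | mul F G _ _ hF hG =>
    obtain ⟨P, hP⟩ := hF
    obtain ⟨R, hR⟩ := hG
    exact ⟨P * R, fun s => by simp [hP, hR]⟩

theorem uniPi_pow (m p q : Fin k → ℝ) (n : ℕ) : SL2.uniPi m p q 1 ^ n = SL2.uniPi m p q n := by
  funext i
  simp [SL2.uniPi, SL2.uni_pow]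

/-- The Zariski closure of the group generated by a unipotent element contains its one-parameter
group. -/
theorem uniPi_mem_zariskiClosure {Γ : Subgroup (V ≃ₗ[ℝ] V)} {m p q : Fin k → ℝ}
    (h : blockAction t Φ (SL2.uniPi m p q 1) ∈ Γ) (s : ℝ) :
    SL2.uniPi m p q s ∈ (zariskiClosure Γ).comap (blockAction t Φ) := by
  intro F hF h0
  obtain ⟨P, hP⟩ := exists_polynomial_uniPi m p q (regular_blockAction (t := t) (Φ := Φ) hF)
  -- The polynomial vanishes at all natural numbers, which correspond to the powers of the given
  -- element.
  have hzero : P = 0 := by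
    refine Polynomial.eq_zero_of_infinite_isRoot P (Set.infinite_of_injective_forall_mem
      (f := fun n : ℕ => (n : ℝ)) Nat.cast_injective fun n => ?_)
    change P.eval (n : ℝ) = 0
    rw [← hP, ← uniPi_pow, map_pow]
    exact h0 _ (Γ.pow_mem h n)
  have := hP s
  rw [hzero, Polynomial.eval_zero] at this
  exact this

/-- The conditions on the coordinates of an element of the image of `SL(2, ℝ)^k`. -/
theorem mem_range_blockAction_of_mem_zariskiClosure (ht : Function.Surjective t)
    {Γ : Subgroup (V ≃ₗ[ℝ] V)} (h : Γ ≤ (blockAction t Φ).range) :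
    zariskiClosure Γ ≤ (blockAction t Φ).range := by
  intro γ hγ
  let l : ι × Fin 2 → Module.Dual ℝ V := fun p => LinearMap.proj p ∘ₗ Φ.toLinearMap
  let e : ι × Fin 2 → V := fun p => Φ.symm (Pi.single p 1)
  have hent : ∀ g a b a' b', l (a, b) (blockAction t Φ g (e (a', b'))) =
      if a = a' then (g (t a)).1 b b' else 0 := by
    intro g a b a' b'
    change Φ (blockAction t Φ g (e (a', b'))) (a, b) = _
    rw [coord_blockAction, Φ.apply_symm_apply, blockEnd_apply]
    by_cases haa : a = a'
    · subst haa
      simp [Pi.single_apply]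
    · simp [haa]
  -- For each place `r` picks one summand on which this place acts; the matrix of the place is read
  -- off there.
  obtain ⟨r, hr⟩ := ht.hasRightInverse
  have hentry : ∀ p p', (fun g : V ≃ₗ[ℝ] V => l p (g (e p'))) ∈ regularGL V := fun p p' =>
    regularGL_coeff _ _
  -- First equations: different summands do not mix.
  have h1 : ∀ a b a' b', a ≠ a' → l (a, b) (γ (e (a', b'))) = 0 := fun a b a' b' haa =>
    hγ _ (hentry (a, b) (a', b')) fun δ hδ => by
      obtain ⟨g, rfl⟩ := h hδ
      rw [hent, if_neg haa]
  -- Second equations: summands belonging to the same place carry the same matrix.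
  have h2 : ∀ a b b', l (a, b) (γ (e (a, b'))) = l (r (t a), b) (γ (e (r (t a), b'))) :=
    fun a b b' => sub_eq_zero.1 (hγ _ ((regularGL V).sub_mem (hentry (a, b) (a, b'))
      (hentry (r (t a), b) (r (t a), b'))) fun δ hδ => by
      obtain ⟨g, rfl⟩ := h hδ
      simp only [Pi.sub_apply, hent, if_true, hr (t a), sub_self])
  let A : Fin k → Matrix (Fin 2) (Fin 2) ℝ := fun i => Matrix.of fun b b' => l (r i, b) (γ (e (r i, b')))
  -- Third equations: the determinants are one. All three kinds are regular functions that vanish on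
  -- `Γ`, hence on its closure.
  have h3 : ∀ i, (A i).det = 1 := by
    intro i
    have := hγ _ ((regularGL V).sub_mem ((regularGL V).sub_mem
      ((regularGL V).mul_mem (hentry (r i, 0) (r i, 0)) (hentry (r i, 1) (r i, 1)))
      ((regularGL V).mul_mem (hentry (r i, 0) (r i, 1)) (hentry (r i, 1) (r i, 0))))
      ((regularGL V).one_mem)) (fun δ hδ => by
        obtain ⟨g, rfl⟩ := h hδ
        simp only [Pi.sub_apply, Pi.mul_apply, hent, if_true, Pi.one_apply]
        rw [← det_fin_two, (g (t (r i))).2, sub_self])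
    rw [det_fin_two]
    exact sub_eq_zero.1 this
  let g : Fin k → SpecialLinearGroup (Fin 2) ℝ := fun i => ⟨A i, h3 i⟩
  refine ⟨g, ?_⟩
  refine LinearEquiv.ext fun v => Φ.injective (funext fun ⟨a, b⟩ => ?_)
  rw [coord_blockAction, blockEnd_apply]
  have hv : v = ∑ p : ι × Fin 2, Φ v p • e p := by
    apply Φ.injective
    rw [map_sum]
    conv_lhs => rw [pi_eq_sum_univ' (Φ v)]
    refine Finset.sum_congr rfl fun p _ => ?_
    rw [map_smul, Φ.apply_symm_apply]
  have h4 : Φ (γ v) (a, b) = ∑ p : ι × Fin 2, Φ v p * l (a, b) (γ (e p)) := by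
    conv_lhs => rw [hv]
    rw [map_sum, map_sum, Finset.sum_apply]
    refine Finset.sum_congr rfl fun p _ => ?_
    rw [map_smul, map_smul]
    rfl
  rw [h4, Fintype.sum_prod_type, Finset.sum_eq_single a]
  · refine Finset.sum_congr rfl fun b' _ => ?_
    rw [h2 a b b', mul_comm]
    rfl
  · intro a' _ haa
    exact Finset.sum_eq_zero fun b' _ => by rw [h1 a b a' b' haa.symm, mul_zero]
  · simp

omit [Fintype ι] in
theorem blockAction_injective (ht : Function.Surjective t) :
    Function.Injective (blockAction t Φ) := by
  intro g g' h
  funext i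
  obtain ⟨a, rfl⟩ := ht i
  ext b b'
  have h1 := congrArg (fun γ : V ≃ₗ[ℝ] V => Φ (γ (Φ.symm (Pi.single (a, b') 1))) (a, b)) h
  simpa [coord_blockAction, blockEnd_apply, Pi.single_apply] using h1

/-- The Zariski closure of a group of which a subgroup of finite index is Zariski dense in the
image of `SL(2, ℝ)^k`. -/
theorem zariskiClosure_of_blockAction (ht : Function.Surjective t) {Γ Δ : Subgroup (V ≃ₗ[ℝ] V)}
    (hΔ : Δ ≤ Γ) [Δ.IsFiniteRelIndex Γ] (hup : Δ ≤ (blockAction t Φ).range)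
    (hlow : (zariskiClosure Δ).comap (blockAction t Φ) = ⊤) :
    IsAlgebraicallySL2Pow (identityComponent (zariskiClosure Γ)) k ∧
      (identityComponent (zariskiClosure Γ)).IsFiniteRelIndex (zariskiClosure Γ) ∧
      identityComponent (zariskiClosure Γ) = zariskiClosure Δ := by
  have hrange : zariskiClosure Δ = (blockAction t Φ).range := by
    refine le_antisymm (mem_range_blockAction_of_mem_zariskiClosure ht hup) ?_
    rintro _ ⟨g, rfl⟩
    have : g ∈ (zariskiClosure Δ).comap (blockAction t Φ) := by rw [hlow]; trivial
    exact this
  have hfin : (zariskiClosure Δ).IsFiniteRelIndex (zariskiClosure Γ) := isFiniteRelIndex_zariskiClosure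
  have hid : identityComponent (zariskiClosure Γ) = zariskiClosure Δ := by
    refine le_antisymm (sInf_le ⟨zariskiClosure_mono hΔ, zariskiClosure_idem _, hfin⟩) ?_
    refine le_sInf fun K ⟨_, _, hKfin⟩ => ?_
    have h1 : K.IsFiniteRelIndex (zariskiClosure Δ) :=
      Subgroup.isFiniteRelIndex_of_le_right _ (zariskiClosure_mono hΔ)
    -- Any competitor in the infimum meets the image of SL(2, ℝ)^k in finite index, and SL(2, ℝ)^k
    -- has no proper subgroup of finite index.
    have h2 : (K.comap (blockAction t Φ)).index ≠ 0 := by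
      rw [Subgroup.index_comap, ← hrange]
      exact h1.relIndex_ne_zero
    have h3 := SL2.eq_top_of_relIndex_ne_zero h2
    rw [hrange]
    rintro _ ⟨g, rfl⟩
    have : g ∈ K.comap (blockAction t Φ) := by rw [h3]; trivial
    exact this
  refine ⟨?_, by rwa [hid], hid⟩
  rw [hid, hrange]
  refine ⟨MonoidHom.ofInjective (blockAction_injective ht), fun F hF => regular_blockAction hF,
    fun F hF => ?_⟩
  have hext : ∀ F ∈ regularSL2Pow k, ∃ F' ∈ regularGL V, ∀ x, F x = F' (blockAction t Φ x) := by
    intro F hF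
    induction hF using Algebra.adjoin_induction with
    | mem F hF =>
      obtain ⟨i, b, b', rfl⟩ := hF
      obtain ⟨a, rfl⟩ := ht i
      refine ⟨_, regularGL_coeff (LinearMap.proj (a, b) ∘ₗ Φ.toLinearMap)
        (Φ.symm (Pi.single (a, b') 1)), fun x => ?_⟩
      simp [coord_blockAction, blockEnd_apply, Pi.single_apply]
    | algebraMap r => exact ⟨_, (regularGL V).algebraMap_mem r, fun x => rfl⟩
    | add F G _ _ hF hG =>
      obtain ⟨F', hF', eF⟩ := hF
      obtain ⟨G', hG', eG⟩ := hG
      exact ⟨_, (regularGL V).add_mem hF' hG', fun x => by simp [eF, eG]⟩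
    | mul F G _ _ hF hG =>
      obtain ⟨F', hF', eF⟩ := hF
      obtain ⟨G', hG', eG⟩ := hG
      exact ⟨_, (regularGL V).mul_mem hF' hG', fun x => by simp [eF, eG]⟩
  obtain ⟨F', hF', e⟩ := hext F hF
  refine ⟨F', hF', fun g => ?_⟩
  obtain ⟨x, rfl⟩ := (MonoidHom.ofInjective (blockAction_injective (Φ := Φ) ht)).surjective g
  rw [MulEquiv.symm_apply_apply, e]
  rfl

end Zariski

namespace Origami

open unitInterval

variable {Q : Type} {O O' O'' : Origami Q}

/-! #### Equivariance under the deck group -/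

/-- The permutation `τ` of the squares is compatible with the gluing. -/
def Commutes (O : Origami Q) (τ : Equiv.Perm Q) : Prop :=
  (∀ q, τ (O.right q) = O.right (τ q)) ∧ ∀ q, τ (O.up q) = O.up (τ q)

theorem Commutes.symm {τ : Equiv.Perm Q} (h : O.Commutes τ) : O.Commutes τ.symm := by
  constructor <;> intro q <;> rw [Equiv.symm_apply_eq]
  · rw [h.1, Equiv.apply_symm_apply]
  · rw [h.2, Equiv.apply_symm_apply]

/-- The map of the surface that permutes the squares. -/
def permMap (τ : Equiv.Perm Q) (h : O.Commutes τ) : C(O.Surface, O.Surface) :=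
  O.lift (fun q => O.square (τ q)) (fun q y => by rw [square_right, h.1])
    (fun q x => by rw [square_up, h.2])

@[simp] theorem permMap_square (τ : Equiv.Perm Q) (h : O.Commutes τ) (q : Q) (z : I × I) :
    permMap τ h (O.square q z) = O.square (τ q) z := rfl

/-- The homeomorphism of the surface that permutes the squares. -/
def permHomeo (τ : Equiv.Perm Q) (h : O.Commutes τ) : O.Surface ≃ₜ O.Surface where
  toFun := permMap τ h
  invFun := permMap τ.symm h.symm
  left_inv s := by
    obtain ⟨q, z, rfl⟩ := exists_square_eq s
    rw [permMap_square, permMap_square, Equiv.symm_apply_apply]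
  right_inv s := by
    obtain ⟨q, z, rfl⟩ := exists_square_eq s
    rw [permMap_square, permMap_square, Equiv.apply_symm_apply]
  continuous_toFun := (permMap τ h).continuous
  continuous_invFun := (permMap τ.symm h.symm).continuous

theorem toTorus_permHomeo (τ : Equiv.Perm Q) (h : O.Commutes τ) (s : O.Surface) :
    O.toTorus (permHomeo τ h s) = O.toTorus s := by
  obtain ⟨q, z, rfl⟩ := exists_square_eq s
  rfl

theorem exists_eq_permMap {a : O.Surface ≃ₜ O.Surface} (ha : ∀ s, O.toTorus (a s) = O.toTorus s) :
    ∃ (τ : Equiv.Perm Q) (h : O.Commutes τ), ∀ s, a s = permMap τ h s := by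
  obtain ⟨τ, h1, h2, h3⟩ := exists_perm_of_toTorus a ha
  refine ⟨τ, ⟨h2, h3⟩, fun s => ?_⟩
  obtain ⟨q, z, rfl⟩ := exists_square_eq s
  exact h1 q z

/-- The map `f` commutes with the permutations of the squares that are compatible with the
gluing. -/
def IsEquivariant (f : O.Surface ≃ₜ O'.Surface) : Prop :=
  (∀ τ, O.Commutes τ ↔ O'.Commutes τ) ∧
    ∀ τ (h : O.Commutes τ) (h' : O'.Commutes τ) s, f (permMap τ h s) = permMap τ h' (f s)

theorem IsEquivariant.trans {f : O.Surface ≃ₜ O'.Surface} {g : O'.Surface ≃ₜ O''.Surface}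
    (hf : IsEquivariant f) (hg : IsEquivariant g) : IsEquivariant (f.trans g) :=
  ⟨fun τ => (hf.1 τ).trans (hg.1 τ), fun τ h h'' s => by
    have h' := (hf.1 τ).1 h
    rw [Homeomorph.trans_apply, Homeomorph.trans_apply, hf.2 τ h h', hg.2 τ h' h'']⟩

theorem IsEquivariant.symm {f : O.Surface ≃ₜ O'.Surface} (hf : IsEquivariant f) :
    IsEquivariant f.symm :=
  ⟨fun τ => (hf.1 τ).symm, fun τ h' h s => by
    rw [Homeomorph.symm_apply_eq, hf.2 τ h h', Homeomorph.apply_symm_apply]⟩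

/-- The shear replaces the two permutations by other generators of the same group, and the
permutations commuting with a group do not depend on its generators. -/
theorem commutes_shear (τ : Equiv.Perm Q) : O.Commutes τ ↔ O.shear.Commutes τ := by
  have hr : ∀ (O : Origami Q), (∀ q, τ (O.right q) = O.right (τ q)) →
      ∀ q, τ (O.right.symm q) = O.right.symm (τ q) := fun O h q => by
    rw [Equiv.eq_symm_apply, ← h, Equiv.apply_symm_apply]
  refine ⟨fun h => ⟨h.1, fun q => ?_⟩, fun h => ⟨h.1, fun q => ?_⟩⟩
  · change τ (O.up (O.right.symm q)) = O.up (O.right.symm (τ q))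
    rw [h.2, hr O h.1]
  · have h1 : τ (O.up (O.right.symm (O.right q))) = O.up (O.right.symm (τ (O.right q))) :=
      h.2 (O.right q)
    have h2 : τ (O.right q) = O.right (τ q) := h.1 q
    rwa [h2, Equiv.symm_apply_apply, Equiv.symm_apply_apply] at h1

theorem isEquivariant_shear : IsEquivariant O.shearHomeo := by
  refine ⟨commutes_shear, fun τ h h' s => ?_⟩
  obtain ⟨q, z, rfl⟩ := exists_square_eq s
  change O.shearSquare (τ q) z = permMap τ h' (O.shearSquare q z)
  simp only [shearSquare, ContinuousMap.coe_mk]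
  split_ifs
  · rfl
  · rw [permMap_square, h.1]

theorem commutes_rotate (τ : Equiv.Perm Q) : O.Commutes τ ↔ O.rotate.Commutes τ := by
  refine ⟨fun h => ⟨fun q => ?_, h.1⟩, fun h => ⟨h.2, fun q => ?_⟩⟩
  · change τ (O.up.symm q) = O.up.symm (τ q)
    rw [Equiv.eq_symm_apply, ← h.2, Equiv.apply_symm_apply]
  · have h1 : τ (O.up.symm (O.up q)) = O.up.symm (τ (O.up q)) := h.1 (O.up q)
    rw [Equiv.symm_apply_apply, Equiv.eq_symm_apply] at h1
    exact h1.symm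

theorem isEquivariant_rotate : IsEquivariant O.rotateHomeo := by
  refine ⟨commutes_rotate, fun τ h h' s => ?_⟩
  obtain ⟨q, z, rfl⟩ := exists_square_eq s
  rfl

end Origami

/-! ### Triples of integers -/

/-- Triples of integers. -/
abbrev Triple := ℤ × ℤ × ℤ

namespace Triple

/-- The dot product. -/
def dot (r x : Triple) : ℤ := r.1 * x.1 + r.2.1 * x.2.1 + r.2.2 * x.2.2

/-- Square matrices of size three, given by their rows. -/
abbrev Mat := Triple × Triple × Triple

/-- The product of a matrix and a column. -/
def app (A : Mat) (x : Triple) : Triple := (dot A.1 x, dot A.2.1 x, dot A.2.2 x)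

/-- The product of a row and a matrix. -/
def rowMul (r : Triple) (A : Mat) : Triple :=
  (r.1 * A.1.1 + r.2.1 * A.2.1.1 + r.2.2 * A.2.2.1,
    r.1 * A.1.2.1 + r.2.1 * A.2.1.2.1 + r.2.2 * A.2.2.2.1,
    r.1 * A.1.2.2 + r.2.1 * A.2.1.2.2 + r.2.2 * A.2.2.2.2)

/-- The product of matrices. -/
def mul (A B : Mat) : Mat := (rowMul A.1 B, rowMul A.2.1 B, rowMul A.2.2 B)

/-- Linear combinations. -/
def comb (r s : ℤ) (x y : Triple) : Triple :=
  (r * x.1 + s * y.1, r * x.2.1 + s * y.2.1, r * x.2.2 + s * y.2.2)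

/-- The identity matrix. -/
def one : Mat := ((1, 0, 0), (0, 1, 0), (0, 0, 1))

theorem dot_rowMul (r : Triple) (A : Mat) (x : Triple) : dot (rowMul r A) x = dot r (app A x) := by
  simp only [dot, rowMul, app]; ring

theorem rowMul_mul (r : Triple) (A B : Mat) : rowMul r (mul A B) = rowMul (rowMul r A) B := by
  simp only [rowMul, mul]
  refine Prod.ext ?_ (Prod.ext ?_ ?_) <;> ring

theorem rowMul_one (r : Triple) : rowMul r one = r := by
  simp [rowMul, one]

theorem dot_comb (r : Triple) (a b : ℤ) (x y : Triple) :
    dot r (comb a b x y) = a * dot r x + b * dot r y := by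
  simp only [dot, comb]; ring

/-- Evaluates `z` before it is passed on. -/
def forceInt {α : Sort*} (z : ℤ) (f : ℤ → α) : α :=
  match z with
  | .ofNat 0 => f 0
  | .ofNat (n + 1) => f (.ofNat (n + 1))
  | .negSucc 0 => f (.negSucc 0)
  | .negSucc (n + 1) => f (.negSucc (n + 1))

theorem forceInt_eq {α : Sort*} (z : ℤ) (f : ℤ → α) : forceInt z f = f z := by
  rcases z with (_ | n) | (_ | n) <;> rfl

/-- Evaluates `x` before it is passed on. -/
def force {α : Sort*} (x : Triple) (f : Triple → α) : α :=
  forceInt x.1 fun a => forceInt x.2.1 fun b => forceInt x.2.2 fun c => f (a, b, c)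

@[simp] theorem force_eq {α : Sort*} (x : Triple) (f : Triple → α) : force x f = f x := by
  simp only [force, forceInt_eq]

/-- Evaluates `A` before it is passed on. -/
def forceMat {α : Sort*} (A : Mat) (f : Mat → α) : α :=
  force A.1 fun a => force A.2.1 fun b => force A.2.2 fun c => f (a, b, c)

@[simp] theorem forceMat_eq {α : Sort*} (A : Mat) (f : Mat → α) : forceMat A f = f A := by
  simp only [forceMat, force_eq]

/-- The sum of `A ^ i x` over `i < r`. -/
def sumPow (A : Mat) (x : Triple) : ℕ → Triple
  | 0 => (0, 0, 0)
  | r + 1 => force (sumPow A x r) fun y => comb 1 1 x (app A y)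

end Triple

namespace Origami

open unitInterval Triple

variable {Q : Type} {O O' : Origami Q}

/-! #### Equivariant cochains and twists -/

/-- The matrices that describe the change of the coefficients between neighbouring squares, and
their inverses. -/
structure Transition where
  right : Mat
  up : Mat
  rightInv : Mat
  upInv : Mat

namespace Transition

/-- The transition matrices after a shear. -/
def shear (T : Transition) : Transition :=
  ⟨T.right, mul T.rightInv T.up, T.rightInv, mul T.upInv T.right⟩

/-- The transition matrices after a rotation. -/
def rotate (T : Transition) : Transition := ⟨T.upInv, T.right, T.up, T.rightInv⟩

/-- Evaluates the matrices before they are passed on. -/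
def force {α : Sort*} (T : Transition) (f : Transition → α) : α :=
  forceMat T.right fun A => forceMat T.up fun B => forceMat T.rightInv fun C =>
    forceMat T.upInv fun D => f ⟨A, B, C, D⟩

@[simp] theorem force_eq {α : Sort*} (T : Transition) (f : Transition → α) : T.force f = f T := by
  simp only [force, forceMat_eq]

/-- `T` describes the change of the coefficients `row`. -/
structure IsFor (T : Transition) (O : Origami Q) (row : Q → Triple) : Prop where
  right : ∀ q, row (O.right q) = rowMul (row q) T.right
  up : ∀ q, row (O.up q) = rowMul (row q) T.up
  rightInv : ∀ q, row (O.right.symm q) = rowMul (row q) T.rightInv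
  upInv : ∀ q, row (O.up.symm q) = rowMul (row q) T.upInv

theorem IsFor.of_mul {T : Transition} {row : Q → Triple}
    (h1 : ∀ q, row (O.right q) = rowMul (row q) T.right)
    (h2 : ∀ q, row (O.up q) = rowMul (row q) T.up) (h3 : mul T.right T.rightInv = one)
    (h4 : mul T.up T.upInv = one) : T.IsFor O row where
  right := h1
  up := h2
  rightInv q := by
    conv_rhs => rw [← O.right.apply_symm_apply q, h1, ← rowMul_mul, h3, rowMul_one]
  upInv q := by
    conv_rhs => rw [← O.up.apply_symm_apply q, h2, ← rowMul_mul, h4, rowMul_one]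

theorem IsFor.shear {T : Transition} {row : Q → Triple} (h : T.IsFor O row) :
    T.shear.IsFor O.shear row where
  right := h.right
  up q := by
    change row (O.up (O.right.symm q)) = rowMul (row q) (mul T.rightInv T.up)
    rw [h.up, h.rightInv, rowMul_mul]
  rightInv := h.rightInv
  upInv q := by
    have e : O.shear.up.symm q = O.right (O.up.symm q) := by
      rw [Equiv.symm_apply_eq]
      change q = O.up (O.right.symm (O.right (O.up.symm q)))
      rw [Equiv.symm_apply_apply, Equiv.apply_symm_apply]
    rw [e, h.right, h.upInv, ← rowMul_mul]
    rfl

theorem IsFor.rotate {T : Transition} {row : Q → Triple} (h : T.IsFor O row) :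
    T.rotate.IsFor O.rotate row where
  right q := h.upInv q
  up q := h.right q
  rightInv q := h.up q
  upInv q := h.rightInv q

/-- The effect of a twist on equivariant cochains: apply the moves of the word, then `r` shears, and
then the inverses of the moves. -/
def twist (r : ℕ) : List Bool → Transition → Triple → Triple → Triple × Triple
  -- After `r` shears the left side has crossed `r` consecutive squares to the right, so its value
  -- grows by the sum of the values on `r` lower sides; the other moves conjugate this by a change
  -- of direction.
  | [], T, x, y => Triple.force (sumPow T.right x r) fun s => (x, comb 1 1 s y)
  | true :: l, T, x, y =>
    Triple.force (app T.rightInv (comb 1 (-1) y x)) fun y₁ => T.shear.force fun T₁ =>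
      let p := twist r l T₁ x y₁
      Triple.force p.1 fun x' => Triple.force p.2 fun y' => (x', comb 1 1 x' (app T.right y'))
  | false :: l, T, x, y =>
    Triple.force (comb 0 (-1) y y) fun x₁ => Triple.force (app T.up x) fun y₁ =>
      T.rotate.force fun T₁ =>
      let p := twist r l T₁ x₁ y₁
      Triple.force p.1 fun x' => Triple.force p.2 fun y' => (app T.upInv y', comb 0 (-1) x' x')

end Transition

/-- The cocycle `κ` has the values `row q · x` on the lower and `row q · y` on the left sides. -/
def Represents (row : Q → Triple) (κ : pathCocycle O.Surface) (x y : Triple) : Prop :=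
  (∀ q, horValue κ q = (dot (row q) x : ℤ)) ∧ ∀ q, verValue κ q = (dot (row q) y : ℤ)

theorem Represents.congr_right {row : Q → Triple} {κ : pathCocycle O.Surface} {x y y' : Triple}
    (h : Represents row κ x y) (e : ∀ q, dot (row q) y = dot (row q) y') : Represents row κ x y' :=
  ⟨h.1, fun q => by rw [h.2, e]⟩

theorem Represents.shear {row : Q → Triple} {T : Transition} (hT : T.IsFor O row)
    {κ : pathCocycle O.shear.Surface} {x y : Triple} (h : Represents row κ x y) :
    Represents row (pathCocycle.pullback (O.shearHomeo : C(O.Surface, O.shear.Surface)) κ) x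
      (comb 1 1 x (app T.right y)) := by
  refine ⟨fun q => by rw [horValue_shear, h.1], fun q => ?_⟩
  rw [verValue_shear, h.1, h.2, dot_comb, ← dot_rowMul, ← hT.right]
  push_cast
  ring

theorem Represents.rotate {row : Q → Triple} {T : Transition} (hT : T.IsFor O row)
    {κ : pathCocycle O.rotate.Surface} {x y : Triple} (h : Represents row κ x y) :
    Represents row (pathCocycle.pullback (O.rotateHomeo : C(O.Surface, O.rotate.Surface)) κ)
      (app T.upInv y) (comb 0 (-1) x x) := by
  refine ⟨fun q => ?_, fun q => ?_⟩
  · rw [horValue_rotate, h.2, ← dot_rowMul, ← hT.upInv]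
  · rw [verValue_rotate, h.1, dot_comb]
    push_cast
    ring

theorem pullback_pullback_symm (f : O.Surface ≃ₜ O'.Surface) (κ : pathCocycle O.Surface) :
    pathCocycle.pullback (f : C(O.Surface, O'.Surface))
      (pathCocycle.pullback (f.symm : C(O'.Surface, O.Surface)) κ) = κ := by
  refine Subtype.ext (funext fun γ => congrArg κ.1 (ContinuousMap.ext fun t => ?_))
  simp

theorem Represents.unshear {row : Q → Triple} {T : Transition} (hT : T.IsFor O row)
    {κ : pathCocycle O.Surface} {x y : Triple} (h : Represents row κ x y) :
    Represents row (pathCocycle.pullback (O.shearHomeo.symm : C(O.shear.Surface, O.Surface)) κ) x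
      (app T.rightInv (comb 1 (-1) y x)) := by
  have e := pullback_pullback_symm O.shearHomeo κ
  set κ' := pathCocycle.pullback (O.shearHomeo.symm : C(O.shear.Surface, O.Surface)) κ
  have h1 : ∀ q, horValue κ' q = horValue κ q := fun q => by rw [← horValue_shear κ' q, e]
  refine ⟨fun q => by rw [h1, h.1], fun q => ?_⟩
  have h2 := verValue_shear κ' (O.right.symm q)
  rw [e, h1, Equiv.apply_symm_apply, h.1, h.2] at h2
  rw [← dot_rowMul, ← hT.rightInv, dot_comb]
  push_cast
  linarith

theorem Represents.unrotate {row : Q → Triple} {T : Transition} (hT : T.IsFor O row)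
    {κ : pathCocycle O.Surface} {x y : Triple} (h : Represents row κ x y) :
    Represents row (pathCocycle.pullback (O.rotateHomeo.symm : C(O.rotate.Surface, O.Surface)) κ)
      (comb 0 (-1) y y) (app T.up x) := by
  have e := pullback_pullback_symm O.rotateHomeo κ
  set κ' := pathCocycle.pullback (O.rotateHomeo.symm : C(O.rotate.Surface, O.Surface)) κ
  refine ⟨fun q => ?_, fun q => ?_⟩
  · have h2 := verValue_rotate κ' q
    rw [e, h.2] at h2
    rw [dot_comb]
    push_cast
    linarith
  · have h2 := horValue_rotate κ' (O.up q)
    rw [e, Equiv.symm_apply_apply, h.1] at h2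
    rw [← h2, ← dot_rowMul, ← hT.up]

/-- The surface obtained by a word of moves. -/
def applyWord : List Bool → Origami Q → Origami Q
  | [], O => O
  | true :: l, O => applyWord l O.shear
  | false :: l, O => applyWord l O.rotate

/-- The new left value at `q` is the sum over `r` lower sides plus the old left value at the square
`r` steps to the right. It is recorded through products with rows, since triples are determined only
up to what the rows detect. When the width divides `r`, the second term is the old value at `q`
itself. -/
theorem exists_shear_pow (r : ℕ) : ∃ (O' : Origami Q) (f : O.Surface ≃ₜ O'.Surface),
    O'.right = O.right ∧ O'.up = O.up * (O.right⁻¹) ^ r ∧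
    (∃ B : Matrix.SpecialLinearGroup (Fin 2) ℤ, HasLinearPart B.1 f) ∧ IsEquivariant f ∧
    ∀ (row : Q → Triple) (T : Transition), T.IsFor O row → ∀ (κ : pathCocycle O'.Surface) x y,
      Represents row κ x y → ∃ y', Represents row (pathCocycle.pullback (f : C(O.Surface, O'.Surface)) κ) x y' ∧
        ∀ q, dot (row q) y' = dot (row q) (sumPow T.right x r) + dot (row ((O.right ^ r) q)) y := by
  induction r with
  | zero =>
    refine ⟨O, Homeomorph.refl _, rfl, by simp, ⟨1, fun s => by simp⟩, ⟨fun τ => Iff.rfl, fun τ h h' s => rfl⟩,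
      fun row T hT κ x y h => ⟨y, h, fun q => by simp [sumPow, dot]⟩⟩
  | succ r ih =>
    obtain ⟨O', f, e1, e2, ⟨B, hB⟩, h2, h3⟩ := ih
    refine ⟨O'.shear, f.trans O'.shearHomeo, e1, ?_, ⟨⟨!![1, 1; 0, 1], by simp [Matrix.det_fin_two_of]⟩ * B, ?_⟩,
      h2.trans isEquivariant_shear, fun row T hT κ x y h => ?_⟩
    · change O'.up * O'.right⁻¹ = _
      rw [e1, e2, pow_succ, mul_assoc]
    · have := hB.trans (hasLinearPart_shear (O := O'))
      exact this
    · have hq : ∀ q, verValue (pathCocycle.pullback (O'.shearHomeo : C(O'.Surface, O'.shear.Surface)) κ) q =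
          (dot (row q) (comb 1 1 x (app T.right y)) : ℤ) := by
        intro q
        rw [verValue_shear, h.1, h.2, dot_comb, ← dot_rowMul, ← hT.right, e1]
        push_cast
        ring
      have h4 : Represents row (pathCocycle.pullback (O'.shearHomeo : C(O'.Surface, O'.shear.Surface)) κ) x
          (comb 1 1 x (app T.right y)) := ⟨fun q => by rw [horValue_shear, h.1], hq⟩
      obtain ⟨y', h5, h6⟩ := h3 row T hT _ _ _ h4
      refine ⟨y', h5, fun q => ?_⟩
      -- The sum over `r + 1` consecutive squares may be split off at the far end as well as at the
      -- near end.
      have hpow : ∀ (r : ℕ) q, dot (row ((O.right ^ r) q)) x + dot (row q) (sumPow T.right x r) =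
          dot (row q) (sumPow T.right x (r + 1)) := by
        intro r
        induction r with
        | zero => intro q; simp [sumPow, dot, comb, app]
        | succ r ih =>
          intro q
          rw [pow_succ, Equiv.Perm.mul_apply]
          have h7 := ih (O.right q)
          rw [hT.right, dot_rowMul, dot_rowMul] at h7
          have e7 : ∀ n, dot (row q) (sumPow T.right x (n + 1)) =
              dot (row q) x + dot (row q) (app T.right (sumPow T.right x n)) := fun n => by
            rw [sumPow, Triple.force_eq, dot_comb, one_mul, one_mul]
          rw [e7 r, e7 (r + 1)]
          linarith
      rw [h6, dot_comb, ← dot_rowMul, ← hT.right, one_mul, one_mul, pow_succ', Equiv.Perm.mul_apply,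
        ← hpow r q]
      ring

/-- The twist along a direction in which the surface is a union of cylinders of width dividing
`r`. -/
theorem exists_twist (r : ℕ) (l : List Bool) (O : Origami Q) (hr : (applyWord l O).right ^ r = 1) :
    ∃ f : O.Surface ≃ₜ O.Surface, (∃ B : Matrix.SpecialLinearGroup (Fin 2) ℤ, HasLinearPart B.1 f) ∧
      IsEquivariant f ∧ ∀ (row : Q → Triple) (T : Transition), T.IsFor O row →
        ∀ (κ : pathCocycle O.Surface) x y, Represents row κ x y →
          Represents row (pathCocycle.pullback (f : C(O.Surface, O.Surface)) κ)
            (T.twist r l x y).1 (T.twist r l x y).2 := by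
  have hinv : ∀ B : Matrix.SpecialLinearGroup (Fin 2) ℤ, (B⁻¹).1 * B.1 = 1 := fun B => by
    rw [← Matrix.SpecialLinearGroup.coe_mul, inv_mul_cancel, Matrix.SpecialLinearGroup.coe_one]
  induction l generalizing O with
  | nil =>
    change O.right ^ r = 1 at hr
    obtain ⟨O', f, e1, e2, h1, h2, h3⟩ := exists_shear_pow (O := O) r
    -- The factor `right⁻¹ ^ r` by which `up` has changed is trivial, so the sheared surface is the
    -- original one and the shear becomes an affine self-map.
    obtain rfl : O' = O := ext_perm e1 (by rw [e2, inv_pow, hr, inv_one, mul_one])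
    refine ⟨f, h1, h2, fun row T hT κ x y h => ?_⟩
    obtain ⟨y', h4, h5⟩ := h3 row T hT κ x y h
    simp only [Transition.twist, Triple.force_eq]
    refine h4.congr_right fun q => ?_
    rw [h5, hr, dot_comb, Equiv.Perm.one_apply, one_mul, one_mul]
  | cons b l ih =>
    cases b with
    | true =>
      obtain ⟨f, ⟨B, hB⟩, h2, h3⟩ := ih O.shear hr
      let S : Matrix.SpecialLinearGroup (Fin 2) ℤ := ⟨!![1, 1; 0, 1], by simp [Matrix.det_fin_two_of]⟩
      refine ⟨(O.shearHomeo.trans f).trans O.shearHomeo.symm, ⟨S⁻¹ * (B * S), ?_⟩,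
        (isEquivariant_shear.trans h2).trans isEquivariant_shear.symm, fun row T hT κ x y h => ?_⟩
      · have hS : HasLinearPart S.1 O.shearHomeo := hasLinearPart_shear
        have := (hS.trans hB).trans (hS.symm (hinv S))
        exact this
      · have h4 := Represents.shear hT (h3 row T.shear hT.shear _ _ _ (h.unshear hT))
        simp only [Transition.twist, Triple.force_eq, Transition.force_eq]
        exact h4
    | false =>
      obtain ⟨f, ⟨B, hB⟩, h2, h3⟩ := ih O.rotate hr
      let S : Matrix.SpecialLinearGroup (Fin 2) ℤ := ⟨!![0, -1; 1, 0], by simp [Matrix.det_fin_two_of]⟩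
      refine ⟨(O.rotateHomeo.trans f).trans O.rotateHomeo.symm, ⟨S⁻¹ * (B * S), ?_⟩,
        (isEquivariant_rotate.trans h2).trans isEquivariant_rotate.symm, fun row T hT κ x y h => ?_⟩
      · have hS : HasLinearPart S.1 O.rotateHomeo := hasLinearPart_rotate
        have := (hS.trans hB).trans (hS.symm (hinv S))
        exact this
      · have h4 := Represents.rotate hT (h3 row T.rotate hT.rotate _ _ _ (h.unrotate hT))
        simp only [Transition.twist, Triple.force_eq, Transition.force_eq]
        exact h4

end Origami

namespace Origami

open unitInterval

variable {Q : Type} {O : Origami Q}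

/-! #### A bound for the dimension of the cohomology -/

/-- The value of a cellular cochain on a lower side (`false`) or a left side (`true`). -/
def onSides {R : Type*} (a b : Q → R) : Bool × Q → R
  | (false, q) => a q
  | (true, q) => b q

variable (O) in
/-- The square whose lower left corner is the end point of a side. -/
def sideEnd : Bool × Q → Q
  | (false, q) => O.right q
  | (true, q) => O.up q

variable (O) in
/-- If three of the sides of the square `q` are in the list, then the fourth one is added. -/
def peel [DecidableEq Q] (K : List (Bool × Q)) (q : Q) : List (Bool × Q) :=
  if ((true, O.right q) ∈ K ∧ (true, q) ∈ K ∧ (false, O.up q) ∈ K) ∨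
      ((false, q) ∈ K ∧ (true, q) ∈ K ∧ (false, O.up q) ∈ K) ∨
      ((false, q) ∈ K ∧ (true, O.right q) ∈ K ∧ (false, O.up q) ∈ K) ∨
      ((false, q) ∈ K ∧ (true, O.right q) ∈ K ∧ (true, q) ∈ K) then
    (false, q) :: (true, O.right q) :: (true, q) :: (false, O.up q) :: K
  else K

theorem onSides_peel [DecidableEq Q] {a b : Q → ℝ} (hab : O.IsClosed a b) {K : List (Bool × Q)} {q : Q}
    (h : ∀ e ∈ K, onSides a b e = 0) : ∀ e ∈ O.peel K q, onSides a b e = 0 := by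
  have hc : onSides a b (false, q) + onSides a b (true, O.right q) =
      onSides a b (true, q) + onSides a b (false, O.up q) := hab q
  intro e he
  rw [peel] at he
  split_ifs at he with hK
  · have h4 : onSides a b (false, q) = 0 ∧ onSides a b (true, O.right q) = 0 ∧
        onSides a b (true, q) = 0 ∧ onSides a b (false, O.up q) = 0 := by
      rcases hK with ⟨h1, h2, h3⟩ | ⟨h1, h2, h3⟩ | ⟨h1, h2, h3⟩ | ⟨h1, h2, h3⟩ <;>
      · replace h1 := h _ h1
        replace h2 := h _ h2
        replace h3 := h _ h3
        refine ⟨?_, ?_, ?_, ?_⟩ <;> linarith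
    simp only [List.mem_cons] at he
    rcases he with rfl | rfl | rfl | rfl | he
    exacts [h4.1, h4.2.1, h4.2.2.1, h4.2.2.2, h e he]
  · exact h e he

theorem onSides_foldl_peel [DecidableEq Q] {a b : Q → ℝ} (hab : O.IsClosed a b) (l : List Q)
    {K : List (Bool × Q)} (h : ∀ e ∈ K, onSides a b e = 0) :
    ∀ e ∈ l.foldl O.peel K, onSides a b e = 0 := by
  induction l generalizing K with
  | nil => exact h
  | cons q l ih => exact ih (onSides_peel hab h)

/-- A tree of sides, the functions on the vertices dual to its sides, further sides, and an order
in which the squares can be removed when all these sides have been cut. -/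
structure CutSystem (Q : Type) (n m : ℕ) where
  tree : Fin n → Bool × Q
  dual : Fin n → Q → ℤ
  extra : Fin m → Bool × Q
  order : List Q

/-- The properties of a cut system of a square-tiled surface. -/
structure CutSystem.IsFor [DecidableEq Q] {n m : ℕ} (S : CutSystem Q n m) (O : Origami Q) : Prop where
  vertex : ∀ l, O.IsVertexFunction (S.dual l)
  tree : ∀ l l', S.dual l (O.sideEnd (S.tree l')) - S.dual l (S.tree l').2 = if l = l' then 1 else 0
  order : ∀ e, e ∈ S.order.foldl O.peel (List.ofFn S.tree ++ List.ofFn S.extra)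

/-- Subtracting a coboundary makes a cocycle vanish on the tree. If it also vanishes on the extra
sides, closedness spreads the zeros from square to square until all sides are reached. So the
corrected values on the `m` extra sides determine the class. -/
theorem CutSystem.IsFor.finrank_dual_le [DecidableEq Q] {n m : ℕ} {S : CutSystem Q n m}
    (h : S.IsFor O) : Module.Finite ℝ (Module.Dual ℝ (H₁ O.Surface)) ∧
      Module.finrank ℝ (Module.Dual ℝ (H₁ O.Surface)) ≤ m := by
  let sideValue : pathCocycle O.Surface → Bool × Q → ℝ := fun κ => onSides (horValue κ) (verValue κ)
  let L : pathCocycle O.Surface →ₗ[ℝ] (Fin m → ℝ) :=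
    { toFun := fun κ i => sideValue κ (S.extra i) - ∑ l, sideValue κ (S.tree l) *
        (S.dual l (O.sideEnd (S.extra i)) - S.dual l (S.extra i).2 : ℤ)
      map_add' := fun κ κ' => by
        have e : ∀ s, sideValue (κ + κ') s = sideValue κ s + sideValue κ' s := by rintro ⟨_ | _, q⟩ <;> rfl
        funext i
        simp only [e, add_mul, Finset.sum_add_distrib, Pi.add_apply]
        ring
      map_smul' := fun r κ => by
        have e : ∀ s, sideValue (r • κ) s = r * sideValue κ s := by rintro ⟨_ | _, q⟩ <;> rfl
        funext i
        simp only [e, mul_assoc, ← Finset.mul_sum, Pi.smul_apply, smul_eq_mul, RingHom.id_apply]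
        ring }
  have hker : LinearMap.ker L ≤ LinearMap.ker (pathCocycle.functional O.Surface) := by
    intro κ hκ
    -- This vertex function has the prescribed increments along the tree, since the dual functions
    -- have increment one along one tree side and zero along the others.
    let u : Q → ℝ := fun q => ∑ l, sideValue κ (S.tree l) * (S.dual l q : ℤ)
    have hu : O.IsVertexFunction u := fun q => by
      simp only [u]
      exact Finset.sum_congr rfl fun l _ => by rw [h.vertex l q]
    have hκ' : ∀ i, sideValue κ (S.extra i) = ∑ l, sideValue κ (S.tree l) *
        (S.dual l (O.sideEnd (S.extra i)) - S.dual l (S.extra i).2 : ℤ) := fun i =>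
      sub_eq_zero.1 (congrFun hκ i)
    have hδ : ∀ e, u (O.sideEnd e) - u e.2 = ∑ l, sideValue κ (S.tree l) *
        (S.dual l (O.sideEnd e) - S.dual l e.2 : ℤ) := fun e => by
      simp only [u, ← Finset.sum_sub_distrib, Int.cast_sub, mul_sub]
    let a : Q → ℝ := fun q => horValue κ q - (u (O.right q) - u q)
    let b : Q → ℝ := fun q => verValue κ q - (u (O.up q) - u q)
    have hs : ∀ e, onSides a b e = sideValue κ e - (u (O.sideEnd e) - u e.2) := by
      rintro ⟨_ | _, q⟩ <;> rfl
    have hab : O.IsClosed a b := fun q => by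
      have h1 := isClosed_values κ q
      have h2 := hu q
      simp only [a, b]
      linarith
    have h0 := onSides_foldl_peel hab S.order (K := List.ofFn S.tree ++ List.ofFn S.extra) (by
      intro e he
      rw [hs, hδ, sub_eq_zero]
      rcases List.mem_append.1 he with he | he
      · obtain ⟨l, rfl⟩ := (List.mem_ofFn' _ _).1 he
        simp [h.tree]
      · obtain ⟨i, rfl⟩ := (List.mem_ofFn' _ _).1 he
        exact hκ' i)
    exact functional_eq_zero_of_values hu (fun q => sub_eq_zero.1 (h0 (false, q) (h.order _)))
      fun q => sub_eq_zero.1 (h0 (true, q) (h.order _))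
  -- The functional of a cocycle is a function of `L κ`; extended from the range of `L` it becomes a
  -- surjection from `ℝ^m` to the dual.
  obtain ⟨g, hg⟩ := LinearMap.exists_extend
    ((LinearMap.ker L).liftQ (pathCocycle.functional O.Surface) hker ∘ₗ
      L.quotKerEquivRange.symm.toLinearMap)
  have hsurj : Function.Surjective g := by
    intro l
    obtain ⟨κ, rfl⟩ := pathCocycle.functional_surjective l
    refine ⟨L κ, ?_⟩
    have := LinearMap.congr_fun hg ⟨L κ, LinearMap.mem_range_self L κ⟩
    rw [LinearMap.comp_apply, Submodule.subtype_apply] at this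
    rw [this, LinearMap.comp_apply]
    have e : L.quotKerEquivRange.symm ⟨L κ, LinearMap.mem_range_self L κ⟩ =
        (LinearMap.ker L).mkQ κ := by
      rw [LinearEquiv.symm_apply_eq]; rfl
    rw [LinearEquiv.coe_coe, e]
    rfl
  exact ⟨Module.Finite.of_surjective g hsurj, by
    simpa using LinearMap.finrank_le_finrank_of_surjective hsurj⟩

end Origami

/-! ### Frames: decomposition of the cohomology into planes. -/

namespace Origami

variable {Q : Type} {O : Origami Q} {ι : Type} {k : ℕ}

/-- The pairing with a fixed cocycle. -/
noncomputable def pairingLeft [Fintype Q] (κ' : pathCocycle O.Surface) :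
    pathCocycle O.Surface →ₗ[ℝ] ℝ where
  toFun κ := pairing κ κ'
  map_add' κ₁ κ₂ := pairing_add κ₁ κ₂ κ'
  map_smul' r κ := pairing_smul r κ κ'

theorem horValue_sum {s : ℕ} (c : Fin s → ℝ) (κ : Fin s → pathCocycle O.Surface) (q : Q) :
    horValue (∑ l, c l • κ l) q = ∑ l, c l * horValue (κ l) q := by
  let e : pathCocycle O.Surface →ₗ[ℝ] ℝ :=
    ⟨⟨fun κ => horValue κ q, fun _ _ => rfl⟩, fun _ _ => rfl⟩
  change e _ = _
  rw [map_sum]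
  rfl

theorem verValue_sum {s : ℕ} (c : Fin s → ℝ) (κ : Fin s → pathCocycle O.Surface) (q : Q) :
    verValue (∑ l, c l • κ l) q = ∑ l, c l * verValue (κ l) q := by
  let e : pathCocycle O.Surface →ₗ[ℝ] ℝ :=
    ⟨⟨fun κ => verValue κ q, fun _ _ => rfl⟩, fun _ _ => rfl⟩
  change e _ = _
  rw [map_sum]
  rfl

/-- The combination of the actions of symmetries on the cohomology. -/
noncomputable def average {s : ℕ} (σ : Fin s → Equiv.Perm Q) (hσ : ∀ l, O.Commutes (σ l))
    (c : Fin s → ℤ) : Module.Dual ℝ (H₁ O.Surface) →ₗ[ℝ] Module.Dual ℝ (H₁ O.Surface) :=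
  ∑ l, (c l : ℝ) • LinearMap.lcomp ℝ ℝ (H₁map (permMap (σ l) (hσ l)))

theorem average_functional {s : ℕ} (σ : Fin s → Equiv.Perm Q) (hσ : ∀ l, O.Commutes (σ l))
    (c : Fin s → ℤ) (κ : pathCocycle O.Surface) :
    average σ hσ c (pathCocycle.functional _ κ) =
      pathCocycle.functional _ (∑ l, (c l : ℝ) • pathCocycle.pullback (permMap (σ l) (hσ l)) κ) := by
  ext w
  rw [map_sum, average]
  simp only [LinearMap.sum_apply, LinearMap.smul_apply, map_smul, LinearMap.lcomp_apply',
    LinearMap.comp_apply, pathCocycle.functional_H₁map]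

/-- A map that commutes with each of the symmetries commutes with their combinations; this replaces
the explicit use of isotypic projections. -/
theorem average_comp {s : ℕ} {σ : Fin s → Equiv.Perm Q} (hσ : ∀ l, O.Commutes (σ l)) (c : Fin s → ℤ)
    {f : O.Surface ≃ₜ O.Surface} (hf : IsEquivariant f) (l : Module.Dual ℝ (H₁ O.Surface)) :
    average σ hσ c (l ∘ₗ H₁map (f : C(O.Surface, O.Surface))) =
      average σ hσ c l ∘ₗ H₁map (f : C(O.Surface, O.Surface)) := by
  ext w
  simp only [average, LinearMap.sum_apply, LinearMap.smul_apply, LinearMap.lcomp_apply',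
    LinearMap.comp_apply]
  refine Finset.sum_congr rfl fun i _ => ?_
  rw [← H₁map_comp, ← H₁map_comp]
  congr 4
  ext x
  exact hf.2 _ (hσ i) (hσ i) x

/-- Data of a family of cocycles on a square-tiled surface: for each `i` the values of the two
cocycles with index `i` are obtained from the coefficients `row i` and vectors that depend only on
the type of `i`. -/
structure Frame (Q ι : Type) (k : ℕ) where
  type : ι → Fin k
  row : ι → Q → Triple
  trans : Fin k → Transition
  hor : Fin k → Fin 2 → Triple
  ver : Fin k → Fin 2 → Triple

namespace Frame

/-- The values on the lower sides, including those of the holonomy cocycles. -/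
def horCochain (F : Frame Q ι k) : Option ι × Fin 2 → Q → ℤ
  | (some i, b), q => Triple.dot (F.row i q) (F.hor (F.type i) b)
  | (none, b), _ => ![1, 0] b

/-- The values on the left sides, including those of the holonomy cocycles. -/
def verCochain (F : Frame Q ι k) : Option ι × Fin 2 → Q → ℤ
  | (some i, b), q => Triple.dot (F.row i q) (F.ver (F.type i) b)
  | (none, b), _ => ![0, 1] b

/-- The data describe cocycles, and the cocycles with different indices are orthogonal. -/
structure IsFor [Fintype Q] (F : Frame Q ι k) (O : Origami Q) : Prop where
  trans : ∀ i, (F.trans (F.type i)).IsFor O (F.row i)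
  closed : ∀ j b, Triple.comb 1 1 (F.hor j b) (Triple.app (F.trans j).right (F.ver j b)) =
    Triple.comb 1 1 (F.ver j b) (Triple.app (F.trans j).up (F.hor j b))
  orthogonal : ∀ p p', p.1 ≠ p'.1 →
    O.form (F.horCochain p) (F.verCochain p) (F.horCochain p') (F.verCochain p') = 0
  nondegenerate : ∀ i, O.form (F.horCochain (i, 0)) (F.verCochain (i, 0)) (F.horCochain (i, 1))
    (F.verCochain (i, 1)) ≠ 0

variable {F : Frame Q ι k} [Fintype Q]

theorem IsFor.isClosed (hF : F.IsFor O) (p : Option ι × Fin 2) :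
    O.IsClosed (F.horCochain p) (F.verCochain p) := by
  rcases p with ⟨_ | i, b⟩
  · exact fun q => add_comm _ _
  · intro q
    have h := congrArg (Triple.dot (F.row i q)) (hF.closed (F.type i) b)
    simp only [Triple.dot_comb, one_mul, ← Triple.dot_rowMul, ← (hF.trans i).right,
      ← (hF.trans i).up] at h
    exact h

/-- The cocycles of a frame, including the holonomy cocycles. -/
noncomputable def cocycle (hF : F.IsFor O) (p : Option ι × Fin 2) : pathCocycle O.Surface :=
  cellCocycle O (F.horCochain p) (F.verCochain p) (hF.isClosed p)

theorem pairing_cocycle (hF : F.IsFor O) (p p' : Option ι × Fin 2) :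
    pairing (cocycle hF p) (cocycle hF p') =
      (O.form (F.horCochain p) (F.verCochain p) (F.horCochain p') (F.verCochain p') : ℤ) := by
  simp only [pairing, form, cup, cocycle, horValue_cellCocycle, verValue_cellCocycle]
  push_cast
  rfl

theorem functional_cocycle_none (hF : F.IsFor O) (b : Fin 2) :
    pathCocycle.functional _ (cocycle hF (none, b)) = pathCocycle.functional _ (O.holonomy b) := by
  refine functional_eq_of_values (fun q => ?_) fun q => ?_
  · rw [horValue_holonomy, cocycle, horValue_cellCocycle]
    fin_cases b <;> simp [horCochain]
  · rw [verValue_holonomy, cocycle, verValue_cellCocycle]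
    fin_cases b <;> simp [verCochain]

theorem represents_cocycle (hF : F.IsFor O) (i : ι) (b : Fin 2) :
    Represents (F.row i) (cocycle hF (some i, b)) (F.hor (F.type i) b) (F.ver (F.type i) b) :=
  ⟨fun q => horValue_cellCocycle _ _ _ q, fun q => verValue_cellCocycle _ _ _ q⟩

section Basis

variable [Fintype ι]

/-- The Gram matrix of the intersection form is block diagonal with invertible skew blocks of size
two; the form is well defined on classes. -/
theorem linearIndependent (hF : F.IsFor O) :
    LinearIndependent ℝ fun p => pathCocycle.functional _ (cocycle hF p) := by
  classical
  rw [Fintype.linearIndependent_iff]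
  intro g hg
  have h0 : ∀ p', ∑ p, g p * pairing (cocycle hF p) (cocycle hF p') = 0 := by
    intro p'
    have h1 : pathCocycle.functional _ (∑ p, g p • cocycle hF p) = 0 := by
      rw [map_sum, ← hg]
      exact Finset.sum_congr rfl fun p _ => map_smul _ _ _
    have h2 : pairingLeft (cocycle hF p') (∑ p, g p • cocycle hF p) = 0 := pairing_eq_zero h1 _
    rw [map_sum] at h2
    rw [← h2]
    exact Finset.sum_congr rfl fun p _ => (pairing_smul _ _ _).symm
  have h3 : ∀ i b', ∑ b, g (i, b) * pairing (cocycle hF (i, b)) (cocycle hF (i, b')) = 0 := by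
    intro i b'
    rw [← h0 (i, b'), Fintype.sum_prod_type, Finset.sum_eq_single i]
    · intro i' _ hi
      refine Finset.sum_eq_zero fun b _ => ?_
      rw [pairing_cocycle, hF.orthogonal _ _ hi, Int.cast_zero, mul_zero]
    · exact fun h => absurd (Finset.mem_univ _) h
  rintro ⟨i, b⟩
  have hne : pairing (cocycle hF (i, 0)) (cocycle hF (i, 1)) ≠ 0 := by
    rw [pairing_cocycle]
    exact_mod_cast hF.nondegenerate i
  have hself : ∀ κ : pathCocycle O.Surface, pairing κ κ = 0 := fun κ => by
    have := pairing_swap κ κ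
    linarith
  have h4 := h3 i 1
  have h5 := h3 i 0
  rw [Fin.sum_univ_two, hself, mul_zero, add_zero] at h4
  rw [Fin.sum_univ_two, hself, mul_zero, zero_add, pairing_swap, mul_neg, neg_eq_zero] at h5
  fin_cases b
  · exact (mul_eq_zero.1 h4).resolve_right hne
  · exact (mul_eq_zero.1 h5).resolve_right hne

/-- The cohomology has the dimension that makes the cocycles of a frame a basis. -/
def SpansDual (O : Origami Q) (ι : Type) [Fintype ι] : Prop :=
  Module.Finite ℝ (Module.Dual ℝ (H₁ O.Surface)) ∧
    Module.finrank ℝ (Module.Dual ℝ (H₁ O.Surface)) ≤ 2 * Fintype.card ι + 2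

/-- The independent classes of the frame already fill the upper bound supplied by a cut system. -/
theorem card_eq_finrank (hF : F.IsFor O) (h : SpansDual O ι) :
    Fintype.card (Option ι × Fin 2) = Module.finrank ℝ (Module.Dual ℝ (H₁ O.Surface)) := by
  have := h.1
  refine le_antisymm (linearIndependent hF).fintype_card_le_finrank (h.2.trans (le_of_eq ?_))
  simp
  ring

/-- The basis of the cohomology given by a frame. -/
noncomputable def basis (hF : F.IsFor O) (h : SpansDual O ι) :
    Module.Basis (Option ι × Fin 2) ℝ (Module.Dual ℝ (H₁ O.Surface)) :=
  Module.Basis.mk (linearIndependent hF)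
    (have := h.1; ((linearIndependent hF).span_eq_top_of_card_eq_finrank' (card_eq_finrank hF h)).ge)

@[simp] theorem basis_apply (hF : F.IsFor O) (h : SpansDual O ι) (p : Option ι × Fin 2) :
    basis hF h p = pathCocycle.functional _ (cocycle hF p) := by
  rw [basis, Module.Basis.mk_apply]

/-- The coordinates on the homology given by a frame. -/
noncomputable def coords (hF : F.IsFor O) (h : SpansDual O ι) :
    H₁ O.Surface ≃ₗ[ℝ] (Option ι × Fin 2 → ℝ) :=
  LinearEquiv.ofBijective (LinearMap.pi fun p => pathCocycle.functional _ (cocycle hF p)) (by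
    have hfin := h.1
    have : Module.Finite ℝ (H₁ O.Surface) := (Module.finite_dual_iff ℝ).1 hfin
    have hinj : Function.Injective
        (LinearMap.pi fun p => pathCocycle.functional _ (cocycle hF p)) := by
      rw [injective_iff_map_eq_zero]
      intro w hw
      rw [← Module.forall_dual_apply_eq_zero_iff ℝ]
      intro l
      have h1 : ∀ l : Module.Dual ℝ (H₁ O.Surface), Module.Dual.eval ℝ _ w l = 0 := fun l => by
        have : Module.Dual.eval ℝ _ w = 0 := (basis hF h).ext fun p => by
          rw [basis_apply]
          exact congrFun hw p
        rw [this, LinearMap.zero_apply]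
      exact h1 l
    refine ⟨hinj, (LinearMap.injective_iff_surjective_of_finrank_eq_finrank ?_).1 hinj⟩
    rw [← Subspace.dual_finrank_eq, ← card_eq_finrank hF h, Module.finrank_fintype_fun_eq_card])

theorem coords_apply (hF : F.IsFor O) (h : SpansDual O ι) (w : H₁ O.Surface)
    (p : Option ι × Fin 2) : coords hF h w p = pathCocycle.functional _ (cocycle hF p) w := rfl

end Basis

/-- The homeomorphism `f` acts on the cocycles of the frame by elements of `SL(2, ℝ)` that depend
only on the type of the index. -/
def ActsBy (hF : F.IsFor O) (f : O.Surface ≃ₜ O.Surface)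
    (g : Fin k → Matrix.SpecialLinearGroup (Fin 2) ℝ) : Prop :=
  ∀ i b w, pathCocycle.functional _ (cocycle hF (some i, b)) (H₁map (f : C(O.Surface, O.Surface)) w) =
    ∑ b', (g (F.type i)).1 b b' * pathCocycle.functional _ (cocycle hF (some i, b')) w

/-! #### Twists -/

/-- Data of a twist: the word of moves that makes its direction horizontal, the width of the
cylinders, the unipotent matrices `1 + m • !![-p * q, p ^ 2; -q ^ 2, p * q]` by which it acts, and
the vectors that give the coboundaries. -/
structure Twist (k : ℕ) where
  word : List Bool
  width : ℕ
  m : Fin k → ℤ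
  p : Fin k → ℤ
  q : Fin k → ℤ
  cob : Fin k → Fin 2 → Triple

/-- The vector `s • x 0 + r • x 1 + A z - z`. -/
def combCob (s r : ℤ) (x : Fin 2 → Triple) (A : Triple.Mat) (z : Triple) : Triple :=
  Triple.comb 1 1 (Triple.comb s r (x 0) (x 1)) (Triple.comb 1 (-1) (Triple.app A z) z)

/-- The coefficients of the unipotent matrix of a twist. -/
def Twist.coeff (D : Twist k) (j : Fin k) (b b' : Fin 2) : ℤ :=
  (1 + D.m j • !![-(D.p j * D.q j), D.p j ^ 2; -D.q j ^ 2, D.p j * D.q j] : Matrix _ _ ℤ) b b'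

/-- The data describe a twist and its effect on the cocycles of the frame. -/
structure Twist.IsFor (D : Twist k) (F : Frame Q ι k) (O : Origami Q) : Prop where
  width : ∀ q, (applyWord D.word O).right^[D.width] q = q
  cob : ∀ j b, Triple.app (F.trans j).right (Triple.app (F.trans j).up (D.cob j b)) =
    Triple.app (F.trans j).up (Triple.app (F.trans j).right (D.cob j b))
  eq : ∀ j b, (F.trans j).twist D.width D.word (F.hor j b) (F.ver j b) =
    (combCob (D.coeff j b 0) (D.coeff j b 1) (F.hor j) (F.trans j).right (D.cob j b),
      combCob (D.coeff j b 0) (D.coeff j b 1) (F.ver j) (F.trans j).up (D.cob j b))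

/-- The table states that the pulled back cochain equals the unipotent combination of the two frame
cochains plus a coboundary, and coboundaries do not affect the functional. -/
theorem Twist.IsFor.exists_actsBy {D : Twist k} (hD : D.IsFor F O) (hF : F.IsFor O) :
    ∃ f : O.Surface ≃ₜ O.Surface, (∃ B : Matrix.SpecialLinearGroup (Fin 2) ℤ, HasLinearPart B.1 f) ∧
      IsEquivariant f ∧ ActsBy hF f (SL2.uniPi (fun j => D.m j) (fun j => D.p j) (fun j => D.q j) 1) := by
  obtain ⟨f, h1, h2, h3⟩ := exists_twist D.width D.word O
    (Equiv.ext fun q => by rw [← Equiv.Perm.iterate_eq_pow]; exact hD.width q)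
  refine ⟨f, h1, h2, fun i b w => ?_⟩
  have h4 := h3 (F.row i) _ (hF.trans i) _ _ _ (represents_cocycle hF i b)
  rw [hD.eq] at h4
  set j := F.type i with hj
  set z := D.cob j b
  let κ := pathCocycle.pullback (f : C(O.Surface, O.Surface)) (cocycle hF (some i, b)) -
    ((D.coeff j b 0 : ℝ) • cocycle hF (some i, 0) + (D.coeff j b 1 : ℝ) • cocycle hF (some i, 1))
  have h5 : pathCocycle.functional _ κ = 0 := by
    -- The potential is `row q · z`. The equation `cob` says that moving `z` right and up in either
    -- order gives the same result, which is the vertex condition.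
    refine functional_eq_zero_of_values (u := fun q => (Triple.dot (F.row i q) z : ℤ))
      (fun q => ?_) (fun q => ?_) fun q => ?_
    · dsimp only
      rw [(hF.trans i).up, (hF.trans i).right, (hF.trans i).right, (hF.trans i).up]
      simp only [Triple.dot_rowMul]
      rw [hD.cob j b]
    · change horValue _ q - (_ * horValue (cocycle hF (some i, 0)) q +
        _ * horValue (cocycle hF (some i, 1)) q) = _
      rw [h4.1, (represents_cocycle hF i 0).1, (represents_cocycle hF i 1).1]
      simp only [combCob, Triple.dot_comb]
      rw [← Triple.dot_rowMul, ← (hF.trans i).right]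
      push_cast
      ring
    · change verValue _ q - (_ * verValue (cocycle hF (some i, 0)) q +
        _ * verValue (cocycle hF (some i, 1)) q) = _
      rw [h4.2, (represents_cocycle hF i 0).2, (represents_cocycle hF i 1).2]
      simp only [combCob, Triple.dot_comb]
      rw [← Triple.dot_rowMul, ← (hF.trans i).up]
      push_cast
      ring
  have h6 := LinearMap.congr_fun h5 w
  rw [map_sub, map_add, map_smul, map_smul] at h6
  simp only [LinearMap.sub_apply, LinearMap.add_apply, LinearMap.smul_apply, smul_eq_mul,
    LinearMap.zero_apply, ← pathCocycle.functional_H₁map] at h6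
  have h7 : ∀ b', ((SL2.uniPi (fun j => (D.m j : ℝ)) (fun j => D.p j) (fun j => D.q j) 1 j :
      Matrix.SpecialLinearGroup (Fin 2) ℝ) : Matrix (Fin 2) (Fin 2) ℝ) b b' = D.coeff j b b' := by
    intro b'
    rw [SL2.uniPi, SL2.uni_coe, Twist.coeff]
    fin_cases b <;> fin_cases b' <;> simp <;> ring
  rw [Fin.sum_univ_two, h7, h7]
  linarith

/-! #### Maps that commute with the symmetries -/

/-- The combination of the images of `row i` under the permutations `σ` with the coefficients `c` is
`r` times `row i'`. -/
def IsCombination (F : Frame Q ι k) {s : ℕ} (σ : Fin s → Equiv.Perm Q) (c : Fin s → ℤ) (i i' : ι)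
    (r : ℤ) : Prop :=
  ∀ q, ∑ l, c l * (F.row i (σ l q)).1 = r * (F.row i' q).1 ∧
    ∑ l, c l * (F.row i (σ l q)).2.1 = r * (F.row i' q).2.1 ∧
    ∑ l, c l * (F.row i (σ l q)).2.2 = r * (F.row i' q).2.2

/-- Symmetries of the surface, a combination of them of which the cocycles of a frame are
eigenvectors with eigenvalues that distinguish the indices, and combinations of them that connect
the indices of the same type. -/
structure Symmetries (Q ι : Type) (k s : ℕ) where
  perm : Fin s → Equiv.Perm Q
  weight : Fin s → ℤ
  eigenvalue : ι → ℤ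
  base : Fin k → ι
  link : ι → Fin s → ℤ
  factor : ι → ℤ

/-- The properties of the symmetries. -/
structure Symmetries.IsFor {s : ℕ} (Y : Symmetries Q ι k s) (F : Frame Q ι k) (O : Origami Q) :
    Prop where
  commutes : ∀ l, O.Commutes (Y.perm l)
  eigen : ∀ i, F.IsCombination Y.perm Y.weight i i (Y.eigenvalue i)
  injective : Function.Injective Y.eigenvalue
  ne : ∀ i, Y.eigenvalue i ≠ ∑ l, Y.weight l
  type_base : ∀ j, F.type (Y.base j) = j
  link : ∀ i, F.IsCombination Y.perm (Y.link i) i (Y.base (F.type i)) (Y.factor i)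
  factor_ne : ∀ i, Y.factor i ≠ 0

theorem dot_sum {s : ℕ} (c : Fin s → ℤ) (r : Fin s → Triple) (x : Triple) :
    ∑ l, c l * Triple.dot (r l) x =
      Triple.dot (∑ l, c l * (r l).1, ∑ l, c l * (r l).2.1, ∑ l, c l * (r l).2.2) x := by
  simp only [Triple.dot, Finset.sum_mul, ← Finset.sum_add_distrib]
  exact Finset.sum_congr rfl fun l _ => by ring

theorem average_cocycle {s : ℕ} {σ : Fin s → Equiv.Perm Q} (hσ : ∀ l, O.Commutes (σ l))
    {c : Fin s → ℤ} {i i' : ι} {r : ℤ} (hF : F.IsFor O) (h : F.IsCombination σ c i i' r)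
    (ht : F.type i = F.type i') (b : Fin 2) :
    average σ hσ c (pathCocycle.functional _ (cocycle hF (some i, b))) =
      (r : ℝ) • pathCocycle.functional _ (cocycle hF (some i', b)) := by
  have hd : ∀ x q, ∑ l, c l * Triple.dot (F.row i (σ l q)) x = r * Triple.dot (F.row i' q) x := by
    intro x q
    obtain ⟨h1, h2, h3⟩ := h q
    rw [dot_sum, h1, h2, h3]
    simp only [Triple.dot]
    ring
  rw [average_functional, ← map_smul]
  refine functional_eq_of_values (fun q => ?_) fun q => ?_
  · rw [horValue_sum]
    change _ = (r : ℝ) * horValue (cocycle hF (some i', b)) q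
    rw [(represents_cocycle hF i' b).1, ← ht, ← Int.cast_mul, ← hd]
    push_cast
    refine Finset.sum_congr rfl fun l _ => ?_
    rw [horValue_pullback_perm (τ := σ l) (fun q z => rfl), (represents_cocycle hF i b).1]
  · rw [verValue_sum]
    change _ = (r : ℝ) * verValue (cocycle hF (some i', b)) q
    rw [(represents_cocycle hF i' b).2, ← ht, ← Int.cast_mul, ← hd]
    push_cast
    refine Finset.sum_congr rfl fun l _ => ?_
    rw [verValue_pullback_perm (τ := σ l) (fun q z => rfl), (represents_cocycle hF i b).2]

theorem average_holonomy {s : ℕ} {σ : Fin s → Equiv.Perm Q} (hσ : ∀ l, O.Commutes (σ l))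
    {c : Fin s → ℤ} (hF : F.IsFor O) (b : Fin 2) :
    average σ hσ c (pathCocycle.functional _ (cocycle hF (none, b))) =
      ((∑ l, c l : ℤ) : ℝ) • pathCocycle.functional _ (cocycle hF (none, b)) := by
  rw [average_functional, ← map_smul]
  refine functional_eq_of_values (fun q => ?_) fun q => ?_
  · rw [horValue_sum]
    change _ = _ * horValue (cocycle hF (none, b)) q
    push_cast
    rw [Finset.sum_mul]
    refine Finset.sum_congr rfl fun l _ => ?_
    rw [horValue_pullback_perm (τ := σ l) (fun q z => rfl), cocycle, horValue_cellCocycle,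
      horValue_cellCocycle]
    rfl
  · rw [verValue_sum]
    change _ = _ * verValue (cocycle hF (none, b)) q
    push_cast
    rw [Finset.sum_mul]
    refine Finset.sum_congr rfl fun l _ => ?_
    rw [verValue_pullback_perm (τ := σ l) (fun q z => rfl), cocycle, verValue_cellCocycle,
      verValue_cellCocycle]
    rfl

/-- The operator induced by `f` commutes with a combination of symmetries whose eigenspaces are the
planes of the frame, so it preserves each plane. The linking combinations identify planes of equal
type compatibly with `f`, and invariance of the intersection form fixes the determinant. -/
theorem Symmetries.IsFor.exists_actsBy [Fintype ι] {s : ℕ} {Y : Symmetries Q ι k s} (hY : Y.IsFor F O)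
    (hF : F.IsFor O) (h : SpansDual O ι) {f : O.Surface ≃ₜ O.Surface}
    {B : Matrix.SpecialLinearGroup (Fin 2) ℤ} (hB : HasLinearPart B.1 f) (hf : IsEquivariant f) :
    ∃ g, ActsBy hF f g := by
  classical
  let β := basis hF h
  -- On the holonomy classes every symmetry acts trivially, so there the eigenvalue is the sum of
  -- the weights.
  let ev : Option ι → ℤ := fun i => i.elim (∑ l, Y.weight l) Y.eigenvalue
  have hev : Function.Injective ev := by
    rintro (_ | i) (_ | i') e
    · rfl
    · exact absurd e.symm (hY.ne i')
    · exact absurd e (hY.ne i)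
    · exact congrArg some (hY.injective e)
  have hA : ∀ p, average Y.perm hY.commutes Y.weight (β p) = (ev p.1 : ℝ) • β p := by
    rintro ⟨_ | i, b⟩
    · rw [basis_apply]; exact average_holonomy _ hF b
    · rw [basis_apply]; exact average_cocycle _ hF (hY.eigen i) rfl b
  let M : ι → Matrix (Fin 2) (Fin 2) ℝ := fun i => Matrix.of fun b b' =>
    β.repr (β (some i, b) ∘ₗ H₁map (f : C(O.Surface, O.Surface))) (some i, b')
  have hM : ∀ i b, β (some i, b) ∘ₗ H₁map (f : C(O.Surface, O.Surface)) =
      ∑ b', M i b b' • β (some i, b') := by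
    intro i b
    set v := β (some i, b) ∘ₗ H₁map (f : C(O.Surface, O.Surface)) with hv
    have h1 : average Y.perm hY.commutes Y.weight v = (ev (some i) : ℝ) • v := by
      rw [hv, average_comp _ _ hf, hA, LinearMap.smul_comp]
    have h2 : ∀ p, β.repr (average Y.perm hY.commutes Y.weight v) p = ev p.1 * β.repr v p := by
      intro p
      conv_lhs => rw [← β.sum_repr v, map_sum, map_sum]
      simp only [map_smul, hA, Finsupp.coe_finsetSum, Finset.sum_apply, Finsupp.smul_apply,
        β.repr_self, Finsupp.single_apply, smul_eq_mul, mul_ite, mul_one, mul_zero,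
        Finset.sum_ite_eq', Finset.mem_univ, if_true]
      ring
    -- The image lies in the eigenspace of the index `i`, and the eigenvalues of the other indices
    -- are different.
    have h3 : ∀ p : Option ι × Fin 2, p.1 ≠ some i → β.repr v p = 0 := by
      intro p hp
      have h4 := h2 p
      rw [h1, map_smul, Finsupp.smul_apply, smul_eq_mul] at h4
      have h5 : ((ev (some i) : ℝ) - ev p.1) * β.repr v p = 0 := by linarith
      refine (mul_eq_zero.1 h5).resolve_left fun h6 => hp (hev ?_)
      exact_mod_cast (sub_eq_zero.1 h6).symm
    conv_lhs => rw [← β.sum_repr v]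
    rw [Fintype.sum_prod_type, Finset.sum_eq_single (some i)]
    · rfl
    · intro i' _ hi
      exact Finset.sum_eq_zero fun b' _ => by rw [h3 _ hi, zero_smul]
    · exact fun h => absurd (Finset.mem_univ _) h
  -- The link maps the plane `i` to the plane of the base index by a nonzero scalar in the given
  -- bases and commutes with `f`; comparing coefficients gives equal matrices.
  have hlink : ∀ i, M i = M (Y.base (F.type i)) := by
    intro i
    ext b b'
    set i' := Y.base (F.type i) with hi'
    have hL : ∀ b, average Y.perm hY.commutes (Y.link i) (β (some i, b)) =
        (Y.factor i : ℝ) • β (some i', b) := fun b => by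
      rw [basis_apply, basis_apply]
      exact average_cocycle _ hF (hY.link i) (hY.type_base _).symm b
    have h1 := average_comp hY.commutes (Y.link i) hf (β (some i, b))
    rw [hL, LinearMap.smul_comp, hM, hM, map_sum] at h1
    simp only [map_smul, hL] at h1
    have h2 := congrArg (fun v => β.repr v (some i', b')) h1
    simp only [map_sum, map_smul, Finsupp.coe_finsetSum, Finset.sum_apply, Finsupp.smul_apply,
      β.repr_self, Finsupp.single_apply, smul_eq_mul, Prod.mk.injEq, true_and, mul_ite, mul_one,
      mul_zero, Finset.sum_ite_eq', Finset.mem_univ, if_true] at h2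
    have h3 : (Y.factor i : ℝ) ≠ 0 := by exact_mod_cast hY.factor_ne i
    exact mul_right_cancel₀ h3 (h2.trans (mul_comm _ _))
  -- On a plane with a nonzero skew form, a linear map multiplies the form by its determinant.
  have hdet : ∀ i, (M i).det = 1 := by
    intro i
    have hpres := preservesForm_of_hasLinearPart hB (cocycle hF (some i, 0)) (cocycle hF (some i, 1))
    have hne : pairing (cocycle hF (some i, 0)) (cocycle hF (some i, 1)) ≠ 0 := by
      rw [pairing_cocycle]
      exact_mod_cast hF.nondegenerate _
    have hval : ∀ b κ', pairing (pathCocycle.pullback (f : C(O.Surface, O.Surface))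
        (cocycle hF (some i, b))) κ' = M i b 0 * pairing (cocycle hF (some i, 0)) κ' +
          M i b 1 * pairing (cocycle hF (some i, 1)) κ' := by
      intro b κ'
      have h1 : pathCocycle.functional _ (pathCocycle.pullback (f : C(O.Surface, O.Surface))
          (cocycle hF (some i, b)) - (M i b 0 • cocycle hF (some i, 0) +
            M i b 1 • cocycle hF (some i, 1))) = 0 := by
        ext w
        have h2 := LinearMap.congr_fun (hM i b) w
        rw [Fin.sum_univ_two] at h2
        simp only [LinearMap.comp_apply, β, basis_apply, LinearMap.add_apply,
          LinearMap.smul_apply] at h2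
        rw [map_sub, map_add, map_smul, map_smul]
        simp only [LinearMap.sub_apply, LinearMap.add_apply, LinearMap.smul_apply,
          LinearMap.zero_apply, ← pathCocycle.functional_H₁map]
        rw [h2, sub_self]
      have h3 := pairing_eq_zero h1 κ'
      change pairingLeft κ' _ = 0 at h3
      rw [map_sub, map_add, map_smul, map_smul, sub_eq_zero] at h3
      exact h3
    have hself : ∀ κ : pathCocycle O.Surface, pairing κ κ = 0 := fun κ => by
      have := pairing_swap κ κ
      linarith
    have hval' : ∀ b κ', pairing κ' (pathCocycle.pullback (f : C(O.Surface, O.Surface))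
        (cocycle hF (some i, b))) = M i b 0 * pairing κ' (cocycle hF (some i, 0)) +
          M i b 1 * pairing κ' (cocycle hF (some i, 1)) := by
      intro b κ'
      rw [pairing_swap, hval, pairing_swap κ' (cocycle hF (some i, 0)),
        pairing_swap κ' (cocycle hF (some i, 1))]
      ring
    rw [hval, hval', hval', hself, hself, pairing_swap (cocycle hF (some i, 0))] at hpres
    rw [Matrix.det_fin_two]
    refine mul_right_cancel₀ hne ?_
    linarith
  refine ⟨fun j => ⟨M (Y.base j), hdet _⟩, fun i b w => ?_⟩
  have h1 := LinearMap.congr_fun (hM i b) w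
  rw [hlink i] at h1
  simpa [β] using h1

end Frame

end Origami

/-! ### From the square-tiled surface to the monodromy group. -/

theorem continuous_torusLinear (B : Matrix (Fin 2) (Fin 2) ℤ) : Continuous (torusLinear B) :=
  continuous_pi fun i => by
    simp only [torusLinear]
    fun_prop

theorem H₁map_symm_H₁map {S S' : Type} [TopologicalSpace S] [TopologicalSpace S'] (Ψ : S ≃ₜ S')
    (w : H₁ S) : H₁map (Ψ.symm : C(S', S)) (H₁map (Ψ : C(S, S')) w) = w := by
  rw [← H₁map_comp]
  conv_rhs => rw [← H₁map_id w]
  congr 2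
  ext s
  simp

namespace LatticePolygons

variable {n : ℕ} [NeZero n] {X : LatticePolygons n} {Q : Type} {O : Origami Q}

/-- The map of a surface has the given integral linear part. -/
def HasLinearPart (B : Matrix (Fin 2) (Fin 2) ℤ) (f : X.Surface ≃ₜ X.Surface) : Prop :=
  ∀ s, X.toTorus (f s) = torusLinear B (X.toTorus s)

theorem HasLinearPart.mem_zeroHolonomy {B : Matrix (Fin 2) (Fin 2) ℤ} {f : X.Surface ≃ₜ X.Surface}
    (hf : HasLinearPart B f) {w : H₁ X.Surface} (hw : w ∈ X.zeroHolonomy) :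
    H₁map (f : C(X.Surface, X.Surface)) w ∈ X.zeroHolonomy := by
  have e : X.toTorus.comp (f : C(X.Surface, X.Surface)) =
      (⟨torusLinear B, continuous_torusLinear B⟩ : C(_, _)).comp X.toTorus :=
    ContinuousMap.ext hf
  change H₁map X.toTorus _ = 0
  rw [← H₁map_comp, e, H₁map_comp]
  have : H₁map X.toTorus w = 0 := hw
  rw [this, map_zero]

/-- All affine homeomorphisms of `X` have an integral linear part of determinant one. -/
def IsIntegral (X : LatticePolygons n) : Prop :=
  ∀ f ∈ X.Aff, ∃ B : Matrix.SpecialLinearGroup (Fin 2) ℤ, HasLinearPart B.1 f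

namespace IsIntegral

theorem H₁map_mem (hX : X.IsIntegral) (f : X.Aff) (w : X.zeroHolonomy) :
    H₁map ((f : X.Surface ≃ₜ X.Surface) : C(X.Surface, X.Surface)) (w : H₁ X.Surface) ∈ X.zeroHolonomy :=
  (hX f f.2).choose_spec.mem_zeroHolonomy w.2

/-- The endomorphism of the zero-holonomy subspace induced by an affine homeomorphism. -/
noncomputable def actionMap (hX : X.IsIntegral) (f : X.Aff) : X.zeroHolonomy →ₗ[ℝ] X.zeroHolonomy :=
  (H₁map ((f : X.Surface ≃ₜ X.Surface) : C(X.Surface, X.Surface))).restrict fun w hw =>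
    hX.H₁map_mem f ⟨w, hw⟩

theorem coe_actionMap (hX : X.IsIntegral) (f : X.Aff) (w : X.zeroHolonomy) :
    (hX.actionMap f w : H₁ X.Surface) =
      H₁map ((f : X.Surface ≃ₜ X.Surface) : C(X.Surface, X.Surface)) (w : H₁ X.Surface) := rfl

theorem actionMap_mul (hX : X.IsIntegral) (f f' : X.Aff) :
    hX.actionMap (f * f') = hX.actionMap f ∘ₗ hX.actionMap f' := by
  ext w
  rw [LinearMap.comp_apply, coe_actionMap, coe_actionMap, coe_actionMap, ← H₁map_comp]
  rfl

theorem actionMap_one (hX : X.IsIntegral) : hX.actionMap 1 = LinearMap.id := by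
  ext w
  exact H₁map_id _

/-- The action of the affine group on the zero-holonomy subspace. -/
noncomputable def action (hX : X.IsIntegral) : X.Aff →* (X.zeroHolonomy ≃ₗ[ℝ] X.zeroHolonomy) where
  toFun f := LinearEquiv.ofLinearMap (hX.actionMap f) (hX.actionMap f⁻¹)
    (by rw [← actionMap_mul, mul_inv_cancel, actionMap_one])
    (by rw [← actionMap_mul, inv_mul_cancel, actionMap_one])
  map_one' := LinearEquiv.toLinearMap_injective hX.actionMap_one
  map_mul' f f' := LinearEquiv.toLinearMap_injective (hX.actionMap_mul f f')

theorem homologyAction_eq (hX : X.IsIntegral) {Γ : Subgroup (X.Surface ≃ₜ X.Surface)}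
    (hΓ : Γ ≤ X.Aff) : X.homologyAction Γ = (Γ.subgroupOf X.Aff).map hX.action := by
  ext g
  constructor
  · rintro ⟨f, hf, h⟩
    refine ⟨⟨f, hΓ hf⟩, hf, LinearEquiv.ext fun w => Subtype.ext ?_⟩
    exact (h w).symm
  · rintro ⟨f, hf, rfl⟩
    exact ⟨f, hf, fun w => rfl⟩

/-- The element `a` is invisible in the torus and `f` acts there through its linear part, so the
conjugate is invisible as well. -/
theorem conj_mem_Aut (hX : X.IsIntegral) {f a : X.Surface ≃ₜ X.Surface} (hf : f ∈ X.Aff)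
    (ha : a ∈ X.Aut) : f * a * f⁻¹ ∈ X.Aut := by
  obtain ⟨B, hB⟩ := hX f hf
  intro s
  change X.toTorus (f (a (f.symm s))) = X.toTorus s
  rw [hB, ha, ← hB, f.apply_symm_apply]

/-- The affine group normalizes the finite group Aut(X), and the centralizer is the kernel of the
conjugation action, whose image lies in a finite automorphism group. -/
theorem isFiniteRelIndex (hX : X.IsIntegral) [Finite X.Aut] : X.AffCentral.IsFiniteRelIndex X.Aff := by
  have h1 : X.Aff ≤ Subgroup.normalizer (X.Aut : Set (X.Surface ≃ₜ X.Surface)) := by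
    intro f hf
    rw [Subgroup.mem_normalizer_iff]
    refine fun a => ⟨hX.conj_mem_Aut hf, fun h => ?_⟩
    have := hX.conj_mem_Aut (X.Aff.inv_mem hf) h
    simpa [mul_assoc] using this
  have h2 : (Subgroup.centralizer (X.Aut : Set (X.Surface ≃ₜ X.Surface))).IsFiniteRelIndex
      (Subgroup.normalizer (X.Aut : Set (X.Surface ≃ₜ X.Surface))) := by
    refine ⟨?_⟩
    rw [Subgroup.relIndex, ← Subgroup.normalizerMonoidHom_ker]
    have : Finite (MulAut X.Aut) := Finite.of_injective (fun e : MulAut X.Aut => (e : X.Aut → X.Aut))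
      DFunLike.coe_injective
    exact Subgroup.FiniteIndex.index_ne_zero
  have h3 := Subgroup.isFiniteRelIndex_of_le_right
    (Subgroup.centralizer (X.Aut : Set (X.Surface ≃ₜ X.Surface))) h1
  refine ⟨?_⟩
  rw [AffCentral, Subgroup.inf_relIndex_left]
  exact h3.relIndex_ne_zero

theorem isFiniteRelIndex_homologyAction (hX : X.IsIntegral) [Finite X.Aut] :
    (X.homologyAction X.AffCentral).IsFiniteRelIndex X.monodromyGroup := by
  have h := hX.isFiniteRelIndex
  rw [monodromyGroup, hX.homologyAction_eq le_rfl, hX.homologyAction_eq (Γ := X.AffCentral) inf_le_left,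
    Subgroup.subgroupOf_self]
  refine ⟨?_⟩
  rw [Subgroup.relIndex_map_map]
  have h1 : (X.AffCentral.subgroupOf X.Aff).IsFiniteRelIndex ⊤ := ⟨by
    rw [Subgroup.relIndex_top_right]; exact h.relIndex_ne_zero⟩
  have h2 : (X.AffCentral.subgroupOf X.Aff ⊔ hX.action.ker).IsFiniteRelIndex ⊤ :=
    Subgroup.isFiniteRelIndex_of_le_left _ le_sup_left
  rw [top_sup_eq]
  exact h2.relIndex_ne_zero

end IsIntegral

/-! #### Comparison with a square-tiled surface -/

section Origami

variable (Ψ : X.Surface ≃ₜ O.Surface)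

/-- The homeomorphism of the square-tiled surface that corresponds to a homeomorphism of `X`. -/
def conj (f : X.Surface ≃ₜ X.Surface) : O.Surface ≃ₜ O.Surface := (Ψ.symm.trans f).trans Ψ

variable {Ψ}

theorem hasLinearPart_conj (hΨ : ∀ s, O.toTorus (Ψ s) = X.toTorus s)
    {B : Matrix (Fin 2) (Fin 2) ℤ} {f : X.Surface ≃ₜ X.Surface} :
    Origami.HasLinearPart B (conj Ψ f) ↔ HasLinearPart B f := by
  constructor
  · intro h s
    have := h (Ψ s)
    change O.toTorus (Ψ (f (Ψ.symm (Ψ s)))) = _ at this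
    rwa [Ψ.symm_apply_apply, hΨ, hΨ] at this
  · intro h s
    obtain ⟨s, rfl⟩ := Ψ.surjective s
    change O.toTorus (Ψ (f (Ψ.symm (Ψ s)))) = _
    rw [Ψ.symm_apply_apply, hΨ, hΨ, h]

theorem isIntegral [Finite X.Cell] (hΨ : ∀ s, O.toTorus (Ψ s) = X.toTorus s)
    (hO : O.IsRigid) : X.IsIntegral := by
  have := Ψ.symm.t2Space
  rintro f ⟨A, hA⟩
  have h1 := hA.isLocallyAffine.conj Ψ hΨ
  obtain ⟨B, hB⟩ := hO.exists_hasLinearPart (f := conj Ψ f) h1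
  exact ⟨B, (hasLinearPart_conj hΨ).1 hB⟩

theorem mem_Aff_of_hasLinearPart [Finite X.Cell] (Ψ : X.Surface ≃ₜ O.Surface)
    {B : Matrix.SpecialLinearGroup (Fin 2) ℤ}
    {f : X.Surface ≃ₜ X.Surface} (hf : HasLinearPart B.1 f) : f ∈ X.Aff := by
  have := Ψ.symm.t2Space
  refine ⟨Matrix.SpecialLinearGroup.map (Int.castRingHom ℝ) B, isAffine_of_isLocallyAffine ?_⟩
  exact isLocallyAffine_of_torusLinear hf

theorem exists_perm_of_mem_Aut (hΨ : ∀ s, O.toTorus (Ψ s) = X.toTorus s)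
    {a : X.Surface ≃ₜ X.Surface} (ha : a ∈ X.Aut) :
    ∃ (τ : Equiv.Perm Q) (h : O.Commutes τ), ∀ s, conj Ψ a s = Origami.permMap τ h s :=
  Origami.exists_eq_permMap fun s => by
    change O.toTorus (Ψ (a (Ψ.symm s))) = _
    rw [hΨ, ha, ← hΨ, Ψ.apply_symm_apply]

/-- A deck transformation is determined by its permutation of the finitely many squares. -/
theorem finite_Aut [Finite Q] (hΨ : ∀ s, O.toTorus (Ψ s) = X.toTorus s) : Finite X.Aut := by
  choose τ h1 h2 using fun a : X.Aut => exists_perm_of_mem_Aut hΨ a.2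
  refine Finite.of_injective τ fun a a' e => Subtype.ext (Homeomorph.ext fun s => ?_)
  have h3 := h2 a (Ψ s)
  have h4 := h2 a' (Ψ s)
  have h5 : Origami.permMap (τ a) (h1 a) (Ψ s) = Origami.permMap (τ a') (h1 a') (Ψ s) := by
    congr 2
  rw [← h3, ← h4] at h5
  have h6 := Ψ.injective h5
  simpa using h6

theorem isEquivariant_conj_iff (hΨ : ∀ s, O.toTorus (Ψ s) = X.toTorus s)
    {f : X.Surface ≃ₜ X.Surface} :
    Origami.IsEquivariant (conj Ψ f) ↔
      f ∈ Subgroup.centralizer (X.Aut : Set (X.Surface ≃ₜ X.Surface)) := by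
  rw [Subgroup.mem_centralizer_iff]
  constructor
  · intro h a ha
    obtain ⟨τ, hτ, e⟩ := exists_perm_of_mem_Aut hΨ ha
    refine Homeomorph.ext fun s => Ψ.injective ?_
    have h1 := h.2 τ hτ hτ (Ψ s)
    rw [← e, ← e] at h1
    simpa [conj] using h1.symm
  · intro h
    refine ⟨fun τ => Iff.rfl, fun τ hτ _ s => ?_⟩
    have ha : (Ψ.trans (Origami.permHomeo τ hτ)).trans Ψ.symm ∈ X.Aut := fun s => by
      rw [← hΨ]
      simp [Origami.toTorus_permHomeo, hΨ]
    have h1 := congrArg (fun g : X.Surface ≃ₜ X.Surface => Ψ (g (Ψ.symm s))) (h _ ha)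
    have h2 : Ψ (f (Ψ.symm (Origami.permHomeo τ hτ s))) =
        Origami.permHomeo τ hτ (Ψ (f (Ψ.symm s))) := by simpa using h1.symm
    exact h2

variable [Fintype Q] {ι : Type} {k : ℕ} {F : Origami.Frame Q ι k}

theorem mem_zeroHolonomy_iff [Fintype ι] (hΨ : ∀ s, O.toTorus (Ψ s) = X.toTorus s) (hF : F.IsFor O) (h : Origami.Frame.SpansDual O ι)
    (w : H₁ X.Surface) : w ∈ X.zeroHolonomy ↔
      ∀ b, Origami.Frame.coords hF h (H₁map (Ψ : C(X.Surface, O.Surface)) w) (none, b) = 0 := by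
  have e : X.toTorus = O.toTorus.comp (Ψ : C(X.Surface, O.Surface)) :=
    ContinuousMap.ext fun s => (hΨ s).symm
  change H₁map X.toTorus w = 0 ↔ _
  rw [e, H₁map_comp, Origami.H₁map_toTorus_eq_zero_iff]
  simp only [Origami.Frame.coords_apply, Origami.Frame.functional_cocycle_none]

/-- The coordinates on the zero-holonomy subspace given by a frame. -/
theorem exists_coords [Fintype ι] (hΨ : ∀ s, O.toTorus (Ψ s) = X.toTorus s) (hF : F.IsFor O) (h : Origami.Frame.SpansDual O ι) :
    ∃ Φ : X.zeroHolonomy ≃ₗ[ℝ] (ι × Fin 2 → ℝ), ∀ w i b, Φ w (i, b) =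
      pathCocycle.functional _ (Origami.Frame.cocycle hF (some i, b))
        (H₁map (Ψ : C(X.Surface, O.Surface)) (w : H₁ X.Surface)) := by
  let L : X.zeroHolonomy →ₗ[ℝ] (ι × Fin 2 → ℝ) :=
    LinearMap.pi fun p => pathCocycle.functional _ (Origami.Frame.cocycle hF (some p.1, p.2)) ∘ₗ
      H₁map (Ψ : C(X.Surface, O.Surface)) ∘ₗ X.zeroHolonomy.subtype
  refine ⟨LinearEquiv.ofBijective L ⟨?_, fun v => ?_⟩, fun w i b => rfl⟩
  · rw [injective_iff_map_eq_zero]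
    intro w hw
    have h1 : Origami.Frame.coords hF h (H₁map (Ψ : C(X.Surface, O.Surface)) (w : H₁ X.Surface)) = 0 := by
      funext ⟨i, b⟩
      rcases i with _ | i
      · exact (mem_zeroHolonomy_iff hΨ hF h w).1 w.2 b
      · exact congrFun hw (i, b)
    rw [LinearEquiv.map_eq_zero_iff] at h1
    refine Subtype.ext ?_
    rw [← H₁map_symm_H₁map Ψ (w : H₁ X.Surface), h1, map_zero]
    rfl
  · let v' : Option ι × Fin 2 → ℝ := fun p => p.1.elim 0 fun i => v (i, p.2)
    let w' := (Origami.Frame.coords hF h).symm v'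
    let w := H₁map (Ψ.symm : C(O.Surface, X.Surface)) w'
    have hw : H₁map (Ψ : C(X.Surface, O.Surface)) w = w' := H₁map_symm_H₁map Ψ.symm w'
    have hv : Origami.Frame.coords hF h (H₁map (Ψ : C(X.Surface, O.Surface)) w) = v' := by
      rw [hw, LinearEquiv.apply_symm_apply]
    refine ⟨⟨w, (mem_zeroHolonomy_iff hΨ hF h w).2 fun b => by rw [hv]; rfl⟩, ?_⟩
    funext ⟨i, b⟩
    exact congrFun hv (some i, b)

theorem eq_blockAction_of_actsBy {hF : F.IsFor O} {Φ : X.zeroHolonomy ≃ₗ[ℝ] (ι × Fin 2 → ℝ)}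
    (hΦ : ∀ w i b, Φ w (i, b) = pathCocycle.functional _ (Origami.Frame.cocycle hF (some i, b))
      (H₁map (Ψ : C(X.Surface, O.Surface)) (w : H₁ X.Surface)))
    {f : X.Surface ≃ₜ X.Surface} {g : Fin k → Matrix.SpecialLinearGroup (Fin 2) ℝ}
    (hfg : Origami.Frame.ActsBy hF (conj Ψ f) g) {w w' : X.zeroHolonomy}
    (hw : (w' : H₁ X.Surface) = H₁map (f : C(X.Surface, X.Surface)) (w : H₁ X.Surface)) :
    w' = blockAction F.type Φ g w := by
  refine Φ.injective (funext fun ⟨i, b⟩ => ?_)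
  have e : (Ψ : C(X.Surface, O.Surface)).comp (f : C(X.Surface, X.Surface)) =
      (conj Ψ f : C(O.Surface, O.Surface)).comp (Ψ : C(X.Surface, O.Surface)) := by
    ext s
    simp [conj]
  rw [coord_blockAction, blockEnd_apply, hΦ, hw, ← H₁map_comp, e, H₁map_comp, hfg]
  simp only [hΦ]

/-- The monodromy of a translation surface whose cohomology splits under its symmetries into
two-dimensional pieces on which enough twists are known. -/
theorem hasMonodromySL2Pow [Fintype ι] [Finite X.Cell] (hΨ : ∀ s, O.toTorus (Ψ s) = X.toTorus s)
    (hO : O.IsRigid) (hF : F.IsFor O) (h : Origami.Frame.SpansDual O ι) {s : ℕ}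
    {Y : Origami.Frame.Symmetries Q ι k s} (hY : Y.IsFor F O) {r : ℕ}
    {D : Fin r → Origami.Frame.Twist k} (hD : ∀ l, (D l).IsFor F O)
    (hgen : ∀ G : Subgroup (Fin k → Matrix.SpecialLinearGroup (Fin 2) ℝ),
      (∀ l s, SL2.uniPi (fun j => ((D l).m j : ℝ)) (fun j => (D l).p j) (fun j => (D l).q j) s ∈ G) →
        G = ⊤) : HasMonodromySL2Pow X k := by
  classical
  have hX : X.IsIntegral := isIntegral hΨ hO
  have := finite_Aut hΨ
  have hfin := hX.isFiniteRelIndex_homologyAction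
  obtain ⟨Φ, hΦ⟩ := exists_coords hΨ hF h
  have hle : X.homologyAction X.AffCentral ≤ X.monodromyGroup := fun g ⟨f, hf, e⟩ => ⟨f, hf.1, e⟩
  -- Upper bound: an element of Aff_*(X) has an integral linear part and commutes with all
  -- symmetries, so it acts by blocks of determinant one.
  have hup : X.homologyAction X.AffCentral ≤ (blockAction F.type Φ).range := by
    rintro g ⟨f, ⟨hf, hf'⟩, e⟩
    obtain ⟨B, hB⟩ := hX f hf
    obtain ⟨g', hg'⟩ := hY.exists_actsBy hF h ((hasLinearPart_conj hΨ).2 hB)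
      ((isEquivariant_conj_iff hΨ).2 hf')
    exact ⟨g', LinearEquiv.ext fun w => (eq_blockAction_of_actsBy hΦ hg' (e w)).symm⟩
  -- Lower bound: the twists, carried over to `X`, belong to Aff_*(X), and the closure contains
  -- their one-parameter groups; `hgen` then applies.
  have hlow : (zariskiClosure (X.homologyAction X.AffCentral)).comap (blockAction F.type Φ) = ⊤ := by
    refine hgen _ fun l => uniPi_mem_zariskiClosure ?_
    obtain ⟨f₀, ⟨B, hB⟩, heq, hact⟩ := (hD l).exists_actsBy hF
    let f : X.Surface ≃ₜ X.Surface := (Ψ.trans f₀).trans Ψ.symm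
    have hf : conj Ψ f = f₀ := by
      ext s
      simp [conj, f]
    rw [← hf] at hB heq hact
    have hB' := (hasLinearPart_conj hΨ).1 hB
    refine ⟨f, ⟨mem_Aff_of_hasLinearPart Ψ hB', (isEquivariant_conj_iff hΨ).1 heq⟩, fun w => ?_⟩
    rw [← eq_blockAction_of_actsBy hΦ hact (w := w)
      (w' := ⟨_, hB'.mem_zeroHolonomy w.2⟩) rfl]
  obtain ⟨h1, h2, h3⟩ := zariskiClosure_of_blockAction
    (fun j => ⟨Y.base j, hY.type_base j⟩) hle hup hlow
  exact ⟨h1, h2, hX.isFiniteRelIndex, h3⟩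

end Origami

end LatticePolygons

namespace Origami

open unitInterval

variable {Q : Type} {O : Origami Q}

/-! #### Surfaces laid out in half squares -/

/-- The lower left (`false`) and the upper right (`true`) half of the unit square. -/
def InHalf : Bool → I × I → Prop
  | false, h => (h.1 + h.2 : ℝ) ≤ 1
  | true, h => 1 ≤ (h.1 + h.2 : ℝ)

/-- The vertical projection of the unit square to one of its halves. -/
noncomputable def toHalf : Bool → I × I → I × I
  | false, h => (h.1, min h.2 (unitInterval.symm h.1))
  | true, h => (h.1, max h.2 (unitInterval.symm h.1))

theorem continuous_toHalf (b : Bool) : Continuous (toHalf b) := by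
  cases b
  · exact continuous_fst.prodMk (continuous_snd.min (unitInterval.continuous_symm.comp continuous_fst))
  · exact continuous_fst.prodMk (continuous_snd.max (unitInterval.continuous_symm.comp continuous_fst))

theorem inHalf_toHalf (b : Bool) (h : I × I) : InHalf b (toHalf b h) := by
  cases b
  · change (h.1 : ℝ) + ((min h.2 (unitInterval.symm h.1) : I) : ℝ) ≤ 1
    have h1 : ((min h.2 (unitInterval.symm h.1) : I) : ℝ) ≤ (unitInterval.symm h.1 : ℝ) :=
      Subtype.coe_le_coe.2 (min_le_right _ _)
    rw [unitInterval.coe_symm_eq] at h1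
    linarith
  · change 1 ≤ (h.1 : ℝ) + ((max h.2 (unitInterval.symm h.1) : I) : ℝ)
    have h1 : (unitInterval.symm h.1 : ℝ) ≤ ((max h.2 (unitInterval.symm h.1) : I) : ℝ) :=
      Subtype.coe_le_coe.2 (le_max_right _ _)
    rw [unitInterval.coe_symm_eq] at h1
    linarith

theorem toHalf_of_inHalf {b : Bool} {h : I × I} (hh : InHalf b h) : toHalf b h = h := by
  cases b
  · have h1 : h.2 ≤ unitInterval.symm h.1 := Subtype.coe_le_coe.1 (by
      rw [unitInterval.coe_symm_eq]
      have : (h.1 + h.2 : ℝ) ≤ 1 := hh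
      linarith)
    exact Prod.ext rfl (min_eq_left h1)
  · have h1 : unitInterval.symm h.1 ≤ h.2 := Subtype.coe_le_coe.1 (by
      rw [unitInterval.coe_symm_eq]
      have : 1 ≤ (h.1 + h.2 : ℝ) := hh
      linarith)
    exact Prod.ext rfl (max_eq_left h1)

/-- The point of the plane with the coordinates `h` in the unit square at `z`. -/
def pos (z : ℤ × ℤ) (h : I × I) : Fin 2 → ℝ := ![z.1 + h.1, z.2 + h.2]

theorem continuous_pos (z : ℤ × ℤ) : Continuous (pos z) := by
  refine continuous_pi fun i => ?_
  fin_cases i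
  · exact continuous_const.add (continuous_subtype_val.comp continuous_fst)
  · exact continuous_const.add (continuous_subtype_val.comp continuous_snd)

/-- The coordinates in the unit square at `z` of a point of the plane. -/
noncomputable def localCoord (z : ℤ × ℤ) (x : Fin 2 → ℝ) : I × I := (clamp (x 0 - z.1), clamp (x 1 - z.2))

theorem localCoord_pos (z : ℤ × ℤ) (h : I × I) : localCoord z (pos z h) = h := by
  simp [localCoord, pos]

theorem continuous_localCoord (z : ℤ × ℤ) : Continuous (localCoord z) :=
  (continuous_clamp.comp (by fun_prop)).prodMk (continuous_clamp.comp (by fun_prop))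

/-- The lattice point given by a corner of the unit square. -/
def cornerVec (v : Bool × Bool) : ℤ × ℤ := (if v.1 then 1 else 0, if v.2 then 1 else 0)

/-- The corners of the two halves of the unit square. -/
def IsCorner : Bool → Bool × Bool → Prop
  | false, v => v ≠ (true, true)
  | true, v => v ≠ (false, false)

instance (b : Bool) (v : Bool × Bool) : Decidable (IsCorner b v) := by
  cases b <;> unfold IsCorner <;> infer_instance

/-- A square with its lower left corner at the corner `v` of the square `q`. -/
def cornerSquare (O : Origami Q) (q : Q) : Bool × Bool → Q
  | (false, false) => q
  | (true, false) => O.right q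
  | (false, true) => O.up q
  | (true, true) => O.up (O.right q)

/-- The corner of the unit square as a point. -/
def cornerPoint (v : Bool × Bool) : I × I := (if v.1 then 1 else 0, if v.2 then 1 else 0)

theorem square_cornerPoint (q : Q) (v : Bool × Bool) :
    O.square q (cornerPoint v) = O.square (O.cornerSquare q v) (0, 0) := by
  rcases v with ⟨_ | _, _ | _⟩
  · rfl
  · exact square_up _ _ _
  · exact square_right _ _ _
  · exact (square_right _ _ _).trans (square_up _ _ _)

/-- The commutator of the two permutations, which turns once around a vertex. -/
def turn (O : Origami Q) (q : Q) : Q := O.right (O.up (O.right.symm (O.up.symm q)))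

theorem square_turn (q : Q) : O.square (O.turn q) (0, 0) = O.square q (0, 0) := by
  have h := square_cornerPoint (O := O) (O.right.symm (O.up.symm q)) (true, true)
  have h' := (square_up O (O.right.symm (O.up.symm q)) 1).trans (square_right O _ 0)
  rw [cornerSquare, Equiv.apply_symm_apply, Equiv.apply_symm_apply] at h
  exact h'.symm.trans h

theorem square_iterate_turn (m : ℕ) (q : Q) : O.square (O.turn^[m] q) (0, 0) = O.square q (0, 0) := by
  induction m generalizing q with
  | zero => rfl
  | succ m ih => rw [Function.iterate_succ_apply, ih, square_turn]

/-- A layout of polygons with the given corners, glued along their sides as given by `next`, in half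
squares: the half `b` of the square `q` is placed in the polygon `cell b q` with its square at
`offset b q`. The numbers `lower` and `upper` bound the coordinates `x`, `y` and `x + y` on the
polygons. -/
structure Layout (n M : ℕ) (Q : Type) where
  corner : Fin M → Fin n → ℤ × ℤ
  next : Fin M → Fin n → Fin M × Fin n
  cell : Bool → Q → Fin M
  offset : Bool → Q → ℤ × ℤ
  lower : Fin M → ℤ × ℤ × ℤ
  upper : Fin M → ℤ × ℤ × ℤ

/-- The three kinds of sides of half squares, as sides of the lower left half. -/
def lowerSide : Fin 3 → (Bool × Bool) × (Bool × Bool) :=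
  ![((false, false), (true, false)), ((false, false), (false, true)), ((true, false), (false, true))]

/-- The three kinds of sides of half squares, as sides of the upper right half. -/
def upperSide : Fin 3 → (Bool × Bool) × (Bool × Bool) :=
  ![((false, true), (true, true)), ((true, false), (true, true)), ((true, false), (false, true))]

/-- The square whose upper right half is adjacent to the lower left half of `q`. -/
def below (O : Origami Q) : Fin 3 → Q → Q := ![O.up.symm, O.right.symm, id]

/-- The point that divides the segment between two corners of the unit square in the ratio `t`. -/
noncomputable def sidePoint (e : (Bool × Bool) × (Bool × Bool)) (t : I) : I × I :=
  (lerp (cornerPoint e.1).1 (cornerPoint e.2).1 t, lerp (cornerPoint e.1).2 (cornerPoint e.2).2 t)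

theorem square_sidePoint (d : Fin 3) (q : Q) (t : I) :
    O.square q (sidePoint (lowerSide d) t) = O.square (O.below d q) (sidePoint (upperSide d) t) := by
  fin_cases d
  · have h := square_up O (O.up.symm q) t
    rw [Equiv.apply_symm_apply] at h
    simpa [sidePoint, lowerSide, upperSide, below, cornerPoint] using h.symm
  · have h := square_right O (O.right.symm q) t
    rw [Equiv.apply_symm_apply] at h
    simpa [sidePoint, lowerSide, upperSide, below, cornerPoint] using h.symm
  · rfl

theorem inHalf_lowerSide (d : Fin 3) (t : I) : InHalf false (sidePoint (lowerSide d) t) := by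
  have h1 := t.2.2
  fin_cases d <;> simp [sidePoint, lowerSide, cornerPoint, coe_lerp, InHalf, h1]

theorem inHalf_upperSide (d : Fin 3) (t : I) : InHalf true (sidePoint (upperSide d) t) := by
  have h0 := t.2.1
  fin_cases d <;> simp [sidePoint, upperSide, cornerPoint, coe_lerp, InHalf, h0]

/-- A lattice point as a point of the plane. -/
def latticePoint (z : ℤ × ℤ) : Fin 2 → ℝ := ![z.1, z.2]

theorem pos_cornerPoint (z : ℤ × ℤ) (v : Bool × Bool) :
    pos z (cornerPoint v) = latticePoint (z + cornerVec v) := by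
  rcases v with ⟨_ | _, _ | _⟩ <;> simp [pos, cornerPoint, cornerVec, latticePoint]

theorem latticePoint_injective : Function.Injective latticePoint := fun z w h => by
  have h0 := congrFun h 0
  have h1 := congrFun h 1
  simp only [latticePoint, Matrix.cons_val_zero, Matrix.cons_val_one, Int.cast_inj] at h0 h1
  exact Prod.ext h0 h1

theorem pos_sidePoint (z : ℤ × ℤ) (e : (Bool × Bool) × (Bool × Bool)) (t : I) :
    pos z (sidePoint e t) = (1 - t : ℝ) • latticePoint (z + cornerVec e.1) +
      (t : ℝ) • latticePoint (z + cornerVec e.2) := by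
  rw [← pos_cornerPoint, ← pos_cornerPoint]
  funext i
  fin_cases i <;> simp [pos, sidePoint, coe_lerp] <;> ring

theorem inHalf_cornerPoint {b : Bool} {v : Bool × Bool} (h : InHalf b (cornerPoint v)) :
    IsCorner b v := by
  rcases b with _ | _ <;> rcases v with ⟨_ | _, _ | _⟩ <;> simp [IsCorner] <;>
    norm_num [InHalf, cornerPoint] at h

namespace Layout

variable {n M : ℕ} [NeZero n] (Λ : Layout n M Q)

/-- The side `j` of the polygon `i` is the segment between `A` and `B`, and the gluing takes the point
`A` to the point `A'` of the polygon `i'`. -/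
def Across (i : Fin M) (A B : ℤ × ℤ) (i' : Fin M) (A' : ℤ × ℤ) (j : Fin n) : Prop :=
  ((Λ.corner i j = A ∧ Λ.corner i (j + 1) = B) ∨ (Λ.corner i j = B ∧ Λ.corner i (j + 1) = A)) ∧
    (Λ.next i j).1 = i' ∧ Λ.corner i' ((Λ.next i j).2 + 1) - Λ.corner i j = A' - A

instance (i : Fin M) (A B : ℤ × ℤ) (i' : Fin M) (A' : ℤ × ℤ) (j : Fin n) :
    Decidable (Λ.Across i A B i' A' j) := by
  unfold Across; infer_instance

/-- The combinatorial conditions for the half squares to be a subdivision of the polygons that is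
compatible with the gluings. -/
structure IsFor (O : Origami Q) : Prop where
  -- A corner of a half square is the midpoint of two possibly equal corners of the polygon. Proper
  -- midpoints occur at the centers of the hexagons.
  mem : ∀ b q v, IsCorner b v → ∃ j j', Λ.corner (Λ.cell b q) j + Λ.corner (Λ.cell b q) j' =
    (Λ.offset b q + cornerVec v) + (Λ.offset b q + cornerVec v)
  bounds : ∀ i j, ((Λ.lower i).1 ≤ (Λ.corner i j).1 ∧ (Λ.corner i j).1 ≤ (Λ.upper i).1) ∧
    ((Λ.lower i).2.1 ≤ (Λ.corner i j).2 ∧ (Λ.corner i j).2 ≤ (Λ.upper i).2.1) ∧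
    ((Λ.lower i).2.2 ≤ (Λ.corner i j).1 + (Λ.corner i j).2 ∧
      (Λ.corner i j).1 + (Λ.corner i j).2 ≤ (Λ.upper i).2.2)
  -- The barycenter of the corners satisfies all six inequalities strictly; it is the point towards
  -- which boundary points are moved.
  center : ∀ i, (n * (Λ.lower i).1 < ∑ j, (Λ.corner i j).1 ∧ ∑ j, (Λ.corner i j).1 < n * (Λ.upper i).1) ∧
    (n * (Λ.lower i).2.1 < ∑ j, (Λ.corner i j).2 ∧ ∑ j, (Λ.corner i j).2 < n * (Λ.upper i).2.1) ∧
    (n * (Λ.lower i).2.2 < ∑ j, ((Λ.corner i j).1 + (Λ.corner i j).2) ∧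
      ∑ j, ((Λ.corner i j).1 + (Λ.corner i j).2) < n * (Λ.upper i).2.2)
  width : ∀ i, (Λ.upper i).1 ≤ (Λ.lower i).1 + 2 ∧ (Λ.upper i).2.1 ≤ (Λ.lower i).2.1 + 2
  -- By `width` at most two unit squares fit in each coordinate direction, so these four positions
  -- with two halves each exhaust the polygon.
  cover : ∀ i (u v : Fin 2) (b : Bool), (Λ.lower i).1 + (u : ℕ) < (Λ.upper i).1 →
    (Λ.lower i).2.1 + (v : ℕ) < (Λ.upper i).2.1 →
    (Λ.lower i).2.2 ≤ (Λ.lower i).1 + (u : ℕ) + ((Λ.lower i).2.1 + (v : ℕ)) + b.toNat →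
    (Λ.lower i).1 + (u : ℕ) + ((Λ.lower i).2.1 + (v : ℕ)) + b.toNat < (Λ.upper i).2.2 →
    ∃ q, Λ.cell b q = i ∧ Λ.offset b q = ((Λ.lower i).1 + (u : ℕ), (Λ.lower i).2.1 + (v : ℕ))
  join : ∀ d q, (Λ.cell false q = Λ.cell true (O.below d q) ∧
      Λ.offset false q + cornerVec (lowerSide d).1 =
        Λ.offset true (O.below d q) + cornerVec (upperSide d).1) ∨
    ∃ j, Λ.Across (Λ.cell false q) (Λ.offset false q + cornerVec (lowerSide d).1)
      (Λ.offset false q + cornerVec (lowerSide d).2) (Λ.cell true (O.below d q))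
      (Λ.offset true (O.below d q) + cornerVec (upperSide d).1) j
  side : ∀ i j, ∃ d q, (Λ.cell false q = i ∧ Λ.Across i
      (Λ.offset false q + cornerVec (lowerSide d).1)
      (Λ.offset false q + cornerVec (lowerSide d).2) (Λ.cell true (O.below d q))
      (Λ.offset true (O.below d q) + cornerVec (upperSide d).1) j) ∨
    (Λ.cell true (O.below d q) = i ∧ Λ.Across i
      (Λ.offset true (O.below d q) + cornerVec (upperSide d).1)
      (Λ.offset true (O.below d q) + cornerVec (upperSide d).2) (Λ.cell false q)
      (Λ.offset false q + cornerVec (lowerSide d).1) j)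
  unique : ∀ b q q', Λ.cell b q = Λ.cell b q' → Λ.offset b q = Λ.offset b q' → q = q'
  adjacent : ∀ q q', Λ.cell false q = Λ.cell true q' →
    (Λ.offset false q = Λ.offset true q' → q = q') ∧
    (Λ.offset false q = Λ.offset true q' + (1, 0) → q = O.right q') ∧
    (Λ.offset false q = Λ.offset true q' + (0, 1) → q = O.up q')
  -- Lattice points shared by several half squares are matched by turning around the vertex; at most
  -- two full turns are needed.
  vertex : ∀ b b' q q', Λ.cell b q = Λ.cell b' q' → ∀ v v', IsCorner b v → IsCorner b' v' →
    Λ.offset b q + cornerVec v = Λ.offset b' q' + cornerVec v' →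
    ∃ m : Fin 3, O.turn^[m] (O.cornerSquare q v) = O.cornerSquare q' v'

variable {Λ}

theorem exists_cornerPoint {h : I × I} (h1 : h.1 = 0 ∨ h.1 = 1) (h2 : h.2 = 0 ∨ h.2 = 1) :
    ∃ v, h = cornerPoint v := by
  obtain ⟨x, y⟩ := h
  rcases h1 with h1 | h1 <;> rcases h2 with h2 | h2 <;> dsimp only at h1 h2 <;> subst h1 h2
  exacts [⟨(false, false), rfl⟩, ⟨(false, true), rfl⟩, ⟨(true, false), rfl⟩, ⟨(true, true), rfl⟩]

theorem IsFor.square_eq_of_corner (hΛ : Λ.IsFor O) {b b' : Bool} {q q' : Q} {h h' : I × I}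
    (hc : Λ.cell b q = Λ.cell b' q') (hb : InHalf b h) (hb' : InHalf b' h')
    (hp : pos (Λ.offset b q) h = pos (Λ.offset b' q') h') (h1 : h.1 = 0 ∨ h.1 = 1)
    (h2 : h.2 = 0 ∨ h.2 = 1) (h1' : h'.1 = 0 ∨ h'.1 = 1) (h2' : h'.2 = 0 ∨ h'.2 = 1) :
    O.square q h = O.square q' h' := by
  obtain ⟨v, rfl⟩ := exists_cornerPoint h1 h2
  obtain ⟨v', rfl⟩ := exists_cornerPoint h1' h2'
  rw [pos_cornerPoint, pos_cornerPoint] at hp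
  obtain ⟨m, hm⟩ := hΛ.vertex b b' q q' hc v v' (inHalf_cornerPoint hb) (inHalf_cornerPoint hb')
    (latticePoint_injective hp)
  rw [square_cornerPoint, square_cornerPoint, ← hm, square_iterate_turn]

theorem int_cases {z : ℤ} {x y : I} (h : (x : ℝ) - y = z) :
    (z = 1 ∧ x = 1 ∧ y = 0) ∨ (z = 0 ∧ x = y) ∨ (z = -1 ∧ x = 0 ∧ y = 1) := by
  have hx0 := x.2.1
  have hx1 := x.2.2
  have hy0 := y.2.1
  have hy1 := y.2.2
  have h1 : -1 ≤ z := by exact_mod_cast (show (-1 : ℝ) ≤ z by linarith)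
  have h2 : z ≤ 1 := by exact_mod_cast (show (z : ℝ) ≤ 1 by linarith)
  interval_cases z
  · simp only [Int.reduceNeg, Int.cast_neg, Int.cast_one] at h
    exact Or.inr (Or.inr ⟨rfl, coe_eq_of_le_zero (by linarith), coe_eq_of_one_le (by linarith)⟩)
  · exact Or.inr (Or.inl ⟨rfl, Subtype.ext (by simp at h; linarith)⟩)
  · simp only [Int.cast_one] at h
    exact Or.inl ⟨rfl, coe_eq_of_one_le (by linarith), coe_eq_of_le_zero (by linarith)⟩

/-- In each direction the integral offsets differ by `-1`, `0` or `1`, and a nonzero difference puts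
the point on opposite sides of the two unit squares. Equal offsets are settled by `unique` and
`adjacent`. Otherwise either the halves share a whole side, or their triangular shape forces the
point into a corner. -/
theorem IsFor.square_eq (hΛ : Λ.IsFor O) {b b' : Bool} {q q' : Q} {h h' : I × I}
    (hc : Λ.cell b q = Λ.cell b' q') (hb : InHalf b h) (hb' : InHalf b' h')
    (hp : pos (Λ.offset b q) h = pos (Λ.offset b' q') h') : O.square q h = O.square q' h' := by
  have e1 := congrFun hp 0
  have e2 := congrFun hp 1
  simp only [pos, Matrix.cons_val_zero, Matrix.cons_val_one] at e1 e2
  have i1 := int_cases (z := (Λ.offset b' q').1 - (Λ.offset b q).1) (x := h.1) (y := h'.1)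
    (by push_cast; linarith)
  have i2 := int_cases (z := (Λ.offset b' q').2 - (Λ.offset b q).2) (x := h.2) (y := h'.2)
    (by push_cast; linarith)
  have hcorner := hΛ.square_eq_of_corner hc hb hb' hp
  obtain ⟨x, y⟩ := h
  obtain ⟨x', y'⟩ := h'
  have hone : ∀ {x : I}, (1 : ℝ) ≤ x → x = 1 := coe_eq_of_one_le
  have hzero : ∀ {x : I}, (x : ℝ) ≤ 0 → x = 0 := coe_eq_of_le_zero
  dsimp only at i1 i2 hcorner
  rcases i1 with ⟨z1, rfl, rfl⟩ | ⟨z1, rfl⟩ | ⟨z1, rfl, rfl⟩ <;>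
    rcases i2 with ⟨z2, rfl, rfl⟩ | ⟨z2, rfl⟩ | ⟨z2, rfl, rfl⟩
  · exact hcorner (Or.inr rfl) (Or.inr rfl) (Or.inl rfl) (Or.inl rfl)
  · cases b
    · have hy : y = 0 := hzero (by simpa [InHalf] using hb)
      subst hy
      exact hcorner (Or.inr rfl) (Or.inl rfl) (Or.inl rfl) (Or.inl rfl)
    · cases b'
      · have := (hΛ.adjacent q' q hc.symm).2.1 (Prod.ext (by simp; omega) (by simp; omega))
        rw [this, square_right]
      · have hy : y = 1 := hone (by simpa [InHalf] using hb')
        subst hy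
        exact hcorner (Or.inr rfl) (Or.inr rfl) (Or.inl rfl) (Or.inr rfl)
  · exact hcorner (Or.inr rfl) (Or.inl rfl) (Or.inl rfl) (Or.inr rfl)
  · cases b
    · have hx : x = 0 := hzero (by simpa [InHalf] using hb)
      subst hx
      exact hcorner (Or.inl rfl) (Or.inr rfl) (Or.inl rfl) (Or.inl rfl)
    · cases b'
      · have := (hΛ.adjacent q' q hc.symm).2.2 (Prod.ext (by simp; omega) (by simp; omega))
        rw [this, square_up]
      · have hx : x = 1 := hone (by simpa [InHalf] using hb')
        subst hx
        exact hcorner (Or.inr rfl) (Or.inr rfl) (Or.inr rfl) (Or.inl rfl)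
  · have hoff : Λ.offset b q = Λ.offset b' q' := Prod.ext (by omega) (by omega)
    cases b <;> cases b'
    · rw [hΛ.unique _ _ _ hc hoff]
    · rw [(hΛ.adjacent q q' hc).1 hoff]
    · rw [(hΛ.adjacent q' q hc.symm).1 hoff.symm]
    · rw [hΛ.unique _ _ _ hc hoff]
  · cases b'
    · have hx : x = 0 := hzero (by simpa [InHalf] using hb')
      subst hx
      exact hcorner (Or.inl rfl) (Or.inl rfl) (Or.inl rfl) (Or.inr rfl)
    · cases b
      · have := (hΛ.adjacent q q' hc).2.2 (Prod.ext (by simp; omega) (by simp; omega))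
        rw [this, square_up]
      · have hx : x = 1 := hone (by simpa [InHalf] using hb)
        subst hx
        exact hcorner (Or.inr rfl) (Or.inl rfl) (Or.inr rfl) (Or.inr rfl)
  · exact hcorner (Or.inl rfl) (Or.inr rfl) (Or.inr rfl) (Or.inl rfl)
  · cases b'
    · have hy : y = 0 := hzero (by simpa [InHalf] using hb')
      subst hy
      exact hcorner (Or.inl rfl) (Or.inl rfl) (Or.inr rfl) (Or.inl rfl)
    · cases b
      · have := (hΛ.adjacent q q' hc).2.1 (Prod.ext (by simp; omega) (by simp; omega))
        rw [this, square_right]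
      · have hy : y = 1 := hone (by simpa [InHalf] using hb)
        subst hy
        exact hcorner (Or.inl rfl) (Or.inr rfl) (Or.inr rfl) (Or.inr rfl)
  · exact hcorner (Or.inl rfl) (Or.inl rfl) (Or.inr rfl) (Or.inr rfl)

end Layout

end Origami

namespace Origami

open unitInterval

variable {Q : Type} {O : Origami Q}

namespace Layout

variable {n M : ℕ} {Λ : Layout n M Q} {X : LatticePolygons n} {e : Fin M ≃ X.Cell}

/-- The tables of the layout describe the polygons and the gluings of `X`. -/
structure Describes (Λ : Layout n M Q) (X : LatticePolygons n) (e : Fin M ≃ X.Cell) : Prop where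
  corner : ∀ i j, X.corner (e i) j = ![(Λ.corner i j).1, (Λ.corner i j).2]
  glued : ∀ i j i' j', X.Glued (e i) j (e i') j' ↔ Λ.next i j = (i', j')

theorem Describes.realCorner (hX : Λ.Describes X e) (i : Fin M) (j : Fin n) :
    X.realCorner (e i) j = latticePoint (Λ.corner i j) := by
  funext l
  rw [LatticePolygons.realCorner, hX.corner]
  fin_cases l <;> rfl

variable [NeZero n]

theorem latticePoint_add (z w : ℤ × ℤ) : latticePoint (z + w) = latticePoint z + latticePoint w := by
  funext l
  fin_cases l <;> simp [latticePoint]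

theorem latticePoint_sub (z w : ℤ × ℤ) : latticePoint (z - w) = latticePoint z - latticePoint w := by
  funext l
  fin_cases l <;> simp [latticePoint]

/-- A half square is the triangle spanned by its three corners, which lie in the convex polygon as
midpoints of corners of it. The weights are barycentric coordinates in the triangle. -/
theorem pos_mem_polygon (hX : Λ.Describes X e) (hΛ : Λ.IsFor O) {b : Bool} (q : Q) {h : I × I}
    (hh : InHalf b h) : pos (Λ.offset b q) h ∈ X.polygon (e (Λ.cell b q)) := by
  have hconv : Convex ℝ (X.polygon (e (Λ.cell b q))) := convex_convexHull _ _
  have hv : ∀ v, IsCorner b v → pos (Λ.offset b q) (cornerPoint v) ∈ X.polygon (e (Λ.cell b q)) := by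
    intro v hv
    obtain ⟨j, j', hj⟩ := hΛ.mem b q v hv
    have h1 : ∀ j, latticePoint (Λ.corner (Λ.cell b q) j) ∈ X.polygon (e (Λ.cell b q)) := fun j =>
      subset_convexHull _ _ ⟨j, hX.realCorner _ _⟩
    have h2 := hconv (h1 j) (h1 j') (a := 1 / 2) (b := 1 / 2) (by norm_num) (by norm_num) (by norm_num)
    rw [pos_cornerPoint]
    convert h2 using 1
    rw [← smul_add, ← latticePoint_add, hj, latticePoint_add _ (Λ.offset b q + cornerVec v), smul_add,
      ← add_smul]
    norm_num
  have h0 := h.1.2.1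
  have h1 := h.1.2.2
  have h2 := h.2.2.1
  have h3 := h.2.2.2
  cases b
  · have h4 : (h.1 + h.2 : ℝ) ≤ 1 := hh
    have h5 := hconv.sum_mem (t := Finset.univ) (w := ![1 - (h.1 + h.2 : ℝ), h.1, h.2])
      (z := fun i => pos (Λ.offset false q) (cornerPoint (![(false, false), (true, false), (false, true)] i))) (fun i _ => by fin_cases i <;> simp <;> linarith)
      (by simp [Fin.sum_univ_three]; ring) (fun i _ => by
        fin_cases i
        exacts [hv (false, false) (by decide), hv (true, false) (by decide),
          hv (false, true) (by decide)])
    convert h5 using 1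
    funext l
    fin_cases l <;> simp [Fin.sum_univ_three, pos, cornerPoint] <;> ring
  · have h4 : 1 ≤ (h.1 + h.2 : ℝ) := hh
    have h5 := hconv.sum_mem (t := Finset.univ) (w := ![(h.1 + h.2 : ℝ) - 1, 1 - h.2, 1 - h.1])
      (z := fun i => pos (Λ.offset true q) (cornerPoint (![(true, true), (true, false), (false, true)] i))) (fun i _ => by fin_cases i <;> simp <;> linarith)
      (by simp [Fin.sum_univ_three]) (fun i _ => by
        fin_cases i
        exacts [hv (true, true) (by decide), hv (true, false) (by decide),
          hv (false, true) (by decide)])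
    convert h5 using 1
    funext l
    fin_cases l <;> simp [Fin.sum_univ_three, pos, cornerPoint] <;> ring

/-! #### The half squares cover the polygons -/

/-- A linear inequality that holds weakly on the polygon and strictly at the barycenter becomes
strict as soon as a point is moved towards the barycenter. -/
theorem lt_of_center (c : X.Cell) (f : (Fin 2 → ℝ) →ₗ[ℝ] ℝ) {a : ℝ}
    (ha : ∀ j, a ≤ f (X.realCorner c j)) (hc : n * a < ∑ j, f (X.realCorner c j))
    {x : Fin 2 → ℝ} (hx : x ∈ X.polygon c) {t : ℝ} (ht : 0 < t) (ht' : t ≤ 1) :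
    a < f ((1 - t) • x + t • ((n : ℝ)⁻¹ • ∑ j, X.realCorner c j)) := by
  have hn : (0 : ℝ) < n := by exact_mod_cast Nat.pos_of_ne_zero (NeZero.ne n)
  have h1 : a ≤ f x := by
    have : X.polygon c ⊆ {x | a ≤ f x} :=
      convexHull_min (by rintro _ ⟨j, rfl⟩; exact ha j) (convex_halfSpace_ge f.isLinear a)
    exact this hx
  have h2 : a < f ((n : ℝ)⁻¹ • ∑ j, X.realCorner c j) := by
    rw [map_smul, map_sum, smul_eq_mul, inv_mul_eq_div, lt_div_iff₀ hn, mul_comm]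
    exact hc
  rw [map_add, map_smul, map_smul, smul_eq_mul, smul_eq_mul]
  nlinarith

/-- The integer parts of the coordinates select the unit square and the sum of the fractional parts
selects the half. Strictness excludes squares and halves that merely touch the polygon. -/
theorem exists_of_strict (hΛ : Λ.IsFor O) {i : Fin M} {x y : ℝ}
    (h1 : (Λ.lower i).1 < x) (h2 : x < (Λ.upper i).1) (h3 : (Λ.lower i).2.1 < y)
    (h4 : y < (Λ.upper i).2.1) (h5 : (Λ.lower i).2.2 < x + y) (h6 : x + y < (Λ.upper i).2.2) :
    ∃ b q h, Λ.cell b q = i ∧ InHalf b h ∧ ![x, y] = pos (Λ.offset b q) h := by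
  have hw := hΛ.width i
  have a1 : (Λ.lower i).1 ≤ ⌊x⌋ := Int.le_floor.2 h1.le
  have a2 : ⌊x⌋ < (Λ.upper i).1 := Int.floor_lt.2 h2
  have a3 : (Λ.lower i).2.1 ≤ ⌊y⌋ := Int.le_floor.2 h3.le
  have a4 : ⌊y⌋ < (Λ.upper i).2.1 := Int.floor_lt.2 h4
  obtain ⟨u, hu⟩ : ∃ u : Fin 2, (Λ.lower i).1 + (u : ℕ) = ⌊x⌋ :=
    ⟨⟨(⌊x⌋ - (Λ.lower i).1).toNat, by omega⟩, by dsimp only; omega⟩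
  obtain ⟨v, hv⟩ : ∃ v : Fin 2, (Λ.lower i).2.1 + (v : ℕ) = ⌊y⌋ :=
    ⟨⟨(⌊y⌋ - (Λ.lower i).2.1).toNat, by omega⟩, by dsimp only; omega⟩
  let h : I × I := (⟨Int.fract x, Int.fract_nonneg x, (Int.fract_lt_one x).le⟩,
    ⟨Int.fract y, Int.fract_nonneg y, (Int.fract_lt_one y).le⟩)
  have hx : (⌊x⌋ : ℝ) + Int.fract x = x := Int.floor_add_fract x
  have hy : (⌊y⌋ : ℝ) + Int.fract y = y := Int.floor_add_fract y
  have hx1 := Int.fract_lt_one x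
  have hy1 := Int.fract_lt_one y
  have hx0 := Int.fract_nonneg x
  have hy0 := Int.fract_nonneg y
  obtain ⟨b, hb, b1, b2⟩ : ∃ b, InHalf b h ∧ ((⌊x⌋ + ⌊y⌋ + b.toNat : ℤ) : ℝ) ≤ x + y ∧
      x + y < ((⌊x⌋ + ⌊y⌋ + b.toNat + 1 : ℤ) : ℝ) := by
    rcases lt_or_ge (Int.fract x + Int.fract y) 1 with hs | hs
    · exact ⟨false, hs.le, by simp; linarith, by simp; linarith⟩
    · exact ⟨true, hs, by simp; linarith, by simp; linarith⟩
  have c1 : (Λ.lower i).2.2 < ⌊x⌋ + ⌊y⌋ + b.toNat + 1 := by exact_mod_cast h5.trans b2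
  have c2 : ⌊x⌋ + ⌊y⌋ + b.toNat < (Λ.upper i).2.2 := by exact_mod_cast b1.trans_lt h6
  obtain ⟨q, hq, ho⟩ := hΛ.cover i u v b (by omega) (by omega) (by omega) (by omega)
  refine ⟨b, q, h, hq, hb, ?_⟩
  rw [ho, hu, hv, pos]
  simp only [h, hx, hy]

theorem isCompact_inHalf (b : Bool) : IsCompact {h : I × I | InHalf b h} := by
  refine IsClosed.isCompact ?_
  cases b
  · exact isClosed_le (by fun_prop) continuous_const
  · exact isClosed_le continuous_const (by fun_prop)

/-- Points moved slightly towards the barycenter satisfy strict inequalities and so lie in the union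
of the half squares. This union is a finite union of compact sets, hence closed, and contains the
limit. -/
theorem exists_pos_eq [Finite Q] (hX : Λ.Describes X e) (hΛ : Λ.IsFor O) {i : Fin M} {x : Fin 2 → ℝ}
    (hx : x ∈ X.polygon (e i)) :
    ∃ b q h, Λ.cell b q = i ∧ InHalf b h ∧ x = pos (Λ.offset b q) h := by
  let C : Set (Fin 2 → ℝ) := ⋃ p : {p : Bool × Q // Λ.cell p.1 p.2 = i},
    pos (Λ.offset p.1.1 p.1.2) '' {h | InHalf p.1.1 h}
  have hC : _root_.IsClosed C := isClosed_iUnion_of_finite fun p =>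
    ((isCompact_inHalf _).image (continuous_pos _)).isClosed
  suffices hxC : x ∈ C by
    obtain ⟨⟨⟨b, q⟩, hq⟩, h, hh, rfl⟩ := Set.mem_iUnion.1 hxC
    exact ⟨b, q, h, hq, hh, rfl⟩
  let p : Fin 2 → ℝ := (n : ℝ)⁻¹ • ∑ j, X.realCorner (e i) j
  let g : ℝ → Fin 2 → ℝ := fun t => (1 - t) • x + t • p
  have hg : Filter.Tendsto g (𝓝[>] 0) (𝓝 x) := by
    have : Continuous g := by fun_prop
    have h0 : g 0 = x := by simp [g]
    have := this.continuousWithinAt (s := Set.Ioi 0) (x := 0)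
    rwa [ContinuousWithinAt, h0] at this
  refine hC.mem_of_tendsto hg ?_
  filter_upwards [Ioc_mem_nhdsGT (zero_lt_one (α := ℝ))] with t ht
  have hb := hΛ.bounds i
  obtain ⟨⟨c1, c2⟩, ⟨c3, c4⟩, c5, c6⟩ := hΛ.center i
  have key : ∀ (f : (Fin 2 → ℝ) →ₗ[ℝ] ℝ) (φ : Fin n → ℤ) (a : ℤ),
      (∀ j, f (latticePoint (Λ.corner i j)) = φ j) → (∀ j, a ≤ φ j) → n * a < ∑ j, φ j →
      (a : ℝ) < f (g t) := by
    intro f φ a h1 h2 h3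
    refine lt_of_center (e i) f (fun j => ?_) ?_ hx ht.1 ht.2
    · rw [hX.realCorner, h1]
      exact_mod_cast h2 j
    · simp only [hX.realCorner, h1]
      exact_mod_cast h3
  have key' : ∀ (f : (Fin 2 → ℝ) →ₗ[ℝ] ℝ) (φ : Fin n → ℤ) (a : ℤ),
      (∀ j, f (latticePoint (Λ.corner i j)) = φ j) → (∀ j, φ j ≤ a) → ∑ j, φ j < n * a →
      f (g t) < a := by
    intro f φ a h1 h2 h3
    have := key (-f) (fun j => -φ j) (-a) (fun j => by simp [h1]) (fun j => neg_le_neg (h2 j))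
      (by simpa using h3)
    simpa using this
  let f0 : (Fin 2 → ℝ) →ₗ[ℝ] ℝ := LinearMap.proj 0
  let f1 : (Fin 2 → ℝ) →ₗ[ℝ] ℝ := LinearMap.proj 1
  have e0 : ∀ j, f0 (latticePoint (Λ.corner i j)) = (Λ.corner i j).1 := fun j => rfl
  have e1 : ∀ j, f1 (latticePoint (Λ.corner i j)) = (Λ.corner i j).2 := fun j => rfl
  have e2 : ∀ j, (f0 + f1) (latticePoint (Λ.corner i j)) =
      ((Λ.corner i j).1 + (Λ.corner i j).2 : ℤ) := fun j => by
    rw [LinearMap.add_apply, e0, e1]; push_cast; rfl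
  obtain ⟨b, q, h, hq, hh, he⟩ := exists_of_strict hΛ (i := i) (x := g t 0) (y := g t 1)
    (key f0 _ _ e0 (fun j => (hb j).1.1) c1) (key' f0 _ _ e0 (fun j => (hb j).1.2) c2)
    (key f1 _ _ e1 (fun j => (hb j).2.1.1) c3) (key' f1 _ _ e1 (fun j => (hb j).2.1.2) c4)
    (key (f0 + f1) _ _ e2 (fun j => (hb j).2.2.1) c5)
    (key' (f0 + f1) _ _ e2 (fun j => (hb j).2.2.2) c6)
  refine Set.mem_iUnion.2 ⟨⟨⟨b, q⟩, hq⟩, h, hh, ?_⟩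
  rw [← he]
  funext l
  fin_cases l <;> rfl

/-! #### The homeomorphism -/

theorem exists_segment {A B x : Fin 2 → ℝ} (hx : x ∈ segment ℝ A B) :
    ∃ t : I, x = (1 - t : ℝ) • A + (t : ℝ) • B := by
  rw [segment_eq_image] at hx
  obtain ⟨t, ht, rfl⟩ := hx
  exact ⟨⟨t, ht⟩, rfl⟩

theorem pt_eq_of_across (hX : Λ.Describes X e) {i i' : Fin M} {A B A' : ℤ × ℤ} {j : Fin n}
    (h : Λ.Across i A B i' A' j) {x : X.polygon (e i)} {y : X.polygon (e i')} (t : I)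
    (hx : (x : Fin 2 → ℝ) = (1 - t : ℝ) • latticePoint A + (t : ℝ) • latticePoint B)
    (hy : (y : Fin 2 → ℝ) = x + (latticePoint A' - latticePoint A)) : X.pt (e i) x = X.pt (e i') y := by
  obtain ⟨h1, rfl, h3⟩ := h
  refine Quot.sound (LatticePolygons.Ident.glue _ _ j (Λ.next i j).2 ((hX.glued _ _ _ _).2 rfl) x y ?_ ?_)
  · rw [hX.realCorner, hX.realCorner, segment_eq_image]
    rcases h1 with ⟨h1, h2⟩ | ⟨h1, h2⟩ <;> rw [h1, h2]
    · exact ⟨t, t.2, hx.symm⟩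
    · refine ⟨1 - t, ⟨by linarith [t.2.2], by linarith [t.2.1]⟩, ?_⟩
      rw [hx]
      dsimp only
      rw [sub_sub_cancel, add_comm]
  · rw [hy, hX.realCorner, hX.realCorner, ← latticePoint_sub, ← latticePoint_sub, h3]

/-- The map of a half square to the surface. -/
noncomputable def pieceMap (hX : Λ.Describes X e) (hΛ : Λ.IsFor O) (b : Bool) (q : Q) :
    C(I × I, X.Surface) :=
  ⟨fun h => X.pt (e (Λ.cell b q)) ⟨pos (Λ.offset b q) (toHalf b h),
    pos_mem_polygon hX hΛ q (inHalf_toHalf b h)⟩,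
    (LatticePolygons.continuous_pt (X := X) _).comp
      (((continuous_pos _).comp (continuous_toHalf b)).subtype_mk _)⟩

theorem pieceMap_apply (hX : Λ.Describes X e) (hΛ : Λ.IsFor O) {b : Bool} {q : Q} {h : I × I}
    (hh : InHalf b h) : pieceMap hX hΛ b q h =
      X.pt (e (Λ.cell b q)) ⟨pos (Λ.offset b q) h, pos_mem_polygon hX hΛ q hh⟩ := by
  change X.pt _ _ = X.pt _ _
  congr 2
  rw [toHalf_of_inHalf hh]

theorem cornerVec_side (d : Fin 3) : cornerVec (upperSide d).2 - cornerVec (upperSide d).1 =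
    cornerVec (lowerSide d).2 - cornerVec (lowerSide d).1 := by
  fin_cases d <;> rfl

theorem pos_upperSide (z w : ℤ × ℤ) (d : Fin 3) (t : I) : pos w (sidePoint (upperSide d) t) =
    pos z (sidePoint (lowerSide d) t) + (latticePoint (w + cornerVec (upperSide d).1) -
      latticePoint (z + cornerVec (lowerSide d).1)) := by
  have h := congrArg latticePoint (cornerVec_side d)
  simp only [pos_sidePoint, latticePoint_add, latticePoint_sub] at h ⊢
  funext l
  have hl := congrFun h l
  simp only [Pi.add_apply, Pi.sub_apply, Pi.smul_apply, smul_eq_mul] at hl ⊢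
  linear_combination (t : ℝ) * hl

theorem pieceMap_join (hX : Λ.Describes X e) (hΛ : Λ.IsFor O) (d : Fin 3) (q : Q) (t : I) :
    pieceMap hX hΛ false q (sidePoint (lowerSide d) t) =
      pieceMap hX hΛ true (O.below d q) (sidePoint (upperSide d) t) := by
  rw [pieceMap_apply hX hΛ (inHalf_lowerSide d t), pieceMap_apply hX hΛ (inHalf_upperSide d t)]
  have hp := pos_upperSide (Λ.offset false q) (Λ.offset true (O.below d q)) d t
  rcases hΛ.join d q with ⟨h1, h2⟩ | ⟨j, h⟩
  · rw [h2, sub_self, add_zero] at hp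
    have : ∀ (i i' : Fin M) (hi : i = i') (x y : Fin 2 → ℝ) (hx : x ∈ X.polygon (e i))
        (hy : y ∈ X.polygon (e i')), x = y → X.pt (e i) ⟨x, hx⟩ = X.pt (e i') ⟨y, hy⟩ := by
      rintro i _ rfl x _ hx hy rfl
      rfl
    exact this _ _ h1 _ _ _ _ hp.symm
  · exact pt_eq_of_across hX h t (pos_sidePoint _ _ _) hp

theorem exists_sidePoint_two {h : I × I} (hh : (h.1 + h.2 : ℝ) = 1) :
    h = sidePoint (lowerSide 2) h.2 := by
  refine Prod.ext (Subtype.ext ?_) (Subtype.ext ?_) <;>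
    simp [sidePoint, lowerSide, cornerPoint, coe_lerp]
  linarith

/-- The map of a square to the surface. -/
noncomputable def squareMap (hX : Λ.Describes X e) (hΛ : Λ.IsFor O) (q : Q) : C(I × I, X.Surface) :=
  ⟨fun h => if (h.1 + h.2 : ℝ) ≤ 1 then pieceMap hX hΛ false q h else pieceMap hX hΛ true q h, by
    refine Continuous.if_le (pieceMap hX hΛ false q).continuous (pieceMap hX hΛ true q).continuous
      (by fun_prop) continuous_const fun h hh => ?_
    rw [exists_sidePoint_two hh]
    exact pieceMap_join hX hΛ 2 q h.2⟩

theorem squareMap_apply (hX : Λ.Describes X e) (hΛ : Λ.IsFor O) {b : Bool} {q : Q} {h : I × I}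
    (hh : InHalf b h) : squareMap hX hΛ q h = pieceMap hX hΛ b q h := by
  cases b
  · exact if_pos hh
  · by_cases h1 : (h.1 + h.2 : ℝ) ≤ 1
    · refine (if_pos h1).trans ?_
      rw [exists_sidePoint_two (le_antisymm h1 hh)]
      exact pieceMap_join hX hΛ 2 q h.2
    · exact if_neg h1

/-- The map from the square-tiled surface. -/
noncomputable def fromOrigami (hX : Λ.Describes X e) (hΛ : Λ.IsFor O) : C(O.Surface, X.Surface) :=
  O.lift (squareMap hX hΛ)
    (fun q y => by
      have h := pieceMap_join hX hΛ 1 (O.right q) y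
      have e1 : sidePoint (lowerSide 1) y = (0, y) := by
        simp [sidePoint, lowerSide, cornerPoint]
      have e2 : sidePoint (upperSide 1) y = (1, y) := by
        simp [sidePoint, upperSide, cornerPoint]
      have e3 : O.below 1 (O.right q) = q := O.right.symm_apply_apply q
      have i1 := inHalf_lowerSide 1 y
      have i2 := inHalf_upperSide 1 y
      rw [e1] at i1 h
      rw [e2] at i2 h
      rw [squareMap_apply hX hΛ i1, squareMap_apply hX hΛ i2, h, e3])
    (fun q x => by
      have h := pieceMap_join hX hΛ 0 (O.up q) x
      have e1 : sidePoint (lowerSide 0) x = (x, 0) := by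
        simp [sidePoint, lowerSide, cornerPoint]
      have e2 : sidePoint (upperSide 0) x = (x, 1) := by
        simp [sidePoint, upperSide, cornerPoint]
      have e3 : O.below 0 (O.up q) = q := O.up.symm_apply_apply q
      have i1 := inHalf_lowerSide 0 x
      have i2 := inHalf_upperSide 0 x
      rw [e1] at i1 h
      rw [e2] at i2 h
      rw [squareMap_apply hX hΛ i1, squareMap_apply hX hΛ i2, h, e3])

theorem fromOrigami_square (hX : Λ.Describes X e) (hΛ : Λ.IsFor O) {b : Bool} {q : Q} {h : I × I}
    (hh : InHalf b h) : fromOrigami hX hΛ (O.square q h) =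
      X.pt (e (Λ.cell b q)) ⟨pos (Λ.offset b q) h, pos_mem_polygon hX hΛ q hh⟩ :=
  (squareMap_apply hX hΛ hh).trans (pieceMap_apply hX hΛ hh)

section Inverse

variable [Finite Q]

/-- The point of the square-tiled surface that corresponds to a point of a polygon. -/
noncomputable def polygonMap (hX : Λ.Describes X e) (hΛ : Λ.IsFor O) (i : Fin M) (x : X.polygon (e i)) :
    O.Surface :=
  O.square (exists_pos_eq hX hΛ x.2).choose_spec.choose
    (exists_pos_eq hX hΛ x.2).choose_spec.choose_spec.choose

/-- The chosen representation of the point does not matter, because two representations in the same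
polygon give the same point of the origami. -/
theorem polygonMap_eq (hX : Λ.Describes X e) (hΛ : Λ.IsFor O) {i : Fin M} {x : X.polygon (e i)}
    {b : Bool} {q : Q} {h : I × I} (hq : Λ.cell b q = i) (hh : InHalf b h)
    (hx : (x : Fin 2 → ℝ) = pos (Λ.offset b q) h) : polygonMap hX hΛ i x = O.square q h := by
  obtain ⟨h1, h2, h3⟩ := (exists_pos_eq hX hΛ x.2).choose_spec.choose_spec.choose_spec
  exact hΛ.square_eq (h1.trans hq.symm) h2 hh (h3.symm.trans hx)

theorem continuous_polygonMap (hX : Λ.Describes X e) (hΛ : Λ.IsFor O) (i : Fin M) :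
    Continuous (polygonMap hX hΛ i) := by
  let C : {p : Bool × Q // Λ.cell p.1 p.2 = i} → Set (X.polygon (e i)) := fun p =>
    Subtype.val ⁻¹' (pos (Λ.offset p.1.1 p.1.2) '' {h | InHalf p.1.1 h})
  refine LocallyFinite.continuous (f := C) (locallyFinite_of_finite _) ?_ (fun p => ?_) fun p => ?_
  · refine Set.eq_univ_of_forall fun x => ?_
    obtain ⟨b, q, h, hq, hh, hx⟩ := exists_pos_eq hX hΛ x.2
    exact Set.mem_iUnion.2 ⟨⟨⟨b, q⟩, hq⟩, h, hh, hx.symm⟩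
  · exact (((isCompact_inHalf _).image (continuous_pos _)).isClosed).preimage continuous_subtype_val
  · have hc : Continuous fun x : X.polygon (e i) =>
        O.square p.1.2 (localCoord (Λ.offset p.1.1 p.1.2) x) :=
      (O.square p.1.2).continuous.comp ((continuous_localCoord _).comp continuous_subtype_val)
    refine hc.continuousOn.congr fun x hx => ?_
    obtain ⟨h, hh, hx⟩ := hx
    rw [polygonMap_eq hX hΛ p.2 hh hx.symm]
    dsimp only
    rw [← hx, localCoord_pos]

/-- Every side of a polygon is a side of a half square, either a lower left or an upper right one.
Across it lies a half of the opposite kind, and the two sides are identified in the origami. -/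
theorem polygonMap_eq_of_glued (hX : Λ.Describes X e) (hΛ : Λ.IsFor O) {i i' : Fin M} {j j' : Fin n}
    (hg : X.Glued (e i) j (e i') j') {x : X.polygon (e i)} {y : X.polygon (e i')}
    (hx : (x : Fin 2 → ℝ) ∈ segment ℝ (X.realCorner (e i) j) (X.realCorner (e i) (j + 1)))
    (hy : (y : Fin 2 → ℝ) = x + (X.realCorner (e i') (j' + 1) - X.realCorner (e i) j)) :
    polygonMap hX hΛ i x = polygonMap hX hΛ i' y := by
  rw [hX.glued] at hg
  rw [hX.realCorner, hX.realCorner] at hx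
  rw [hX.realCorner, hX.realCorner, ← latticePoint_sub] at hy
  have hseg : ∀ {A B : ℤ × ℤ}, ((Λ.corner i j = A ∧ Λ.corner i (j + 1) = B) ∨
      (Λ.corner i j = B ∧ Λ.corner i (j + 1) = A)) →
      ∃ t : I, (x : Fin 2 → ℝ) = (1 - t : ℝ) • latticePoint A + (t : ℝ) • latticePoint B := by
    rintro A B (⟨rfl, rfl⟩ | ⟨rfl, rfl⟩)
    · exact exists_segment hx
    · exact exists_segment (segment_symm ℝ (latticePoint _) _ ▸ hx)
  obtain ⟨d, q, ⟨hq, h1, h2, h3⟩ | ⟨hq, h1, h2, h3⟩⟩ := hΛ.side i j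
  · obtain ⟨t, ht⟩ := hseg h1
    rw [hg] at h2 h3
    dsimp only at h2 h3
    subst h2
    rw [h3, latticePoint_sub] at hy
    rw [← pos_sidePoint] at ht
    rw [ht, ← pos_upperSide] at hy
    rw [polygonMap_eq hX hΛ hq (inHalf_lowerSide d t) ht,
      polygonMap_eq hX hΛ rfl (inHalf_upperSide d t) hy, square_sidePoint]
  · obtain ⟨t, ht⟩ := hseg h1
    rw [hg] at h2 h3
    dsimp only at h2 h3
    subst h2
    rw [h3, latticePoint_sub] at hy
    rw [← pos_sidePoint] at ht
    rw [ht, pos_upperSide (Λ.offset false q), add_assoc, sub_add_sub_cancel, sub_self, add_zero] at hy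
    rw [polygonMap_eq hX hΛ hq (inHalf_upperSide d t) ht,
      polygonMap_eq hX hΛ rfl (inHalf_lowerSide d t) hy, square_sidePoint]

/-- The map to the square-tiled surface. -/
noncomputable def toOrigami (hX : Λ.Describes X e) (hΛ : Λ.IsFor O) : X.Surface → O.Surface :=
  Quot.lift (fun p => polygonMap hX hΛ (e.symm p.1) ⟨p.2, by rw [e.apply_symm_apply]; exact p.2.2⟩) (by
    rintro _ _ ⟨c, c', j, j', hg, x, y, hx, hy⟩
    obtain ⟨i, rfl⟩ := e.surjective c
    obtain ⟨i', rfl⟩ := e.surjective c'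
    have key : ∀ k k' (hk : k = i) (hk' : k' = i') (hx') (hy'),
        polygonMap hX hΛ k ⟨x, hx'⟩ = polygonMap hX hΛ k' ⟨y, hy'⟩ := by
      rintro _ _ rfl rfl hx' hy'
      exact polygonMap_eq_of_glued hX hΛ hg hx hy
    exact key _ _ (e.symm_apply_apply i) (e.symm_apply_apply i') _ _)

theorem toOrigami_pt (hX : Λ.Describes X e) (hΛ : Λ.IsFor O) (i : Fin M) (x : X.polygon (e i)) :
    toOrigami hX hΛ (X.pt (e i) x) = polygonMap hX hΛ i x := by
  have key : ∀ k (hk : k = i) (hx'), polygonMap hX hΛ k ⟨x, hx'⟩ = polygonMap hX hΛ i x := by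
    rintro _ rfl hx'
    rfl
  exact key _ (e.symm_apply_apply i) _

theorem continuous_toOrigami (hX : Λ.Describes X e) (hΛ : Λ.IsFor O) :
    Continuous (toOrigami hX hΛ) := by
  refine continuous_quot_lift _ (continuous_sigma fun c => ?_)
  obtain ⟨i, rfl⟩ := e.surjective c
  exact (continuous_polygonMap hX hΛ i).congr fun x => (toOrigami_pt hX hΛ i x).symm

/-- The surface `X` is the square-tiled surface of its layout. -/
noncomputable def homeo (hX : Λ.Describes X e) (hΛ : Λ.IsFor O) : X.Surface ≃ₜ O.Surface where
  toFun := toOrigami hX hΛ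
  invFun := fromOrigami hX hΛ
  left_inv s := by
    obtain ⟨⟨c, x⟩, rfl⟩ := Quot.exists_rep s
    obtain ⟨i, rfl⟩ := e.surjective c
    obtain ⟨b, q, h, hq, hh, hx⟩ := exists_pos_eq hX hΛ x.2
    change fromOrigami hX hΛ (toOrigami hX hΛ (X.pt (e i) x)) = X.pt (e i) x
    rw [toOrigami_pt, polygonMap_eq hX hΛ hq hh hx, fromOrigami_square hX hΛ hh]
    subst hq
    congr 1
    exact Subtype.ext hx.symm
  right_inv s := by
    obtain ⟨q, h, rfl⟩ := exists_square_eq s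
    obtain ⟨b, hb⟩ : ∃ b, InHalf b h := by
      rcases le_total (h.1 + h.2 : ℝ) 1 with h1 | h1
      exacts [⟨false, h1⟩, ⟨true, h1⟩]
    rw [fromOrigami_square hX hΛ hb, toOrigami_pt, polygonMap_eq hX hΛ rfl hb rfl]
  continuous_toFun := continuous_toOrigami hX hΛ
  continuous_invFun := (fromOrigami hX hΛ).continuous

theorem toTorus_homeo (hX : Λ.Describes X e) (hΛ : Λ.IsFor O) (s : X.Surface) :
    O.toTorus (homeo hX hΛ s) = X.toTorus s := by
  obtain ⟨s, rfl⟩ := (homeo hX hΛ).symm.surjective s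
  rw [Homeomorph.apply_symm_apply]
  obtain ⟨q, h, rfl⟩ := exists_square_eq s
  obtain ⟨b, hb⟩ : ∃ b, InHalf b h := by
    rcases le_total (h.1 + h.2 : ℝ) 1 with h1 | h1
    exacts [⟨false, h1⟩, ⟨true, h1⟩]
  change _ = X.toTorus (fromOrigami hX hΛ (O.square q h))
  rw [fromOrigami_square hX hΛ hb, LatticePolygons.toTorus_pt]
  -- The offsets of the half squares are lattice points and disappear in the torus.
  have hz : ∀ (z : ℤ) (t : ℝ), ((z + t : ℝ) : UnitAddCircle) = (t : UnitAddCircle) := fun z t => by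
    rw [AddCircle.coe_add]
    have : ((z : ℝ) : UnitAddCircle) = 0 := (AddCircle.coe_eq_zero_iff 1).2 ⟨z, by simp⟩
    rw [this, zero_add]
  funext l
  fin_cases l
  · exact (hz _ _).symm
  · exact (hz _ _).symm

end Inverse

end Layout

end Origami

namespace PolyhedralSurface

variable {n m : ℕ} [NeZero n]

/-! ### Tables of translation covers -/

/-- A decision procedure for `SameEdge`, given one for the lattice of periods. -/
def sameEdgeTest (P : PolyhedralSurface n m) (test : ℤ → ℤ → ℤ → Bool) (f : P.Face) (j : Fin n)
    (f' : P.Face) (j' : Fin n) : Bool :=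
  (P.vertex f' (j' + 1) 0 - P.vertex f j 0 == P.vertex f' j' 0 - P.vertex f (j + 1) 0) &&
  (P.vertex f' (j' + 1) 1 - P.vertex f j 1 == P.vertex f' j' 1 - P.vertex f (j + 1) 1) &&
  (P.vertex f' (j' + 1) 2 - P.vertex f j 2 == P.vertex f' j' 2 - P.vertex f (j + 1) 2) &&
  test (P.vertex f' j' 0 - P.vertex f (j + 1) 0) (P.vertex f' j' 1 - P.vertex f (j + 1) 1)
    (P.vertex f' j' 2 - P.vertex f (j + 1) 2)

theorem sameEdge_iff {P : PolyhedralSurface n m} {test : ℤ → ℤ → ℤ → Bool}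
    (htest : ∀ a b c, ![a, b, c] ∈ P.period ↔ test a b c = true) (f : P.Face) (j : Fin n)
    (f' : P.Face) (j' : Fin n) :
    P.SameEdge f j f' j' ↔ P.sameEdgeTest test f j f' j' = true := by
  simp only [sameEdgeTest, Bool.and_eq_true, beq_iff_eq, ← htest]
  constructor
  · rintro ⟨t, ht, h1, h2⟩
    rw [h1, h2]
    have : ![t 0, t 1, t 2] = t := by ext i; fin_cases i <;> rfl
    simpa [this] using ht
  · rintro ⟨⟨⟨h0, h1⟩, h2⟩, ht⟩
    refine ⟨_, ht, ?_, ?_⟩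
    · ext i; fin_cases i <;> simp
    · ext i; fin_cases i <;> simp <;> omega

variable [NeZero m]

/-- A table of the cells of the translation cover of `P`: the faces and rotations, the neighbours
across the sides, and the corners of the rotated tiles. -/
structure CoverTable (P : PolyhedralSurface n m) (M : ℕ) where
  cell : Fin M → P.Face × Fin m
  next : Fin M → Fin n → Fin M × Fin n
  rotated : Fin m → Fin n → ℤ × ℤ

namespace CoverTable

variable {P : PolyhedralSurface n m} {M : ℕ}

/-- The side `j` of the tile with rotation `k`. -/
def sideVec (Θ : CoverTable P M) (k : Fin m) (j : Fin n) : ℤ × ℤ := Θ.rotated k (j + 1) - Θ.rotated k j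

/-- The conditions for the table to be the one of the translation cover of `P`. -/
structure IsFor [NeZero M] (Θ : CoverTable P M) (test : ℤ → ℤ → ℤ → Bool) : Prop where
  period : ∀ a b c, ![a, b, c] ∈ P.period ↔ test a b c = true
  rotated : ∀ k j, P.rotatedCorner k j = ![(Θ.rotated k j).1, (Θ.rotated k j).2]
  base : Θ.cell 0 = (P.base, 0)
  injective : ∀ i i', Θ.cell i = Θ.cell i' → i = i'
  edge : ∀ i j, P.sameEdgeTest test (Θ.cell i).1 j (Θ.cell (Θ.next i j).1).1 (Θ.next i j).2 = true
  unique : ∀ i j f' j', P.sameEdgeTest test (Θ.cell i).1 j f' j' = true →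
    f' = (Θ.cell (Θ.next i j).1).1 ∧ j' = (Θ.next i j).2
  side : ∀ i j, Θ.sideVec (Θ.cell (Θ.next i j).1).2 (Θ.next i j).2 = -Θ.sideVec (Θ.cell i).2 j
  rotation : ∀ j k k', Θ.sideVec k j = Θ.sideVec k' j → k = k'
  reach : ∀ i, i ≠ 0 → ∃ i' < i, ∃ j, (Θ.next i' j).1 = i

variable [NeZero M] {Θ : CoverTable P M} {test : ℤ → ℤ → ℤ → Bool}

theorem IsFor.fits_iff (h : Θ.IsFor test) (q : P.Face × Fin m) (j : Fin n) (q' : P.Face × Fin m)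
    (j' : Fin n) : P.Fits q j q' j' ↔
      P.sameEdgeTest test q.1 j q'.1 j' = true ∧ Θ.sideVec q'.2 j' = -Θ.sideVec q.2 j := by
  rw [Fits, sameEdge_iff h.period, h.rotated, h.rotated, h.rotated, h.rotated]
  refine and_congr_right fun _ => ?_
  simp only [sideVec, Prod.ext_iff, funext_iff, Fin.forall_fin_two]
  rfl

/-- The edge determines the adjacent face and its side; the rotation of the neighbour is determined
by the direction of this side, since different rotations give different side vectors. -/
theorem IsFor.fits_cell_iff (h : Θ.IsFor test) (i : Fin M) (j : Fin n) (q : P.Face × Fin m)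
    (j' : Fin n) : P.Fits (Θ.cell i) j q j' ↔ q = Θ.cell (Θ.next i j).1 ∧ j' = (Θ.next i j).2 := by
  rw [h.fits_iff]
  constructor
  · rintro ⟨h1, h2⟩
    obtain ⟨h3, rfl⟩ := h.unique i j _ _ h1
    exact ⟨Prod.ext h3 (h.rotation _ _ _ (h2.trans (h.side i j).symm)), rfl⟩
  · rintro ⟨rfl, rfl⟩
    exact ⟨h.edge i j, h.side i j⟩

theorem IsFor.reachable (h : Θ.IsFor test) (i : Fin M) :
    Relation.ReflTransGen (fun a b => ∃ j j', P.Fits a j b j') (P.base, 0) (Θ.cell i) := by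
  induction i using WellFoundedLT.induction with
  | ind i ih =>
    by_cases hi : i = 0
    · rw [hi, h.base]
    · obtain ⟨i', hi', j, rfl⟩ := h.reach i hi
      exact (ih i' hi').tail ⟨j, _, (h.fits_cell_iff _ _ _ _).2 ⟨rfl, rfl⟩⟩

/-- The enumeration of the cells of the translation cover. -/
noncomputable def IsFor.equiv (h : Θ.IsFor test) : Fin M ≃ P.translationCover.Cell :=
  Equiv.ofBijective (fun i => ⟨Θ.cell i, h.reachable i⟩) <| by
    refine ⟨fun i i' e => h.injective _ _ (congrArg Subtype.val e), fun ⟨q, hq⟩ => ?_⟩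
    suffices ∃ i, Θ.cell i = q by
      obtain ⟨i, rfl⟩ := this
      exact ⟨i, rfl⟩
    induction hq with
    | refl => exact ⟨0, h.base⟩
    -- The table is closed under passing to neighbours, so developing along adjacent faces never
    -- leaves it.
    | tail _ h1 ih =>
      obtain ⟨i, rfl⟩ := ih
      obtain ⟨j, j', hj⟩ := h1
      exact ⟨_, ((h.fits_cell_iff _ _ _ _).1 hj).1.symm⟩

theorem IsFor.finite_cell (h : Θ.IsFor test) : Finite P.translationCover.Cell := Finite.of_equiv _ h.equiv

/-- The smallest value of a function on the corners. -/
def least (f : Fin n → ℤ) : ℤ := (List.ofFn f).foldl min (f 0)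

/-- The largest value of a function on the corners. -/
def greatest (f : Fin n → ℤ) : ℤ := (List.ofFn f).foldl max (f 0)

/-- The layout of the translation cover given by a table of the positions of the half squares. -/
def layout (Θ : CoverTable P M) {Q : Type} (place : Bool → Q → Fin M × ℤ × ℤ) :
    Origami.Layout n M Q where
  corner i j := Θ.rotated (Θ.cell i).2 j
  next := Θ.next
  cell b q := (place b q).1
  offset b q := (place b q).2
  lower i := (least fun j => (Θ.rotated (Θ.cell i).2 j).1, least fun j => (Θ.rotated (Θ.cell i).2 j).2,
    least fun j => (Θ.rotated (Θ.cell i).2 j).1 + (Θ.rotated (Θ.cell i).2 j).2)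
  upper i := (greatest fun j => (Θ.rotated (Θ.cell i).2 j).1,
    greatest fun j => (Θ.rotated (Θ.cell i).2 j).2,
    greatest fun j => (Θ.rotated (Θ.cell i).2 j).1 + (Θ.rotated (Θ.cell i).2 j).2)

theorem IsFor.describes (h : Θ.IsFor test) {Q : Type} (place : Bool → Q → Fin M × ℤ × ℤ) :
    (Θ.layout place).Describes P.translationCover h.equiv where
  corner i j := h.rotated _ j
  glued i j i' j' := by
    refine (h.fits_cell_iff i j (Θ.cell i') j').trans ?_
    constructor
    · rintro ⟨h1, rfl⟩
      rw [h.injective _ _ h1]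
      rfl
    · intro h1
      have h2 : Θ.next i j = (i', j') := h1
      rw [h2]
      exact ⟨rfl, rfl⟩

end CoverTable

end PolyhedralSurface

/-! ### Criteria for rigidity and for generation by twists. -/

namespace Origami

variable {N : ℕ} [NeZero N] {O : Origami (Fin N)}

theorem isSingularPoint_of_turn_ne {Q : Type} {O : Origami Q} {q : Q} (h : O.turn q ≠ q) :
    IsSingularPoint O.toTorus (O.square q (0, 0)) := by
  have h1 := square_cornerPoint (O := O) (O.right.symm (O.up.symm q)) (true, true)
  rw [cornerSquare, Equiv.apply_symm_apply, Equiv.apply_symm_apply] at h1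
  rw [← h1]
  refine isSingularPoint_square ?_
  rw [Equiv.apply_symm_apply, Equiv.apply_symm_apply]
  exact Ne.symm h

/-- A criterion for rigidity: every square is reached from the square `0` by moving to the right,
upwards and to the right again, and there are a horizontal and a vertical side with singular ends. -/
theorem isRigid_of_turn_ne (w : ℕ)
    (h : ∀ q, ∃ a b c : Fin w, O.right^[a] (O.up^[b] (O.right^[c] 0)) = q)
    (hor : ∃ q, O.turn q ≠ q ∧ O.turn (O.right q) ≠ O.right q)
    (ver : ∃ q, O.turn q ≠ q ∧ O.turn (O.up q) ≠ O.up q) : O.IsRigid where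
  preconnectedSpace := by
    refine preconnectedSpace 0 fun q => ?_
    obtain ⟨a, b, c, rfl⟩ := h q
    have hr : ∀ (m : ℕ) q, Relation.ReflTransGen (fun a b => b = O.right a ∨ b = O.up a) q
        (O.right^[m] q) := fun m q => by
      induction m generalizing q with
      | zero => exact .refl
      | succ m ih => exact .head (Or.inl rfl) (ih _)
    have hu : ∀ (m : ℕ) q, Relation.ReflTransGen (fun a b => b = O.right a ∨ b = O.up a) q
        (O.up^[m] q) := fun m q => by
      induction m generalizing q with
      | zero => exact .refl
      | succ m ih => exact .head (Or.inr rfl) (ih _)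
    exact ((hr _ _).trans (hu _ _)).trans (hr _ _)
  horizontal := by
    obtain ⟨q, h1, h2⟩ := hor
    have h3 := isSingularPoint_of_turn_ne h2
    rw [← square_right] at h3
    exact ⟨q, isSingularPoint_of_turn_ne h1, h3⟩
  vertical := by
    obtain ⟨q, h1, h2⟩ := ver
    have h3 := isSingularPoint_of_turn_ne h2
    rw [← square_up] at h3
    exact ⟨q, isSingularPoint_of_turn_ne h1, h3⟩

/-- The triple with the entry `x` at the place `a` modulo `3` and zeros elsewhere. -/
def unitTriple (x : ℤ) (a : ℕ) : Triple :=
  if a % 3 = 0 then (x, 0, 0) else if a % 3 = 1 then (0, x, 0) else (0, 0, x)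

namespace Frame

open Matrix

variable {k : ℕ} {G : Subgroup (Fin k → SpecialLinearGroup (Fin 2) ℝ)}

/-- The group contains the one-parameter group of unipotent elements given by a twist. -/
def Twist.FlowMem (D : Twist k) (G : Subgroup (Fin k → SpecialLinearGroup (Fin 2) ℝ)) : Prop :=
  ∀ s, SL2.uniPi (fun j => (D.m j : ℝ)) (fun j => (D.p j : ℝ)) (fun j => (D.q j : ℝ)) s ∈ G

/-- Two twists have different directions at the place `i`. -/
def Twist.Transversal (D D' : Twist k) (i : Fin k) : Prop :=
  D.m i ≠ 0 ∧ D'.m i ≠ 0 ∧ D.p i * D'.q i - D.q i * D'.p i ≠ 0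

instance (D D' : Twist k) (i : Fin k) : Decidable (D.Transversal D' i) := by
  unfold Twist.Transversal; infer_instance

theorem Twist.Transversal.place_eq_top {D D' : Twist k} {i : Fin k} (h : D.Transversal D' i)
    (hD : D.FlowMem G) (hD' : D'.FlowMem G) {S : Set (Fin k)} (hS : ∀ j, j ∉ S → D.m j = 0)
    (hS' : ∀ j, j ∉ S → D'.m j = 0) : SL2.place G S i = ⊤ :=
  SL2.place_eq_top hD hD' (fun j hj => by rw [hS j hj, Int.cast_zero])
    (fun j hj => by rw [hS' j hj, Int.cast_zero]) (Int.cast_ne_zero.2 h.1) (Int.cast_ne_zero.2 h.2.1)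
    (by exact_mod_cast h.2.2)

/-- Two twists that are transversal at the place `i`, and a third one that has no other place in common
with them. -/
theorem Twist.Transversal.place_eq_top_of_inter {D D' E : Twist k} {i : Fin k} (h : D.Transversal D' i)
    (hD : D.FlowMem G) (hD' : D'.FlowMem G) (hE : E.FlowMem G) (hi : E.m i ≠ 0)
    (hpq : E.p i ^ 2 + E.q i ^ 2 ≠ 0) (hS : ∀ j, j = i ∨ (D.m j = 0 ∧ D'.m j = 0) ∨ E.m j = 0) :
    SL2.place G {i} i = ⊤ := by
  have h1 := SL2.place_inter_eq_top hE (S' := {j | E.m j ≠ 0})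
    (fun j hj => by rw [not_not.1 hj, Int.cast_zero]) (Int.cast_ne_zero.2 hi) (by exact_mod_cast hpq)
    (h.place_eq_top hD hD' (S := {j | j = i ∨ ¬(D.m j = 0 ∧ D'.m j = 0)})
      (fun j hj => (not_not.1 (not_or.1 hj).2).1) (fun j hj => (not_not.1 (not_or.1 hj).2).2))
  have h2 : {j | j = i ∨ ¬(D.m j = 0 ∧ D'.m j = 0)} ∩ {j | E.m j ≠ 0} = {i} := by
    ext j
    simp only [Set.mem_inter_iff, Set.mem_ofPred_eq, Set.mem_singleton_iff]
    constructor
    · rintro ⟨h3, h4⟩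
      rcases hS j with h5 | h5 | h5
      exacts [h5, h3.resolve_right (not_not.2 h5), absurd h5 h4]
    · rintro rfl
      exact ⟨Or.inl rfl, hi⟩
  rwa [h2] at h1

/-- Two twists that are transversal at the place `i` and have only one other place, at which the group
is already known to be everything. -/
theorem Twist.Transversal.place_eq_top_of_diff {D D' : Twist k} {i i' : Fin k} (h : D.Transversal D' i)
    (hD : D.FlowMem G) (hD' : D'.FlowMem G) (hi' : SL2.place G {i'} i' = ⊤) (hne : i ≠ i')
    (hS : ∀ j, j = i ∨ j = i' ∨ (D.m j = 0 ∧ D'.m j = 0)) : SL2.place G {i} i = ⊤ := by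
  have h1 := SL2.place_diff_eq_top hne (h.place_eq_top hD hD' (S := {i, i'})
    (fun j hj => (((hS j).resolve_left fun e => hj (Or.inl e)).resolve_left fun e => hj (Or.inr e)).1)
    (fun j hj => (((hS j).resolve_left fun e => hj (Or.inl e)).resolve_left fun e => hj (Or.inr e)).2)) hi'
  rwa [Set.pair_sdiff_right hne] at h1

end Frame

end Origami

/-! ### Congruences for the lattices of periods. -/

namespace PolyhedralSurface

theorem mem_closure_triple {u v w t : Fin 3 → ℤ} :
    t ∈ AddSubgroup.closure {u, v, w} ↔ ∃ x y z : ℤ, x • u + y • v + z • w = t := by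
  rw [Set.insert_eq, Set.insert_eq v, AddSubgroup.closure_union, AddSubgroup.closure_union]
  simp only [AddSubgroup.mem_sup, AddSubgroup.mem_closure_singleton]
  constructor
  · rintro ⟨_, ⟨x, rfl⟩, _, ⟨_, ⟨y, rfl⟩, _, ⟨z, rfl⟩, rfl⟩, rfl⟩
    exact ⟨x, y, z, add_assoc _ _ _⟩
  · rintro ⟨x, y, z, rfl⟩
    exact ⟨_, ⟨x, rfl⟩, _, ⟨_, ⟨y, rfl⟩, _, ⟨z, rfl⟩, rfl⟩, (add_assoc _ _ _).symm⟩

theorem mem_closure_triple_coord {u v w : Fin 3 → ℤ} {a b c : ℤ} :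
    ![a, b, c] ∈ AddSubgroup.closure {u, v, w} ↔ ∃ x y z : ℤ, x * u 0 + y * v 0 + z * w 0 = a ∧
      x * u 1 + y * v 1 + z * w 1 = b ∧ x * u 2 + y * v 2 + z * w 2 = c := by
  rw [mem_closure_triple]
  simp only [funext_iff, Fin.forall_fin_succ, IsEmpty.forall_iff, and_true]
  rfl

/-- The trivial lattice. -/
def zeroPeriod (a b c : ℤ) : Bool := a == 0 && b == 0 && c == 0

theorem mem_zeroPeriod {a b c : ℤ} :
    ![a, b, c] ∈ (⊥ : AddSubgroup (Fin 3 → ℤ)) ↔ zeroPeriod a b c = true := by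
  simp [zeroPeriod, and_assoc]

/-- The cubic lattice. -/
def cubicPeriod (a b c : ℤ) : Bool := a % 2 == 0 && b % 2 == 0 && c % 2 == 0

theorem mem_cubicPeriod {a b c : ℤ} :
    ![a, b, c] ∈ AddSubgroup.closure {![2, 0, 0], ![0, 2, 0], ![0, 0, 2]} ↔
      cubicPeriod a b c = true := by
  rw [mem_closure_triple_coord]
  simp only [cubicPeriod, Bool.and_eq_true, beq_iff_eq, Matrix.cons_val]
  constructor
  · rintro ⟨x, y, z, h1, h2, h3⟩
    omega
  · intro h
    exact ⟨a / 2, b / 2, c / 2, by omega, by omega, by omega⟩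

/-- The body-centered cubic lattice. -/
def centeredPeriod (a b c : ℤ) : Bool := a % 4 == 0 && (a - b) % 8 == 0 && (a - c) % 8 == 0

theorem mem_centeredPeriod {a b c : ℤ} :
    ![a, b, c] ∈ AddSubgroup.closure {![4, 4, 4], ![4, -4, -4], ![-4, 4, -4]} ↔
      centeredPeriod a b c = true := by
  rw [mem_closure_triple_coord]
  simp only [centeredPeriod, Bool.and_eq_true, beq_iff_eq, Matrix.cons_val]
  constructor
  · rintro ⟨x, y, z, h1, h2, h3⟩
    omega
  · intro h
    -- These are the solutions of the linear system; the congruences make the divisions exact.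
    exact ⟨(a + b) / 8, (a - c) / 8, (b - c) / 8, by omega, by omega, by omega⟩

/-- The face-centered cubic lattice. -/
def faceCenteredPeriod (a b c : ℤ) : Bool :=
  a % 4 == 0 && b % 4 == 0 && c % 4 == 0 && (a + b + c) % 8 == 0

theorem mem_faceCenteredPeriod {a b c : ℤ} :
    ![a, b, c] ∈ AddSubgroup.closure {![4, 4, 0], ![4, 0, 4], ![0, 4, 4]} ↔
      faceCenteredPeriod a b c = true := by
  rw [mem_closure_triple_coord]
  simp only [faceCenteredPeriod, Bool.and_eq_true, beq_iff_eq, Matrix.cons_val]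
  constructor
  · rintro ⟨x, y, z, h1, h2, h3⟩
    omega
  · intro h
    exact ⟨(a + b - c) / 8, (a + c - b) / 8, (b + c - a) / 8, by omega, by omega, by omega⟩

end PolyhedralSurface

/-! ### The octahedron and Octa-8 -/

/-- The square-tiled surface whose squares are the elements of the tetrahedral group. The element with
the number `3 * s + r` is the product of the diagonal matrix with the entries `evenSigns s` and the
`r`-th power of the cyclic permutation matrix. -/
def tetrahedralOrigami : Origami (Fin 12) where
right := ⟨fun q => [1, 2, 0, 4, 5, 3, 7, 8, 6, 10, 11, 9].getD q 0,
fun q => [2, 0, 1, 5, 3, 4, 8, 6, 7, 11, 9, 10].getD q 0, by decide, by decide⟩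
up := ⟨fun q => [5, 6, 10, 2, 9, 7, 11, 0, 4, 8, 3, 1].getD q 0,
fun q => [7, 11, 3, 10, 8, 0, 1, 5, 9, 4, 2, 6].getD q 0, by decide, by decide⟩

/-- A cut system of `tetrahedralOrigami`. -/
def tetrahedralCuts : Origami.CutSystem (Fin 12) 5 8 where
tree l := [(false, 0), (true, 0), (false, 1), (true, 1), (true, 2)].getD l (false, 0)
-- Each number is a bit mask over the squares: it marks those whose lower left corner lies beyond
-- the side `l` of the tree. The surface has six vertices, so five sides span a tree.
dual l q := if ([1502, 2080, 1412, 72, 1152].getD l 0).testBit q then 1 else 0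
extra l := [(false, 4), (true, 4), (true, 6), (false, 8), (true, 9), (false, 10), (true,
    10), (true, 11)].getD l (false, 0)
order := [11, 1, 2, 10, 9, 8, 6, 3, 4, 7, 5]

/-- The three-dimensional irreducible representation. -/
def tetrahedralFrame : Origami.Frame (Fin 12) (Fin 3) 1 where
  type _ := 0
  -- This is the row `a` of the matrix belonging to `q`; modulo `3` its nonzero entry is in the
  -- column `a - r`, written as `a + 2 * q`. Passing to a neighbour multiplies the matrix on the
  -- right, hence the rows by a fixed matrix.
  row a q := Origami.unitTriple (evenSigns ⟨q / 3, by omega⟩ a) (a + 2 * q)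
  trans _ := ⟨((0, 0, 1), (1, 0, 0), (0, 1, 0)), ((0, 1, 0), (0, 0, -1), (-1, 0, 0)),
    ((0, 1, 0), (0, 0, 1), (1, 0, 0)), ((0, 0, -1), (1, 0, 0), (0, -1, 0))⟩
  hor _ := ![(1, 1, -1), (0, 0, 0)]
  ver _ := ![(0, 0, 0), (1, 1, 1)]

/-- The horizontal and the vertical twist. -/
def tetrahedralTwist (l : Fin 2) : Origami.Frame.Twist 1 where
  word := ![[], [false]] l
  width := 3
  m _ := 1
  p _ := ![1, 0] l
  q _ := ![0, 1] l
  cob _ _ := (0, 0, 0)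

/-- The symmetries given by the diagonal matrices and the cyclic permutations. -/
def tetrahedralSymmetries : Origami.Frame.Symmetries (Fin 12) (Fin 3) 1 6 where
  perm := ![
    ⟨fun q => [0, 1, 2, 3, 4, 5, 6, 7, 8, 9, 10, 11].getD q 0,
      fun q => [0, 1, 2, 3, 4, 5, 6, 7, 8, 9, 10, 11].getD q 0, by decide, by decide⟩,
    ⟨fun q => [3, 4, 5, 0, 1, 2, 9, 10, 11, 6, 7, 8].getD q 0,
      fun q => [3, 4, 5, 0, 1, 2, 9, 10, 11, 6, 7, 8].getD q 0, by decide, by decide⟩,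
    ⟨fun q => [6, 7, 8, 9, 10, 11, 0, 1, 2, 3, 4, 5].getD q 0,
      fun q => [6, 7, 8, 9, 10, 11, 0, 1, 2, 3, 4, 5].getD q 0, by decide, by decide⟩,
    ⟨fun q => [9, 10, 11, 6, 7, 8, 3, 4, 5, 0, 1, 2].getD q 0,
      fun q => [9, 10, 11, 6, 7, 8, 3, 4, 5, 0, 1, 2].getD q 0, by decide, by decide⟩,
    ⟨fun q => [1, 2, 0, 7, 8, 6, 10, 11, 9, 4, 5, 3].getD q 0,
      fun q => [2, 0, 1, 11, 9, 10, 5, 3, 4, 8, 6, 7].getD q 0, by decide, by decide⟩,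
    ⟨fun q => [2, 0, 1, 11, 9, 10, 5, 3, 4, 8, 6, 7].getD q 0,
      fun q => [1, 2, 0, 7, 8, 6, 10, 11, 9, 4, 5, 3].getD q 0, by decide, by decide⟩]
  -- The diagonal matrices act on the coordinates by the signs `evenSigns`. The weights `1`, `2`,
  -- `4` on the three nontrivial ones separate the three coordinates from each other and from the
  -- value `7` on the holonomy classes.
  weight := ![0, 1, 2, 4, 0, 0]
  eigenvalue := ![-5, -3, 1]
  base _ := 0
  link := ![![1, 0, 0, 0, 0, 0], ![0, 0, 0, 0, 1, 0], ![0, 0, 0, 0, 0, 1]]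
  factor _ := 1

theorem isRigid_tetrahedralOrigami : tetrahedralOrigami.IsRigid :=
  Origami.isRigid_of_turn_ne 3 (by decide +kernel) (by decide +kernel) (by decide +kernel)

theorem tetrahedralCuts_isFor : tetrahedralCuts.IsFor tetrahedralOrigami where
  vertex := by unfold Origami.IsVertexFunction; decide +kernel
  tree := by decide +kernel
  order := by decide +kernel

theorem tetrahedralFrame_isFor : tetrahedralFrame.IsFor tetrahedralOrigami where
  trans i := .of_mul (by revert i; decide +kernel) (by revert i; decide +kernel)
    (by revert i; decide +kernel) (by revert i; decide +kernel)
  closed := by decide +kernel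
  orthogonal := by decide +kernel
  nondegenerate := by decide +kernel

theorem tetrahedralTwist_isFor (l : Fin 2) :
    (tetrahedralTwist l).IsFor tetrahedralFrame tetrahedralOrigami where
  width := by revert l; decide +kernel
  cob := by revert l; decide +kernel
  eq := by revert l; decide +kernel

theorem tetrahedralSymmetries_isFor :
    tetrahedralSymmetries.IsFor tetrahedralFrame tetrahedralOrigami where
  commutes := by unfold Origami.Commutes; decide +kernel
  eigen := by unfold Origami.Frame.IsCombination; decide +kernel
  injective := by decide +kernel
  ne := by decide +kernel
  type_base := by decide +kernel
  link := by unfold Origami.Frame.IsCombination; decide +kernel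
  factor_ne := by decide +kernel

/-- There is only one place, at which the horizontal and the vertical twist have different axes, so
no separation of places is needed. -/
theorem hasMonodromySL2Pow_of_tetrahedralOrigami {n : ℕ} [NeZero n] {X : LatticePolygons n}
    [Finite X.Cell] {Ψ : X.Surface ≃ₜ tetrahedralOrigami.Surface}
    (hΨ : ∀ s, tetrahedralOrigami.toTorus (Ψ s) = X.toTorus s) : HasMonodromySL2Pow X 1 := by
  refine LatticePolygons.hasMonodromySL2Pow hΨ isRigid_tetrahedralOrigami tetrahedralFrame_isFor
    ⟨tetrahedralCuts_isFor.finrank_dual_le.1, tetrahedralCuts_isFor.finrank_dual_le.2.trans (by simp)⟩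
    tetrahedralSymmetries_isFor tetrahedralTwist_isFor fun G hG => ?_
  refine SL2.eq_top_of_place fun i => SL2.place_eq_top (hG 0) (hG 1) ?_ ?_ ?_ ?_ ?_ <;>
    simp [tetrahedralTwist, Subsingleton.elim _ i]

namespace PolyhedralSurface

/-- The cells of the translation cover of the octahedron. -/
def octahedronTable : CoverTable octahedron 24 where
-- Each of the eight faces occurs with three rotations, and the resulting 24 triangles are the
-- halves of the 12 squares.
cell i := ([(0, 0), (1, 5), (4, 3), (2, 1), (3, 4), (5, 2), (6, 2), (5, 4), (6, 4), (3, 2), (2,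
    3), (7, 1), (4, 1), (7, 3), (2, 5), (1, 1), (7, 5), (4, 5), (1, 3), (0, 2), (6, 0), (5, 0), (0,
    4), (3, 0)] : List ((Fin 8) × Fin 6)).getD i (0, 0)
next i j := ([[(1, 2), (2, 1), (3, 0)], [(4, 2), (5, 1), (0, 0)], [(6, 2), (0, 1), (7, 0)], [(0,
    2), (8, 1), (9, 0)], [(10, 2), (11, 1), (1, 0)], [(12, 2), (1, 1), (13, 0)], [(11, 2), (14,
    1), (2, 0)], [(2, 2), (15, 1), (16, 0)], [(13, 2), (3, 1), (17, 0)], [(3, 2), (16, 1), (18,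
    0)], [(19, 2), (20, 1), (4, 0)], [(21, 2), (4, 1), (6, 0)], [(20, 2), (22, 1), (5, 0)], [(5,
    2), (23, 1), (8, 0)], [(22, 2), (6, 1), (23, 0)], [(23, 2), (7, 1), (19, 0)], [(7, 2), (9,
    1), (20, 0)], [(8, 2), (19, 1), (21, 0)], [(9, 2), (21, 1), (22, 0)], [(15, 2), (17, 1), (10,
    0)], [(16, 2), (10, 1), (12, 0)], [(17, 2), (18, 1), (11, 0)], [(18, 2), (12, 1), (14, 0)],
    [(14, 2), (13, 1), (15, 0)]].getD i []).getD j (0, 0)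
rotated k j := ([[(0, 0), (1, 0), (0, 1)], [(0, 0), (0, 1), (-1, 1)], [(0, 0), (-1, 1), (-1, 0)],
    [(0, 0), (-1, 0), (0, -1)], [(0, 0), (0, -1), (1, -1)], [(0, 0), (1, -1), (1, 0)]].getD k
    []).getD j (0, 0)

/-- The half squares in the cells of the translation cover of the octahedron. -/
def octahedronPlace (b : Bool) (q : Fin 12) : Fin 24 × ℤ × ℤ :=
  if b then
[(2, -1, -1), (16, 0, -1), (3, -1, 0), (18, -1, -1), (14, 0, -1), (11, -1, 0), (10, -1, -1), (1, 0,
    -1), (12, -1, 0), (13, -1, -1), (17, 0, -1), (15, -1, 0)].getD q 0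
  else
[(0, 0, 0), (7, 0, -1), (9, -1, 0), (21, 0, 0), (22, 0, -1), (6, -1, 0), (20, 0, 0), (4, 0,
    -1), (5, -1, 0), (23, 0, 0), (8, 0, -1), (19, -1, 0)].getD q 0


instance : Fintype octahedron.Face := inferInstanceAs (Fintype (Fin 8))

instance : DecidableEq octahedron.Face := inferInstanceAs (DecidableEq (Fin 8))

theorem octahedronTable_isFor : octahedronTable.IsFor zeroPeriod where
  period a b c := mem_zeroPeriod
  rotated := by decide +kernel
  base := rfl
  injective := by decide +kernel
  edge := by decide +kernel
  unique := by decide +kernel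
  side := by decide +kernel
  rotation := by decide +kernel
  reach := by decide +kernel

theorem octahedronTable_layout_isFor : (octahedronTable.layout octahedronPlace).IsFor tetrahedralOrigami where
  mem := by decide +kernel
  bounds := by decide +kernel
  center := by decide +kernel
  width := by decide +kernel
  cover := by decide +kernel
  join := by decide +kernel
  side := by decide +kernel
  unique := by decide +kernel
  adjacent := by decide +kernel
  vertex := by decide +kernel

theorem hasMonodromySL2Pow_octahedron : HasMonodromySL2Pow octahedron.translationCover 1 :=
  have := octahedronTable_isFor.finite_cell
  hasMonodromySL2Pow_of_tetrahedralOrigami (Origami.Layout.toTorus_homeo (octahedronTable_isFor.describes octahedronPlace)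
    octahedronTable_layout_isFor)

/-- The cells of the translation cover of the quotient of Octa-8. -/
def octa8Table : CoverTable octa8 24 where
-- Each of the 24 faces occurs exactly once: the quotient already has trivial holonomy and is its
-- own translation cover.
cell i := ([((0, false, 0), 0), ((3, true, 0), 3), ((0, true, 2), 3), ((0, true, 1), 3), ((3,
    false, 1), 0), ((3, false, 2), 0), ((2, false, 2), 0), ((0, false, 1), 0), ((1, false, 1),
    0), ((0, false, 2), 0), ((2, true, 1), 3), ((3, true, 2), 3), ((1, true, 2), 3), ((3, true, 1),
    3), ((2, true, 0), 3), ((1, true, 1), 3), ((0, true, 0), 3), ((1, true, 0), 3), ((2, true, 2),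
    3), ((2, false, 0), 0), ((1, false, 2), 0), ((3, false, 0), 0), ((1, false, 0), 0), ((2, false,
    1), 0)] : List ((Fin 4 × Bool × Fin 3) × Fin 6)).getD i ((0, false, 0), 0)
next i j := ([[(1, 0), (2, 1), (3, 2)], [(0, 0), (4, 1), (5, 2)], [(6, 0), (0, 1), (7, 2)], [(8,
    0), (9, 1), (0, 2)], [(10, 0), (1, 1), (11, 2)], [(12, 0), (13, 1), (1, 2)], [(2, 0), (10,
    1), (14, 2)], [(15, 0), (16, 1), (2, 2)], [(3, 0), (17, 1), (12, 2)], [(18, 0), (3, 1), (16,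
    2)], [(4, 0), (6, 1), (19, 2)], [(20, 0), (21, 1), (4, 2)], [(5, 0), (22, 1), (8, 2)], [(23,
    0), (5, 1), (21, 2)], [(22, 0), (23, 1), (6, 2)], [(7, 0), (20, 1), (22, 2)], [(21, 0), (7,
    1), (9, 2)], [(19, 0), (8, 1), (20, 2)], [(9, 0), (19, 1), (23, 2)], [(17, 0), (18, 1), (10,
    2)], [(11, 0), (15, 1), (17, 2)], [(16, 0), (11, 1), (13, 2)], [(14, 0), (12, 1), (15, 2)],
    [(13, 0), (14, 1), (18, 2)]].getD i []).getD j (0, 0)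
rotated k j := ([[(0, 0), (1, 0), (0, 1)], [(0, 0), (0, 1), (-1, 1)], [(0, 0), (-1, 1), (-1, 0)],
    [(0, 0), (-1, 0), (0, -1)], [(0, 0), (0, -1), (1, -1)], [(0, 0), (1, -1), (1, 0)]].getD k
    []).getD j (0, 0)

/-- The half squares in the cells of the translation cover of the quotient of Octa-8. -/
def octa8Place (b : Bool) (q : Fin 12) : Fin 24 × ℤ × ℤ :=
  if b then
[(2, -1, -1), (16, -1, -1), (3, -1, -1), (18, -1, -1), (14, -1, -1), (10, -1, -1), (11, -1,
    -1), (1, -1, -1), (13, -1, -1), (12, -1, -1), (17, -1, -1), (15, -1, -1)].getD q 0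
  else
[(0, 0, 0), (7, 0, 0), (9, 0, 0), (19, 0, 0), (23, 0, 0), (6, 0, 0), (21, 0, 0), (4, 0, 0), (5, 0,
    0), (22, 0, 0), (8, 0, 0), (20, 0, 0)].getD q 0


instance : Fintype octa8.Face := inferInstanceAs (Fintype (Fin 4 × Bool × Fin 3))

instance : DecidableEq octa8.Face := inferInstanceAs (DecidableEq (Fin 4 × Bool × Fin 3))

theorem octa8Table_isFor : octa8Table.IsFor centeredPeriod where
  period a b c := mem_centeredPeriod
  rotated := by decide +kernel
  base := rfl
  injective := by decide +kernel
  edge := by decide +kernel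
  unique := by decide +kernel
  side := by decide +kernel
  rotation := by decide +kernel
  reach := by decide +kernel

theorem octa8Table_layout_isFor : (octa8Table.layout octa8Place).IsFor tetrahedralOrigami where
  mem := by decide +kernel
  bounds := by decide +kernel
  center := by decide +kernel
  width := by decide +kernel
  cover := by decide +kernel
  join := by decide +kernel
  side := by decide +kernel
  unique := by decide +kernel
  adjacent := by decide +kernel
  vertex := by decide +kernel

theorem hasMonodromySL2Pow_octa8 : HasMonodromySL2Pow octa8.translationCover 1 :=
  have := octa8Table_isFor.finite_cell
  hasMonodromySL2Pow_of_tetrahedralOrigami (Origami.Layout.toTorus_homeo (octa8Table_isFor.describes octa8Place)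
    octa8Table_layout_isFor)

end PolyhedralSurface

/-! ### The cube and the mucube -/

/-- The square-tiled surface whose squares are the elements of the symmetric group of degree four,
realized by signed permutation matrices. The element with the number `6 * s + 3 * t + r` is the
product of the diagonal matrix with the entries `evenSigns s`, the `r`-th power of the cyclic
permutation matrix, and the `t`-th power of the matrix that exchanges the first two coordinates. -/
def octahedralOrigami : Origami (Fin 24) where
right := ⟨fun q => [9, 16, 23, 12, 19, 8, 3, 22, 17, 18, 13, 2, 21, 4, 11, 0, 7, 20, 15, 10, 5, 6,
    1, 14].getD q 0,
fun q => [15, 22, 11, 6, 13, 20, 21, 16, 5, 0, 19, 14, 3, 10, 23, 18, 1, 8, 9, 4, 17, 12, 7,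
      2].getD q 0, by decide, by decide⟩
up := ⟨fun q => [10, 17, 21, 14, 18, 7, 4, 23, 15, 20, 12, 1, 22, 5, 9, 2, 6, 19, 16, 11, 3, 8, 0,
    13].getD q 0,
fun q => [22, 11, 15, 20, 6, 13, 16, 5, 21, 14, 0, 19, 10, 23, 3, 8, 18, 1, 4, 17, 9, 2, 12,
      7].getD q 0, by decide, by decide⟩

/-- A cut system of `octahedralOrigami`. -/
def octahedralCuts : Origami.CutSystem (Fin 24) 7 18 where
tree l := [(false, 0), (true, 0), (true, 1), (false, 2), (true, 2), (false, 6), (false, 7)].getD l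
    (false, 0)
dual l q := if ([394002, 15842540, 16514813, 10381147, 2162720, 15720383, 4229120].getD l
    0).testBit q then 1 else 0
extra l := [(false, 1), (false, 3), (false, 4), (true, 4), (true, 5), (true, 6), (true, 7), (true,
    8), (true, 11), (false, 14), (true, 14), (false, 15), (true, 16), (true, 17), (false,
    18), (true, 20), (false, 23), (true, 23)].getD l (false, 0)
order := [1, 8, 2, 6, 7, 15, 16, 5, 23, 4, 11, 17, 21, 3, 22, 18, 20, 14, 13, 19, 12, 9, 10]

/-- The column, modulo `3`, of the nonzero entry in the row `a` of the matrix with the number `q`. -/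
def octahedralColumn (q a : ℕ) : ℕ := if q % 6 < 3 then a + 2 * q else 1 + 2 * (a + 2 * q)

/-- The three irreducible representations of dimensions `2`, `3` and `3`; the first one is the action
on the triples with sum zero, and the second one is the product of the third one and the sign. -/
def octahedralFrame : Origami.Frame (Fin 24) (Fin 8) 3 where
  type := ![0, 0, 1, 1, 1, 2, 2, 2]
  row i q :=
    let ε : Fin 3 → ℤ := evenSigns ⟨q / 6, by omega⟩
    let δ : ℤ := if (q : ℕ) % 6 < 3 then 1 else -1
    let e (x : ℤ) (a : ℕ) : Triple := Origami.unitTriple x (octahedralColumn q a)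
    -- The two entries of the first type are orthogonal combinations, with coefficient sum zero, of
    -- the rows of the matrix with its signs removed. The others are the rows of the signed matrix,
    -- with and without the sign `δ` of the permutation.
    ![.comb 1 (-1) (e 1 0) (e 1 1), .comb 1 (-2) (.comb 1 1 (e 1 0) (e 1 1)) (e 1 2), e (δ * ε 0) 0,
      e (δ * ε 1) 1, e (δ * ε 2) 2, e (ε 0) 0, e (ε 1) 1, e (ε 2) 2] i
  trans := ![
    ⟨((0, 1, 0), (1, 0, 0), (0, 0, 1)), ((0, 0, 1), (0, 1, 0), (1, 0, 0)),
      ((0, 1, 0), (1, 0, 0), (0, 0, 1)), ((0, 0, 1), (0, 1, 0), (1, 0, 0))⟩,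
    ⟨((0, -1, 0), (1, 0, 0), (0, 0, 1)), ((0, 0, -1), (0, 1, 0), (1, 0, 0)),
      ((0, 1, 0), (-1, 0, 0), (0, 0, 1)), ((0, 0, 1), (0, 1, 0), (-1, 0, 0))⟩,
    ⟨((0, 1, 0), (-1, 0, 0), (0, 0, -1)), ((0, 0, 1), (0, -1, 0), (-1, 0, 0)),
      ((0, -1, 0), (1, 0, 0), (0, 0, -1)), ((0, 0, -1), (0, -1, 0), (1, 0, 0))⟩]
  hor := ![![(1, -2, 1), (0, 0, 0)], ![(1, 1, 1), (0, 0, 0)], ![(0, 1, 0), (1, 1, 1)]]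
  ver := ![![(0, 0, 0), (1, 1, -2)], ![(1, 1, 1), (0, 0, 1)], ![(1, 1, 0), (1, 1, 1)]]

/-- Twists in five directions. -/
def octahedralTwist (l : Fin 5) : Origami.Frame.Twist 3 where
  word := ![[], [false], [true, false], [false, true, false], [true, true, true, false]] l
  width := ![4, 4, 3, 3, 3] l
  -- A zero means a trivial action. The two twists of width four are trivial at the third place, and
  -- those of width three at the first; this is what allows the places to be separated.
  m := ![![-2, 4, 0], ![-2, 4, 0], ![0, 1, -1], ![0, 1, -1], ![0, 1, -1]] l
  p := ![![1, 1, 1], ![0, 1, 1], ![1, 0, 1], ![1, 0, 1], ![1, 4, 1]] l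
  q := ![![0, 0, 0], ![1, 0, 0], ![0, 1, 0], ![0, 1, 2], ![0, -1, 2]] l
  cob j b :=
    match l, j, b with
    | 1, 1, 0 => (-2, 2, 2)
    | 3, 1, 1 => (1, -1, -1)
    | 4, 1, 0 => (-4, 4, 4)
    | 4, 1, 1 => (1, -1, -1)
    | _, _, _ => (0, 0, 0)

/-- The symmetries given by the diagonal matrices, the six transpositions and the cyclic permutations. -/
def octahedralSymmetries : Origami.Frame.Symmetries (Fin 24) (Fin 8) 3 12 where
  perm := ![
⟨fun q => [0, 1, 2, 3, 4, 5, 6, 7, 8, 9, 10, 11, 12, 13, 14, 15, 16, 17, 18, 19, 20, 21, 22,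
      23].getD q 0,
fun q => [0, 1, 2, 3, 4, 5, 6, 7, 8, 9, 10, 11, 12, 13, 14, 15, 16, 17, 18, 19, 20, 21, 22,
      23].getD q 0, by decide, by decide⟩,
⟨fun q => [6, 7, 8, 9, 10, 11, 0, 1, 2, 3, 4, 5, 18, 19, 20, 21, 22, 23, 12, 13, 14, 15, 16,
      17].getD q 0,
fun q => [6, 7, 8, 9, 10, 11, 0, 1, 2, 3, 4, 5, 18, 19, 20, 21, 22, 23, 12, 13, 14, 15, 16,
      17].getD q 0, by decide, by decide⟩,
⟨fun q => [12, 13, 14, 15, 16, 17, 18, 19, 20, 21, 22, 23, 0, 1, 2, 3, 4, 5, 6, 7, 8, 9, 10,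
      11].getD q 0,
fun q => [12, 13, 14, 15, 16, 17, 18, 19, 20, 21, 22, 23, 0, 1, 2, 3, 4, 5, 6, 7, 8, 9, 10,
      11].getD q 0, by decide, by decide⟩,
⟨fun q => [18, 19, 20, 21, 22, 23, 12, 13, 14, 15, 16, 17, 6, 7, 8, 9, 10, 11, 0, 1, 2, 3, 4,
      5].getD q 0,
fun q => [18, 19, 20, 21, 22, 23, 12, 13, 14, 15, 16, 17, 6, 7, 8, 9, 10, 11, 0, 1, 2, 3, 4,
      5].getD q 0, by decide, by decide⟩,
⟨fun q => [3, 5, 4, 0, 2, 1, 15, 17, 16, 12, 14, 13, 9, 11, 10, 6, 8, 7, 21, 23, 22, 18, 20,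
      19].getD q 0,
fun q => [3, 5, 4, 0, 2, 1, 15, 17, 16, 12, 14, 13, 9, 11, 10, 6, 8, 7, 21, 23, 22, 18, 20,
      19].getD q 0, by decide, by decide⟩,
⟨fun q => [4, 3, 5, 1, 0, 2, 22, 21, 23, 19, 18, 20, 16, 15, 17, 13, 12, 14, 10, 9, 11, 7, 6,
      8].getD q 0,
fun q => [4, 3, 5, 1, 0, 2, 22, 21, 23, 19, 18, 20, 16, 15, 17, 13, 12, 14, 10, 9, 11, 7, 6,
      8].getD q 0, by decide, by decide⟩,
⟨fun q => [5, 4, 3, 2, 1, 0, 11, 10, 9, 8, 7, 6, 23, 22, 21, 20, 19, 18, 17, 16, 15, 14, 13,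
      12].getD q 0,
fun q => [5, 4, 3, 2, 1, 0, 11, 10, 9, 8, 7, 6, 23, 22, 21, 20, 19, 18, 17, 16, 15, 14, 13,
      12].getD q 0, by decide, by decide⟩,
⟨fun q => [11, 10, 9, 8, 7, 6, 5, 4, 3, 2, 1, 0, 17, 16, 15, 14, 13, 12, 23, 22, 21, 20, 19,
      18].getD q 0,
fun q => [11, 10, 9, 8, 7, 6, 5, 4, 3, 2, 1, 0, 17, 16, 15, 14, 13, 12, 23, 22, 21, 20, 19,
      18].getD q 0, by decide, by decide⟩,
⟨fun q => [16, 15, 17, 13, 12, 14, 10, 9, 11, 7, 6, 8, 4, 3, 5, 1, 0, 2, 22, 21, 23, 19, 18,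
      20].getD q 0,
fun q => [16, 15, 17, 13, 12, 14, 10, 9, 11, 7, 6, 8, 4, 3, 5, 1, 0, 2, 22, 21, 23, 19, 18,
      20].getD q 0, by decide, by decide⟩,
⟨fun q => [21, 23, 22, 18, 20, 19, 9, 11, 10, 6, 8, 7, 15, 17, 16, 12, 14, 13, 3, 5, 4, 0, 2,
      1].getD q 0,
fun q => [21, 23, 22, 18, 20, 19, 9, 11, 10, 6, 8, 7, 15, 17, 16, 12, 14, 13, 3, 5, 4, 0, 2,
      1].getD q 0, by decide, by decide⟩,
⟨fun q => [1, 2, 0, 4, 5, 3, 13, 14, 12, 16, 17, 15, 19, 20, 18, 22, 23, 21, 7, 8, 6, 10, 11,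
      9].getD q 0,
fun q => [2, 0, 1, 5, 3, 4, 20, 18, 19, 23, 21, 22, 8, 6, 7, 11, 9, 10, 14, 12, 13, 17, 15,
      16].getD q 0, by decide, by decide⟩,
⟨fun q => [2, 0, 1, 5, 3, 4, 20, 18, 19, 23, 21, 22, 8, 6, 7, 11, 9, 10, 14, 12, 13, 17, 15,
      16].getD q 0,
fun q => [1, 2, 0, 4, 5, 3, 13, 14, 12, 16, 17, 15, 19, 20, 18, 22, 23, 21, 7, 8, 6, 10, 11,
      9].getD q 0, by decide, by decide⟩]
  -- The diagonal matrices separate the coordinates of the representations of dimension three. The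
  -- sum of all six transpositions is the scalar `0` on the first type, `-2` on the second and `2`
  -- on the third. The additional weight `8` on the two transpositions that exchange the first two
  -- coordinates separates the two indices of the first type. On holonomy the value is `29`.
  weight := ![0, 1, 2, 4, 9, 1, 1, 1, 1, 9, 0, 0]
  eigenvalue := ![-9, 23, -7, -5, -17, -3, -1, 19]
  base := ![0, 2, 5]
  link := ![![1, 0, 0, 0, 0, 0, 0, 0, 0, 0, 0, 0],
    -- The difference of the two cyclic permutations turns the combination with coefficients `1`,
    -- `1`, `-2` into three times the one with coefficients `1`, `-1`, `0`, which explains the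
    -- factor `3`.
    ![0, 0, 0, 0, 0, 0, 0, 0, 0, 0, 1, -1],
    ![1, 0, 0, 0, 0, 0, 0, 0, 0, 0, 0, 0],
    ![0, 0, 0, 0, 0, 0, 0, 0, 0, 0, 1, 0],
    ![0, 0, 0, 0, 0, 0, 0, 0, 0, 0, 0, 1],
    ![1, 0, 0, 0, 0, 0, 0, 0, 0, 0, 0, 0],
    ![0, 0, 0, 0, 0, 0, 0, 0, 0, 0, 1, 0],
    ![0, 0, 0, 0, 0, 0, 0, 0, 0, 0, 0, 1]]
  factor := ![1, 3, 1, 1, 1, 1, 1, 1]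

theorem isRigid_octahedralOrigami : octahedralOrigami.IsRigid :=
  Origami.isRigid_of_turn_ne 4 (by decide +kernel) (by decide +kernel) (by decide +kernel)

theorem octahedralCuts_isFor : octahedralCuts.IsFor octahedralOrigami where
  vertex := by unfold Origami.IsVertexFunction; decide +kernel
  tree := by decide +kernel
  order := by decide +kernel

theorem octahedralFrame_isFor : octahedralFrame.IsFor octahedralOrigami where
  trans i := .of_mul (by revert i; decide +kernel) (by revert i; decide +kernel)
    (by revert i; decide +kernel) (by revert i; decide +kernel)
  closed := by decide +kernel
  orthogonal := by decide +kernel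
  nondegenerate := by decide +kernel

theorem octahedralTwist_isFor (l : Fin 5) :
    (octahedralTwist l).IsFor octahedralFrame octahedralOrigami where
  width := by revert l; decide +kernel
  cob := by revert l; decide +kernel
  eq := by revert l; decide +kernel

theorem octahedralSymmetries_isFor :
    octahedralSymmetries.IsFor octahedralFrame octahedralOrigami where
  commutes := by unfold Origami.Commutes; decide +kernel
  eigen := by unfold Origami.Frame.IsCombination; decide +kernel
  injective := by decide +kernel
  ne := by decide +kernel
  type_base := by decide +kernel
  link := by unfold Origami.Frame.IsCombination; decide +kernel
  factor_ne := by decide +kernel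

theorem hasMonodromySL2Pow_of_octahedralOrigami {n : ℕ} [NeZero n] {X : LatticePolygons n}
    [Finite X.Cell] {Ψ : X.Surface ≃ₜ octahedralOrigami.Surface}
    (hΨ : ∀ s, octahedralOrigami.toTorus (Ψ s) = X.toTorus s) : HasMonodromySL2Pow X 3 := by
  refine LatticePolygons.hasMonodromySL2Pow hΨ isRigid_octahedralOrigami octahedralFrame_isFor
    ⟨octahedralCuts_isFor.finrank_dual_le.1, octahedralCuts_isFor.finrank_dual_le.2.trans (by simp)⟩
    octahedralSymmetries_isFor octahedralTwist_isFor fun G hG => ?_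
  -- The twists `2` and `4` live at the places `1` and `2`, the twist `0` at `0` and `1`, so
  -- commutators isolate the place `1`. The twist `3` could not replace `4`, being parallel to `2`
  -- at this place.
  have h1 : SL2.place G {1} 1 = ⊤ :=
    Origami.Frame.Twist.Transversal.place_eq_top_of_inter (by decide) (hG 2) (hG 4) (hG 0)
      (by decide) (by decide) (by decide)
  -- The remaining two places are each coupled only with the place `1`, which can now be divided
  -- out.
  have h0 : SL2.place G {0} 0 = ⊤ :=
    Origami.Frame.Twist.Transversal.place_eq_top_of_diff (by decide) (hG 0) (hG 1) h1
      (by decide) (by decide)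
  have h2 : SL2.place G {2} 2 = ⊤ :=
    Origami.Frame.Twist.Transversal.place_eq_top_of_diff (by decide) (hG 2) (hG 3) h1
      (by decide) (by decide)
  exact SL2.eq_top_of_place (Fin.forall_fin_succ.2 ⟨h0, Fin.forall_fin_two.2 ⟨h1, h2⟩⟩)

namespace PolyhedralSurface

/-- The cells of the translation cover of the cube. -/
def cubeTable : CoverTable cube 24 where
cell i := ([(0, 0), (5, 0), (2, 1), (4, 3), (3, 0), (1, 3), (2, 0), (3, 1), (1, 1), (4, 2), (5,
    1), (3, 3), (2, 2), (5, 3), (4, 0), (3, 2), (2, 3), (1, 0), (4, 1), (0, 3), (0, 1), (1, 2), (5,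
    2), (0, 2)] : List ((Fin 6) × Fin 4)).getD i (0, 0)
next i j := ([[(1, 2), (2, 2), (3, 1), (4, 1)], [(5, 3), (6, 3), (0, 0), (7, 0)], [(8, 2), (9,
    2), (0, 1), (10, 1)], [(11, 2), (0, 2), (12, 1), (5, 1)], [(13, 3), (0, 3), (14, 0), (8, 0)],
    [(15, 3), (3, 3), (16, 0), (1, 0)], [(17, 2), (18, 2), (19, 1), (1, 1)], [(1, 3), (20, 3), (18,
    0), (21, 0)], [(4, 3), (18, 3), (2, 0), (22, 0)], [(15, 2), (19, 2), (2, 1), (21, 1)], [(17,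
    3), (2, 3), (20, 0), (15, 0)], [(22, 3), (19, 3), (3, 0), (17, 0)], [(21, 2), (3, 2), (20,
    1), (22, 1)], [(21, 3), (16, 3), (19, 0), (4, 0)], [(4, 2), (20, 2), (16, 1), (17, 1)], [(10,
    3), (23, 3), (9, 0), (5, 0)], [(5, 2), (14, 2), (23, 1), (13, 1)], [(11, 3), (14, 3), (6,
    0), (10, 0)], [(7, 2), (23, 2), (6, 1), (8, 1)], [(13, 2), (6, 2), (9, 1), (11, 1)], [(10,
    2), (12, 2), (14, 1), (7, 1)], [(7, 3), (9, 3), (12, 0), (13, 0)], [(8, 3), (12, 3), (23,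
    0), (11, 0)], [(22, 2), (16, 2), (18, 1), (15, 1)]].getD i []).getD j (0, 0)
rotated k j := ([[(0, 0), (1, 0), (1, 1), (0, 1)], [(0, 0), (0, 1), (-1, 1), (-1, 0)], [(0,
    0), (-1, 0), (-1, -1), (0, -1)], [(0, 0), (0, -1), (1, -1), (1, 0)]].getD k []).getD j (0, 0)

/-- The half squares in the cells of the translation cover of the cube. -/
def cubePlace (b : Bool) (q : Fin 24) : Fin 24 × ℤ × ℤ :=
  if b then
-- A face of the cube is a whole unit square, so both halves of a square lie in the same cell with
-- the same offset.
[(0, 0, 0), (6, 0, 0), (14, 0, 0), (15, -1, -1), (22, -1, -1), (21, -1, -1), (23, -1, -1), (7, -1,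
    0), (13, 0, -1), (2, -1, 0), (3, 0, -1), (17, 0, 0), (5, 0, -1), (12, -1, -1), (10, -1, 0), (4,
    0, 0), (18, -1, 0), (19, 0, -1), (8, -1, 0), (11, 0, -1), (9, -1, -1), (16, 0, -1), (1, 0,
    0), (20, -1, 0)].getD q 0
  else
[(0, 0, 0), (6, 0, 0), (14, 0, 0), (15, -1, -1), (22, -1, -1), (21, -1, -1), (23, -1, -1), (7, -1,
    0), (13, 0, -1), (2, -1, 0), (3, 0, -1), (17, 0, 0), (5, 0, -1), (12, -1, -1), (10, -1, 0), (4,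
    0, 0), (18, -1, 0), (19, 0, -1), (8, -1, 0), (11, 0, -1), (9, -1, -1), (16, 0, -1), (1, 0,
    0), (20, -1, 0)].getD q 0


instance : Fintype cube.Face := inferInstanceAs (Fintype (Fin 6))

instance : DecidableEq cube.Face := inferInstanceAs (DecidableEq (Fin 6))

theorem cubeTable_isFor : cubeTable.IsFor zeroPeriod where
  period a b c := mem_zeroPeriod
  rotated := by decide +kernel
  base := rfl
  injective := by decide +kernel
  edge := by decide +kernel
  unique := by decide +kernel
  side := by decide +kernel
  rotation := by decide +kernel
  reach := by decide +kernel

theorem cubeTable_layout_isFor : (cubeTable.layout cubePlace).IsFor octahedralOrigami where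
  mem := by decide +kernel
  bounds := by decide +kernel
  center := by decide +kernel
  width := by decide +kernel
  cover := by decide +kernel
  join := by decide +kernel
  side := by decide +kernel
  unique := by decide +kernel
  adjacent := by decide +kernel
  vertex := by decide +kernel

theorem hasMonodromySL2Pow_cube : HasMonodromySL2Pow cube.translationCover 3 :=
  have := cubeTable_isFor.finite_cell
  hasMonodromySL2Pow_of_octahedralOrigami (Origami.Layout.toTorus_homeo (cubeTable_isFor.describes cubePlace)
    cubeTable_layout_isFor)

/-- The cells of the translation cover of the quotient of the mucube. -/
def mucubeTable : CoverTable mucube 24 where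
-- Each of the twelve faces occurs with two opposite rotations, so the translation cover of the
-- quotient has degree two.
cell i := ([(0, 0), (6, 3), (2, 1), (7, 0), (3, 0), (5, 3), (1, 3), (4, 2), (1, 1), (9, 1), (8,
    2), (4, 0), (5, 1), (8, 0), (9, 3), (7, 2), (11, 0), (10, 3), (3, 2), (2, 3), (10, 1), (11,
    2), (6, 1), (0, 2)] : List ((Fin 12) × Fin 4)).getD i (0, 0)
next i j := ([[(1, 3), (2, 2), (3, 0), (4, 1)], [(5, 2), (6, 3), (7, 1), (0, 0)], [(8, 2), (9,
    3), (0, 1), (10, 0)], [(0, 2), (11, 3), (6, 1), (12, 0)], [(13, 2), (0, 3), (14, 1), (8, 0)],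
    [(15, 3), (16, 2), (1, 0), (17, 1)], [(18, 3), (3, 2), (19, 0), (1, 1)], [(20, 3), (1, 2), (21,
    0), (15, 1)], [(4, 3), (15, 2), (2, 0), (22, 1)], [(16, 3), (18, 2), (20, 0), (2, 1)], [(2,
    3), (17, 2), (18, 0), (21, 1)], [(17, 3), (22, 2), (16, 0), (3, 1)], [(3, 3), (21, 2), (22,
    0), (20, 1)], [(19, 3), (20, 2), (4, 0), (16, 1)], [(21, 3), (4, 2), (17, 0), (19, 1)], [(23,
    2), (7, 3), (8, 1), (5, 0)], [(11, 2), (13, 3), (5, 1), (9, 0)], [(14, 2), (5, 3), (10,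
    1), (11, 0)], [(10, 2), (23, 3), (9, 1), (6, 0)], [(6, 2), (14, 3), (23, 1), (13, 0)], [(9,
    2), (12, 3), (13, 1), (7, 0)], [(7, 2), (10, 3), (12, 1), (14, 0)], [(12, 2), (8, 3), (11,
    1), (23, 0)], [(22, 3), (19, 2), (15, 0), (18, 1)]].getD i []).getD j (0, 0)
rotated k j := ([[(0, 0), (1, 0), (1, 1), (0, 1)], [(0, 0), (0, 1), (-1, 1), (-1, 0)], [(0,
    0), (-1, 0), (-1, -1), (0, -1)], [(0, 0), (0, -1), (1, -1), (1, 0)]].getD k []).getD j (0, 0)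

/-- The half squares in the cells of the translation cover of the quotient of the mucube. -/
def mucubePlace (b : Bool) (q : Fin 24) : Fin 24 × ℤ × ℤ :=
  if b then
[(0, 0, 0), (7, -1, -1), (14, 0, -1), (18, -1, -1), (22, -1, 0), (16, 0, 0), (23, -1, -1), (5, 0,
    -1), (13, 0, 0), (2, -1, 0), (3, 0, 0), (21, -1, -1), (6, 0, -1), (11, 0, 0), (10, -1, -1), (4,
    0, 0), (15, -1, -1), (20, -1, 0), (8, -1, 0), (12, -1, 0), (9, -1, 0), (19, 0, -1), (1, 0,
    -1), (17, 0, -1)].getD q 0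
  else
[(0, 0, 0), (7, -1, -1), (14, 0, -1), (18, -1, -1), (22, -1, 0), (16, 0, 0), (23, -1, -1), (5, 0,
    -1), (13, 0, 0), (2, -1, 0), (3, 0, 0), (21, -1, -1), (6, 0, -1), (11, 0, 0), (10, -1, -1), (4,
    0, 0), (15, -1, -1), (20, -1, 0), (8, -1, 0), (12, -1, 0), (9, -1, 0), (19, 0, -1), (1, 0,
    -1), (17, 0, -1)].getD q 0


instance : Fintype mucube.Face := inferInstanceAs (Fintype (Fin 12))

instance : DecidableEq mucube.Face := inferInstanceAs (DecidableEq (Fin 12))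

theorem mucubeTable_isFor : mucubeTable.IsFor cubicPeriod where
  period a b c := mem_cubicPeriod
  rotated := by decide +kernel
  base := rfl
  injective := by decide +kernel
  edge := by decide +kernel
  unique := by decide +kernel
  side := by decide +kernel
  rotation := by decide +kernel
  reach := by decide +kernel

theorem mucubeTable_layout_isFor : (mucubeTable.layout mucubePlace).IsFor octahedralOrigami where
  mem := by decide +kernel
  bounds := by decide +kernel
  center := by decide +kernel
  width := by decide +kernel
  cover := by decide +kernel
  join := by decide +kernel
  side := by decide +kernel
  unique := by decide +kernel
  adjacent := by decide +kernel
  vertex := by decide +kernel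

theorem hasMonodromySL2Pow_mucube : HasMonodromySL2Pow mucube.translationCover 3 :=
  have := mucubeTable_isFor.finite_cell
  hasMonodromySL2Pow_of_octahedralOrigami (Origami.Layout.toTorus_homeo (mucubeTable_isFor.describes mucubePlace)
    mucubeTable_layout_isFor)

end PolyhedralSurface

/-! ### The mutetrahedron -/

/-- The square-tiled surface of the mutetrahedron. The square with the number `3 * g + s` is the image of
the square `s` under the symmetry `g` of the elementary abelian group of order eight, which acts by
the addition of binary digits without carry. -/
def mutetrahedralOrigami : Origami (Fin 24) where
right := ⟨fun q => [2, 6, 13, 5, 9, 16, 8, 0, 19, 11, 3, 22, 14, 18, 1, 17, 21, 4, 20, 12, 7, 23,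
    15, 10].getD q 0,
fun q => [7, 14, 0, 10, 17, 3, 1, 20, 6, 4, 23, 9, 19, 2, 12, 22, 5, 15, 13, 8, 18, 16, 11,
      21].getD q 0, by decide, by decide⟩
up := ⟨fun q => [4, 2, 12, 1, 5, 15, 10, 8, 18, 7, 11, 21, 16, 14, 0, 13, 17, 3, 22, 20, 6, 19, 23,
    9].getD q 0,
fun q => [14, 3, 1, 17, 0, 4, 20, 9, 7, 23, 6, 10, 2, 15, 13, 5, 12, 16, 8, 21, 19, 11, 18,
      22].getD q 0, by decide, by decide⟩

/-- A cut system of `mutetrahedralOrigami`. -/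
def mutetrahedralCuts : Origami.CutSystem (Fin 24) 15 10 where
tree l := [(false, 0), (true, 0), (true, 1), (false, 2), (true, 2), (true, 3), (true, 4), (false,
    5), (true, 5), (false, 6), (false, 9), (false, 12), (false, 15), (false, 18), (false, 21)].getD
    l (false, 0)
dual l q := if ([5537294, 754160, 11272181, 9216, 23040, 15466487, 229856, 65664, 164160, 256,
    2048, 16384, 131072, 1048576, 8388608].getD l 0).testBit q then 1 else 0
extra l := [(false, 3), (false, 10), (false, 13), (false, 14), (false, 16), (false, 17), (false,
    20), (false, 22), (false, 23), (true, 23)].getD l (false, 0)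
order := [5, 2, 14, 16, 3, 17, 13, 12, 21, 1, 15, 23, 18, 19, 6, 22, 10, 20, 8, 11, 7, 9, 4]

/-- Four characters of the group of symmetries: the three coordinates and their product. -/
def mutetrahedralFrame : Origami.Frame (Fin 24) (Fin 4) 4 where
  type i := i
  row i q :=
    let χ (a : ℕ) : ℤ := if ((q : ℕ) / 3).testBit a then -1 else 1
    Origami.unitTriple (![χ 0, χ 1, χ 2, χ 0 * χ 1 * χ 2] i) q
  trans := ![
    ⟨((0, 0, 1), (1, 0, 0), (0, 1, 0)), ((0, -1, 0), (0, 0, 1), (1, 0, 0)),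
      ((0, 1, 0), (0, 0, 1), (1, 0, 0)), ((0, 0, 1), (-1, 0, 0), (0, 1, 0))⟩,
    ⟨((0, 0, 1), (-1, 0, 0), (0, 1, 0)), ((0, 1, 0), (0, 0, 1), (1, 0, 0)),
      ((0, -1, 0), (0, 0, 1), (1, 0, 0)), ((0, 0, 1), (1, 0, 0), (0, 1, 0))⟩,
    ⟨((0, 0, 1), (1, 0, 0), (0, -1, 0)), ((0, 1, 0), (0, 0, 1), (-1, 0, 0)),
      ((0, 1, 0), (0, 0, -1), (1, 0, 0)), ((0, 0, -1), (1, 0, 0), (0, 1, 0))⟩,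
    ⟨((0, 0, 1), (-1, 0, 0), (0, -1, 0)), ((0, -1, 0), (0, 0, 1), (-1, 0, 0)),
      ((0, -1, 0), (0, 0, -1), (1, 0, 0)), ((0, 0, -1), (-1, 0, 0), (0, 1, 0))⟩]
  hor := ![![(1, 0, 1), (0, 0, 0)], ![(0, 1, 0), (1, 1, 1)], ![(1, 0, 1), (1, 1, 1)], ![(1, -1, -1), (0, 0, 0)]]
  ver := ![![(2, 1, 1), (1, 1, 1)], ![(0, 1, 1), (0, 0, 0)], ![(2, 1, 1), (1, 1, 1)], ![(0, 0, 0), (1, -1, 1)]]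

/-- Twists in six directions. -/
def mutetrahedralTwist (l : Fin 6) : Origami.Frame.Twist 4 where
  word := ![[], [false], [true, false], [true, true, true, false], [false, true, true, false], [true, true, true, true, false]] l
  width := 6
  -- Every twist acts at exactly two places: at the last one and at one of the other three. Each of
  -- these pairs of places is served by two directions.
  m := ![![4, 0, 0, 2], ![0, -4, 0, 2], ![0, 0, -4, 2], ![0, 0, -4, 2], ![4, 0, 0, 2], ![0, -4, 0, 2]] l
  p := ![![1, 1, 1, 1], ![1, 1, 1, 0], ![1, 1, 1, 1], ![1, 1, 1, 1], ![3, 1, 1, 1], ![1, 1, 1, 0]] l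
  q := ![![0, 0, 0, 0], ![0, 0, 0, 1], ![0, 0, 0, 1], ![0, 0, 2, -1], ![2, 0, 0, 2], ![0, 2, 0, 1]] l
  cob j b :=
    match l, j, b with
    | 2, 3, 0 => (0, 0, 4)
    | 2, 3, 1 => (0, 0, 4)
    | 4, 3, 0 => (0, 0, 4)
    | 4, 3, 1 => (0, 0, 8)
    | 5, 3, 1 => (0, 0, 4)
    | _, _, _ => (0, 0, 0)

/-- The generators of the group of symmetries. -/
def mutetrahedralSymmetries : Origami.Frame.Symmetries (Fin 24) (Fin 4) 4 4 where
  perm := ![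
⟨fun q => [0, 1, 2, 3, 4, 5, 6, 7, 8, 9, 10, 11, 12, 13, 14, 15, 16, 17, 18, 19, 20, 21, 22,
      23].getD q 0,
fun q => [0, 1, 2, 3, 4, 5, 6, 7, 8, 9, 10, 11, 12, 13, 14, 15, 16, 17, 18, 19, 20, 21, 22,
      23].getD q 0, by decide, by decide⟩,
⟨fun q => [3, 4, 5, 0, 1, 2, 9, 10, 11, 6, 7, 8, 15, 16, 17, 12, 13, 14, 21, 22, 23, 18, 19,
      20].getD q 0,
fun q => [3, 4, 5, 0, 1, 2, 9, 10, 11, 6, 7, 8, 15, 16, 17, 12, 13, 14, 21, 22, 23, 18, 19,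
      20].getD q 0, by decide, by decide⟩,
⟨fun q => [6, 7, 8, 9, 10, 11, 0, 1, 2, 3, 4, 5, 18, 19, 20, 21, 22, 23, 12, 13, 14, 15, 16,
      17].getD q 0,
fun q => [6, 7, 8, 9, 10, 11, 0, 1, 2, 3, 4, 5, 18, 19, 20, 21, 22, 23, 12, 13, 14, 15, 16,
      17].getD q 0, by decide, by decide⟩,
⟨fun q => [12, 13, 14, 15, 16, 17, 18, 19, 20, 21, 22, 23, 0, 1, 2, 3, 4, 5, 6, 7, 8, 9, 10,
      11].getD q 0,
fun q => [12, 13, 14, 15, 16, 17, 18, 19, 20, 21, 22, 23, 0, 1, 2, 3, 4, 5, 6, 7, 8, 9, 10,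
      11].getD q 0, by decide, by decide⟩]
  -- A generator acts by `-1` on its own coordinate character and on the product character. The
  -- weights `1`, `2`, `4` therefore separate the four characters from each other and from the value
  -- `7` on holonomy.
  weight := ![0, 1, 2, 4]
  eigenvalue := ![5, 3, -1, -7]
  base := ![0, 1, 2, 3]
  link := ![![1, 0, 0, 0],
    ![1, 0, 0, 0],
    ![1, 0, 0, 0],
    ![1, 0, 0, 0]]
  factor := ![1, 1, 1, 1]

theorem isRigid_mutetrahedralOrigami : mutetrahedralOrigami.IsRigid :=
  Origami.isRigid_of_turn_ne 6 (by decide +kernel) (by decide +kernel) (by decide +kernel)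

theorem mutetrahedralCuts_isFor : mutetrahedralCuts.IsFor mutetrahedralOrigami where
  vertex := by unfold Origami.IsVertexFunction; decide +kernel
  tree := by decide +kernel
  order := by decide +kernel

theorem mutetrahedralFrame_isFor : mutetrahedralFrame.IsFor mutetrahedralOrigami where
  trans i := .of_mul (by revert i; decide +kernel) (by revert i; decide +kernel)
    (by revert i; decide +kernel) (by revert i; decide +kernel)
  closed := by decide +kernel
  orthogonal := by decide +kernel
  nondegenerate := by decide +kernel

theorem mutetrahedralTwist_isFor (l : Fin 6) :
    (mutetrahedralTwist l).IsFor mutetrahedralFrame mutetrahedralOrigami where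
  width := by revert l; decide +kernel
  cob := by revert l; decide +kernel
  eq := by revert l; decide +kernel

theorem mutetrahedralSymmetries_isFor :
    mutetrahedralSymmetries.IsFor mutetrahedralFrame mutetrahedralOrigami where
  commutes := by unfold Origami.Commutes; decide +kernel
  eigen := by unfold Origami.Frame.IsCombination; decide +kernel
  injective := by decide +kernel
  ne := by decide +kernel
  type_base := by decide +kernel
  link := by unfold Origami.Frame.IsCombination; decide +kernel
  factor_ne := by decide +kernel

theorem hasMonodromySL2Pow_of_mutetrahedralOrigami {n : ℕ} [NeZero n] {X : LatticePolygons n}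
    [Finite X.Cell] {Ψ : X.Surface ≃ₜ mutetrahedralOrigami.Surface}
    (hΨ : ∀ s, mutetrahedralOrigami.toTorus (Ψ s) = X.toTorus s) : HasMonodromySL2Pow X 4 := by
  refine LatticePolygons.hasMonodromySL2Pow hΨ isRigid_mutetrahedralOrigami mutetrahedralFrame_isFor
    ⟨mutetrahedralCuts_isFor.finrank_dual_le.1, mutetrahedralCuts_isFor.finrank_dual_le.2.trans (by simp)⟩
    mutetrahedralSymmetries_isFor mutetrahedralTwist_isFor fun G hG => ?_
  -- The twists `0` and `4` share the places `0` and `3`, while the twist `1` acts at `1` and `3`;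
  -- only the place `3` is common. Every other place is coupled with this one alone.
  have h3 : SL2.place G {3} 3 = ⊤ :=
    Origami.Frame.Twist.Transversal.place_eq_top_of_inter (by decide) (hG 0) (hG 4) (hG 1)
      (by decide) (by decide) (by decide)
  have h0 : SL2.place G {0} 0 = ⊤ :=
    Origami.Frame.Twist.Transversal.place_eq_top_of_diff (by decide) (hG 0) (hG 4) h3
      (by decide) (by decide)
  have h1 : SL2.place G {1} 1 = ⊤ :=
    Origami.Frame.Twist.Transversal.place_eq_top_of_diff (by decide) (hG 1) (hG 5) h3
      (by decide) (by decide)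
  have h2 : SL2.place G {2} 2 = ⊤ :=
    Origami.Frame.Twist.Transversal.place_eq_top_of_diff (by decide) (hG 2) (hG 3) h3
      (by decide) (by decide)
  exact SL2.eq_top_of_place
    (Fin.forall_fin_succ.2 ⟨h0, Fin.forall_fin_succ.2 ⟨h1, Fin.forall_fin_two.2 ⟨h2, h3⟩⟩⟩)

namespace PolyhedralSurface

/-- The cells of the translation cover of the quotient of the mutetrahedron. -/
def mutetrahedronTable : CoverTable mutetrahedron 8 where
-- Each of the four hexagons occurs with two opposite rotations; a hexagon consists of six half
-- squares around its center, which gives 24 squares in all.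
cell i := ([(0, 0), (2, 3), (3, 3), (1, 3), (1, 0), (3, 0), (2, 0), (0, 3)] : List ((Fin 4) × Fin
    6)).getD i (0, 0)
next i j := ([[(1, 0), (2, 1), (3, 2), (1, 3), (2, 4), (3, 5)], [(0, 0), (4, 1), (5, 2), (0,
    3), (4, 4), (5, 5)], [(4, 0), (0, 1), (6, 2), (4, 3), (0, 4), (6, 5)], [(5, 0), (6, 1), (0,
    2), (5, 3), (6, 4), (0, 5)], [(2, 0), (1, 1), (7, 2), (2, 3), (1, 4), (7, 5)], [(3, 0), (7,
    1), (1, 2), (3, 3), (7, 4), (1, 5)], [(7, 0), (3, 1), (2, 2), (7, 3), (3, 4), (2, 5)], [(6,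
    0), (5, 1), (4, 2), (6, 3), (5, 4), (4, 5)]].getD i []).getD j (0, 0)
rotated k j := ([[(0, 0), (1, 0), (1, 1), (0, 2), (-1, 2), (-1, 1)], [(0, 0), (0, 1), (-1, 2), (-2,
    2), (-2, 1), (-1, 0)], [(0, 0), (-1, 1), (-2, 1), (-2, 0), (-1, -1), (0, -1)], [(0, 0), (-1,
    0), (-1, -1), (0, -2), (1, -2), (1, -1)], [(0, 0), (0, -1), (1, -2), (2, -2), (2, -1), (1, 0)],
    [(0, 0), (1, -1), (2, -1), (2, 0), (1, 1), (0, 1)]].getD k []).getD j (0, 0)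

/-- The half squares in the cells of the translation cover of the quotient of the mutetrahedron. -/
def mutetrahedronPlace (b : Bool) (q : Fin 24) : Fin 8 × ℤ × ℤ :=
  if b then
[(0, -1, 1), (0, 0, 0), (3, -1, -2), (1, -1, -1), (1, 0, -2), (5, -1, 0), (2, -1, -1), (2, 0,
    -2), (6, -1, 0), (4, -1, 1), (4, 0, 0), (7, -1, -2), (3, -1, -1), (3, 0, -2), (0, -1, 0), (5,
    -1, 1), (5, 0, 0), (1, -1, -2), (6, -1, 1), (6, 0, 0), (2, -1, -2), (7, -1, -1), (7, 0,
    -2), (4, -1, 0)].getD q 0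
  else
[(0, -1, 1), (0, 0, 0), (0, 0, 1), (1, -1, -1), (1, 0, -2), (1, 0, -1), (2, -1, -1), (2, 0,
    -2), (2, 0, -1), (4, -1, 1), (4, 0, 0), (4, 0, 1), (3, -1, -1), (3, 0, -2), (3, 0, -1), (5, -1,
    1), (5, 0, 0), (5, 0, 1), (6, -1, 1), (6, 0, 0), (6, 0, 1), (7, -1, -1), (7, 0, -2), (7, 0,
    -1)].getD q 0


instance : Fintype mutetrahedron.Face := inferInstanceAs (Fintype (Fin 4))

instance : DecidableEq mutetrahedron.Face := inferInstanceAs (DecidableEq (Fin 4))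

theorem mutetrahedronTable_isFor : mutetrahedronTable.IsFor faceCenteredPeriod where
  period a b c := mem_faceCenteredPeriod
  rotated := by decide +kernel
  base := rfl
  injective := by decide +kernel
  edge := by decide +kernel
  unique := by decide +kernel
  side := by decide +kernel
  rotation := by decide +kernel
  reach := by decide +kernel

theorem mutetrahedronTable_layout_isFor : (mutetrahedronTable.layout mutetrahedronPlace).IsFor mutetrahedralOrigami where
  mem := by decide +kernel
  bounds := by decide +kernel
  center := by decide +kernel
  width := by decide +kernel
  cover := by decide +kernel
  join := by decide +kernel
  side := by decide +kernel
  unique := by decide +kernel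
  adjacent := by decide +kernel
  vertex := by decide +kernel

theorem hasMonodromySL2Pow_mutetrahedron : HasMonodromySL2Pow mutetrahedron.translationCover 4 :=
  have := mutetrahedronTable_isFor.finite_cell
  hasMonodromySL2Pow_of_mutetrahedralOrigami (Origami.Layout.toTorus_homeo (mutetrahedronTable_isFor.describes mutetrahedronPlace)
    mutetrahedronTable_layout_isFor)

end PolyhedralSurface

theorem mainTheorem1 :
    HasMonodromySL2Pow octahedron.translationCover 1 ∧
    HasMonodromySL2Pow octa8.translationCover 1 ∧
    HasMonodromySL2Pow cube.translationCover 3 ∧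
    HasMonodromySL2Pow mucube.translationCover 3 ∧
    HasMonodromySL2Pow mutetrahedron.translationCover 4 :=
  ⟨PolyhedralSurface.hasMonodromySL2Pow_octahedron, PolyhedralSurface.hasMonodromySL2Pow_octa8,
    PolyhedralSurface.hasMonodromySL2Pow_cube, PolyhedralSurface.hasMonodromySL2Pow_mucube,
    PolyhedralSurface.hasMonodromySL2Pow_mutetrahedron⟩
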